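/- Let $V$ be a nonsingular complex variety, with tangent sheaf $T_V=\mathcal{D}er_{\mathbb C}(\mathcal O_V,\mathcal O_V)$. For $U\subset V$ open, $\prod_{k\ge0}\mathrm{Sym}^kT_U$ carries the Poisson bracket of the cotangent bundle: the biderivation with $\{f,g\}=0$, $\{\partial,f\}=\partial(f)$, $\{\partial,\partial'\}=[\partial,\partial']$ for $f,g\in\mathcal O_U$, $\partial,\partial'\in T_U$; it induces brackets $\prod_{k\le l}\mathrm{Sym}^kT_U\times\prod_{k\le l}\mathrm{Sym}^kT_U\to\prod_{k\le l-1}\mathrm{Sym}^kT_U$. Let $n\ge1$. A *tower of Poisson thickenings of length $n$* consists of sheaves of commutative $\mathbb C$-algebras $\mathcal A_l$ on $V$ ($0\le l\le n$, $\mathcal A_{-1}=0$) and exact sequences $$0\to\mathrm{Sym}^lT_V\to\mathcal A_l\to\mathcal A_{l-1}\to0\qquad(0\le l\le n)$$ such that: for $l=0$ the map $\mathcal O_V\to\mathcal A_0$ is an isomorphism of algebras; for $l\ge1$ the map $\mathcal A_l\to\mathcal A_{l-1}$ is a homomorphism of $\mathbb C$-algebras; $\mathrm{Sym}^lT_V\to\mathcal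 A_l$ is $\mathcal A_l$-linear, where $\mathcal A_l$ acts on $\mathrm{Sym}^lT_V$ through $\mathcal A_l\to\mathcal A_0=\mathcal O_V$ (so that for $l\ge1$ it is a square-zero ideal); each $\mathcal A_l$ has a $\mathbb C$-bilinear skew-symmetric bracket $\mathcal A_l\times\mathcal A_l\to\mathcal A_{l-1}$ satisfying the Leibniz rule and the Jacobi identity and compatible with $\mathcal A_l\to\mathcal A_{l-1}$; and for $1\le l\le n$ the restriction of this bracket to $\mathrm{Sym}^lT_V\times\mathcal A_l$ is the natural derivation $\mathrm{Sym}^lT_V\times\mathcal O_V\to\mathrm{Sym}^{l-1}T_V$, $(\partial_1\cdots\partial_l,f)\mapsto\sum_i\partial_i(f)\prod_{j\ne i}\partial_j$ (so that the bracket is non-degenerate). **(1)** Let $\mathcal A=\{\mathcal A_l\}$ and $\mathcal A'=\{\mathcal A'_l\}$ be two such towers and $V=\bigcup_iU_i$ an affine open covering with compatible isomorphisms of sheaves of $\mathbb C$-algebras $(\alpha_l)_i:\prod_{k\le l}\mathrm{Sym}^kT_{U_i}\to\mathcal A_l|_{U_i}$ and $(\alpha'_l)_i:\prod_{k\le l}\mathrm{Sym}^kT_{U_i}\to\mathcal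 A'_l|_{U_i}$ for $0\le l\le n-1$, which are the identity on $\mathrm{Sym}^lT_{U_i}$ and preserve the Poisson brackets. Let $\alpha_{n-1}:\mathcal A_{n-1}\to\mathcal A'_{n-1}$ be an isomorphism of sheaves of algebras with $\alpha_{n-1}|_{U_i}=(\alpha'_{n-1})_i\circ(\alpha_{n-1})_i^{-1}$ for all $i$. Call *normalized lift* an algebra isomorphism $\beta_i:\prod_{k\le n}\mathrm{Sym}^kT_{U_i}\to\mathcal A_n|_{U_i}$ that lifts $(\alpha_{n-1})_i$, is the identity on $\mathrm{Sym}^nT_{U_i}$ and satisfies $\{\beta_i(\partial),\beta_i(f)\}=(\alpha_{n-1})_i(\partial(f))$ for all $\partial\in T_{U_i}$, $f\in\mathcal O_{U_i}$; define normalized lifts $\beta'_i$ for $\mathcal A'$ in the same way. Then normalized lifts $\beta_i$ and $\beta'_i$ exist for all $i$, and there is a class $\xi\in H^1(V,T_V\otimes\mathrm{Sym}^nT_V)$ such that, for every choice of the $\beta_i$ and $\beta'_i$, the differences $\beta_i^{-1}\beta_j-(\beta'_i)^{-1}\beta'_j$ on $U_i\cap U_j$ are given by derivations $\mathcal O_{U_i\cap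 U_j}\to\mathrm{Sym}^nT_{U_i\cap U_j}$, i.e. by sections $d_{i,j}$ of $T_V\otimes\mathrm{Sym}^nT_V=\mathcal{H}om(\Omega^1_V,\mathrm{Sym}^nT_V)$, which form a Čech $1$-cocycle with class $\xi$. Moreover $\xi=0$ if and only if there is an isomorphism of sheaves of $\mathbb C$-algebras $\alpha_n:\mathcal A_n\to\mathcal A'_n$ which is compatible with $\alpha_{n-1}$ and with the identity of $\mathrm{Sym}^nT_V$ and preserves the Poisson brackets, i.e. $\alpha_{n-1}(\{a,b\})=\{\alpha_n(a),\alpha_n(b)\}$. **(2)** Let $Y$ be a nonsingular complex variety with a symplectic form (a closed non-degenerate algebraic $2$-form) and suppose that $V\subset Y$ is a closed Lagrangian subvariety, i.e. $\dim Y=2\dim V$ and the form restricts to zero on $V$. If $H^1(V,T_V\otimes\mathrm{Sym}^nT_V)=0$ for all $n\ge1$, then the formal completion $\hat Y_V$ of $Y$ along $V$ is isomorphic, as a formal Poisson scheme and by an isomorphism inducing the identity on $V$, to the completion of the total space of the cotangent bundle $T_V^*$ along its zero section. -/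

import Mathlib

open CategoryTheory AlgebraicGeometry TopologicalSpace Opposite
open scoped TensorProduct

noncomputable section

namespace SymmetricAlgebra

section Generic

variable {R L : Type} [CommRing R] [AddCommGroup L] [Module R L]

/-- The homogeneous part `Sym^n L` of the symmetric algebra: the span of `n`-fold products. -/
abbrev symPow (R L : Type) [CommRing R] [AddCommGroup L] [Module R L] (n : ℕ) :
    Submodule R (SymmetricAlgebra R L) :=
  (LinearMap.range (ι R L)) ^ n

/-- The augmentation ideal `Sym^{≥ 1} L`: the kernel of `Sym L → Sym^0 L = R`. -/
abbrev augIdeal (R L : Type) [CommRing R] [AddCommGroup L] [Module R L] :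
    Ideal (SymmetricAlgebra R L) :=
  RingHom.ker (algebraMapInv : SymmetricAlgebra R L →ₐ[R] R)

/-- Two ring homomorphisms out of `Sym L` agreeing on `R` and `L` are equal. -/
theorem ringHom_ext' {A : Type} [CommRing A] {f g : SymmetricAlgebra R L →+* A}
    (h₁ : ∀ r, f (algebraMap R _ r) = g (algebraMap R _ r))
    (h₂ : ∀ x, f (ι R L x) = g (ι R L x)) : f = g := by
  refine RingHom.ext fun a => ?_
  induction a using SymmetricAlgebra.induction with
  | algebraMap r => exact h₁ r
  | ι x => exact h₂ x
  | mul a b ha hb => rw [map_mul, map_mul, ha, hb]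
  | add a b ha hb => rw [map_add, map_add, ha, hb]

/-- Functoriality of `Sym` in the pair (ring, module): a ring homomorphism `φ : R → R'` and a
`φ`-semilinear map `f : L → L'` induce a ring homomorphism `Sym_R L → Sym_{R'} L'`. -/
def mapSemi {R' L' : Type} [CommRing R'] [AddCommGroup L'] [Module R' L']
    (φ : R →+* R') (f : L →ₛₗ[φ] L') : SymmetricAlgebra R L →+* SymmetricAlgebra R' L' :=
  letI : Algebra R (SymmetricAlgebra R' L') := ((algebraMap R' _).comp φ).toAlgebra
  ((lift { toFun := fun x => ι R' L' (f x)
           map_add' := fun x y => by simp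
           map_smul' := fun r x => by
            rw [map_smulₛₗ, map_smul, Algebra.smul_def, Algebra.smul_def]; rfl } :
    SymmetricAlgebra R L →ₐ[R] SymmetricAlgebra R' L') :
      SymmetricAlgebra R L →+* SymmetricAlgebra R' L')

section mapSemi

variable {R' L' : Type} [CommRing R'] [AddCommGroup L'] [Module R' L']
  (φ : R →+* R') (f : L →ₛₗ[φ] L')

@[simp] theorem mapSemi_ι (x : L) : mapSemi φ f (ι R L x) = ι R' L' (f x) := by
  let _ : Algebra R (SymmetricAlgebra R' L') := ((algebraMap R' _).comp φ).toAlgebra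
  exact lift_ι_apply _ x

@[simp] theorem mapSemi_algebraMap (r : R) :
    mapSemi φ f (algebraMap R _ r) = algebraMap R' _ (φ r) := by
  let _ : Algebra R (SymmetricAlgebra R' L') := ((algebraMap R' _).comp φ).toAlgebra
  exact AlgHom.commutes (lift _ : SymmetricAlgebra R L →ₐ[R] SymmetricAlgebra R' L') r

theorem mapSemi_smul (r : R) (s : SymmetricAlgebra R L) :
    mapSemi φ f (r • s) = φ r • mapSemi φ f s := by
  rw [Algebra.smul_def, Algebra.smul_def, map_mul, mapSemi_algebraMap]

theorem mapSemi_mem_symPow (n : ℕ) {s : SymmetricAlgebra R L} (hs : s ∈ symPow R L n) :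
    mapSemi φ f s ∈ symPow R' L' n := by
  induction n generalizing s with
  | zero =>
    rw [symPow, pow_zero, Submodule.mem_one] at hs
    obtain ⟨r, rfl⟩ := hs
    rw [symPow, pow_zero, Submodule.mem_one]
    exact ⟨φ r, (mapSemi_algebraMap φ f r).symm⟩
  | succ n ih =>
    rw [symPow, pow_succ'] at hs
    induction hs using Submodule.mul_induction_on' with
    | mem_mul_mem a ha b hb =>
      obtain ⟨x, rfl⟩ := ha
      rw [map_mul, mapSemi_ι, symPow, pow_succ']
      exact Submodule.mul_mem_mul ⟨_, rfl⟩ (ih hb)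
    | add a _ b _ ha hb => rw [map_add]; exact add_mem ha hb

/-- The map `Sym^n_R L → Sym^n_{R'} L'` induced by `(φ, f)`. -/
def powSemi (n : ℕ) : symPow R L n →ₛₗ[φ] symPow R' L' n where
  toFun s := ⟨mapSemi φ f s.1, mapSemi_mem_symPow φ f n s.2⟩
  map_add' s t := Subtype.ext (map_add (mapSemi φ f) s.1 t.1)
  map_smul' r s := Subtype.ext (mapSemi_smul φ f r s.1)

/-- The map `L ⊗ Sym^n L → L' ⊗ Sym^n L'` induced by `(φ, f)`. -/
def tensorSemi (n : ℕ) : (L ⊗[R] symPow R L n) →+ (L' ⊗[R'] symPow R' L' n) :=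
  TensorProduct.liftAddHom
    (AddMonoidHom.mk' (fun x => AddMonoidHom.mk'
        (fun s => f x ⊗ₜ[R'] powSemi φ f n s)
        (fun s t => by rw [map_add, TensorProduct.tmul_add]))
      (fun x y => AddMonoidHom.ext fun s => by
        change f (x + y) ⊗ₜ[R'] powSemi φ f n s =
          f x ⊗ₜ[R'] powSemi φ f n s + f y ⊗ₜ[R'] powSemi φ f n s
        rw [map_add, TensorProduct.add_tmul]))
    (fun r x s => by
      change f (r • x) ⊗ₜ[R'] powSemi φ f n s = f x ⊗ₜ[R'] powSemi φ f n (r • s)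
      rw [map_smulₛₗ, map_smulₛₗ, TensorProduct.smul_tmul])

theorem tensorSemi_tmul (n : ℕ) (x : L) (s : symPow R L n) :
    tensorSemi φ f n (x ⊗ₜ s) = f x ⊗ₜ powSemi φ f n s := rfl

theorem tensorSemi_self (n : ℕ) {φ : R →+* R} {f : L →ₛₗ[φ] L}
    (hf : ∀ x, f x = x) (hs : ∀ s, mapSemi φ f s = s) (t : L ⊗[R] symPow R L n) :
    tensorSemi φ f n t = t := by
  induction t using TensorProduct.induction_on with
  | zero => exact map_zero _
  | tmul x s =>
    have h₂ : powSemi φ f n s = s := Subtype.ext (hs s.1)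
    rw [tensorSemi_tmul, hf, h₂]
  | add a b ha hb => rw [map_add, ha, hb]

theorem tensorSemi_comp (n : ℕ) {R'' L'' : Type} [CommRing R''] [AddCommGroup L'']
    [Module R'' L''] {φ : R →+* R'} {f : L →ₛₗ[φ] L'} {φ' : R' →+* R''} {f' : L' →ₛₗ[φ'] L''}
    {φ'' : R →+* R''} {f'' : L →ₛₗ[φ''] L''} (hf : ∀ x, f' (f x) = f'' x)
    (hs : ∀ s, mapSemi φ' f' (mapSemi φ f s) = mapSemi φ'' f'' s) (t : L ⊗[R] symPow R L n) :
    tensorSemi φ' f' n (tensorSemi φ f n t) = tensorSemi φ'' f'' n t := by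
  induction t using TensorProduct.induction_on with
  | zero => rw [map_zero, map_zero, map_zero]
  | tmul x s =>
    have h₂ : powSemi φ' f' n (powSemi φ f n s) = powSemi φ'' f'' n s := Subtype.ext (hs s.1)
    rw [tensorSemi_tmul, tensorSemi_tmul, tensorSemi_tmul, hf, h₂]
  | add a b ha hb => rw [map_add, map_add, map_add, ha, hb]

end mapSemi

/-- Extension of derivations to `Sym L`: a derivation `δ` on `R` and an additive map `μ` on `L`
with values in a `Sym L`-module, related by the Leibniz rule for the products `r • x`, extend to
a derivation of `Sym L`. -/
theorem exists_extendDer {N : Type} [AddCommGroup N] [Module (SymmetricAlgebra R L) N]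
    (δ : R →+ N) (μ : L →+ N)
    (hδ : ∀ r s, δ (r * s) = algebraMap R (SymmetricAlgebra R L) r • δ s
      + algebraMap R (SymmetricAlgebra R L) s • δ r)
    (hμ : ∀ r x, μ (r • x) =
      algebraMap R (SymmetricAlgebra R L) r • μ x + ι R L x • δ r) :
    ∃ D : Derivation ℤ (SymmetricAlgebra R L) N,
      (∀ r, D (algebraMap R _ r) = δ r) ∧ (∀ x, D (ι R L x) = μ x) := by
  let _ : Module (SymmetricAlgebra R L)ᵐᵒᵖ N :=
    Module.compHom N ((RingHom.id (SymmetricAlgebra R L)).fromOpposite mul_comm)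
  have _ : IsCentralScalar (SymmetricAlgebra R L) N := ⟨fun _ _ => rfl⟩
  let ψ : R →+* TrivSqZeroExt (SymmetricAlgebra R L) N :=
    { toFun := fun r => (algebraMap R (SymmetricAlgebra R L) r, δ r)
      map_one' := by
        refine Prod.ext (map_one _) ?_
        have h := hδ 1 1
        rw [mul_one, map_one (algebraMap R (SymmetricAlgebra R L)), one_smul] at h
        exact left_eq_add.mp h
      map_mul' := fun r s => Prod.ext (map_mul _ _ _) (hδ r s)
      map_zero' := Prod.ext (map_zero _) (map_zero _)
      map_add' := fun r s => Prod.ext (map_add _ _ _) (map_add _ _ _) }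
  let _ : Algebra R (TrivSqZeroExt (SymmetricAlgebra R L) N) := ψ.toAlgebra
  let g : L →ₗ[R] TrivSqZeroExt (SymmetricAlgebra R L) N :=
    { toFun := fun x => (ι R L x, μ x)
      map_add' := fun x y => Prod.ext (map_add _ _ _) (map_add _ _ _)
      map_smul' := fun r x => by
        refine Eq.trans ?_ (Algebra.smul_def r _).symm
        refine Prod.ext ?_ (hμ r x)
        exact (map_smul (ι R L) r x).trans (Algebra.smul_def _ _) }
  let Φ : SymmetricAlgebra R L →ₐ[R] TrivSqZeroExt (SymmetricAlgebra R L) N := lift g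
  have h₁ : ∀ r, Φ (algebraMap R _ r) = ψ r := fun r => AlgHom.commutes _ r
  have h₂ : ∀ x, Φ (ι R L x) = g x := fun x => lift_ι_apply g x
  have hfst : ∀ s, (Φ s).fst = s := fun s => by
    induction s using SymmetricAlgebra.induction with
    | algebraMap r => rw [h₁]; rfl
    | ι x => rw [h₂]; rfl
    | mul a b ha hb => rw [map_mul, TrivSqZeroExt.fst_mul, ha, hb]
    | add a b ha hb => rw [map_add, TrivSqZeroExt.fst_add, ha, hb]
  refine ⟨Derivation.mk'
    ((AddMonoidHom.mk' (fun s => (Φ s).snd) (fun a b => by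
      rw [map_add, TrivSqZeroExt.snd_add])).toIntLinearMap)
    (fun a b => ?_), fun r => ?_, fun x => ?_⟩
  · change (Φ (a * b)).snd = a • (Φ b).snd + b • (Φ a).snd
    rw [map_mul, TrivSqZeroExt.snd_mul, hfst, hfst]
    rfl
  · change (Φ _).snd = _
    rw [h₁]; rfl
  · change (Φ _).snd = _
    rw [h₂]; rfl

/-- The (unique) derivation of `Sym L` extending `δ` and `μ`. -/
def extendDer {N : Type} [AddCommGroup N] [Module (SymmetricAlgebra R L) N]
    (δ : R →+ N) (μ : L →+ N)
    (hδ : ∀ r s, δ (r * s) = algebraMap R (SymmetricAlgebra R L) r • δ s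
      + algebraMap R (SymmetricAlgebra R L) s • δ r)
    (hμ : ∀ r x, μ (r • x) =
      algebraMap R (SymmetricAlgebra R L) r • μ x + ι R L x • δ r) :
    Derivation ℤ (SymmetricAlgebra R L) N :=
  (exists_extendDer δ μ hδ hμ).choose

section extendDer

variable {N : Type} [AddCommGroup N] [Module (SymmetricAlgebra R L) N]
    (δ : R →+ N) (μ : L →+ N)
    (hδ : ∀ r s, δ (r * s) = algebraMap R (SymmetricAlgebra R L) r • δ s
      + algebraMap R (SymmetricAlgebra R L) s • δ r)
    (hμ : ∀ r x, μ (r • x) =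
      algebraMap R (SymmetricAlgebra R L) r • μ x + ι R L x • δ r)

theorem extendDer_algebraMap (r : R) :
    extendDer δ μ hδ hμ (algebraMap R (SymmetricAlgebra R L) r) = δ r :=
  (exists_extendDer δ μ hδ hμ).choose_spec.1 r

theorem extendDer_ι (x : L) : extendDer δ μ hδ hμ (ι R L x) = μ x :=
  (exists_extendDer δ μ hδ hμ).choose_spec.2 x

/-- Two derivations of `Sym L` agreeing on `R` and on `L` are equal. -/
theorem derivation_ext' {D E : Derivation ℤ (SymmetricAlgebra R L) N}
    (h₁ : ∀ r, D (algebraMap R _ r) = E (algebraMap R _ r))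
    (h₂ : ∀ x, D (ι R L x) = E (ι R L x)) : D = E := by
  refine Derivation.ext fun a => ?_
  induction a using SymmetricAlgebra.induction with
  | algebraMap r => exact h₁ r
  | ι x => exact h₂ x
  | mul a b ha hb => rw [Derivation.leibniz, Derivation.leibniz, ha, hb]
  | add a b ha hb => rw [map_add, map_add, ha, hb]

end extendDer

end Generic

section Poisson

variable (R L : Type) [CommRing R] [LieRing L] [Module R L] [LieRingModule L R]
  [LieRinehartRing R L]

/-- `{f, -}` for `f ∈ R`: it kills `R` and sends `x ∈ L` to `-x(f)`. -/
def hamFun₀ (f : R) : Derivation ℤ (SymmetricAlgebra R L) (SymmetricAlgebra R L) :=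
  extendDer 0
    (AddMonoidHom.mk' (fun x : L => -algebraMap R (SymmetricAlgebra R L) ⁅x, f⁆) (fun x y => by
      rw [add_lie, map_add, neg_add]))
    (fun r s => by
      rw [AddMonoidHom.zero_apply, AddMonoidHom.zero_apply, AddMonoidHom.zero_apply, smul_zero,
        smul_zero, add_zero])
    (fun r x => by
      rw [AddMonoidHom.zero_apply, smul_zero, add_zero, AddMonoidHom.mk'_apply,
        LieRinehartRing.lie_smul_eq_mul, map_mul, smul_eq_mul, mul_neg])

/-- `{x, -}` for `x ∈ L`: it sends `f ∈ R` to `x(f)` and `y ∈ L` to `[x, y]`. -/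
def hamVec₀ (x : L) : Derivation ℤ (SymmetricAlgebra R L) (SymmetricAlgebra R L) :=
  extendDer
    (AddMonoidHom.mk' (fun f : R => algebraMap R (SymmetricAlgebra R L) ⁅x, f⁆) (fun f g => by
      rw [lie_add, map_add]))
    (AddMonoidHom.mk' (fun y : L => ι R L ⁅x, y⁆) (fun y z => by
      rw [lie_add, map_add]))
    (fun r s => by
      rw [AddMonoidHom.mk'_apply,
        LieRinehartRing.leibniz_mul_right, map_add, smul_eq_mul, map_mul, map_mul, smul_eq_mul,
        smul_eq_mul]
      ring)
    (fun r y => by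
      rw [AddMonoidHom.mk'_apply,
        LieRinehartRing.leibniz_smul_right, map_add, map_smul, map_smul, Algebra.smul_def,
        Algebra.smul_def, smul_eq_mul, smul_eq_mul, AddMonoidHom.mk'_apply]
      ring)

variable {R L}

theorem hamFun₀_fun (f g : R) : hamFun₀ R L f (algebraMap R _ g) = 0 :=
  extendDer_algebraMap _ _ _ _ _

theorem hamFun₀_vec (f : R) (x : L) : hamFun₀ R L f (ι R L x) = -algebraMap R _ ⁅x, f⁆ :=
  extendDer_ι _ _ _ _ _

theorem hamVec₀_fun (x : L) (f : R) : hamVec₀ R L x (algebraMap R _ f) = algebraMap R _ ⁅x, f⁆ :=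
  extendDer_algebraMap _ _ _ _ _

theorem hamVec₀_vec (x y : L) : hamVec₀ R L x (ι R L y) = ι R L ⁅x, y⁆ :=
  extendDer_ι _ _ _ _ _

variable (R L)

/-- `f ↦ {f, -}` as an additive map. -/
def hamFun : R →+ Derivation ℤ (SymmetricAlgebra R L) (SymmetricAlgebra R L) :=
  AddMonoidHom.mk' (hamFun₀ R L) (fun f g => derivation_ext'
    (fun r => by
      rw [Derivation.add_apply, hamFun₀_fun, hamFun₀_fun, hamFun₀_fun, add_zero])
    (fun x => by
      rw [Derivation.add_apply, hamFun₀_vec, hamFun₀_vec, hamFun₀_vec, lie_add, map_add, neg_add]))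

/-- `x ↦ {x, -}` as an additive map. -/
def hamVec : L →+ Derivation ℤ (SymmetricAlgebra R L) (SymmetricAlgebra R L) :=
  AddMonoidHom.mk' (hamVec₀ R L) (fun x y => derivation_ext'
    (fun r => by
      rw [Derivation.add_apply, hamVec₀_fun, hamVec₀_fun, hamVec₀_fun, add_lie, map_add])
    (fun z => by
      rw [Derivation.add_apply, hamVec₀_vec, hamVec₀_vec, hamVec₀_vec, add_lie, map_add]))

/-- The canonical Poisson bracket on the symmetric algebra of a Lie-Rinehart algebra: the
biderivation with `{f, g} = 0`, `{x, f} = x(f)`, `{x, y} = [x, y]` for `f, g ∈ R`, `x, y ∈ L`. -/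
def poisson : Derivation ℤ (SymmetricAlgebra R L)
    (Derivation ℤ (SymmetricAlgebra R L) (SymmetricAlgebra R L)) :=
  extendDer (hamFun R L) (hamVec R L)
    (fun r s => derivation_ext'
      (fun t => by
        rw [Derivation.add_apply, Derivation.smul_apply, Derivation.smul_apply]
        change hamFun₀ R L _ _ = _ • hamFun₀ R L _ _ + _ • hamFun₀ R L _ _
        rw [hamFun₀_fun, hamFun₀_fun, hamFun₀_fun, smul_zero, smul_zero, add_zero])
      (fun x => by
        rw [Derivation.add_apply, Derivation.smul_apply, Derivation.smul_apply]
        change hamFun₀ R L _ _ = _ • hamFun₀ R L _ _ + _ • hamFun₀ R L _ _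
        rw [hamFun₀_vec, hamFun₀_vec, hamFun₀_vec, LieRinehartRing.leibniz_mul_right, map_add,
          smul_eq_mul, smul_eq_mul, smul_eq_mul, map_mul, map_mul]
        ring))
    (fun r x => derivation_ext'
      (fun t => by
        rw [Derivation.add_apply, Derivation.smul_apply, Derivation.smul_apply]
        change hamVec₀ R L _ _ = _ • hamVec₀ R L _ _ + _ • hamFun₀ R L _ _
        rw [hamVec₀_fun, hamVec₀_fun, hamFun₀_fun, LieRinehartRing.lie_smul_eq_mul, map_mul,
          smul_eq_mul, smul_zero, add_zero])
      (fun y => by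
        rw [Derivation.add_apply, Derivation.smul_apply, Derivation.smul_apply]
        change hamVec₀ R L _ _ = _ • hamVec₀ R L _ _ + _ • hamFun₀ R L _ _
        rw [hamVec₀_vec, hamVec₀_vec, hamFun₀_vec, ← lie_skew,
          LieRinehartRing.leibniz_smul_right, ← lie_skew x y, map_neg, map_add, map_smul,
          map_smul, Algebra.smul_def, Algebra.smul_def, map_neg, smul_eq_mul, smul_eq_mul]
        ring))

variable {R L}

theorem poisson_fun_fun (f g : R) :
    poisson R L (algebraMap R _ f) (algebraMap R _ g) = 0 := by
  rw [poisson, extendDer_algebraMap]; exact hamFun₀_fun f g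

theorem poisson_fun_vec (f : R) (x : L) :
    poisson R L (algebraMap R _ f) (ι R L x) = -algebraMap R _ ⁅x, f⁆ := by
  rw [poisson, extendDer_algebraMap]; exact hamFun₀_vec f x

theorem poisson_vec_fun (x : L) (f : R) :
    poisson R L (ι R L x) (algebraMap R _ f) = algebraMap R _ ⁅x, f⁆ := by
  rw [poisson, extendDer_ι]; exact hamVec₀_fun x f

theorem poisson_vec_vec (x y : L) :
    poisson R L (ι R L x) (ι R L y) = ι R L ⁅x, y⁆ := by
  rw [poisson, extendDer_ι]; exact hamVec₀_vec x y

theorem poisson_mem_symPow (n : ℕ) {s : SymmetricAlgebra R L} (hs : s ∈ symPow R L (n + 1))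
    (f : R) : poisson R L s (algebraMap R _ f) ∈ symPow R L n := by
  induction n generalizing s with
  | zero =>
    rw [symPow, zero_add, pow_one] at hs
    obtain ⟨x, rfl⟩ := hs
    rw [poisson_vec_fun, symPow, pow_zero]
    exact Submodule.mem_one.mpr ⟨_, rfl⟩
  | succ n ih =>
    rw [symPow, pow_succ'] at hs
    induction hs using Submodule.mul_induction_on' with
    | mem_mul_mem a ha b hb =>
      obtain ⟨x, rfl⟩ := ha
      rw [Derivation.leibniz, Derivation.add_apply, Derivation.smul_apply, Derivation.smul_apply,
        poisson_vec_fun, smul_eq_mul, smul_eq_mul]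
      refine add_mem ?_ ?_
      · rw [symPow, pow_succ']
        exact Submodule.mul_mem_mul ⟨_, rfl⟩ (ih hb)
      · rw [mul_comm, ← Algebra.smul_def]
        exact Submodule.smul_mem _ _ hb
    | add a _ b _ ha hb => rw [map_add, Derivation.add_apply]; exact add_mem ha hb

/-- The natural derivation `Sym^{n+1} L × R → Sym^n L`, `(x₁⋯x_{n+1}, f) ↦ Σ xᵢ(f) ∏_{j ≠ i} xⱼ`,
which is the restriction of the Poisson bracket. -/
def derive (n : ℕ) (s : symPow R L (n + 1)) (f : R) : symPow R L n :=
  ⟨poisson R L s (algebraMap R _ f), poisson_mem_symPow n s.2 f⟩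

/-- The derivation `R → Sym^n L`, `f ↦ Σ xₖ(f) sₖ`, given by an element `Σ xₖ ⊗ sₖ` of
`L ⊗ Sym^n L`. -/
def tensorDer (n : ℕ) (t : L ⊗[R] symPow R L n) (f : R) : symPow R L n :=
  TensorProduct.lift
    (LinearMap.mk₂ R (fun (x : L) (s : symPow R L n) => (⁅x, f⁆ : R) • s)
      (fun x y s => by rw [add_lie, add_smul])
      (fun r x s => by rw [LieRinehartRing.lie_smul_eq_mul, mul_smul])
      (fun x s t => smul_add _ _ _)
      (fun r x s => smul_comm _ _ _)) t

end Poisson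

end SymmetricAlgebra

/-! ### Vector fields and the tangent sheaf of a complex scheme -/

namespace CScheme

/-- The base `Spec ℂ`. -/
abbrev specC : Scheme.{0} := Spec (CommRingCat.of ℂ)

/-- The `ℂ`-algebra structure on the sections of the structure sheaf of a scheme over `ℂ`. -/
instance algebraSections (X : Scheme.{0}) [X.Over specC] (U : X.Opens) : Algebra ℂ Γ(X, U) :=
  ((X.presheaf.map (homOfLE (le_top : U ≤ ⊤)).op).hom.comp
    (((X ↘ specC).appTop).hom.comp (Scheme.ΓSpecIso (CommRingCat.of ℂ)).inv.hom)).toAlgebra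

/-- A nonsingular complex variety: an integral separated scheme of finite type, smooth over `ℂ`. -/
structure IsSmoothVariety (X : Scheme.{0}) [X.Over specC] : Prop where
  integral : IsIntegral X
  separated : IsSeparated (X ↘ specC)
  locallyOfFiniteType : LocallyOfFiniteType (X ↘ specC)
  quasiCompact : QuasiCompact (X ↘ specC)
  smooth : Smooth (X ↘ specC)

/-- Restriction of sections of a sheaf of rings on a scheme (as a topological space). -/
abbrev rs {X : Scheme.{0}} (A : TopCat.Sheaf CommRingCat.{0} X) {U W : X.Opens} (h : W ≤ U) :
    A.obj.obj (op U) →+* A.obj.obj (op W) :=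
  (A.obj.map (homOfLE h).op).hom

/-- Restriction of regular functions. -/
abbrev fres (X : Scheme.{0}) {U W : X.Opens} (h : W ≤ U) : Γ(X, U) →+* Γ(X, W) :=
  (X.presheaf.map (homOfLE h).op).hom

theorem fres_refl (X : Scheme.{0}) {U : X.Opens} (f : Γ(X, U)) : fres X (le_refl U) f = f := by
  simp [fres]

theorem fres_fres (X : Scheme.{0}) {U W W' : X.Opens} (h : W ≤ U) (h' : W' ≤ W) (f : Γ(X, U)) :
    fres X h' (fres X h f) = fres X (h'.trans h) f := by
  have : (homOfLE (h'.trans h)).op = (homOfLE h).op ≫ (homOfLE h').op := rfl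
  simp only [fres, this, Functor.map_comp, CommRingCat.hom_comp, RingHom.comp_apply]

/-- The constant sheaf `ℤ`. -/
abbrev constZ (X : Scheme.{0}) : Sheaf (Opens.grothendieckTopology X) AddCommGrpCat.{0} :=
  (constantSheaf (Opens.grothendieckTopology X) AddCommGrpCat.{0}).obj
    (AddCommGrpCat.of (ULift ℤ))

variable (X : Scheme.{0}) [X.Over specC]

/-- Sections over `U` of the tangent sheaf `T_X = Der_ℂ(O_X, O_X)`: derivations of the sheaf of
`ℂ`-algebras `O_X|_U`, i.e. families of derivations of `O_X(W)`, `W ⊆ U` open, compatible with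
restriction. -/
def vectorFields (U : X.Opens) :
    AddSubgroup (∀ W : {W : X.Opens // W ≤ U}, Derivation ℂ Γ(X, W.1) Γ(X, W.1)) where
  carrier := {D | ∀ (W W' : {W : X.Opens // W ≤ U}) (h : W'.1 ≤ W.1) (f : Γ(X, W.1)),
    D W' (fres X h f) = fres X h (D W f)}
  zero_mem' := fun W W' h f => by
    rw [Pi.zero_apply, Pi.zero_apply, Derivation.zero_apply, Derivation.zero_apply, map_zero]
  add_mem' := fun {D E} hD hE W W' h f => by
    rw [Pi.add_apply, Pi.add_apply, Derivation.add_apply, Derivation.add_apply, map_add,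
      hD W W' h f, hE W W' h f]
  neg_mem' := fun {D} hD W W' h f => by
    rw [Pi.neg_apply, Pi.neg_apply, Derivation.neg_apply, Derivation.neg_apply, map_neg,
      hD W W' h f]

/-- Sections of the tangent sheaf over `U`. -/
abbrev TX (U : X.Opens) : Type := vectorFields X U

variable {X}

/-- The derivation of `O_X(W)` defined by a vector field on `U ⊇ W`. -/
abbrev TX.at {U : X.Opens} (D : TX X U) (W : X.Opens) (h : W ≤ U) :
    Derivation ℂ Γ(X, W) Γ(X, W) := D.1 ⟨W, h⟩

theorem TX.ext {U : X.Opens} {D E : TX X U}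
    (h : ∀ (W : X.Opens) (hW : W ≤ U) (f : Γ(X, W)), D.at W hW f = E.at W hW f) : D = E :=
  Subtype.ext (funext fun W => Derivation.ext fun f => h W.1 W.2 f)

instance (U : X.Opens) : SMul Γ(X, U) (TX X U) where
  smul r D := ⟨fun W => fres X W.2 r • D.1 W, fun W W' h f => by
    change fres X W'.2 r • D.1 W' _ = fres X h (fres X W.2 r • D.1 W f)
    rw [D.2 W W' h f, smul_eq_mul, smul_eq_mul, map_mul, fres_fres]⟩

theorem TX.add_at {U : X.Opens} (D E : TX X U) (W : X.Opens) (h : W ≤ U) (f : Γ(X, W)) :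
    (D + E).at W h f = D.at W h f + E.at W h f := rfl

theorem TX.zero_at {U : X.Opens} (W : X.Opens) (h : W ≤ U) (f : Γ(X, W)) :
    (0 : TX X U).at W h f = 0 := rfl

theorem TX.smul_at {U : X.Opens} (r : Γ(X, U)) (D : TX X U) (W : X.Opens) (h : W ≤ U)
    (f : Γ(X, W)) : (r • D).at W h f = fres X h r * D.at W h f := rfl

instance (U : X.Opens) : Module Γ(X, U) (TX X U) where
  one_smul D := TX.ext fun W h f => by rw [TX.smul_at, map_one, one_mul]
  mul_smul r s D := TX.ext fun W h f => by
    rw [TX.smul_at, TX.smul_at, TX.smul_at, map_mul, mul_assoc]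
  smul_zero r := TX.ext fun W h f => by rw [TX.smul_at, TX.zero_at, mul_zero]
  smul_add r D E := TX.ext fun W h f => by
    rw [TX.smul_at, TX.add_at, TX.add_at, TX.smul_at, TX.smul_at, mul_add]
  add_smul r s D := TX.ext fun W h f => by
    rw [TX.smul_at, TX.add_at, TX.smul_at, TX.smul_at, map_add, add_mul]
  zero_smul D := TX.ext fun W h f => by rw [TX.smul_at, map_zero, zero_mul, TX.zero_at]

/-- The commutator of vector fields. -/
instance (U : X.Opens) : Bracket (TX X U) (TX X U) where
  bracket D E := ⟨fun W => ⁅D.1 W, E.1 W⁆, fun W W' h f => by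
    rw [Derivation.commutator_apply, Derivation.commutator_apply, map_sub, D.2 W W' h, E.2 W W' h,
      D.2 W W' h, E.2 W W' h]⟩

theorem TX.lie_at {U : X.Opens} (D E : TX X U) (W : X.Opens) (h : W ≤ U) (f : Γ(X, W)) :
    ⁅D, E⁆.at W h f = D.at W h (E.at W h f) - E.at W h (D.at W h f) :=
  Derivation.commutator_apply (D1 := D.at W h) (D2 := E.at W h) f

instance (U : X.Opens) : LieRing (TX X U) where
  add_lie D E F := TX.ext fun W h f => by
    rw [TX.add_at, TX.lie_at, TX.lie_at, TX.lie_at, TX.add_at, TX.add_at, map_add]; abel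
  lie_add D E F := TX.ext fun W h f => by
    rw [TX.add_at, TX.lie_at, TX.lie_at, TX.lie_at, TX.add_at, TX.add_at, map_add]; abel
  lie_self D := TX.ext fun W h f => by rw [TX.lie_at, sub_self, TX.zero_at]
  leibniz_lie D E F := TX.ext fun W h f => by
    rw [TX.add_at]
    simp only [TX.lie_at, map_sub]
    abel

/-- A vector field on `U` acts on functions on `U`. -/
instance (U : X.Opens) : LieRingModule (TX X U) Γ(X, U) where
  bracket D f := D.at U le_rfl f
  add_lie D E f := rfl
  lie_add D f g := map_add _ _ _
  leibniz_lie D E f := by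
    change D.at U le_rfl (E.at U le_rfl f) = ⁅D, E⁆.at U le_rfl f + E.at U le_rfl (D.at U le_rfl f)
    rw [TX.lie_at, sub_add_cancel]

theorem TX.lie_fun {U : X.Opens} (D : TX X U) (f : Γ(X, U)) : ⁅D, f⁆ = D.at U le_rfl f := rfl

instance (U : X.Opens) : LieRinehartRing Γ(X, U) (TX X U) where
  lie_smul_eq_mul' a b D := by
    rw [TX.lie_fun, TX.lie_fun, TX.smul_at, fres_refl]
  leibniz_mul_right' D a b := by
    rw [TX.lie_fun, TX.lie_fun, TX.lie_fun, Derivation.leibniz, smul_eq_mul, smul_eq_mul,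
      mul_comm b]
  leibniz_smul_right' D E a := TX.ext fun W h f => by
    rw [TX.lie_at, TX.add_at, TX.smul_at, TX.smul_at, TX.smul_at, TX.smul_at, TX.lie_at,
      Derivation.leibniz, TX.lie_fun, smul_eq_mul, smul_eq_mul]
    have : D.at W h (fres X h a) = fres X h (D.at U le_rfl a) := D.2 ⟨U, le_rfl⟩ ⟨W, h⟩ h a
    rw [this]
    ring

/-- Restriction of vector fields, semilinear over restriction of functions. -/
def TX.res {U W : X.Opens} (h : W ≤ U) : TX X U →ₛₗ[fres X h] TX X W where
  toFun D := ⟨fun W' => D.1 ⟨W'.1, W'.2.trans h⟩, fun W₁ W₂ h₁₂ f =>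
    D.2 ⟨W₁.1, W₁.2.trans h⟩ ⟨W₂.1, W₂.2.trans h⟩ h₁₂ f⟩
  map_add' D E := rfl
  map_smul' r D := TX.ext fun W' h' f => by
    change fres X (h'.trans h) r * D.at W' (h'.trans h) f =
      fres X h' (fres X h r) * D.at W' (h'.trans h) f
    rw [fres_fres]

variable (X)

/-- `Sym T_X` on `U`; for `U` affine, the coordinate ring of the cotangent bundle of `U`. -/
abbrev SymT (U : X.Opens) : Type := SymmetricAlgebra Γ(X, U) (TX X U)

/-- `Sym^n T_X` on `U`. -/
abbrev SymTn (n : ℕ) (U : X.Opens) : Submodule Γ(X, U) (SymT X U) :=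
  SymmetricAlgebra.symPow Γ(X, U) (TX X U) n

/-- The ideal `Sym^{≥ 1} T_X` of the zero section of the cotangent bundle, on `U`. -/
abbrev zeroIdeal (U : X.Opens) : Ideal (SymT X U) :=
  SymmetricAlgebra.augIdeal Γ(X, U) (TX X U)

/-- Functions on the `l`-th infinitesimal neighbourhood of the zero section of the cotangent
bundle: `Sym T_X / Sym^{≥ l+1} T_X = ∏_{k ≤ l} Sym^k T_X`, on `U`. -/
abbrev Jet (l : ℕ) (U : X.Opens) : Type := SymT X U ⧸ (zeroIdeal X U) ^ (l + 1)

/-- The class of an element of `Sym T_X` in `∏_{k ≤ l} Sym^k T_X`. -/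
abbrev jet (l : ℕ) {U : X.Opens} (s : SymT X U) : Jet X l U :=
  Ideal.Quotient.mk ((zeroIdeal X U) ^ (l + 1)) s

variable {X}

/-- Regular functions as elements of degree `0` in `Sym T_X`. -/
abbrev ofFun {U : X.Opens} (f : Γ(X, U)) : SymT X U := algebraMap Γ(X, U) (SymT X U) f

/-- Vector fields as elements of degree `1` in `Sym T_X`. -/
abbrev ofVec {U : X.Opens} (D : TX X U) : SymT X U := SymmetricAlgebra.ι Γ(X, U) (TX X U) D

/-- The projection `Sym T_X → Sym^0 T_X = O_X`. -/
abbrev zeroSec {U : X.Opens} : SymT X U →ₐ[Γ(X, U)] Γ(X, U) := SymmetricAlgebra.algebraMapInv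

/-- The canonical Poisson bracket of the cotangent bundle, on `Sym T_X`. -/
abbrev cotBracket {U : X.Opens} (s t : SymT X U) : SymT X U :=
  SymmetricAlgebra.poisson Γ(X, U) (TX X U) s t

/-- Restriction on `Sym T_X`. -/
abbrev symRes {U W : X.Opens} (h : W ≤ U) : SymT X U →+* SymT X W :=
  SymmetricAlgebra.mapSemi (fres X h) (TX.res h)

/-- Restriction on `Sym^n T_X`. -/
abbrev symTnRes (n : ℕ) {U W : X.Opens} (h : W ≤ U) : SymTn X n U →ₛₗ[fres X h] SymTn X n W :=
  SymmetricAlgebra.powSemi (fres X h) (TX.res h) n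

theorem symRes_refl {U : X.Opens} (s : SymT X U) : symRes (le_refl U) s = s := by
  have : symRes (le_refl U) = RingHom.id (SymT X U) := SymmetricAlgebra.ringHom_ext'
    (fun r => by rw [SymmetricAlgebra.mapSemi_algebraMap, fres_refl]; rfl)
    (fun D => by rw [SymmetricAlgebra.mapSemi_ι]; rfl)
  rw [this]; rfl

theorem symRes_symRes {U W W' : X.Opens} (h : W ≤ U) (h' : W' ≤ W) (s : SymT X U) :
    symRes h' (symRes h s) = symRes (h'.trans h) s := by
  have : (symRes h').comp (symRes h) = symRes (X := X) (h'.trans h) :=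
    SymmetricAlgebra.ringHom_ext'
      (fun r => by
        rw [RingHom.comp_apply, SymmetricAlgebra.mapSemi_algebraMap,
          SymmetricAlgebra.mapSemi_algebraMap, SymmetricAlgebra.mapSemi_algebraMap, fres_fres])
      (fun D => by
        rw [RingHom.comp_apply, SymmetricAlgebra.mapSemi_ι, SymmetricAlgebra.mapSemi_ι,
          SymmetricAlgebra.mapSemi_ι]; rfl)
  rw [← this]; rfl

/-! ### The sheaf `T_X ⊗ Sym^n T_X` and its first cohomology -/

/-- Restriction on `T_X ⊗ Sym^n T_X` (presheaf tensor product). -/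
def tensorRes (n : ℕ) {U W : X.Opens} (h : W ≤ U) :
    (TX X U ⊗[Γ(X, U)] SymTn X n U) →+ (TX X W ⊗[Γ(X, W)] SymTn X n W) :=
  SymmetricAlgebra.tensorSemi (fres X h) (TX.res h) n

theorem tensorRes_tmul (n : ℕ) {U W : X.Opens} (h : W ≤ U) (D : TX X U) (s : SymTn X n U) :
    tensorRes n h (D ⊗ₜ s) = TX.res h D ⊗ₜ symTnRes n h s := rfl

theorem tensorRes_refl (n : ℕ) {U : X.Opens} (t : TX X U ⊗[Γ(X, U)] SymTn X n U) :
    tensorRes n (le_refl U) t = t :=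
  SymmetricAlgebra.tensorSemi_self n (fun _ => rfl) symRes_refl t

theorem tensorRes_tensorRes (n : ℕ) {U W W' : X.Opens} (h : W ≤ U) (h' : W' ≤ W)
    (t : TX X U ⊗[Γ(X, U)] SymTn X n U) :
    tensorRes n h' (tensorRes n h t) = tensorRes n (h'.trans h) t :=
  SymmetricAlgebra.tensorSemi_comp n (fun _ => rfl) (symRes_symRes h h') t

variable (X)

/-- The presheaf `U ↦ T_X(U) ⊗ Sym^n T_X(U)` (tensor product over `O_X(U)`). -/
def tensorPresheaf (n : ℕ) : X.Opensᵒᵖ ⥤ AddCommGrpCat.{0} where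
  obj U := AddCommGrpCat.of (TX X U.unop ⊗[Γ(X, U.unop)] SymTn X n U.unop)
  map f := AddCommGrpCat.ofHom (tensorRes n f.unop.le)
  map_id _ := AddCommGrpCat.hom_ext (AddMonoidHom.ext fun t => tensorRes_refl n t)
  map_comp f g := AddCommGrpCat.hom_ext (AddMonoidHom.ext fun t =>
    (tensorRes_tensorRes n f.unop.le g.unop.le t).symm)

/-- The sheaf `T_X ⊗ Sym^n T_X` on `X`. -/
def tensorSheaf (n : ℕ) : Sheaf (Opens.grothendieckTopology X) AddCommGrpCat.{0} :=
  (presheafToSheaf (Opens.grothendieckTopology X) AddCommGrpCat.{0}).obj (tensorPresheaf X n)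

/-- The section of the sheaf `T_X ⊗ Sym^n T_X` over `U` defined by an element of
`T_X(U) ⊗ Sym^n T_X(U)`. -/
def tensorSection (n : ℕ) (U : X.Opens) :
    (TX X U ⊗[Γ(X, U)] SymTn X n U) →+ (tensorSheaf X n).obj.obj (op U) :=
  ((toSheafify (Opens.grothendieckTopology X) (tensorPresheaf X n)).app (op U)).hom

variable {X}

/-- The section `1` of the constant sheaf `ℤ` over `U`. -/
def oneZ (X : Scheme.{0}) (U : X.Opens) : (constZ X).obj.obj (op U) :=
  ((toSheafify (Opens.grothendieckTopology X) ((Functor.const X.Opensᵒᵖ).obj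
    (AddCommGrpCat.of (ULift.{0} ℤ)))).app (op U)).hom (ULift.up 1)

/-- Restriction of sections of an abelian sheaf. -/
abbrev ars {X : Scheme.{0}} (F : Sheaf (Opens.grothendieckTopology X) AddCommGrpCat.{0})
    {U W : X.Opens} (h : W ≤ U) : F.obj.obj (op U) →+ F.obj.obj (op W) :=
  (F.obj.map (homOfLE h).op).hom

/-- `ξ ∈ H¹(X, F)` is the class of the Čech cochain `d` on the open cover `(U i)`: the extension
`0 → F → E → ℤ → 0` of abelian sheaves with class `ξ ∈ Ext¹(ℤ, F) = H¹(X, F)` has sections `e i`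
over `U i` lifting `1` with `e j - e i = d i j` on `U i ∩ U j`. (For a cocycle `d` there is exactly
one such `ξ`, and for other cochains there is none.) -/
def IsCechClass {X : Scheme.{0}} {F : Sheaf (Opens.grothendieckTopology X) AddCommGrpCat.{0}}
    {ι : Type} (U : ι → X.Opens) (d : ∀ i j, F.obj.obj (op (U i ⊓ U j))) (ξ : Sheaf.H.{0} F 1) :
    Prop :=
  ∃ (E : Sheaf (Opens.grothendieckTopology X) AddCommGrpCat.{0}) (a : F ⟶ E) (p : E ⟶ constZ X)
    (w : a ≫ p = 0) (hS : (ShortComplex.mk a p w).ShortExact), hS.extClass = ξ ∧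
    ∃ e : ∀ i, E.obj.obj (op (U i)),
      (∀ i, (p.hom.app (op (U i))).hom (e i) = oneZ X (U i)) ∧
      ∀ i j, ars E inf_le_right (e j) - ars E inf_le_left (e i)
        = (a.hom.app (op (U i ⊓ U j))).hom (d i j)

/-! ### Towers of Poisson infinitesimal thickenings -/

/-- Sections of a sheaf of rings. -/
abbrev sec {X : Scheme.{0}} (A : TopCat.Sheaf CommRingCat.{0} X) (U : X.Opens) : CommRingCat.{0} :=
  A.obj.obj (op U)

/-- A morphism of sheaves of rings on sections over `U`. -/
abbrev onSec {X : Scheme.{0}} {A B : TopCat.Sheaf CommRingCat.{0} X} (f : A ⟶ B) (U : X.Opens) :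
    sec A U →+* sec B U :=
  (f.hom.app (op U)).hom

/-- A tower `A_n → A_{n-1} → ⋯ → A_0 = O_V` of sheaves of `ℂ`-algebras on `V` (only the indices
`l ≤ n` matter) with exact sequences `0 → Sym^l T_V → A_l → A_{l-1} → 0` (`A_{-1} = 0`) and Poisson
brackets `A_l × A_l → A_{l-1}`. Morphisms from the quasi-coherent sheaf `Sym^l T_V` are given on
affine open sets `W`, where its sections are `Sym^l` of the module of vector fields on `W`. -/
structure PoissonTower (V : Scheme.{0}) [V.Over specC] (n : ℕ) where
  /-- The sheaves `A_l`. -/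
  A : ℕ → TopCat.Sheaf CommRingCat.{0} V
  /-- The `ℂ`-algebra structure of `A_l`. -/
  const : ∀ l, ℂ →+* sec (A l) ⊤
  /-- The map `A_{l+1} → A_l`. -/
  proj : ∀ l, A (l + 1) ⟶ A l
  /-- The map `A_l → A_0 = O_V`. -/
  red : ∀ l, A l ⟶ V.sheaf
  /-- The map `Sym^l T_V → A_l`. -/
  incl : ∀ l (W : V.affineOpens), SymTn V l W.1 →+ sec (A l) W.1
  /-- The bracket `A_{l+1} × A_{l+1} → A_l` (the bracket on `A_0` has values in `A_{-1} = 0`). -/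
  bracket : ∀ l (U : V.Opens), sec (A (l + 1)) U →+ sec (A (l + 1)) U →+ sec (A l) U
  /-- `A_{l+1} → A_l` is `ℂ`-linear. -/
  proj_const : ∀ l, l < n → ∀ c, onSec (proj l) ⊤ (const (l + 1) c) = const l c
  /-- `A_0 → O_V` is an isomorphism. -/
  red_zero_bijective : ∀ U, Function.Bijective (onSec (red 0) U)
  /-- `A_0 → O_V` is `ℂ`-linear. -/
  red_const : ∀ c, onSec (red 0) ⊤ (const 0 c) = algebraMap ℂ Γ(V, ⊤) c
  /-- `A_l → O_V` is the composition of the maps of the tower. -/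
  red_succ : ∀ l, l < n → red (l + 1) = proj l ≫ red l
  /-- `Sym^l T_V → A_l` is compatible with restriction. -/
  incl_res : ∀ l, l ≤ n → ∀ (W W' : V.affineOpens) (h : W'.1 ≤ W.1) (s : SymTn V l W.1),
    incl l W' (symTnRes l h s) = rs (A l) h (incl l W s)
  /-- `Sym^l T_V → A_l` is `A_l`-linear, where `A_l` acts on `Sym^l T_V` through `O_V`. For `l ≥ 1`
  its image is therefore an ideal of square zero. -/
  incl_smul : ∀ l, l ≤ n → ∀ (W : V.affineOpens) (a : sec (A l) W.1) (s : SymTn V l W.1),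
    incl l W ((show Γ(V, W.1) from onSec (red l) W.1 a) • s) = a * incl l W s
  /-- For `l = 0` the map `O_V = Sym^0 T_V → A_0` is the inverse of `A_0 → O_V`. -/
  red_incl_zero : ∀ (W : V.affineOpens) (s : SymTn V 0 W.1),
    onSec (red 0) W.1 (incl 0 W s) = zeroSec s.1
  /-- Exactness on the left. -/
  incl_injective : ∀ l, l ≤ n → ∀ W : V.affineOpens, Function.Injective (incl l W)
  /-- Exactness in the middle. -/
  exact : ∀ l, l < n → ∀ (W : V.affineOpens) (a : sec (A (l + 1)) W.1),
    onSec (proj l) W.1 a = 0 ↔ ∃ s, incl (l + 1) W s = a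
  /-- `A_{l+1} → A_l` is a surjection of sheaves. -/
  proj_surjective : ∀ l, l < n → ∀ (U : V.Opens) (a : sec (A l) U), ∀ x ∈ U,
    ∃ (W : V.Opens) (h : W ≤ U), x ∈ W ∧ ∃ b, onSec (proj l) W b = rs (A l) h a
  /-- The bracket is a map of sheaves. -/
  bracket_res : ∀ l, l < n → ∀ (U W : V.Opens) (h : W ≤ U) (a b : sec (A (l + 1)) U),
    bracket l W (rs (A (l + 1)) h a) (rs (A (l + 1)) h b) = rs (A l) h (bracket l U a b)
  /-- The bracket is skew-symmetric. -/
  bracket_self : ∀ l, l < n → ∀ (U : V.Opens) (a : sec (A (l + 1)) U), bracket l U a a = 0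
  /-- The bracket is `ℂ`-bilinear. -/
  bracket_const : ∀ l, l < n → ∀ (U : V.Opens) (c : ℂ) (a b : sec (A (l + 1)) U),
    bracket l U (rs (A (l + 1)) le_top (const (l + 1) c) * a) b =
      rs (A l) le_top (const l c) * bracket l U a b
  /-- The Leibniz rule. -/
  bracket_mul : ∀ l, l < n → ∀ (U : V.Opens) (a b c : sec (A (l + 1)) U),
    bracket l U (a * b) c =
      onSec (proj l) U a * bracket l U b c + onSec (proj l) U b * bracket l U a c
  /-- The brackets are compatible with the maps of the tower. -/
  bracket_proj : ∀ l, l + 1 < n → ∀ (U : V.Opens) (a b : sec (A (l + 2)) U),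
    onSec (proj l) U (bracket (l + 1) U a b) =
      bracket l U (onSec (proj (l + 1)) U a) (onSec (proj (l + 1)) U b)
  /-- The Jacobi identity, with values in `A_l`. -/
  jacobi : ∀ l, l + 1 < n → ∀ (U : V.Opens) (a b c : sec (A (l + 2)) U),
    bracket l U (bracket (l + 1) U a b) (onSec (proj (l + 1)) U c) +
      bracket l U (bracket (l + 1) U b c) (onSec (proj (l + 1)) U a) +
      bracket l U (bracket (l + 1) U c a) (onSec (proj (l + 1)) U b) = 0
  /-- The restriction of the bracket to `Sym^{l+1} T_V × A_{l+1}` is the natural derivation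
  `Sym^{l+1} T_V × O_V → Sym^l T_V`. -/
  bracket_incl : ∀ l, l < n → ∀ (W : V.affineOpens) (s : SymTn V (l + 1) W.1)
    (a : sec (A (l + 1)) W.1),
    bracket l W.1 (incl (l + 1) W s) a =
      incl l W (SymmetricAlgebra.derive l s (show Γ(V, W.1) from onSec (red (l + 1)) W.1 a))

section Tower

variable {V : Scheme.{0}} [V.Over specC]

/-- Compatible Poisson isomorphisms of sheaves of algebras
`α_l : ∏_{k ≤ l} Sym^k T_U → A_l|_U`, `l ≤ m`, which are the identity on `Sym^l T_U`. -/
structure LocalTriv {n : ℕ} (T : PoissonTower V n) (m : ℕ) (U : V.Opens) where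
  /-- The isomorphisms, on affine open sets `W ⊆ U`. -/
  α : ∀ l, l ≤ m → ∀ W : V.affineOpens, W.1 ≤ U → Jet V l W.1 ≃+* sec (T.A l) W.1
  /-- They are compatible with restriction. -/
  res : ∀ l (hl : l ≤ m) (W W' : V.affineOpens) (hW : W.1 ≤ U) (h : W'.1 ≤ W.1) (s : SymT V W.1),
    α l hl W' (h.trans hW) (jet V l (symRes h s)) = rs (T.A l) h (α l hl W hW (jet V l s))
  /-- They are `ℂ`-linear. -/
  const : ∀ l (hl : l ≤ m) (W : V.affineOpens) (hW : W.1 ≤ U) (c : ℂ),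
    α l hl W hW (jet V l (ofFun (algebraMap ℂ Γ(V, W.1) c))) = rs (T.A l) le_top (T.const l c)
  /-- They are the identity on `Sym^l T_U`. -/
  incl : ∀ l (hl : l ≤ m) (W : V.affineOpens) (hW : W.1 ≤ U) (s : SymTn V l W.1),
    α l hl W hW (jet V l s.1) = T.incl l W s
  /-- They are compatible with the maps of the tower. -/
  proj : ∀ l (hl : l + 1 ≤ m) (W : V.affineOpens) (hW : W.1 ≤ U) (s : SymT V W.1),
    onSec (T.proj l) W.1 (α (l + 1) hl W hW (jet V (l + 1) s)) =
      α l (Nat.le_of_succ_le hl) W hW (jet V l s)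
  /-- They preserve the Poisson brackets. -/
  poisson : ∀ l (hl : l + 1 ≤ m) (W : V.affineOpens) (hW : W.1 ≤ U) (s t : SymT V W.1),
    T.bracket l W.1 (α (l + 1) hl W hW (jet V (l + 1) s)) (α (l + 1) hl W hW (jet V (l + 1) t)) =
      α l (Nat.le_of_succ_le hl) W hW (jet V l (cotBracket s t))

/-- A lift of `α_n` to an isomorphism of sheaves of algebras
`β : ∏_{k ≤ n+1} Sym^k T_U → A_{n+1}|_U` which is the identity on `Sym^{n+1} T_U` and satisfies
`{β(∂), β(f)} = α_n(∂(f))` for `∂ ∈ T_U`, `f ∈ O_U`; it need not preserve the other brackets. -/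
structure NormalizedLift {n : ℕ} {T : PoissonTower V (n + 1)} {U : V.Opens}
    (τ : LocalTriv T n U) where
  /-- The isomorphism, on affine open sets `W ⊆ U`. -/
  β : ∀ W : V.affineOpens, W.1 ≤ U → Jet V (n + 1) W.1 ≃+* sec (T.A (n + 1)) W.1
  /-- It is compatible with restriction. -/
  res : ∀ (W W' : V.affineOpens) (hW : W.1 ≤ U) (h : W'.1 ≤ W.1) (s : SymT V W.1),
    β W' (h.trans hW) (jet V (n + 1) (symRes h s)) =
      rs (T.A (n + 1)) h (β W hW (jet V (n + 1) s))
  /-- It is `ℂ`-linear. -/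
  const : ∀ (W : V.affineOpens) (hW : W.1 ≤ U) (c : ℂ),
    β W hW (jet V (n + 1) (ofFun (algebraMap ℂ Γ(V, W.1) c))) =
      rs (T.A (n + 1)) le_top (T.const (n + 1) c)
  /-- It is the identity on `Sym^{n+1} T_U`. -/
  incl : ∀ (W : V.affineOpens) (hW : W.1 ≤ U) (s : SymTn V (n + 1) W.1),
    β W hW (jet V (n + 1) s.1) = T.incl (n + 1) W s
  /-- It lifts `α_n`. -/
  proj : ∀ (W : V.affineOpens) (hW : W.1 ≤ U) (s : SymT V W.1),
    onSec (T.proj n) W.1 (β W hW (jet V (n + 1) s)) = τ.α n le_rfl W hW (jet V n s)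
  /-- It preserves the brackets of vector fields with functions. -/
  vec_fun : ∀ (W : V.affineOpens) (hW : W.1 ≤ U) (D : TX V W.1) (f : Γ(V, W.1)),
    T.bracket n W.1 (β W hW (jet V (n + 1) (ofVec D))) (β W hW (jet V (n + 1) (ofFun f))) =
      τ.α n le_rfl W hW (jet V n (ofFun ⁅D, f⁆))

/-- The sections `d i j` of `T_V ⊗ Sym^{n+1} T_V` represent the differences
`β_i⁻¹ β_j - β'_i⁻¹ β'_j` of the transition maps: on affine open sets `W ⊆ U_i ∩ U_j` this
difference is the derivation `∏_{k ≤ n+1} Sym^k T_W → O_W → Sym^{n+1} T_W` defined by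
`d i j ∈ T_V ⊗ Sym^{n+1} T_V = Hom(Ω_V, Sym^{n+1} T_V)`. -/
def IsDifference {n : ℕ} {T T' : PoissonTower V (n + 1)} {ι : Type} {U : ι → V.affineOpens}
    {τ : ∀ i, LocalTriv T n (U i).1} {τ' : ∀ i, LocalTriv T' n (U i).1}
    (β : ∀ i, NormalizedLift (τ i)) (β' : ∀ i, NormalizedLift (τ' i))
    (d : ∀ i j, (tensorSheaf V (n + 1)).obj.obj (op ((U i).1 ⊓ (U j).1))) : Prop :=
  ∀ (i j : ι) (W : V.affineOpens) (hi : W.1 ≤ (U i).1) (hj : W.1 ≤ (U j).1),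
    ∃ t : TX V W.1 ⊗[Γ(V, W.1)] SymTn V (n + 1) W.1,
      tensorSection V (n + 1) W.1 t = ars (tensorSheaf V (n + 1)) (le_inf hi hj) (d i j) ∧
      ∀ s : SymT V W.1,
        ((β i).β W hi).symm ((β j).β W hj (jet V (n + 1) s)) -
          ((β' i).β W hi).symm ((β' j).β W hj (jet V (n + 1) s)) =
        jet V (n + 1) (SymmetricAlgebra.tensorDer (n + 1) t (zeroSec s)).1

/-- `ψ : A_{n+1} → A'_{n+1}` is an isomorphism of sheaves of Poisson `ℂ`-algebras compatible with
`φ : A_n → A'_n` and with the identity of `Sym^{n+1} T_V`. -/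
structure IsPoissonExtension {n : ℕ} {T T' : PoissonTower V (n + 1)} (φ : T.A n ≅ T'.A n)
    (ψ : T.A (n + 1) ≅ T'.A (n + 1)) : Prop where
  const : ∀ c, onSec ψ.hom ⊤ (T.const (n + 1) c) = T'.const (n + 1) c
  proj : ψ.hom ≫ T'.proj n = T.proj n ≫ φ.hom
  incl : ∀ (W : V.affineOpens) (s : SymTn V (n + 1) W.1),
    onSec ψ.hom W.1 (T.incl (n + 1) W s) = T'.incl (n + 1) W s
  poisson : ∀ (U : V.Opens) (a b : sec (T.A (n + 1)) U),
    onSec φ.hom U (T.bracket n U a b) = T'.bracket n U (onSec ψ.hom U a) (onSec ψ.hom U b)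

end Tower

/-! ### Symplectic varieties and Lagrangian subvarieties -/

/-- The differential of a function, as a linear form on vector fields. -/
def differential {U : X.Opens} (f : Γ(X, U)) : Module.Dual Γ(X, U) (TX X U) where
  toFun D := ⁅D, f⁆
  map_add' D E := add_lie D E f
  map_smul' r D := LieRinehartRing.lie_smul_eq_mul r f D

/-- A symplectic form on a smooth complex scheme: a closed non-degenerate alternating form
`ω : T_X × T_X → O_X`. -/
structure SymplecticForm (X : Scheme.{0}) [X.Over specC] where
  /-- The form on vector fields on `U`. -/
  form : ∀ U : X.Opens, TX X U →ₗ[Γ(X, U)] Module.Dual Γ(X, U) (TX X U)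
  res : ∀ (U W : X.Opens) (h : W ≤ U) (D E : TX X U),
    form W (TX.res h D) (TX.res h E) = fres X h (form U D E)
  alternating : ∀ (U : X.Opens) (D : TX X U), form U D D = 0
  nondegenerate : ∀ U : X.affineOpens, Function.Bijective (form U.1)
  closed : ∀ (U : X.Opens) (D E F : TX X U),
    ⁅D, form U E F⁆ - ⁅E, form U D F⁆ + ⁅F, form U D E⁆
      - form U ⁅D, E⁆ F + form U ⁅D, F⁆ E - form U ⁅E, F⁆ D = 0

/-- The vector field `H_f` with `ω(H_f, -) = df`. -/
def SymplecticForm.hamiltonian (ω : SymplecticForm X) (U : X.affineOpens) (f : Γ(X, U.1)) :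
    TX X U.1 :=
  (LinearEquiv.ofBijective (ω.form U.1) (ω.nondegenerate U)).symm (differential f)

/-- The Poisson bracket `{f, g} = ω(H_f, H_g) = Θ(df ∧ dg)`, where `Θ` is the form on `Ω_X` that
corresponds to `ω` under the isomorphism `T_X ≅ Ω_X` defined by `ω`. -/
def SymplecticForm.bracket (ω : SymplecticForm X) (U : X.affineOpens) (f g : Γ(X, U.1)) :
    Γ(X, U.1) :=
  ω.form U.1 (ω.hamiltonian U f) (ω.hamiltonian U g)

section Lagrangian

variable {V Y : Scheme.{0}} [V.Over specC] [Y.Over specC]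

/-- The ideal of the subscheme `i : V → Y` on `W ⊆ Y`. -/
abbrev idealOn (i : V ⟶ Y) (W : Y.Opens) : Ideal Γ(Y, W) := RingHom.ker (i.app W).hom

/-- `i : V → Y` is (the inclusion of) a Lagrangian subvariety: a closed immersion with
`dim Y = 2 dim V` such that `ω` restricts to zero on `V`, i.e. `ω(D, E)` vanishes on `V` for
vector fields `D, E` tangent to `V`. -/
structure IsLagrangian (ω : SymplecticForm Y) (i : V ⟶ Y) : Prop where
  closedImmersion : IsClosedImmersion i
  dim : ∃ d : ℕ, SmoothOfRelativeDimension d (V ↘ specC) ∧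
    SmoothOfRelativeDimension (2 * d) (Y ↘ specC)
  isotropic : ∀ (W : Y.affineOpens) (D E : TX Y W.1),
    (∀ f ∈ idealOn i W.1, ⁅D, f⁆ ∈ idealOn i W.1) →
    (∀ f ∈ idealOn i W.1, ⁅E, f⁆ ∈ idealOn i W.1) →
    ω.form W.1 D E ∈ idealOn i W.1

/-- An isomorphism, inducing the identity on `V`, of the formal completion of `Y` along `V` with
the formal completion of the cotangent bundle of `V` along its zero section, as formal Poisson
schemes over `ℂ`: compatible isomorphisms of the `l`-th infinitesimal neighbourhoods for all `l`,
`O_Y/I^{l+1} ≅ Sym T_V / Sym^{≥ l+1} T_V`, which intertwine the brackets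
`O_Y/I^{l+2} × O_Y/I^{l+2} → O_Y/I^{l+1}` with those of the cotangent bundle. -/
structure FormalPoissonIso (ω : SymplecticForm Y) (i : V ⟶ Y) where
  /-- The isomorphisms, over affine open sets `W ⊆ Y`. -/
  φ : ∀ (l : ℕ) (W : Y.affineOpens),
    (Γ(Y, W.1) ⧸ (idealOn i W.1) ^ (l + 1)) ≃+* Jet V l (i ⁻¹ᵁ W.1)
  /-- They are compatible with restriction to `W' ⊆ W`. -/
  res : ∀ (l : ℕ) (W W' : Y.affineOpens) (h : W'.1 ≤ W.1) (f : Γ(Y, W.1))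
    (s : SymT V (i ⁻¹ᵁ W.1)), φ l W (Ideal.Quotient.mk _ f) = jet V l s →
    φ l W' (Ideal.Quotient.mk _ (fres Y h f)) = jet V l (symRes (i.preimage_mono h) s)
  /-- They are `ℂ`-linear. -/
  const : ∀ (l : ℕ) (W : Y.affineOpens) (c : ℂ),
    φ l W (Ideal.Quotient.mk _ (algebraMap ℂ Γ(Y, W.1) c)) =
      jet V l (ofFun (algebraMap ℂ Γ(V, i ⁻¹ᵁ W.1) c))
  /-- They are compatible for varying `l`. -/
  proj : ∀ (l : ℕ) (W : Y.affineOpens) (f : Γ(Y, W.1)) (s : SymT V (i ⁻¹ᵁ W.1)),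
    φ (l + 1) W (Ideal.Quotient.mk _ f) = jet V (l + 1) s →
    φ l W (Ideal.Quotient.mk _ f) = jet V l s
  /-- They induce the identity on `V`. -/
  base : ∀ (W : Y.affineOpens) (f : Γ(Y, W.1)),
    φ 0 W (Ideal.Quotient.mk _ f) = jet V 0 (ofFun ((i.app W.1).hom f))
  /-- They preserve the Poisson brackets. -/
  poisson : ∀ (l : ℕ) (W : Y.affineOpens) (f g : Γ(Y, W.1)) (s t : SymT V (i ⁻¹ᵁ W.1)),
    φ (l + 1) W (Ideal.Quotient.mk _ f) = jet V (l + 1) s →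
    φ (l + 1) W (Ideal.Quotient.mk _ g) = jet V (l + 1) t →
    φ l W (Ideal.Quotient.mk _ (ω.bracket W f g)) = jet V l (cotBracket s t)

end Lagrangian

end CScheme

/-! The whole argument rests on Euler's formula. On an affine open set of a smooth variety the
differentials form a projective module, so there are finitely many functions `f k` and vector fields
`x k` with `D g = ∑ x k (g) • D (f k)` for every derivation over `ℂ` and `y = ∑ y (f k) • x k` for
every vector field (`IsDualBasis`). Such dual bases exist on all affine open sets, without
coordinates, and restrict to smaller ones. For `s` in `Sym^n` they give `∑ x k * {s, f k} = n • s`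
(`IsDualBasis.euler`). Dividing by the degree yields two Poincaré lemmas. A derivation `E : O →
Sym^n` with `{E a, b} = {E b, a}` is `{s, -}` for some `s` in `Sym^{n+1}` (`exists_derive_eq`), and
a closed skew biderivation with values in `Sym^n` comes from a derivation `O → Sym^{n+1}`
(`exists_derive_sub_eq`).

Local triviality: let `A` be the next thickening over an affine open set. Formal smoothness lifts
the functions to `A`. The brackets of the lifted functions form a closed biderivation, which the
second Poincaré lemma removes (`exists_fun_lift`). The lifts of the `x k` are then corrected by the
first Poincaré lemma, so that their brackets with functions are right (`exists_framing`). The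
remaining brackets follow from the Jacobi identity, because an element of positive degree whose
brackets with all functions vanish is zero. Restrictions between affine open sets are étale, so
these lifts restrict uniquely.

Obstruction: two lifts whose brackets agree as soon as one entry reduces to zero differ by a
derivation `O → Sym^{n+1}`, that is, by a section of `T ⊗ Sym^{n+1}`. On a cover these differences
form a Čech cocycle, and other choices of lifts change it by a coboundary. If the lifts preserve all
brackets, the derivations are closed, hence of the form `{s, -}` with `s` in `Sym^{n+2}`. The map
from `Sym^{n+2}` to `T ⊗ Sym^{n+1}` is split by multiplication divided by the degree
(`tensorPotential`). Therefore, when the cocycle is a coboundary of arbitrary sections, their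
potentials already split it, and changing the local lifts by these potentials makes them agree while
all brackets are preserved (`exists_symTn_splitting`, `exists_global_lift`). `ComparisonSystem`
isolates this argument, so that it serves both for two towers and for a Lagrangian.

Lagrangian case: at the generic point of `V` the tangent space of `V` is isotropic of half the
dimension, hence equal to its orthogonal, and so the ideal `I` of `V` is closed under the bracket
(`IsLagrangian.bracket_mem`). The bracket identifies `I / I²` with `T_V`, and iterated brackets with
functions identify `I^l / I^{l+1}` with `Sym^l T_V` (`IsSymbol`). Once `O / I^{n+1}` is identified
with the corresponding neighbourhood of the zero section, `O / I^{n+2}` is a Poisson extension of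
the kind above. The vanishing of `H¹` glues its local trivializations, and induction on `n` gives
the formal isomorphism. -/

set_option linter.unusedVariables false
set_option linter.unusedSectionVars false

namespace CScheme

/-! ### Local representatives of sections of a sheafification. -/

section Sheafification

variable {X : TopCat.{0}} (P : (Opens X)ᵒᵖ ⥤ AddCommGrpCat.{0})

theorem exists_local_toSheafify {U : Opens X}
    (s : (sheafify (Opens.grothendieckTopology X) P).obj (op U)) {x : X} (hx : x ∈ U) :
    ∃ (W : Opens X) (h : W ≤ U), x ∈ W ∧ ∃ t : P.obj (op W),
      ((toSheafify (Opens.grothendieckTopology X) P).app (op W)).hom t =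
        ((sheafify (Opens.grothendieckTopology X) P).map (homOfLE h).op).hom s := by
  have h := Presheaf.imageSieve_mem (Opens.grothendieckTopology X)
    (toSheafify (Opens.grothendieckTopology X) P) (U := op U) s
  obtain ⟨W, f, ⟨t, ht⟩, hxW⟩ := h x hx
  exact ⟨W, f.le, hxW, t, ht⟩

theorem exists_local_eq_of_toSheafify_eq {U : Opens X} {s t : P.obj (op U)}
    (h : ((toSheafify (Opens.grothendieckTopology X) P).app (op U)).hom s =
      ((toSheafify (Opens.grothendieckTopology X) P).app (op U)).hom t) {x : X} (hx : x ∈ U) :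
    ∃ (W : Opens X) (h : W ≤ U), x ∈ W ∧
      (P.map (homOfLE h).op).hom s = (P.map (homOfLE h).op).hom t := by
  have h := Presheaf.equalizerSieve_mem (Opens.grothendieckTopology X)
    (toSheafify (Opens.grothendieckTopology X) P) (X := op U) s t h
  obtain ⟨W, f, hf, hxW⟩ := h x hx
  exact ⟨W, f.le, hxW, hf⟩

end Sheafification

/-! ### Gluing and exactness for abelian sheaves. -/

section Exactness
variable {X : Scheme.{0}} {F G H : Sheaf (Opens.grothendieckTopology X) AddCommGrpCat.{0}}

theorem ars_ars (F : Sheaf (Opens.grothendieckTopology X) AddCommGrpCat.{0}) {U W W' : X.Opens}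
    (h : W ≤ U) (h' : W' ≤ W) (s : F.obj.obj (op U)) :
    ars F h' (ars F h s) = ars F (h'.trans h) s := by
  have : (homOfLE (h'.trans h)).op = (homOfLE h).op ≫ (homOfLE h').op := rfl
  simp only [ars, this, Functor.map_comp, AddCommGrpCat.hom_comp, AddMonoidHom.comp_apply]

theorem ars_refl (F : Sheaf (Opens.grothendieckTopology X) AddCommGrpCat.{0}) {U : X.Opens}
    (s : F.obj.obj (op U)) : ars F (le_refl U) s = s := by
  simp [ars]

theorem ars_app (f : F ⟶ G) {U W : X.Opens} (h : W ≤ U) (s : F.obj.obj (op U)) :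
    ars G h ((f.hom.app (op U)).hom s) = (f.hom.app (op W)).hom (ars F h s) := by
  have := f.hom.naturality (homOfLE h).op
  exact (congrArg (fun g => g.hom s) this).symm

theorem ars_ext (F : Sheaf (Opens.grothendieckTopology X) AddCommGrpCat.{0}) {U : X.Opens}
    {s t : F.obj.obj (op U)}
    (h : ∀ x ∈ U, ∃ (W : X.Opens) (h : W ≤ U), x ∈ W ∧ ars F h s = ars F h t) : s = t := by
  choose W hW hx hs using h
  refine TopCat.Sheaf.eq_of_locally_eq' (C := AddCommGrpCat.{0}) (X := X) F
    (fun x : U => W x.1 x.2) U (fun x => homOfLE (hW x.1 x.2)) ?_ s t (fun x => hs x.1 x.2)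
  intro x hxU
  exact Opens.mem_iSup.2 ⟨⟨x, hxU⟩, hx x hxU⟩

theorem ars_glue (F : Sheaf (Opens.grothendieckTopology X) AddCommGrpCat.{0}) {ι : Type} {U : X.Opens}
    (W : ι → X.Opens) (hW : ∀ i, W i ≤ U) (hc : U ≤ ⨆ i, W i)
    (s : ∀ i, F.obj.obj (op (W i)))
    (h : ∀ i j, ars F (inf_le_left : W i ⊓ W j ≤ W i) (s i) = ars F inf_le_right (s j)) :
    ∃ t, ∀ i, ars F (hW i) t = s i := by
  obtain ⟨t, ht, _⟩ := TopCat.Sheaf.existsUnique_gluing' (C := AddCommGrpCat.{0}) (X := X) F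
    W U (fun i => homOfLE (hW i)) hc s h
  exact ⟨t, ht⟩

/-- Injectivity of `f` makes the chosen preimages unique, hence additive and compatible with
restriction; so a morphism killed by `g` factors through `f`. -/
theorem shortComplex_exact_of_sections (f : F ⟶ G) (g : G ⟶ H) (w : f ≫ g = 0)
    (hf : ∀ U, Function.Injective (f.hom.app (op U)).hom)
    (hg : ∀ U (s : G.obj.obj (op U)), (g.hom.app (op U)).hom s = 0 →
      ∃ t, (f.hom.app (op U)).hom t = s) :
    (ShortComplex.mk f g w).Exact ∧ Mono f := by
  have hm : Mono f := by
    refine ⟨fun {Z} u v h => ?_⟩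
    ext U s
    exact hf _ (by simpa using congrArg (fun k => (k.hom.app U).hom s) h)
  refine ⟨ShortComplex.exact_of_f_is_kernel _ (Limits.KernelFork.IsLimit.ofι' _ _ fun {A} k hk => ?_), hm⟩
  have hk' : ∀ (U : X.Opens) (s : A.obj.obj (op U)), ∃ t, (f.hom.app (op U)).hom t = (k.hom.app (op U)).hom s := by
    intro U s
    refine hg U _ ?_
    exact congrArg (fun k => (k.hom.app (op U)).hom s) hk
  choose t ht using hk'
  refine ⟨⟨{ app := fun U => AddCommGrpCat.ofHom (AddMonoidHom.mk' (t U.unop) fun a b => hf _ ?_), naturality := ?_ }⟩, ?_⟩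
  · rw [map_add, ht, ht, ht, map_add]
  · intro U W i
    ext s
    refine hf _ ?_
    change (f.hom.app (op W.unop)).hom (t _ _) = (f.hom.app _).hom (ars F i.unop.le (t _ s))
    rw [ht, ← ars_app, ht, ars_app]
    rfl
  · ext U s
    exact ht _ _
end Exactness
end CScheme

/-! ### First cohomology: Čech cocycles and extensions of `ℤ`. -/

namespace CScheme

section Cech
variable {X : Scheme.{0}} (F : Sheaf (Opens.grothendieckTopology X) AddCommGrpCat.{0})
  {ι : Type} (U : ι → X.Opens)

/-- A Čech cochain of degree one is a cocycle. -/
def IsCocycle (d : ∀ i j, F.obj.obj (op (U i ⊓ U j))) : Prop :=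
  ∀ i j k (W : X.Opens) (hi : W ≤ U i) (hj : W ≤ U j) (hk : W ≤ U k),
    ars F (le_inf hi hj) (d i j) + ars F (le_inf hj hk) (d j k) = ars F (le_inf hi hk) (d i k)

variable {F U} (d : ∀ i j, F.obj.obj (op (U i ⊓ U j)))

/-- Sections over `W` of the presheaf extension of `ℤ` by `F` defined by a Čech cochain. -/
def cechExtSections (W : X.Opens) : AddSubgroup (ℤ × ∀ k, F.obj.obj (op (W ⊓ U k))) where
  -- With imaginary sections `e k` over `U k` satisfying `e k - e j = d j k`, a pair `(m, s)` stands
  -- for the section equal to `s k + m • e k` on each `W ⊓ U k`. The condition says that these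
  -- expressions agree.
  carrier := {s | ∀ j k (W' : X.Opens) (hj : W' ≤ W ⊓ U j) (hk : W' ≤ W ⊓ U k),
    ars F hj (s.2 j) = ars F hk (s.2 k) +
      s.1 • ars F (le_inf (hj.trans inf_le_right) (hk.trans inf_le_right)) (d j k)}
  zero_mem' := fun j k W' hj hk => by simp
  add_mem' := fun {a b} ha hb j k W' hj hk => by
    rw [Prod.snd_add, Prod.fst_add, Pi.add_apply, Pi.add_apply, map_add, map_add, ha j k W' hj hk,
      hb j k W' hj hk, add_smul]
    abel
  neg_mem' := fun {a} ha j k W' hj hk => by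
    rw [Prod.snd_neg, Prod.fst_neg, Pi.neg_apply, Pi.neg_apply, map_neg, map_neg, ha j k W' hj hk,
      neg_smul]
    abel

/-- Restriction for the presheaf extension. -/
def cechExtRes {W W' : X.Opens} (h : W' ≤ W) : cechExtSections d W →+ cechExtSections d W' where
  toFun s := ⟨(s.1.1, fun k => ars F (inf_le_inf_right _ h) (s.1.2 k)), fun j k W'' hj hk => by
    rw [ars_ars, ars_ars]
    exact s.2 j k W'' _ _⟩
  map_zero' := Subtype.ext (Prod.ext rfl (funext fun k => map_zero _))
  map_add' s t := Subtype.ext (Prod.ext rfl (funext fun k => map_add _ _ _))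

/-- The presheaf extension of `ℤ` by `F` defined by a Čech cochain. -/
def cechExtPresheaf : X.Opensᵒᵖ ⥤ AddCommGrpCat.{0} where
  obj W := AddCommGrpCat.of (cechExtSections d W.unop)
  map f := AddCommGrpCat.ofHom (cechExtRes d f.unop.le)
  map_id W := AddCommGrpCat.hom_ext (AddMonoidHom.ext fun s => Subtype.ext (Prod.ext rfl
    (funext fun k => ars_refl F _)))
  map_comp f g := AddCommGrpCat.hom_ext (AddMonoidHom.ext fun s => Subtype.ext (Prod.ext rfl
    (funext fun k => (ars_ars F _ _ _).symm)))

/-- The extension of `ℤ` by `F` defined by a Čech cochain. -/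
def cechExt : Sheaf (Opens.grothendieckTopology X) AddCommGrpCat.{0} :=
  (presheafToSheaf _ _).obj (cechExtPresheaf d)

/-- The section of the extension defined by a section of the presheaf extension. -/
def cechExtMk (W : X.Opens) : cechExtSections d W →+ (cechExt d).obj.obj (op W) :=
  ((toSheafify (Opens.grothendieckTopology X) (cechExtPresheaf d)).app (op W)).hom

theorem cechExtMk_res {W W' : X.Opens} (h : W' ≤ W) (s : cechExtSections d W) :
    cechExtMk d W' (cechExtRes d h s) = ars (cechExt d) h (cechExtMk d W s) := by
  have := (toSheafify (Opens.grothendieckTopology X) (cechExtPresheaf d)).naturality (homOfLE h).op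
  exact congrArg (fun g => g.hom s) this

/-- Sections of the constant sheaf defined by integers. -/
def constZMk (X : Scheme.{0}) (W : X.Opens) : ULift.{0} ℤ →+ (constZ X).obj.obj (op W) :=
  ((toSheafify (Opens.grothendieckTopology X) ((Functor.const X.Opensᵒᵖ).obj
    (AddCommGrpCat.of (ULift.{0} ℤ)))).app (op W)).hom

theorem constZMk_res {W W' : X.Opens} (h : W' ≤ W) (m : ULift.{0} ℤ) :
    constZMk X W' m = ars (constZ X) h (constZMk X W m) := by
  have := (toSheafify (Opens.grothendieckTopology X) ((Functor.const X.Opensᵒᵖ).obj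
    (AddCommGrpCat.of (ULift.{0} ℤ)))).naturality (homOfLE h).op
  exact congrArg (fun g => g.hom m) this

theorem constZMk_eq_smul (W : X.Opens) (m : ULift.{0} ℤ) :
    constZMk X W m = m.down • oneZ X W := by
  have : m = m.down • (ULift.up 1 : ULift.{0} ℤ) := by
    apply ULift.ext; simp
  conv_lhs => rw [this, map_zsmul]
  rfl

theorem oneZ_res {W W' : X.Opens} (h : W' ≤ W) : ars (constZ X) h (oneZ X W) = oneZ X W' :=
  (constZMk_res h _).symm

/-- The section of the presheaf extension defined by a section of `F`. -/
def cechExtOf (W : X.Opens) : F.obj.obj (op W) →+ cechExtSections d W where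
  toFun f := ⟨(0, fun k => ars F inf_le_left f), fun j k W' hj hk => by
    simp [ars_ars]⟩
  map_zero' := Subtype.ext (Prod.ext rfl (funext fun k => map_zero _))
  map_add' s t := Subtype.ext (Prod.ext (by simp) (funext fun k => map_add _ _ _))

/-- The inclusion `F → E` of the extension defined by a Čech cochain. -/
def cechExtIncl : F ⟶ cechExt d where
  hom :=
    { app := fun W => AddCommGrpCat.ofHom ((cechExtMk d W.unop).comp (cechExtOf d W.unop))
      naturality := fun W W' f => by
        ext s
        change cechExtMk d W'.unop (cechExtOf d W'.unop (ars F f.unop.le s)) =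
          ars (cechExt d) f.unop.le (cechExtMk d W.unop (cechExtOf d W.unop s))
        rw [← cechExtMk_res]
        congr 1
        exact Subtype.ext (Prod.ext rfl (funext fun k => (ars_ars F _ _ _).trans (ars_ars F _ _ _).symm)) }

theorem cechExtIncl_apply (W : X.Opens) (s : F.obj.obj (op W)) :
    ((cechExtIncl d).hom.app (op W)).hom s = cechExtMk d W (cechExtOf d W s) := rfl

/-- The projection `E → ℤ` of the extension defined by a Čech cochain. -/
def cechExtProj : cechExt d ⟶ constZ X :=
  (presheafToSheaf _ _).map
    { app := fun W => AddCommGrpCat.ofHom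
        (AddMonoidHom.mk' (fun s : cechExtSections d W.unop => ULift.up s.1.1) fun _ _ => rfl)
      naturality := fun _ _ _ => rfl }

theorem cechExtProj_mk (W : X.Opens) (s : cechExtSections d W) :
    ((cechExtProj d).hom.app (op W)).hom (cechExtMk d W s) = constZMk X W (ULift.up s.1.1) := by
  have := toSheafify_naturality (Opens.grothendieckTopology X)
    (P := cechExtPresheaf d) (Q := (Functor.const X.Opensᵒᵖ).obj (AddCommGrpCat.of (ULift.{0} ℤ)))
    { app := fun W => AddCommGrpCat.ofHom
        (AddMonoidHom.mk' (fun s : cechExtSections d W.unop => ULift.up s.1.1) fun _ _ => rfl)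
      naturality := fun _ _ _ => rfl }
  exact (congrArg (fun g => (g.app (op W)).hom s) this).symm

theorem cechExt_w : cechExtIncl d ≫ cechExtProj d = 0 := by
  ext W s
  change ((cechExtProj d).hom.app (op W.unop)).hom (cechExtMk d _ (cechExtOf d _ s)) = 0
  rw [cechExtProj_mk]
  exact map_zero _

variable {d} (hU : ⨆ i, U i = (⊤ : X.Opens))

include hU in
theorem exists_mem_of_cover (x : X) : ∃ i, x ∈ U i := by
  have : x ∈ ⨆ i, U i := by rw [hU]; trivial
  simpa using this

include hU in
theorem exists_cechExtOf (W : X.Opens) (s : cechExtSections d W) (hs : s.1.1 = 0) :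
    ∃ f, cechExtOf d W f = s := by
  obtain ⟨f, hf⟩ := ars_glue F (U := W) (fun k => W ⊓ U k) (fun k => inf_le_left)
    (by rw [← inf_iSup_eq, hU]; simp) s.1.2 (fun j k => by
      have := s.2 j k _ (inf_le_left : (W ⊓ U j) ⊓ (W ⊓ U k) ≤ _) inf_le_right
      rw [this, hs, zero_smul, add_zero])
  exact ⟨f, Subtype.ext (Prod.ext hs.symm (funext hf))⟩

include hU in
theorem cechExtIncl_injective (W : X.Opens) :
    Function.Injective ((cechExtIncl d).hom.app (op W)).hom := by
  rw [injective_iff_map_eq_zero]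
  intro s hs
  rw [cechExtIncl_apply] at hs
  refine ars_ext F fun x hx => ?_
  obtain ⟨W', h, hx', h'⟩ := exists_local_eq_of_toSheafify_eq (cechExtPresheaf d)
    (s := cechExtOf d W s) (t := 0) (by rw [map_zero]; exact hs) hx
  obtain ⟨i, hi⟩ := exists_mem_of_cover hU x
  refine ⟨W' ⊓ U i, inf_le_left.trans h, ⟨hx', hi⟩, ?_⟩
  have h₂ := congrFun (congrArg (fun t => t.1.2) h') i
  rw [map_zero]
  refine Eq.trans ?_ (h₂.trans (congrFun (congrArg (fun t => t.1.2) (map_zero (cechExtRes d h))) i))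
  exact (ars_ars F _ _ _).symm

include hU in
theorem exists_cechExtIncl (W : X.Opens) (s : (cechExt d).obj.obj (op W))
    (hs : ((cechExtProj d).hom.app (op W)).hom s = 0) :
    ∃ f, ((cechExtIncl d).hom.app (op W)).hom f = s := by
  have key : ∀ x : W, ∃ (W' : X.Opens) (h : W' ≤ W), x.1 ∈ W' ∧ ∃ f,
      ((cechExtIncl d).hom.app (op W')).hom f = ars (cechExt d) h s := by
    rintro ⟨x, hx⟩
    obtain ⟨W₁, h₁, hx₁, t, ht⟩ := exists_local_toSheafify (cechExtPresheaf d) s hx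
    have h0 : constZMk X W₁ (ULift.up t.1.1) = 0 := by
      refine (cechExtProj_mk d W₁ t).symm.trans ?_
      refine (congrArg _ ht).trans ?_
      refine (ars_app (cechExtProj d) h₁ s).symm.trans ?_
      rw [hs, map_zero]
    obtain ⟨W₂, h₂, hx₂, h'⟩ := exists_local_eq_of_toSheafify_eq ((Functor.const X.Opensᵒᵖ).obj
      (AddCommGrpCat.of (ULift.{0} ℤ))) (s := ULift.up t.1.1) (t := 0)
      (by rw [map_zero]; exact h0) hx₁
    -- Restriction in the constant presheaf is the identity, so an integer vanishing on `W₂`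
    -- vanishes outright.
    have h3 : t.1.1 = 0 := congrArg ULift.down h'
    obtain ⟨f, hf⟩ := exists_cechExtOf hU W₁ t h3
    refine ⟨W₁, h₁, hx₁, f, ?_⟩
    rw [cechExtIncl_apply, hf]
    exact ht
  choose W' h hx f hf using key
  obtain ⟨t, ht⟩ := ars_glue F W' h (fun x hx' => Opens.mem_iSup.2 ⟨⟨x, hx'⟩, hx _⟩) f (fun i j => by
    apply cechExtIncl_injective (d := d) hU
    rw [← ars_app, ← ars_app, hf, hf, ars_ars, ars_ars])
  refine ⟨t, ars_ext _ fun x hx' => ⟨W' ⟨x, hx'⟩, h _, hx _, ?_⟩⟩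
  rw [ars_app, ht, hf]

/-- The tautological sections of the presheaf extension. -/
def cechExtSec (hd : IsCocycle F U d) (i : ι) : cechExtSections d (U i) :=
  -- The component of `e i` on `U k` is `e i - e k`, which is `d k i`.
  ⟨(1, fun k => ars F (le_inf inf_le_right inf_le_left) (d k i)), fun j k W' hj hk => by
    rw [one_smul, ars_ars, ars_ars, add_comm]
    exact (hd j k i W' (hj.trans inf_le_right) (hk.trans inf_le_right) (hj.trans inf_le_left)).symm⟩

theorem cechExtSec_sub (hd : IsCocycle F U d) (i j : ι) :
    ars (cechExt d) inf_le_right (cechExtMk d _ (cechExtSec hd j)) -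
      ars (cechExt d) inf_le_left (cechExtMk d _ (cechExtSec hd i)) =
      ((cechExtIncl d).hom.app (op (U i ⊓ U j))).hom (d i j) := by
  rw [← cechExtMk_res, ← cechExtMk_res, ← map_sub, cechExtIncl_apply]
  congr 1
  refine Subtype.ext (Prod.ext (sub_self _) (funext fun k => ?_))
  change ars F _ (ars F _ (d k j)) - ars F _ (ars F _ (d k i)) = ars F _ (d i j)
  rw [ars_ars, ars_ars, sub_eq_iff_eq_add, add_comm]
  exact (hd k i j (U i ⊓ U j ⊓ U k) inf_le_right (inf_le_left.trans inf_le_left)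
    (inf_le_left.trans inf_le_right)).symm

theorem constZ_surj (W : X.Opens) (m : (constZ X).obj.obj (op W)) (x : X) (hx : x ∈ W) :
    ∃ (W' : X.Opens) (h : W' ≤ W) (k : ℤ), x ∈ W' ∧ ars (constZ X) h m = k • oneZ X W' := by
  obtain ⟨W₁, h₁, hx₁, t, ht⟩ := exists_local_toSheafify ((Functor.const X.Opensᵒᵖ).obj
      (AddCommGrpCat.of (ULift.{0} ℤ))) m hx
  refine ⟨W₁, h₁, ULift.down t, hx₁, ?_⟩
  rw [← constZMk_eq_smul]
  exact ht.symm

/-- Sections of the constant sheaf are locally integral multiples of `1`, so lifting `1` locally is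
enough. -/
theorem epi_of_local_one {E : Sheaf (Opens.grothendieckTopology X) AddCommGrpCat.{0}}
    (p : E ⟶ constZ X)
    (h : ∀ x : X, ∃ (W : X.Opens) (e : E.obj.obj (op W)), x ∈ W ∧
      (p.hom.app (op W)).hom e = oneZ X W) : Epi p := by
  have : Sheaf.IsLocallySurjective p := by
    refine ⟨fun {W} m x hx => ?_⟩
    obtain ⟨W₁, h₁, k, hx₁, hk⟩ := constZ_surj W m x hx
    obtain ⟨W₂, e, hx₂, he⟩ := h x
    refine ⟨W₁ ⊓ W₂, homOfLE (inf_le_left.trans h₁), ⟨k • ars E inf_le_right e, ?_⟩, ⟨hx₁, hx₂⟩⟩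
    change (p.hom.app (op (W₁ ⊓ W₂))).hom _ = ars (constZ X) (inf_le_left.trans h₁) m
    rw [map_zsmul, ← ars_app, he, oneZ_res, ← ars_ars _ h₁ inf_le_left, hk, map_zsmul, oneZ_res]
  infer_instance

include hU in
theorem cechExt_shortExact (hd : IsCocycle F U d) :
    (ShortComplex.mk (cechExtIncl d) (cechExtProj d) (cechExt_w d)).ShortExact := by
  obtain ⟨h₁, h₂⟩ := shortComplex_exact_of_sections (cechExtIncl d) (cechExtProj d) (cechExt_w d)
    (cechExtIncl_injective hU) (exists_cechExtIncl hU)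
  have : Epi (cechExtProj d) := epi_of_local_one _ fun x => by
    obtain ⟨i, hi⟩ := exists_mem_of_cover hU x
    exact ⟨U i, cechExtMk d _ (cechExtSec hd i), hi, cechExtProj_mk d _ _⟩
  exact ShortComplex.ShortExact.mk' h₁ h₂ this

section Universal
variable {E : Sheaf (Opens.grothendieckTopology X) AddCommGrpCat.{0}} (a : F ⟶ E)
  (e : ∀ i, E.obj.obj (op (U i)))
  (he : ∀ i j, ars E inf_le_right (e j) - ars E inf_le_left (e i)
        = (a.hom.app (op (U i ⊓ U j))).hom (d i j))

include hU he in
-- In any extension with actual sections `e k`, the local expressions `a (s k) + m • e k` agree on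
-- overlaps because `d` measures the differences of the `e k`. This makes the Čech extension
-- universal among such extensions.
theorem exists_cechExt_glue (W : X.Opens) (s : cechExtSections d W) :
    ∃ t : E.obj.obj (op W), ∀ k (W' : X.Opens) (h : W' ≤ W ⊓ U k),
      ars E (h.trans inf_le_left) t = (a.hom.app (op W')).hom (ars F h (s.1.2 k)) +
        s.1.1 • ars E (h.trans inf_le_right) (e k) := by
  obtain ⟨t, ht⟩ := ars_glue E (U := W) (fun k => W ⊓ U k) (fun k => inf_le_left)
    (by rw [← inf_iSup_eq, hU]; simp)
    (fun k => (a.hom.app (op (W ⊓ U k))).hom (s.1.2 k) + s.1.1 • ars E inf_le_right (e k))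
    (fun j k => by
      have h₁ := s.2 j k _ (inf_le_left : (W ⊓ U j) ⊓ (W ⊓ U k) ≤ _) inf_le_right
      have h₂ := congrArg (ars E (inf_le_inf inf_le_right inf_le_right :
        (W ⊓ U j) ⊓ (W ⊓ U k) ≤ U j ⊓ U k)) (he j k)
      rw [ars_app, map_sub, ars_ars, ars_ars] at h₂
      rw [map_add, map_add, ars_app, ars_app, h₁, map_zsmul, map_zsmul, map_add, map_zsmul,
        ars_ars, ars_ars, ← h₂, smul_sub]
      abel)
  refine ⟨t, fun k W' h => ?_⟩
  rw [← ars_ars E inf_le_left h, ht, map_add, ars_app, map_zsmul, ars_ars]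

include hU in
theorem ars_ext_cover (F : Sheaf (Opens.grothendieckTopology X) AddCommGrpCat.{0}) {W : X.Opens}
    {s t : F.obj.obj (op W)}
    (h : ∀ k, ars F (inf_le_left : W ⊓ U k ≤ W) s = ars F inf_le_left t) : s = t := by
  refine ars_ext F fun x hx => ?_
  obtain ⟨i, hi⟩ := exists_mem_of_cover hU x
  exact ⟨W ⊓ U i, inf_le_left, ⟨hx, hi⟩, h i⟩

include hU he in
theorem exists_cechExt_desc : ∃ ψ : cechExt d ⟶ E, cechExtIncl d ≫ ψ = a ∧
    ∀ (W : X.Opens) (s : cechExtSections d W) k, ars E (inf_le_left : W ⊓ U k ≤ W)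
      ((ψ.hom.app (op W)).hom (cechExtMk d W s)) =
        (a.hom.app (op (W ⊓ U k))).hom (s.1.2 k) + s.1.1 • ars E inf_le_right (e k) := by
  choose g hg using exists_cechExt_glue hU a e he
  have hg' : ∀ W s k, ars E (inf_le_left : W ⊓ U k ≤ W) (g W s) =
        (a.hom.app (op (W ⊓ U k))).hom (s.1.2 k) + s.1.1 • ars E inf_le_right (e k) := by
    intro W s k
    rw [hg W s k _ le_rfl, ars_refl]
  let ψ₀ : cechExtPresheaf d ⟶ E.obj :=
    { app := fun W => AddCommGrpCat.ofHom (AddMonoidHom.mk' (g W.unop) fun s t =>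
        ars_ext_cover hU E fun k => by
          rw [hg', map_add, hg', hg']
          change (a.hom.app _).hom (s.1.2 k + t.1.2 k) + (s.1.1 + t.1.1) • _ = _
          rw [map_add, add_smul]
          abel)
      naturality := fun W W' f => by
        ext s
        refine ars_ext_cover hU E fun k => ?_
        change ars E _ (g W'.unop (cechExtRes d f.unop.le s)) = ars E _ (ars E f.unop.le (g W.unop s))
        rw [hg', ars_ars, hg W.unop s k (W'.unop ⊓ U k) (inf_le_inf_right _ f.unop.le)]
        rfl }
  have hψ : ∀ (W : X.Opens) (s : cechExtSections d W),
      ((sheafifyLift _ ψ₀ E.property).app (op W)).hom (cechExtMk d W s) = g W s := by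
    intro W s
    have := toSheafify_sheafifyLift (Opens.grothendieckTopology X) ψ₀ E.property
    exact congrArg (fun f => (f.app (op W)).hom s) this
  refine ⟨⟨sheafifyLift _ ψ₀ E.property⟩, ?_, fun W s k => ?_⟩
  · ext W f
    change ((sheafifyLift _ ψ₀ E.property).app (op W.unop)).hom (cechExtMk d W.unop _) = _
    rw [hψ]
    refine ars_ext_cover hU E fun k => ?_
    rw [hg', ars_app]
    exact (congrArg₂ _ rfl (zero_smul _ _)).trans (add_zero _)
  · exact (congrArg _ (hψ W s)).trans (hg' W s k)

include hU in
-- The universal morphism from the Čech extension is the identity on `F` and on `ℤ`, and a morphism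
-- of extensions with identities at both ends preserves the class.
theorem extClass_eq_cechExt (hd : IsCocycle F U d) (p : E ⟶ constZ X) (w : a ≫ p = 0)
    (hS : (ShortComplex.mk a p w).ShortExact)
    (hp : ∀ i, (p.hom.app (op (U i))).hom (e i) = oneZ X (U i))
    (he : ∀ i j, ars E inf_le_right (e j) - ars E inf_le_left (e i)
        = (a.hom.app (op (U i ⊓ U j))).hom (d i j)) :
    hS.extClass = (cechExt_shortExact hU hd).extClass := by
  obtain ⟨ψ, h₁, h₂⟩ := exists_cechExt_desc hU a e he
  have h₃ : ψ ≫ p = cechExtProj d := by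
    ext W s
    refine ars_ext (constZ X) fun x hx => ?_
    obtain ⟨W₁, h, hx₁, (t : cechExtSections d W₁), ht⟩ :=
      exists_local_toSheafify (cechExtPresheaf d) s hx
    obtain ⟨i, hi⟩ := exists_mem_of_cover hU x
    refine ⟨W₁ ⊓ U i, inf_le_left.trans h, ⟨hx₁, hi⟩, ?_⟩
    change ars (constZ X) _ ((p.hom.app _).hom ((ψ.hom.app _).hom s)) =
      ars (constZ X) _ (((cechExtProj d).hom.app _).hom s)
    replace ht : cechExtMk d W₁ t = ars (cechExt d) h s := ht
    rw [← ars_ars _ h inf_le_left, ← ars_ars _ h inf_le_left, ars_app p, ars_app ψ,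
      ars_app (cechExtProj d) h, ← ht, ars_app p, h₂, cechExtProj_mk, ← constZMk_res, map_add, map_zsmul,
      ← ars_app, hp, oneZ_res, constZMk_eq_smul]
    have : (p.hom.app (op (W₁ ⊓ U i))).hom ((a.hom.app (op (W₁ ⊓ U i))).hom (t.1.2 i)) = 0 :=
      congrArg (fun k => (k.hom.app (op (W₁ ⊓ U i))).hom (t.1.2 i)) w
    rw [this, zero_add]
  let f : ShortComplex.mk (cechExtIncl d) (cechExtProj d) (cechExt_w d) ⟶ ShortComplex.mk a p w :=
    { τ₁ := 𝟙 F, τ₂ := ψ, τ₃ := 𝟙 _, comm₁₂ := by simp [h₁], comm₂₃ := by simp [h₃] }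
  have := ShortComplex.ShortExact.extClass_naturality (cechExt_shortExact hU hd) hS f
  simpa [f] using this.symm

end Universal

include hU in
/-- A Čech cocycle has exactly one class. -/
theorem exists_isCechClass_iff (hd : IsCocycle F U d) :
    ∃ ξ : Sheaf.H.{0} F 1, ∀ ξ', IsCechClass U d ξ' ↔ ξ' = ξ := by
  refine ⟨(cechExt_shortExact hU hd).extClass, fun ξ' => ⟨?_, ?_⟩⟩
  · rintro ⟨E, a, p, w, hS, rfl, e, hp, he⟩
    exact extClass_eq_cechExt hU a e hd p w hS hp he
  · rintro rfl
    exact ⟨cechExt d, cechExtIncl d, cechExtProj d, cechExt_w d, _, rfl,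
      fun i => cechExtMk d _ (cechExtSec hd i), fun i => cechExtProj_mk d _ _, cechExtSec_sub hd⟩

/-- Cohomologous cochains have the same classes. -/
theorem IsCechClass.add_coboundary {ξ : Sheaf.H.{0} F 1} (h : IsCechClass U d ξ)
    (c : ∀ i, F.obj.obj (op (U i))) (d' : ∀ i j, F.obj.obj (op (U i ⊓ U j)))
    (hd' : ∀ i j, d' i j = d i j + (ars F inf_le_right (c j) - ars F inf_le_left (c i))) :
    IsCechClass U d' ξ := by
  obtain ⟨E, a, p, w, hS, rfl, e, hp, he⟩ := h
  refine ⟨E, a, p, w, hS, rfl, fun i => e i + (a.hom.app (op (U i))).hom (c i), fun i => ?_,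
    fun i j => ?_⟩
  · have : (p.hom.app (op (U i))).hom ((a.hom.app (op (U i))).hom (c i)) = 0 :=
      congrArg (fun k => (k.hom.app (op (U i))).hom (c i)) w
    rw [map_add, hp, this, add_zero]
  · rw [map_add, map_add, hd', map_add, ← he, ars_app, ars_app, map_sub]
    abel

theorem sections_exact {F G H : Sheaf (Opens.grothendieckTopology X) AddCommGrpCat.{0}}
    {f : F ⟶ G} {g : G ⟶ H} {w : f ≫ g = 0} (hS : (ShortComplex.mk f g w).ShortExact)
    (W : X.Opens) (s : G.obj.obj (op W)) (hs : (g.hom.app (op W)).hom s = 0) :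
    ∃ t, (f.hom.app (op W)).hom t = s := by
  have := hS.mono_f
  have h := (hS.exact.map_of_mono_of_preservesKernel (sheafToPresheaf _ _ ⋙
    (evaluation _ _).obj (op W)) inferInstance inferInstance)
  exact (ShortComplex.ab_exact_iff _).1 h s hs

theorem sections_injective {F G H : Sheaf (Opens.grothendieckTopology X) AddCommGrpCat.{0}}
    {f : F ⟶ G} {g : G ⟶ H} {w : f ≫ g = 0} (hS : (ShortComplex.mk f g w).ShortExact)
    (W : X.Opens) : Function.Injective (f.hom.app (op W)).hom := by
  have := hS.mono_f
  have h : Mono ((sheafToPresheaf _ _ ⋙ (evaluation _ _).obj (op W)).map f) := inferInstance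
  exact (AddCommGrpCat.mono_iff_injective _).1 h

/-- A cochain of class zero is a coboundary. -/
theorem IsCechClass.exists_coboundary (h : IsCechClass U d 0) :
    ∃ c : ∀ i, F.obj.obj (op (U i)),
      ∀ i j, d i j = ars F inf_le_right (c j) - ars F inf_le_left (c i) := by
  obtain ⟨E, a, p, w, hS, h0, e, hp, he⟩ := h
  -- The identity of `ℤ` is mapped by the connecting map to the extension class, which is zero;
  -- hence it lifts to a splitting `s` of `p`. The differences `e i - s 1` then come from sections
  -- of `F`.
  obtain ⟨s, hs⟩ := Abelian.Ext.covariant_sequence_exact₃ (constZ X) hS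
    (Abelian.Ext.mk₀ (𝟙 (constZ X))) (zero_add 1) (by
      change (Abelian.Ext.mk₀ (𝟙 (constZ X))).comp hS.extClass _ = 0
      rw [h0]; simp)
  obtain ⟨s, rfl⟩ := (Abelian.Ext.mk₀_bijective _ _).2 s
  rw [Abelian.Ext.mk₀_comp_mk₀] at hs
  have hs' : s ≫ p = 𝟙 _ := (Abelian.Ext.mk₀_bijective _ _).1 hs
  have key : ∀ i, ∃ c, (a.hom.app (op (U i))).hom c = e i - (s.hom.app (op (U i))).hom (oneZ X (U i)) := by
    intro i
    refine sections_exact hS _ _ ?_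
    have : (p.hom.app (op (U i))).hom ((s.hom.app (op (U i))).hom (oneZ X (U i))) = oneZ X (U i) :=
      congrArg (fun k => (k.hom.app (op (U i))).hom (oneZ X (U i))) hs'
    change (p.hom.app (op (U i))).hom _ = 0
    rw [map_sub, hp, this, sub_self]
  choose c hc using key
  refine ⟨c, fun i j => sections_injective hS _ ?_⟩
  rw [← he, map_sub, ← ars_app, ← ars_app, hc, hc, map_sub, map_sub, ars_app s, ars_app s, oneZ_res, oneZ_res]
  abel

include hU in
/-- The zero cochain has class zero. -/
theorem isCechClass_zero : IsCechClass U (fun i j => (0 : F.obj.obj (op (U i ⊓ U j)))) 0 := by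
  have hd : IsCocycle F U (fun i j => (0 : F.obj.obj (op (U i ⊓ U j)))) := by
    intro i j k W hi hj hk
    rw [map_zero, map_zero, map_zero, add_zero]
  have hc := cechExt_shortExact hU hd
  refine ⟨_, _, _, _, hc, ?_, fun i => cechExtMk _ _ (cechExtSec hd i),
    fun i => cechExtProj_mk _ _ _, cechExtSec_sub hd⟩
  -- For the zero cochain the inclusion of `F` has a retraction. The extension class becomes zero
  -- after pushing out along the inclusion, and the retraction carries it back to itself.
  obtain ⟨ψ, h₁, -⟩ := exists_cechExt_desc hU (𝟙 F) (d := fun i j => (0 : F.obj.obj (op (U i ⊓ U j))))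
    (fun i => 0) (fun i j => by simp)
  have h₂ := hc.extClass_comp
  have h₃ := congrArg (fun x => x.comp (Abelian.Ext.mk₀ ψ) (add_zero 1)) h₂
  simpa [h₁, Abelian.Ext.comp_assoc_of_second_deg_zero, Abelian.Ext.mk₀_comp_mk₀] using h₃

end Cech
end CScheme

/-! ### The augmentation filtration of the symmetric algebra. -/

namespace SymmetricAlgebra

section Instances

variable (R L : Type) [CommRing R] [AddCommGroup L] [Module R L] (n : ℕ)

instance : Algebra R (SymmetricAlgebra R L) := inferInstance
instance : AddCommGroup (symPow R L n) := inferInstance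
instance : AddCommMonoid (symPow R L n) := inferInstance
instance : AddGroup (symPow R L n) := inferInstance
instance : AddMonoid (symPow R L n) := inferInstance
instance : AddZeroClass (symPow R L n) := inferInstance
instance : Module R (symPow R L n) := inferInstance
instance : DistribSMul R (symPow R L n) := inferInstance
instance : SMulZeroClass R (symPow R L n) := inferInstance
instance : SMul R (symPow R L n) := inferInstance
instance : MulAction R (symPow R L n) := inferInstance

end Instances

section Augmentation

variable {R L : Type} [CommRing R] [AddCommGroup L] [Module R L]

theorem algebraMapInv_algebraMap (r : R) :
    algebraMapInv (algebraMap R (SymmetricAlgebra R L) r) = r :=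
  (algebraMapInv : SymmetricAlgebra R L →ₐ[R] R).commutes r

theorem ι_mem_augIdeal (x : L) : ι R L x ∈ augIdeal R L := algebraMapInv_ι x

theorem ι_mem_symPow_one (x : L) : ι R L x ∈ symPow R L 1 := by
  rw [symPow, pow_one]; exact ⟨x, rfl⟩

theorem algebraMap_mem_symPow_zero (r : R) :
    algebraMap R (SymmetricAlgebra R L) r ∈ symPow R L 0 := by
  rw [symPow, pow_zero, Submodule.mem_one]; exact ⟨r, rfl⟩

theorem mem_symPow_zero {s : SymmetricAlgebra R L} :
    s ∈ symPow R L 0 ↔ ∃ r, algebraMap R _ r = s := by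
  rw [symPow, pow_zero, Submodule.mem_one]

theorem mul_mem_symPow {m n : ℕ} {s t : SymmetricAlgebra R L} (hs : s ∈ symPow R L m)
    (ht : t ∈ symPow R L n) : s * t ∈ symPow R L (m + n) := by
  rw [symPow, pow_add]; exact Submodule.mul_mem_mul hs ht

theorem ι_mul_mem_symPow {n : ℕ} (x : L) {t : SymmetricAlgebra R L}
    (ht : t ∈ symPow R L n) : ι R L x * t ∈ symPow R L (n + 1) := by
  rw [add_comm]; exact mul_mem_symPow (ι_mem_symPow_one x) ht

@[elab_as_elim]
theorem symPow_succ_induction {n : ℕ} {P : ∀ s, s ∈ symPow R L (n + 1) → Prop}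
    (mul : ∀ x t (ht : t ∈ symPow R L n), P (ι R L x * t) (ι_mul_mem_symPow x ht))
    (add : ∀ s t hs ht, P s hs → P t ht → P (s + t) (add_mem hs ht))
    {s : SymmetricAlgebra R L} (hs : s ∈ symPow R L (n + 1)) : P s hs := by
  have : ∃ h, P s h := by
    rw [symPow, pow_succ'] at hs
    induction hs using Submodule.mul_induction_on' with
    | mem_mul_mem a ha b hb =>
      obtain ⟨x, rfl⟩ := ha
      exact ⟨_, mul x b hb⟩
    | add a _ b _ ha hb =>
      obtain ⟨ha, ha'⟩ := ha
      obtain ⟨hb, hb'⟩ := hb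
      exact ⟨_, add _ _ _ _ ha' hb'⟩
  exact this.2

theorem symPow_le_augIdeal_pow (n : ℕ) {s : SymmetricAlgebra R L} (hs : s ∈ symPow R L n) :
    s ∈ augIdeal R L ^ n := by
  induction n generalizing s with
  | zero => simp
  | succ n ih =>
    induction hs using symPow_succ_induction with
    | mul x t ht => rw [pow_succ']; exact Ideal.mul_mem_mul (ι_mem_augIdeal x) (ih ht)
    | add s t _ _ hs ht => exact add_mem hs ht

theorem sub_algebraMap_mem_span (s : SymmetricAlgebra R L) :
    s - algebraMap R _ (algebraMapInv s) ∈ Ideal.span (Set.range (ι R L)) := by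
  induction s using SymmetricAlgebra.induction with
  | algebraMap r => rw [algebraMapInv_algebraMap, sub_self]; exact zero_mem _
  | ι x =>
    rw [algebraMapInv_ι, map_zero, sub_zero]
    exact Ideal.subset_span ⟨x, rfl⟩
  | mul a b ha hb =>
    have : a * b - algebraMap R _ (algebraMapInv (a * b)) =
      b * (a - algebraMap R _ (algebraMapInv a)) + algebraMap R _ (algebraMapInv a) *
        (b - algebraMap R _ (algebraMapInv b)) := by
      rw [map_mul, map_mul]; ring
    rw [this]
    exact add_mem (Ideal.mul_mem_left _ _ ha) (Ideal.mul_mem_left _ _ hb)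
  | add a b ha hb =>
    rw [map_add, map_add, add_sub_add_comm]
    exact add_mem ha hb

theorem augIdeal_eq_span : augIdeal R L = Ideal.span (Set.range (ι R L)) := by
  refine le_antisymm (fun s hs => ?_) (Ideal.span_le.2 ?_)
  · have := sub_algebraMap_mem_span s
    rwa [show algebraMapInv s = (0 : R) from hs, map_zero, sub_zero] at this
  · rintro _ ⟨x, rfl⟩
    exact ι_mem_augIdeal x

theorem sub_algebraMap_mem_augIdeal (s : SymmetricAlgebra R L) :
    s - algebraMap R _ (algebraMapInv s) ∈ augIdeal R L := by
  rw [augIdeal_eq_span]; exact sub_algebraMap_mem_span s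

/-- The augmentation ideal is generated by `L`, and replacing a coefficient by its constant term
costs only an element of the square. -/
theorem exists_ι_sub_mem {s : SymmetricAlgebra R L} (hs : s ∈ augIdeal R L) :
    ∃ x, s - ι R L x ∈ augIdeal R L ^ 2 := by
  rw [augIdeal_eq_span] at hs
  induction hs using Submodule.span_induction with
  | mem x h =>
    obtain ⟨x, rfl⟩ := h
    exact ⟨x, by rw [sub_self]; exact zero_mem _⟩
  | zero => exact ⟨0, by rw [map_zero, sub_self]; exact zero_mem _⟩
  | add a b _ _ ha hb =>
    obtain ⟨x, hx⟩ := ha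
    obtain ⟨y, hy⟩ := hb
    exact ⟨x + y, by rw [map_add, add_sub_add_comm]; exact add_mem hx hy⟩
  | smul c a ha h =>
    obtain ⟨x, hx⟩ := h
    refine ⟨algebraMapInv c • x, ?_⟩
    have : c • a - ι R L (algebraMapInv c • x) =
       (c - algebraMap R _ (algebraMapInv c)) * a +
        algebraMap R _ (algebraMapInv c) * (a - ι R L x) := by
      rw [map_smul, smul_eq_mul, Algebra.smul_def]; ring
    rw [this]
    refine add_mem ?_ (Ideal.mul_mem_left _ _ hx)
    rw [pow_two]
    replace ha : a ∈ augIdeal R L := by rw [augIdeal_eq_span]; exact ha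
    exact Ideal.mul_mem_mul (sub_algebraMap_mem_augIdeal c) ha

/-- Elements of the `n`-th power of the augmentation ideal have a leading term in `Sym^n`. -/
theorem exists_symPow_sub_mem (n : ℕ) {s : SymmetricAlgebra R L} (hs : s ∈ augIdeal R L ^ n) :
    ∃ t ∈ symPow R L n, s - t ∈ augIdeal R L ^ (n + 1) := by
  induction n generalizing s with
  | zero =>
    refine ⟨_, algebraMap_mem_symPow_zero (algebraMapInv s), ?_⟩
    rw [zero_add, pow_one]
    exact sub_algebraMap_mem_augIdeal s
  | succ n ih =>
    rw [pow_succ'] at hs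
    induction hs using Submodule.mul_induction_on' with
    | mem_mul_mem a ha b hb =>
      obtain ⟨x, hx⟩ := exists_ι_sub_mem ha
      obtain ⟨t, ht, h⟩ := ih hb
      refine ⟨ι R L x * t, ι_mul_mem_symPow x ht, ?_⟩
      have : a * b - ι R L x * t = (a - ι R L x) * b + ι R L x * (b - t) := by ring
      rw [this]
      refine add_mem ?_ ?_
      · rw [show n + 1 + 1 = 2 + n by ring, pow_add]; exact Ideal.mul_mem_mul hx hb
      · rw [pow_succ']; exact Ideal.mul_mem_mul (ι_mem_augIdeal x) h
    | add a _ b _ ha hb =>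
      obtain ⟨s, hs, hs'⟩ := ha
      obtain ⟨t, ht, ht'⟩ := hb
      exact ⟨s + t, add_mem hs ht, by rw [add_sub_add_comm]; exact add_mem hs' ht'⟩

/-- A ring homomorphism out of `Sym L` is given by a ring homomorphism on `R` and a semilinear
map on `L`. -/
theorem exists_ringHom {A : Type} [CommRing A] (σ : R →+* A) (μ : L →+ A)
    (h : ∀ r x, μ (r • x) = σ r * μ x) :
    ∃ β : SymmetricAlgebra R L →+* A, (∀ r, β (algebraMap R _ r) = σ r) ∧
      ∀ x, β (ι R L x) = μ x := by
  let _ : Algebra R A := σ.toAlgebra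
  let g : L →ₗ[R] A := { μ with map_smul' := fun r x => h r x }
  exact ⟨(lift g : SymmetricAlgebra R L →ₐ[R] A), fun r => AlgHom.commutes _ r,
    fun x => lift_ι_apply g x⟩

end Augmentation

theorem derivation_pow_mem {S : Type} [CommRing S] (D : Derivation ℤ S S) (I : Ideal S) (n : ℕ) {s : S}
    (hs : s ∈ I ^ (n + 1)) : D s ∈ I ^ n := by
  induction n generalizing s with
  | zero => simp
  | succ n ih =>
    rw [pow_succ'] at hs
    induction hs using Submodule.mul_induction_on' with
    | mem_mul_mem a ha b hb =>
      rw [Derivation.leibniz]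
      refine add_mem ?_ ?_
      · rw [pow_succ']; exact Ideal.mul_mem_mul ha (ih hb)
      · exact Ideal.mul_mem_right _ _ hb
    | add a _ b _ ha hb => rw [map_add]; exact add_mem ha hb

/-! ### Euler's formula and the two Poincaré lemmas. -/

section Poisson

variable {R L : Type} [CommRing R] [LieRing L] [Module R L] [LieRingModule L R]
  [LieRinehartRing R L]

theorem poisson_mul_left (a b c : SymmetricAlgebra R L) :
    poisson R L (a * b) c = a * poisson R L b c + b * poisson R L a c := by
  rw [Derivation.leibniz]; rfl

theorem poisson_mul_right (a b c : SymmetricAlgebra R L) :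
    poisson R L a (b * c) = b * poisson R L a c + c * poisson R L a b :=
  Derivation.leibniz _ _ _

theorem poisson_add_left (a b c : SymmetricAlgebra R L) :
    poisson R L (a + b) c = poisson R L a c + poisson R L b c := by
  rw [map_add]; rfl

theorem poisson_sub_left (a b c : SymmetricAlgebra R L) :
    poisson R L (a - b) c = poisson R L a c - poisson R L b c := by
  rw [map_sub]; rfl

/-- The bracket was built by extending derivations in one variable after the other, so skew-symmetry
is not built in. It follows from the case of generators by the Leibniz rule in both variables. -/
theorem poisson_skew (a b : SymmetricAlgebra R L) : poisson R L a b = -poisson R L b a := by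
  induction a using SymmetricAlgebra.induction with
  | algebraMap r =>
    induction b using SymmetricAlgebra.induction with
    | algebraMap r' => rw [poisson_fun_fun, poisson_fun_fun, neg_zero]
    | ι x => rw [poisson_fun_vec, poisson_vec_fun]
    | mul a b ha hb => rw [poisson_mul_left, poisson_mul_right, ha, hb]; ring
    | add a b ha hb => rw [poisson_add_left, map_add, ha, hb]; ring
  | ι x =>
    induction b using SymmetricAlgebra.induction with
    | algebraMap r' => rw [poisson_fun_vec, poisson_vec_fun, neg_neg]
    | ι y => rw [poisson_vec_vec, poisson_vec_vec, ← lie_skew, map_neg]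
    | mul a b ha hb => rw [poisson_mul_left, poisson_mul_right, ha, hb]; ring
    | add a b ha hb => rw [poisson_add_left, map_add, ha, hb]; ring
  | mul a b ha hb => rw [poisson_mul_left, poisson_mul_right, ha, hb]; ring
  | add a b ha hb => rw [poisson_add_left, map_add, ha, hb]; ring

theorem poisson_pow_left_mem (n : ℕ) {s : SymmetricAlgebra R L} (t : SymmetricAlgebra R L)
    (hs : s ∈ augIdeal R L ^ (n + 1)) : poisson R L s t ∈ augIdeal R L ^ n := by
  rw [poisson_skew]
  exact neg_mem (derivation_pow_mem _ _ _ hs)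

theorem poisson_symPow_zero {s : SymmetricAlgebra R L} (hs : s ∈ symPow R L 0) (f : R) :
    poisson R L s (algebraMap R _ f) = 0 := by
  obtain ⟨r, rfl⟩ := mem_symPow_zero.1 hs
  exact poisson_fun_fun r f

theorem derive_val (n : ℕ) (s : symPow R L (n + 1)) (f : R) :
    (derive n s f).1 = poisson R L s.1 (algebraMap R _ f) := rfl

theorem derive_add (n : ℕ) (s t : symPow R L (n + 1)) (f : R) :
    derive n (s + t) f = derive n s f + derive n t f :=
  Subtype.ext (poisson_add_left _ _ _)

theorem derive_sub (n : ℕ) (s t : symPow R L (n + 1)) (f : R) :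
    derive n (s - t) f = derive n s f - derive n t f :=
  Subtype.ext (poisson_sub_left _ _ _)

variable [Algebra ℂ R]

variable (R L) in
/-- Finitely many functions `f k` and elements `x k` of `L` such that `D g = ∑ xₖ(g) D fₖ` for all
derivations over `ℂ` on `R`, and `y = ∑ y(fₖ) xₖ` for all `y ∈ L`. -/
structure IsDualBasis {N : ℕ} (f : Fin N → R) (x : Fin N → L) : Prop where
  lie_const : ∀ (y : L) (c : ℂ), ⁅y, algebraMap ℂ R c⁆ = 0
  der : ∀ (M : Type) [AddCommGroup M] [Module R M] (D : Derivation ℤ R M),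
    (∀ c : ℂ, D (algebraMap ℂ R c) = 0) → ∀ g, D g = ∑ k, ⁅x k, g⁆ • D (f k)
  vec : ∀ y : L, y = ∑ k, ⁅y, f k⁆ • x k

namespace IsDualBasis

variable {N : ℕ} {f : Fin N → R} {x : Fin N → L} (h : IsDualBasis R L f x)

include h

/-- For a product `y * t` the Leibniz rule gives `y` times the formula for `t`, plus `(∑ y (f k) x
k) * t`. The second term is one more copy of `y * t` by the dual basis property. -/
theorem euler (n : ℕ) {s : SymmetricAlgebra R L} (hs : s ∈ symPow R L n) :
    ∑ k, ι R L (x k) * poisson R L s (algebraMap R _ (f k)) = n • s := by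
  induction n generalizing s with
  | zero =>
    rw [zero_smul]
    exact Finset.sum_eq_zero fun k _ => by rw [poisson_symPow_zero hs, mul_zero]
  | succ n ih =>
    induction hs using symPow_succ_induction with
    | mul y t ht =>
      have h₁ : ι R L y = ∑ k, algebraMap R _ ⁅y, f k⁆ * ι R L (x k) := by
        conv_lhs => rw [h.vec y]
        rw [map_sum]
        exact Finset.sum_congr rfl fun k _ => by rw [map_smul, Algebra.smul_def]
      have h₂ : ∀ k, ι R L (x k) * poisson R L (ι R L y * t) (algebraMap R _ (f k)) =
          ι R L y * (ι R L (x k) * poisson R L t (algebraMap R _ (f k))) +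
            (algebraMap R _ ⁅y, f k⁆ * ι R L (x k)) * t := fun k => by
        rw [poisson_mul_left, poisson_vec_fun]; ring
      simp only [h₂]
      rw [Finset.sum_add_distrib, ← Finset.mul_sum, ← Finset.sum_mul, ih ht, ← h₁, add_smul,
        one_smul, mul_smul_comm]
    | add s t _ _ hs ht =>
      simp only [poisson_add_left, mul_add]
      rw [Finset.sum_add_distrib, hs, ht, smul_add]

omit h in
theorem nsmul_eq_zero {M : Type} [AddCommGroup M] [Module R M] (n : ℕ) (hn : n ≠ 0) {m : M}
    (hm : n • m = 0) : m = 0 := by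
  have h₁ : (algebraMap ℂ R (n : ℂ)⁻¹) • (algebraMap ℂ R (n : ℂ)) • m = m := by
    rw [← mul_smul, ← map_mul, inv_mul_cancel₀ (Nat.cast_ne_zero.2 hn), map_one, one_smul]
  rw [← h₁, map_natCast, Nat.cast_smul_eq_nsmul, hm, smul_zero]

theorem eq_zero_of_derive (n : ℕ) {s : SymmetricAlgebra R L} (hs : s ∈ symPow R L (n + 1))
    (h₀ : ∀ k, poisson R L s (algebraMap R _ (f k)) = 0) : s = 0 := by
  refine nsmul_eq_zero (R := R) (n + 1) n.succ_ne_zero ?_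
  rw [← h.euler _ hs]
  exact Finset.sum_eq_zero fun k _ => by rw [h₀, mul_zero]

theorem derive_injective (n : ℕ) {s t : symPow R L (n + 1)}
    (hst : ∀ g, derive n s g = derive n t g) : s = t := by
  refine Subtype.ext (sub_eq_zero.1 (h.eq_zero_of_derive n (sub_mem s.2 t.2) fun k => ?_))
  rw [poisson_sub_left, sub_eq_zero]
  exact congrArg Subtype.val (hst (f k))

/-- This replaces a grading of the symmetric algebra. Bracketing with functions lowers the degree
and the power of the ideal together, down to degree `0`, where the augmentation separates constants
from the ideal; Euler's formula brings the vanishing back up. -/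
theorem symPow_inf (n : ℕ) {s : SymmetricAlgebra R L} (hs : s ∈ symPow R L n)
    (hs' : s ∈ augIdeal R L ^ (n + 1)) : s = 0 := by
  induction n generalizing s with
  | zero =>
    obtain ⟨r, rfl⟩ := mem_symPow_zero.1 hs
    rw [zero_add, pow_one] at hs'
    rw [← algebraMapInv_algebraMap (L := L) r, show algebraMapInv _ = (0 : R) from hs', map_zero]
  | succ n ih =>
    exact h.eq_zero_of_derive n hs fun k => ih (poisson_mem_symPow n hs _)
      (poisson_pow_left_mem _ _ hs')

/-- A family of elements of `Sym^n` whose brackets with functions cancel modulo higher order. -/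
theorem sum_poisson_eq_zero {n : ℕ} {K : Type} (I : Finset K) {s : K → SymmetricAlgebra R L}
    (hs : ∀ i ∈ I, s i ∈ symPow R L n) (g : K → R)
    (h₀ : ∑ i ∈ I, poisson R L (s i) (algebraMap R _ (g i)) ∈ augIdeal R L ^ n) :
    ∑ i ∈ I, poisson R L (s i) (algebraMap R _ (g i)) = 0 := by
  cases n with
  | zero => exact Finset.sum_eq_zero fun i hi => poisson_symPow_zero (hs i hi) _
  | succ n => exact h.symPow_inf n (sum_mem fun i hi => poisson_mem_symPow n (hs i hi) _) h₀

omit h in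
theorem poisson_const (hc : ∀ (y : L) (c : ℂ), ⁅y, algebraMap ℂ R c⁆ = 0)
    (s : SymmetricAlgebra R L) (c : ℂ) :
    poisson R L s (algebraMap R _ (algebraMap ℂ R c)) = 0 := by
  induction s using SymmetricAlgebra.induction with
  | algebraMap r => exact poisson_fun_fun _ _
  | ι y => rw [poisson_vec_fun, hc, map_zero]
  | mul a b ha hb => rw [poisson_mul_left, ha, hb, mul_zero, mul_zero, add_zero]
  | add a b ha hb => rw [poisson_add_left, ha, hb, add_zero]

/-- The element of `Sym^{n+1}` with prescribed closed derivative. -/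
theorem exists_derive_eq (n : ℕ) (E : Derivation ℤ R (symPow R L n))
    (hE : ∀ c : ℂ, E (algebraMap ℂ R c) = 0)
    (hc : ∀ a b, poisson R L (E a).1 (algebraMap R _ b) = poisson R L (E b).1 (algebraMap R _ a)) :
    ∃ s : symPow R L (n + 1), ∀ g, derive n s g = E g := by
  -- The usual homotopy of the Poincaré lemma. By closedness `{s₀, g}` is `∑ x k * {E g, f k}`,
  -- which equals `n • E g` by Euler, plus `∑ x k (g) • E (f k)`, which is `E g`; hence the factor
  -- `n + 1`.
  let s₀ : symPow R L (n + 1) := ∑ k, ⟨ι R L (x k) * (E (f k)).1, ι_mul_mem_symPow _ (E (f k)).2⟩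
  have hs₀ : s₀.1 = ∑ k, ι R L (x k) * (E (f k)).1 := by
    simp [s₀]
  have key : ∀ g, poisson R L s₀.1 (algebraMap R _ g) = (n + 1) • (E g).1 := fun g => by
    rw [hs₀, map_sum, ← Derivation.coeFnAddMonoidHom_apply, map_sum, Finset.sum_apply]
    have : ∀ k, poisson R L (ι R L (x k) * (E (f k)).1) (algebraMap R _ g) =
        ι R L (x k) * poisson R L (E g).1 (algebraMap R _ (f k)) + (⁅x k, g⁆ • E (f k)).1 := fun k => by
      rw [poisson_mul_left, poisson_vec_fun, hc, Submodule.coe_smul, Algebra.smul_def,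
        mul_comm (E (f k)).1]
    simp only [Derivation.coeFnAddMonoidHom_apply, this]
    rw [Finset.sum_add_distrib, h.euler n (E g).2, add_smul, one_smul, h.der _ E hE g]
    simp
  refine ⟨algebraMap ℂ R ((n + 1 : ℕ) : ℂ)⁻¹ • s₀, fun g => Subtype.ext ?_⟩
  rw [derive_val, Submodule.coe_smul, Algebra.smul_def, poisson_mul_left, poisson_fun_fun,
    mul_zero, add_zero, key, ← Nat.cast_smul_eq_nsmul R, Algebra.smul_def, ← mul_assoc, ← map_mul,
    ← map_natCast (algebraMap ℂ R), ← map_mul, inv_mul_cancel₀ (Nat.cast_ne_zero.2 n.succ_ne_zero),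
    map_one, map_one, one_mul]

/-- The derivation with prescribed closed bivector. -/
theorem exists_derive_sub_eq (n : ℕ) (η : R →+ Derivation ℤ R (symPow R L n))
    (hη : ∀ a c, η a (algebraMap ℂ R c) = 0) (hskew : ∀ a b, η a b = - η b a)
    (hc : ∀ a b c, poisson R L (η a b).1 (algebraMap R _ c) +
      poisson R L (η b c).1 (algebraMap R _ a) + poisson R L (η c a).1 (algebraMap R _ b) = 0) :
    ∃ θ : Derivation ℤ R (symPow R L (n + 1)), (∀ c : ℂ, θ (algebraMap ℂ R c) = 0) ∧
      ∀ a b, derive n (θ a) b - derive n (θ b) a = - η a b := by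
  let mul (k) : symPow R L n →ₗ[R] symPow R L (n + 1) :=
    { toFun := fun s => ⟨ι R L (x k) * s.1, ι_mul_mem_symPow _ s.2⟩
      map_add' := fun s t => Subtype.ext (mul_add _ _ _)
      map_smul' := fun r s => Subtype.ext (mul_smul_comm _ _ _) }
  have hmul : ∀ k s, (mul k s).1 = ι R L (x k) * s.1 := fun _ _ => rfl
  -- The same homotopy one degree higher. In the antisymmetrization Euler's formula contributes `n`
  -- and the dual basis property contributes one copy of `η` for each of the two terms, in total `n
  -- + 2`.
  let θ : Derivation ℤ R (symPow R L (n + 1)) := algebraMap ℂ R ((n + 2 : ℕ) : ℂ)⁻¹ •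
    ∑ k, (mul k).compDer (η (f k))
  have key : ∀ a, θ a = algebraMap ℂ R ((n + 2 : ℕ) : ℂ)⁻¹ • ∑ k, mul k (η (f k) a) := fun a => by
    simp only [θ, Derivation.smul_apply]
    rw [← Derivation.coeFnAddMonoidHom_apply, map_sum, Finset.sum_apply]
    rfl
  have key₂ : ∀ a b, poisson R L (θ a).1 (algebraMap R _ b) =
      algebraMap ℂ R ((n + 2 : ℕ) : ℂ)⁻¹ • ((η b a).1 + ∑ k, ι R L (x k) *
        poisson R L (η (f k) a).1 (algebraMap R _ b)) := fun a b => by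
    rw [key, Submodule.coe_smul, Algebra.smul_def, poisson_mul_left, poisson_fun_fun,
      mul_zero, add_zero, Algebra.smul_def]
    congr 1
    rw [Submodule.coe_sum, map_sum, ← Derivation.coeFnAddMonoidHom_apply, map_sum, Finset.sum_apply,
      hskew b a, h.der _ (η a) (hη a) b]
    simp only [Derivation.coeFnAddMonoidHom_apply, hmul, poisson_mul_left, poisson_vec_fun]
    rw [Finset.sum_add_distrib, add_comm, ← Finset.sum_neg_distrib, Submodule.coe_sum]
    congr 1
    refine Finset.sum_congr rfl fun k _ => ?_
    rw [hskew a (f k), smul_neg, neg_neg, Submodule.coe_smul, Algebra.smul_def, mul_comm]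
  refine ⟨θ, fun c => ?_, fun a b => Subtype.ext ?_⟩
  · simp [key, hη]
  · change poisson R L (θ a).1 (algebraMap R _ b) - poisson R L (θ b).1 (algebraMap R _ a) = -(η a b).1
    rw [key₂, key₂, ← smul_sub, add_sub_add_comm, ← Finset.sum_sub_distrib]
    have h₁ : ∀ k, ι R L (x k) * poisson R L (η (f k) a).1 (algebraMap R _ b) -
        ι R L (x k) * poisson R L (η (f k) b).1 (algebraMap R _ a) =
        - (ι R L (x k) * poisson R L (η a b).1 (algebraMap R _ (f k))) := fun k => by
      -- Closedness with `f k` as one entry turns the difference of the two remaining terms into the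
      -- bracket of `η a b` with `f k`, to which Euler's formula applies.
      have h₁ := hc (f k) a b
      rw [hskew b (f k)] at h₁
      have h₂ : poisson R L (-η (f k) b).1 (algebraMap R _ a) =
          - poisson R L (η (f k) b).1 (algebraMap R _ a) := by
        rw [Submodule.coe_neg, map_neg]; rfl
      rw [h₂] at h₁
      linear_combination ι R L (x k) * h₁
    rw [Finset.sum_congr rfl fun k _ => h₁ k, Finset.sum_neg_distrib, h.euler n (η a b).2,
      hskew b a, Submodule.coe_neg]
    have h₂ : -(η a b).1 - (η a b).1 + -(n • (η a b).1) = -((n + 2) • (η a b).1) := by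
      rw [add_smul, two_smul]; abel
    rw [h₂, smul_neg, ← Nat.cast_smul_eq_nsmul R, ← mul_smul, ← map_natCast (algebraMap ℂ R),
      ← map_mul, inv_mul_cancel₀ (Nat.cast_ne_zero.2 (by omega)), map_one, one_smul]

omit [Algebra ℂ R] h in
theorem tensorDer_tmul (n : ℕ) (y : L) (s : symPow R L n) (g : R) :
    tensorDer n (y ⊗ₜ[R] s) g = ⁅y, g⁆ • s := by
  simp [tensorDer]

theorem tensor_eq_sum (n : ℕ) (t : L ⊗[R] symPow R L n) :
    t = ∑ k, x k ⊗ₜ[R] tensorDer n t (f k) := by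
  induction t using TensorProduct.induction_on with
  | zero => simp [tensorDer]
  | tmul y s =>
    simp only [tensorDer_tmul, TensorProduct.tmul_smul, TensorProduct.smul_tmul']
    rw [← TensorProduct.sum_tmul, ← h.vec y]
  | add a b ha hb =>
    have : ∀ g, tensorDer n (a + b) g = tensorDer n a g + tensorDer n b g := fun g => by
      simp only [tensorDer, map_add]
    simp only [this, TensorProduct.tmul_add]
    rw [Finset.sum_add_distrib, ← ha, ← hb]

/-- Elements of `L ⊗ Sym^n L` are determined by the corresponding derivations. -/
theorem tensorDer_injective (n : ℕ) {t t' : L ⊗[R] symPow R L n}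
    (ht : ∀ k, tensorDer n t (f k) = tensorDer n t' (f k)) : t = t' := by
  rw [h.tensor_eq_sum n t, h.tensor_eq_sum n t']
  simp only [ht]

/-- Derivations with values in `Sym^n L` are given by elements of `L ⊗ Sym^n L`. -/
theorem exists_tensorDer (n : ℕ) (D : Derivation ℤ R (symPow R L n))
    (hD : ∀ c : ℂ, D (algebraMap ℂ R c) = 0) :
    ∃ t : L ⊗[R] symPow R L n, ∀ g, tensorDer n t g = D g := by
  refine ⟨∑ k, x k ⊗ₜ[R] D (f k), fun g => ?_⟩
  rw [h.der _ D hD g]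
  simp only [tensorDer, map_sum]
  exact Finset.sum_congr rfl fun k _ => tensorDer_tmul n _ _ _

end IsDualBasis
end Poisson
end SymmetricAlgebra

/-! ### Square-zero Poisson extensions and their local trivializations. -/

namespace SymmetricAlgebra

section ZeroJet
variable {R L : Type} [CommRing R] [AddCommGroup L] [Module R L]

variable (R L) in
/-- The projection `∏_{k ≤ n} Sym^k L → Sym^0 L = R`. -/
def zeroJet (n : ℕ) : (SymmetricAlgebra R L ⧸ augIdeal R L ^ (n + 1)) →+* R :=
  Ideal.Quotient.lift _ (algebraMapInv : SymmetricAlgebra R L →ₐ[R] R).toRingHom fun _ ha =>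
    (Ideal.pow_le_self n.succ_ne_zero : augIdeal R L ^ (n + 1) ≤ augIdeal R L) ha

theorem zeroJet_mk (n : ℕ) (s : SymmetricAlgebra R L) :
    zeroJet R L n (Ideal.Quotient.mk _ s) = algebraMapInv s := rfl

theorem mk_mul_symPow {n : ℕ} {a e : SymmetricAlgebra R L} (ha : a ∈ augIdeal R L) (he : e ∈ symPow R L n) :
    (Ideal.Quotient.mk (augIdeal R L ^ (n + 1)) a) * Ideal.Quotient.mk _ e = 0 := by
  rw [← map_mul, Ideal.Quotient.eq_zero_iff_mem, pow_succ']
  exact Ideal.mul_mem_mul ha (symPow_le_augIdeal_pow n he)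

theorem mk_mul_add_symPow {n : ℕ} {a b e : SymmetricAlgebra R L} (ha : a ∈ augIdeal R L)
    (he : e ∈ symPow R L n) :
    (Ideal.Quotient.mk (augIdeal R L ^ (n + 1)) a) * Ideal.Quotient.mk _ (b + e) =
      (Ideal.Quotient.mk (augIdeal R L ^ (n + 1)) a) * Ideal.Quotient.mk _ b := by
  rw [map_add, mul_add, mk_mul_symPow ha he, add_zero]

end ZeroJet

variable {R L : Type} [CommRing R] [LieRing L] [Module R L] [LieRingModule L R]
  [LieRinehartRing R L] [Algebra ℂ R]

variable (R L) in
/-- A square-zero extension `0 → Sym^{n+1} L → A → ∏_{k ≤ n} Sym^k L → 0` with a bracket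
`A × A → ∏_{k ≤ n} Sym^k L` lifting the Poisson bracket. -/
structure PoissonExt (n : ℕ) (A : Type) [CommRing A] where
  const : ℂ →+* A
  p : A →+* SymmetricAlgebra R L ⧸ augIdeal R L ^ (n + 1)
  incl : symPow R L (n + 1) →+ A
  br : A →+ A →+ SymmetricAlgebra R L ⧸ augIdeal R L ^ (n + 1)
  p_const : ∀ c, p (const c) = Ideal.Quotient.mk _ (algebraMap R _ (algebraMap ℂ R c))
  p_surjective : Function.Surjective p
  incl_injective : Function.Injective incl
  exact : ∀ a, p a = 0 ↔ ∃ s, incl s = a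
  incl_smul : ∀ a s, incl (zeroJet R L n (p a) • s) = a * incl s
  br_self : ∀ a, br a a = 0
  br_const : ∀ c a, br (const c) a = 0
  br_mul : ∀ a b c, br (a * b) c = p a * br b c + p b * br a c
  br_incl : ∀ s a, br (incl s) a = Ideal.Quotient.mk _ (derive n s (zeroJet R L n (p a))).1
  -- The representatives `s` and `t` are known modulo the power `n + 1` of the ideal, hence their
  -- bracket only modulo the power `n`.
  br_lift : ∀ a b s t u, p a = Ideal.Quotient.mk _ s → p b = Ideal.Quotient.mk _ t →
    br a b = Ideal.Quotient.mk _ u → u - poisson R L s t ∈ augIdeal R L ^ n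
  jacobi : ∀ a b c s t r u v w, p a = Ideal.Quotient.mk _ s → p b = Ideal.Quotient.mk _ t →
    p c = Ideal.Quotient.mk _ r → br a b = Ideal.Quotient.mk _ u → br b c = Ideal.Quotient.mk _ v →
    br c a = Ideal.Quotient.mk _ w →
    poisson R L u r + poisson R L v s + poisson R L w t ∈ augIdeal R L ^ n

namespace PoissonExt

variable {n : ℕ} {A : Type} [CommRing A] (E : PoissonExt R L n A)

theorem p_incl (s : symPow R L (n + 1)) : E.p (E.incl s) = 0 := (E.exact _).2 ⟨s, rfl⟩

theorem incl_mul_incl (s t : symPow R L (n + 1)) : E.incl s * E.incl t = 0 := by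
  rw [← E.incl_smul, E.p_incl, map_zero, zero_smul, map_zero]

theorem br_skew (a b : A) : E.br a b = - E.br b a := by
  have := E.br_self (a + b)
  rw [map_add, map_add, AddMonoidHom.add_apply, AddMonoidHom.add_apply, E.br_self, E.br_self,
    zero_add, add_zero] at this
  exact eq_neg_of_add_eq_zero_right this

theorem br_mul_right (a b c : A) : E.br a (b * c) = E.p b * E.br a c + E.p c * E.br a b := by
  rw [E.br_skew, E.br_mul, E.br_skew a c, E.br_skew a b]; ring

theorem br_const_right (a : A) (c : ℂ) : E.br a (E.const c) = 0 := by
  rw [E.br_skew, E.br_const, neg_zero]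

/-- Only the component of degree `n` of a bracket is left undetermined by the lower part of the
tower; all the corrections below take place in this degree. -/
theorem exists_br_eq (a b : A) {s t : SymmetricAlgebra R L} (ha : E.p a = Ideal.Quotient.mk _ s)
    (hb : E.p b = Ideal.Quotient.mk _ t) :
    ∃ e ∈ symPow R L n, E.br a b = Ideal.Quotient.mk _ (poisson R L s t + e) := by
  obtain ⟨u, hu⟩ := Ideal.Quotient.mk_surjective (E.br a b)
  obtain ⟨e, he, h⟩ := exists_symPow_sub_mem n (E.br_lift a b s t u ha hb hu.symm)
  refine ⟨e, he, ?_⟩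
  rw [← hu, Ideal.Quotient.mk_eq_mk_iff_sub_mem, ← sub_sub]
  exact h

theorem zeroJet_p_eq_zero {a : A} {s : SymmetricAlgebra R L} (ha : E.p a = Ideal.Quotient.mk _ s)
    (hs : s ∈ augIdeal R L) : zeroJet R L n (E.p a) = 0 := by
  rw [ha, zeroJet_mk]; exact hs

/-- The derivation `{a, β(-)}` of `Sym L`. -/
def brDer (β : SymmetricAlgebra R L →+* A) (hp : ∀ s, E.p (β s) = Ideal.Quotient.mk _ s) (a : A) :
    Derivation ℤ (SymmetricAlgebra R L) (SymmetricAlgebra R L ⧸ augIdeal R L ^ (n + 1)) :=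
  Derivation.mk' (((E.br a).comp β.toAddMonoidHom).toIntLinearMap) fun s t => by
    change E.br a (β (s * t)) = Ideal.Quotient.mk _ s * E.br a (β t) + Ideal.Quotient.mk _ t * E.br a (β s)
    rw [map_mul, E.br_mul_right, hp, hp]

theorem brDer_apply (β : SymmetricAlgebra R L →+* A) (hp : ∀ s, E.p (β s) = Ideal.Quotient.mk _ s)
    (a : A) (s : SymmetricAlgebra R L) : E.brDer β hp a s = E.br a (β s) := rfl

/-- The derivation `{a, -}` of `Sym L` modulo higher order terms. -/
def mkDer (n : ℕ) (a : SymmetricAlgebra R L) :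
    Derivation ℤ (SymmetricAlgebra R L) (SymmetricAlgebra R L ⧸ augIdeal R L ^ (n + 1)) :=
  Derivation.mk' (((Ideal.Quotient.mk (augIdeal R L ^ (n + 1))).toAddMonoidHom.comp
    (poisson R L a : SymmetricAlgebra R L →ₗ[ℤ] SymmetricAlgebra R L).toAddMonoidHom).toIntLinearMap)
    fun s t => by
      change Ideal.Quotient.mk (augIdeal R L ^ (n + 1)) (poisson R L a (s * t)) =
        Ideal.Quotient.mk _ s * Ideal.Quotient.mk _ (poisson R L a t) +
        Ideal.Quotient.mk _ t * Ideal.Quotient.mk _ (poisson R L a s)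
      rw [poisson_mul_right, map_add, map_mul, map_mul]

omit [Algebra ℂ R] in
theorem mkDer_apply (n : ℕ) (a s : SymmetricAlgebra R L) :
    mkDer n a s = Ideal.Quotient.mk _ (poisson R L a s) := rfl

/-- The derivation `{a, σ(-)}` of `R`. -/
def brFunDer (σ : R →+* A) (hσ : ∀ r, E.p (σ r) = Ideal.Quotient.mk _ (algebraMap R _ r)) (a : A) :
    Derivation ℤ R (SymmetricAlgebra R L ⧸ augIdeal R L ^ (n + 1)) :=
  Derivation.mk' (((E.br a).comp σ.toAddMonoidHom).toIntLinearMap) fun s t => by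
    change E.br a (σ (s * t)) = Ideal.Quotient.mk _ (algebraMap R _ s) * E.br a (σ t) +
      Ideal.Quotient.mk _ (algebraMap R _ t) * E.br a (σ s)
    rw [map_mul, E.br_mul_right, hσ, hσ]

theorem brFunDer_apply (σ : R →+* A)
    (hσ : ∀ r, E.p (σ r) = Ideal.Quotient.mk _ (algebraMap R _ r)) (a : A) (r : R) :
    E.brFunDer σ hσ a r = E.br a (σ r) := rfl

section Lift
variable {N : ℕ} {f : Fin N → R} {x : Fin N → L} (h : IsDualBasis R L f x)
  {β : SymmetricAlgebra R L →+* A} (hp : ∀ s, E.p (β s) = Ideal.Quotient.mk _ s)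
  (hv : ∀ y g, E.br (β (ι R L y)) (β (algebraMap R _ g)) =
    Ideal.Quotient.mk _ (algebraMap R _ ⁅y, g⁆))

include h hp hv

/-- For `n ≥ 1`, the Jacobi identity for `y`, `z` and `f k` shows that the defect in degree `n` has
zero bracket with every `f k`, so it vanishes by Euler's formula. For `n = 0` the element `β (ι y)`
lies in the kernel of `p`, and `br_incl` computes the bracket. -/
theorem br_vec_vec (hi : ∀ s : symPow R L (n + 1), β s = E.incl s) (y z : L) :
    E.br (β (ι R L y)) (β (ι R L z)) = Ideal.Quotient.mk _ (ι R L ⁅y, z⁆) := by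
  cases n with
  | zero =>
    have h₁ : β (ι R L y) = E.incl ⟨ι R L y, ι_mem_symPow_one y⟩ := hi ⟨ι R L y, ι_mem_symPow_one y⟩
    rw [h₁, E.br_incl, E.zeroJet_p_eq_zero (hp _) (ι_mem_augIdeal z), derive_val, map_zero, map_zero,
      map_zero, eq_comm, Ideal.Quotient.eq_zero_iff_mem, zero_add, pow_one]
    exact ι_mem_augIdeal _
  | succ n =>
    obtain ⟨e, he, h₁⟩ := E.exists_br_eq _ _ (hp (ι R L y)) (hp (ι R L z))
    rw [poisson_vec_vec] at h₁
    have h₂ : e = 0 := by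
      refine h.eq_zero_of_derive n he fun k => ?_
      have h₃ : E.br (β (algebraMap R _ (f k))) (β (ι R L y)) =
          Ideal.Quotient.mk _ (-(algebraMap R _ ⁅y, f k⁆)) := by
        rw [E.br_skew, hv, map_neg]
      have h₄ := E.jacobi _ _ _ _ _ _ _ _ _ (hp (ι R L y)) (hp (ι R L z))
        (hp (algebraMap R _ (f k))) h₁ (hv z (f k)) h₃
      rw [poisson_add_left, poisson_vec_fun, poisson_fun_vec, map_neg, Derivation.neg_apply,
        poisson_fun_vec, lie_lie, map_sub] at h₄
      refine h.symPow_inf n (poisson_mem_symPow n he _) ?_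
      convert h₄ using 1
      ring
    rw [h₁, h₂, add_zero]

/-- A lift preserving the brackets of vector fields and functions preserves all brackets with
elements of the augmentation ideal. -/
theorem br_of_mem_augIdeal (hi : ∀ s : symPow R L (n + 1), β s = E.incl s)
    {a : SymmetricAlgebra R L} (ha : a ∈ augIdeal R L) (b : SymmetricAlgebra R L) :
    E.br (β a) (β b) = Ideal.Quotient.mk _ (poisson R L a b) := by
  rw [augIdeal_eq_span] at ha
  induction ha using Submodule.span_induction with
  | mem _ hx =>
    obtain ⟨y, rfl⟩ := hx
    have : E.brDer β hp (β (ι R L y)) = mkDer n (ι R L y) := derivation_ext'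
      (fun r => by rw [brDer_apply, mkDer_apply, hv, poisson_vec_fun])
      (fun z => by rw [brDer_apply, mkDer_apply, E.br_vec_vec h hp hv hi, poisson_vec_vec])
    exact DFunLike.congr_fun this b
  | zero => simp
  | add a a' _ _ h₁ h₂ =>
    rw [map_add, map_add, AddMonoidHom.add_apply, h₁, h₂, poisson_add_left, map_add]
  | smul c a ha h₁ =>
    replace ha : a ∈ augIdeal R L := by rw [augIdeal_eq_span]; exact ha
    -- The bracket of the arbitrary coefficient `c` is known only up to the term `e` of degree `n`,
    -- which is annihilated by multiplication with `a` in the augmentation ideal.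
    obtain ⟨e, he, h₂⟩ := E.exists_br_eq _ _ (hp c) (hp b)
    rw [smul_eq_mul, map_mul, E.br_mul, h₁, h₂, hp, hp, mk_mul_add_symPow ha he, poisson_mul_left,
      map_add, map_mul, map_mul]

/-- For fixed `a` the bracket with the lifted functions is a derivation killing constants, so it is
determined by its values on the `f k`. Hence all lifted functions commute, and the formula follows
for all `a` by the Leibniz rule. -/
theorem br_fun (h₀ : ∀ k l, E.br (β (algebraMap R _ (f k))) (β (algebraMap R _ (f l))) = 0)
    (hc : ∀ c, β (algebraMap R _ (algebraMap ℂ R c)) = E.const c)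
    (a : SymmetricAlgebra R L) (g : R) :
    E.br (β a) (β (algebraMap R _ g)) = Ideal.Quotient.mk _ (poisson R L a (algebraMap R _ g)) := by
  have key : ∀ a g, E.br a (β (algebraMap R _ g)) =
      ∑ k, Ideal.Quotient.mk _ (algebraMap R _ ⁅x k, g⁆) * E.br a (β (algebraMap R _ (f k))) := by
    intro a g
    exact h.der _ (E.brFunDer (β.comp (algebraMap R _)) (fun r => hp _) a)
      (fun c => (congrArg _ (hc c)).trans (E.br_const_right a c)) g
  induction a using SymmetricAlgebra.induction with
  | algebraMap r =>
    rw [poisson_fun_fun, map_zero, key]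
    refine Finset.sum_eq_zero fun k _ => ?_
    rw [E.br_skew, key, Finset.sum_eq_zero fun l _ => by rw [h₀, mul_zero], neg_zero, mul_zero]
  | ι y => rw [hv, poisson_vec_fun]
  | mul a b ha hb =>
    rw [map_mul, E.br_mul, ha, hb, hp, hp, poisson_mul_left, map_add, map_mul, map_mul]
  | add a b ha hb => rw [map_add, map_add, AddMonoidHom.add_apply, ha, hb, poisson_add_left, map_add]

/-- Being the identity on the top degree is a consequence of the brackets: `β s` is the image of
some `t` in `Sym^{n+1}`, and `t` and `s` have the same brackets with functions. -/
theorem lift_eq_incl (h₀ : ∀ k l, E.br (β (algebraMap R _ (f k))) (β (algebraMap R _ (f l))) = 0)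
    (hc : ∀ c, β (algebraMap R _ (algebraMap ℂ R c)) = E.const c)
    (s : symPow R L (n + 1)) : β s = E.incl s := by
  have h₁ : E.p (β s) = 0 := by
    rw [hp, Ideal.Quotient.eq_zero_iff_mem]
    exact symPow_le_augIdeal_pow _ s.2
  obtain ⟨t, ht⟩ := (E.exact _).1 h₁
  rw [← ht]
  congr 1
  refine h.derive_injective n fun g => Subtype.ext (sub_eq_zero.1 ?_)
  refine h.symPow_inf n (sub_mem (derive n t g).2 (derive n s g).2) ?_
  rw [← Ideal.Quotient.mk_eq_mk_iff_sub_mem, derive_val n s, ← E.br_fun h hp hv h₀ hc, ← ht, E.br_incl,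
    hp, zeroJet_mk, algebraMapInv_algebraMap]

end Lift

section Kernel
variable {β : SymmetricAlgebra R L →+* A} (hp : ∀ s, E.p (β s) = Ideal.Quotient.mk _ s)
  (hi : ∀ s : symPow R L (n + 1), β s = E.incl s)
include hp hi

/-- The augmentation ideal annihilates the kernel of `p`, so `β` kills its power `n + 2`. Conversely
an element of the kernel lies in the power `n + 1`, and its leading term is zero because `incl` is
injective. -/
theorem lift_eq_zero_iff (s : SymmetricAlgebra R L) : β s = 0 ↔ s ∈ augIdeal R L ^ (n + 2) := by
  have h₁ : ∀ s ∈ augIdeal R L ^ (n + 2), β s = 0 := by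
    intro s hs
    rw [pow_succ'] at hs
    induction hs using Submodule.mul_induction_on' with
    | mem_mul_mem a ha b hb =>
      have : E.p (β b) = 0 := by rw [hp]; exact Ideal.Quotient.eq_zero_iff_mem.2 hb
      obtain ⟨t, ht⟩ := (E.exact _).1 this
      rw [map_mul, ← ht, ← E.incl_smul, E.zeroJet_p_eq_zero (hp a) ha, zero_smul, map_zero]
    | add a _ b _ ha hb => rw [map_add, ha, hb, add_zero]
  refine ⟨fun hs => ?_, h₁ s⟩
  have h₂ : s ∈ augIdeal R L ^ (n + 1) := by
    rw [← Ideal.Quotient.eq_zero_iff_mem, ← hp, hs, map_zero]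
  obtain ⟨t, ht, h₃⟩ := exists_symPow_sub_mem _ h₂
  have h₄ := h₁ _ h₃
  rw [map_sub, hs, zero_sub, neg_eq_zero, hi ⟨t, ht⟩] at h₄
  have h₅ : t = 0 := congrArg Subtype.val (E.incl_injective (h₄.trans (map_zero _).symm))
  rwa [h₅, sub_zero] at h₃

theorem lift_surjective : Function.Surjective β := by
  intro a
  obtain ⟨s, hs⟩ := Ideal.Quotient.mk_surjective (E.p a)
  obtain ⟨t, ht⟩ := (E.exact (a - β s)).1 (by rw [map_sub, hp, hs, sub_self])
  exact ⟨s + t, by rw [map_add, hi, ht, add_sub_cancel]⟩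

/-- The isomorphism `∏_{k ≤ n+1} Sym^k L ≅ A` defined by a lift. -/
def jetEquiv : (SymmetricAlgebra R L ⧸ augIdeal R L ^ (n + 1 + 1)) ≃+* A :=
  (Ideal.quotEquivOfEq (Ideal.ext fun s =>
    (E.lift_eq_zero_iff hp hi s).symm)).trans
    (RingHom.quotientKerEquivOfSurjective (f := β) (E.lift_surjective hp hi))

end Kernel

section Framing
variable {N : ℕ} {f : Fin N → R} {x : Fin N → L} (h : IsDualBasis R L f x)
include h

omit E in
theorem mk_symPow_injective {s t : SymmetricAlgebra R L} (hs : s ∈ symPow R L n)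
    (ht : t ∈ symPow R L n) (hst : Ideal.Quotient.mk (augIdeal R L ^ (n + 1)) s =
      Ideal.Quotient.mk _ t) : s = t :=
  sub_eq_zero.1 (h.symPow_inf n (sub_mem hs ht) (Ideal.Quotient.mk_eq_mk_iff_sub_mem _ _ |>.1 hst))

omit E in
theorem exists_derivation_symPow
    (D : Derivation ℤ R (SymmetricAlgebra R L ⧸ augIdeal R L ^ (n + 1)))
    (hD : ∀ g, ∃ e ∈ symPow R L n, D g = Ideal.Quotient.mk _ e) :
    ∃ D' : Derivation ℤ R (symPow R L n), ∀ g, D g = Ideal.Quotient.mk _ (D' g).1 := by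
  choose e he hDe using hD
  refine ⟨Derivation.mk' (AddMonoidHom.mk' (fun g => (⟨e g, he g⟩ : symPow R L n)) fun a b =>
    Subtype.ext (mk_symPow_injective h (he _) (add_mem (he a) (he b)) ?_)).toIntLinearMap
    fun a b => Subtype.ext (mk_symPow_injective h (he _) (add_mem (Submodule.smul_mem _ _ (he b))
      (Submodule.smul_mem _ _ (he a))) ?_), hDe⟩
  · rw [← hDe, map_add, hDe, hDe]
    exact (map_add _ _ _).symm
  · change Ideal.Quotient.mk (augIdeal R L ^ (n + 1)) (e (a * b)) =
      Ideal.Quotient.mk (augIdeal R L ^ (n + 1)) (a • e b + b • e a)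
    rw [← hDe, D.leibniz, hDe, hDe]
    rfl

/-- Formal smoothness gives some lift `σ`. Its brackets `{σ a, σ b}` lie in `Sym^n` and form a
closed skew biderivation, so by the second Poincaré lemma adding a derivation `θ` to `σ` makes the
lifted functions commute. -/
theorem exists_fun_lift [Algebra.FormallySmooth ℂ R] : ∃ σ : R →+* A,
    (∀ r, E.p (σ r) = Ideal.Quotient.mk _ (algebraMap R _ r)) ∧
    (∀ c, σ (algebraMap ℂ R c) = E.const c) ∧ ∀ a b, E.br (σ a) (σ b) = 0 := by
  obtain ⟨σ, hσ, hσc⟩ : ∃ σ : R →+* A,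
      (∀ r, E.p (σ r) = Ideal.Quotient.mk _ (algebraMap R _ r)) ∧
      (∀ c, σ (algebraMap ℂ R c) = E.const c) := by
    let _ : Algebra ℂ A := E.const.toAlgebra
    let _ : Algebra ℂ (SymmetricAlgebra R L ⧸ augIdeal R L ^ (n + 1)) :=
      (((Ideal.Quotient.mk _).comp (algebraMap R (SymmetricAlgebra R L))).comp
        (algebraMap ℂ R)).toAlgebra
    let p : A →ₐ[ℂ] (SymmetricAlgebra R L ⧸ augIdeal R L ^ (n + 1)) :=
      { E.p with commutes' := E.p_const }
    let q : R →ₐ[ℂ] (SymmetricAlgebra R L ⧸ augIdeal R L ^ (n + 1)) :=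
      { (Ideal.Quotient.mk _).comp (algebraMap R (SymmetricAlgebra R L)) with
        commutes' := fun _ => rfl }
    have hn : IsNilpotent (RingHom.ker (p : A →+* SymmetricAlgebra R L ⧸ augIdeal R L ^ (n + 1))) := by
      refine ⟨2, ?_⟩
      rw [pow_two, Ideal.zero_eq_bot, eq_bot_iff, Ideal.mul_le]
      intro a ha b hb
      obtain ⟨s, rfl⟩ := (E.exact a).1 ha
      obtain ⟨t, rfl⟩ := (E.exact b).1 hb
      exact E.incl_mul_incl s t
    refine ⟨(Algebra.FormallySmooth.liftOfSurjective q p E.p_surjective hn).toRingHom,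
      fun r => ?_, fun c => ?_⟩
    · exact Algebra.FormallySmooth.liftOfSurjective_apply q p E.p_surjective hn r
    · exact (Algebra.FormallySmooth.liftOfSurjective q p E.p_surjective hn).commutes c
  have h₁ : ∀ a, ∃ D : Derivation ℤ R (symPow R L n),
      ∀ b, E.br (σ a) (σ b) = Ideal.Quotient.mk _ (D b).1 := fun a =>
    exists_derivation_symPow h (E.brFunDer σ hσ (σ a)) fun b => by
      obtain ⟨e, he, h₂⟩ := E.exists_br_eq _ _ (hσ a) (hσ b)
      rw [poisson_fun_fun, zero_add] at h₂
      exact ⟨e, he, h₂⟩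
  choose D hD using h₁
  have hinj : ∀ s t : symPow R L n, Ideal.Quotient.mk (augIdeal R L ^ (n + 1)) s.1 =
    Ideal.Quotient.mk _ t.1 → s = t := fun s t hst => Subtype.ext (mk_symPow_injective h s.2 t.2 hst)
  let η : R →+ Derivation ℤ R (symPow R L n) := AddMonoidHom.mk' D fun a b =>
    Derivation.ext fun c => hinj _ _ (by
      rw [← hD, map_add, map_add, AddMonoidHom.add_apply, hD, hD]; rfl)
  have hη : ∀ a b, E.br (σ a) (σ b) = Ideal.Quotient.mk _ (η a b).1 := hD
  obtain ⟨θ, hθc, hθ⟩ := h.exists_derive_sub_eq n η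
    (fun a c => hinj _ _ (by rw [← hη, hσc, E.br_const_right]; rfl))
    (fun a b => hinj _ _ (by rw [← hη, E.br_skew, hη]; rfl))
    (fun a b c => by
      -- The Jacobi identity is available only modulo the power `n` of the ideal. The three terms
      -- have degree `n - 1`, or vanish when `n = 0`, so the congruence is an equality.
      have := h.sum_poisson_eq_zero (n := n) (K := Fin 3) Finset.univ
        (s := ![(η a b).1, (η b c).1, (η c a).1]) (by
          intro i _
          fin_cases i
          · exact (η a b).2
          · exact (η b c).2
          · exact (η c a).2) ![c, a, b] (by
        rw [Fin.sum_univ_three]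
        exact E.jacobi _ _ _ _ _ _ _ _ _ (hσ a) (hσ b) (hσ c) (hη a b) (hη b c) (hη c a))
      rw [Fin.sum_univ_three] at this
      exact this)
  have hred : ∀ r, zeroJet R L n (E.p (σ r)) = r := fun r => by
    rw [hσ, zeroJet_mk, algebraMapInv_algebraMap]
  have hsmul : ∀ r s, E.incl (r • s) = σ r * E.incl s := fun r s => by
    rw [← E.incl_smul, hred]
  refine ⟨{ toFun := fun r => σ r + E.incl (θ r)
            map_one' := by simp
            map_zero' := by simp
            map_mul' := fun a b => by
              rw [θ.leibniz, map_add, hsmul, hsmul, map_mul]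
              linear_combination - E.incl_mul_incl (θ a) (θ b)
            map_add' := fun a b => by rw [map_add, map_add, map_add]; ring }, fun r => ?_, fun c => ?_,
      fun a b => ?_⟩
  · change E.p (σ r + E.incl (θ r)) = _
    rw [map_add, E.p_incl, add_zero, hσ]
  · change σ (algebraMap ℂ R c) + E.incl (θ (algebraMap ℂ R c)) = _
    rw [hθc, map_zero, add_zero, hσc]
  · change E.br (σ a + E.incl (θ a)) (σ b + E.incl (θ b)) = 0
    have h₁ := congrArg (fun s : symPow R L n => Ideal.Quotient.mk (augIdeal R L ^ (n + 1)) s.1) (hθ a b)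
    simp only [Submodule.coe_sub, Submodule.coe_neg, map_sub, map_neg] at h₁
    have h₂ : E.br (E.incl (θ a)) (E.incl (θ b)) = 0 := by
      rw [E.br_incl, E.p_incl, map_zero, derive_val, map_zero, map_zero, map_zero]
    rw [map_add, map_add, AddMonoidHom.add_apply, AddMonoidHom.add_apply, hη, h₂, E.br_incl,
      E.br_skew (σ a), E.br_incl, hred, hred]
    linear_combination h₁

/-- A lift of the functions `R` and of the vector fields of a dual basis with the brackets of the
cotangent bundle. -/
theorem exists_framing [Algebra.FormallySmooth ℂ R] : ∃ (σ : R →+* A) (X : Fin N → A),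
    (∀ r, E.p (σ r) = Ideal.Quotient.mk _ (algebraMap R _ r)) ∧
    (∀ c, σ (algebraMap ℂ R c) = E.const c) ∧
    (∀ k, E.p (X k) = Ideal.Quotient.mk _ (ι R L (x k))) ∧
    (∀ k l, E.br (X k) (σ (f l)) = Ideal.Quotient.mk _ (algebraMap R _ ⁅x k, f l⁆)) ∧
    (∀ k l, E.br (σ (f k)) (σ (f l)) = 0) := by
  obtain ⟨σ, hσ, hσc, h₀⟩ := E.exists_fun_lift h
  have key : ∀ k, ∃ a, E.p a = Ideal.Quotient.mk _ (ι R L (x k)) ∧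
      ∀ g, E.br a (σ g) = Ideal.Quotient.mk _ (algebraMap R _ ⁅x k, g⁆) := by
    intro k
    obtain ⟨a, ha⟩ := E.p_surjective (Ideal.Quotient.mk _ (ι R L (x k)))
    let δ : Derivation ℤ R (SymmetricAlgebra R L ⧸ augIdeal R L ^ (n + 1)) :=
      Derivation.mk' (((Ideal.Quotient.mk (augIdeal R L ^ (n + 1))).comp
        (algebraMap R (SymmetricAlgebra R L))).toAddMonoidHom.comp
        (AddMonoidHom.mk' (fun g : R => ⁅x k, g⁆) (lie_add _))).toIntLinearMap fun s t => by
          change Ideal.Quotient.mk (augIdeal R L ^ (n + 1)) (algebraMap R (SymmetricAlgebra R L)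
            ⁅x k, s * t⁆) = Ideal.Quotient.mk _ (algebraMap R _ s) *
            Ideal.Quotient.mk _ (algebraMap R _ ⁅x k, t⁆) + Ideal.Quotient.mk _ (algebraMap R _ t) *
            Ideal.Quotient.mk _ (algebraMap R _ ⁅x k, s⁆)
          rw [LieRinehartRing.leibniz_mul_right, ← map_mul, ← map_mul, ← map_mul,
            ← map_mul, ← map_add, ← map_add]
          congr 2
          ring
    have hδ : ∀ g, δ g = Ideal.Quotient.mk _ (algebraMap R _ ⁅x k, g⁆) := fun g => rfl
    -- `D` is the error in the brackets of the provisional lift `a` of `x k` with functions. As the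
    -- lifted functions commute, the Jacobi identity makes `D` closed, so `D = {m, -}`, and `a -
    -- incl m` is the corrected lift.
    obtain ⟨D, hD⟩ := exists_derivation_symPow h (E.brFunDer σ hσ a - δ) fun g => by
      obtain ⟨e, he, h₂⟩ := E.exists_br_eq _ _ ha (hσ g)
      refine ⟨e, he, ?_⟩
      rw [Derivation.sub_apply, brFunDer_apply, h₂, poisson_vec_fun, hδ, map_add, add_sub_cancel_left]
    have hD' : ∀ g, E.br a (σ g) = Ideal.Quotient.mk _ (algebraMap R _ ⁅x k, g⁆ + (D g).1) := fun g => by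
      rw [map_add, ← hD, Derivation.sub_apply, hδ, brFunDer_apply, add_sub_cancel]
    obtain ⟨m, hm⟩ := h.exists_derive_eq n D (fun c => by
        refine Subtype.ext (mk_symPow_injective h (D _).2 (zero_mem _) ?_)
        rw [← hD, Derivation.sub_apply, hδ, brFunDer_apply, hσc, E.br_const_right, h.lie_const, map_zero,
          map_zero, sub_zero]
        exact (map_zero _).symm)
      (fun b c => by
        have h₁ : E.br (σ c) a = Ideal.Quotient.mk _ (-(algebraMap R _ ⁅x k, c⁆ + (D c).1)) := by
          rw [E.br_skew, hD', map_neg]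
        have h₂ := E.jacobi _ _ _ _ _ _ _ _ _ ha (hσ b) (hσ c) (hD' b)
          ((h₀ b c).trans (map_zero _).symm) h₁
        rw [map_zero, Derivation.zero_apply, add_zero, map_neg, Derivation.neg_apply, poisson_add_left,
          poisson_add_left, poisson_fun_fun, poisson_fun_fun, zero_add, zero_add] at h₂
        have := h.sum_poisson_eq_zero (n := n) (K := Fin 2) Finset.univ
          (s := ![(D b).1, -(D c).1]) (by
            intro i _
            fin_cases i
            · exact (D b).2
            · exact neg_mem (D c).2) ![c, b] (by
          rw [Fin.sum_univ_two]
          simpa using h₂)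
        rw [Fin.sum_univ_two] at this
        simpa [← sub_eq_add_neg, sub_eq_zero] using this)
    refine ⟨a - E.incl m, by rw [map_sub, E.p_incl, sub_zero, ha], fun g => ?_⟩
    rw [map_sub, AddMonoidHom.sub_apply, hD', E.br_incl, hσ, zeroJet_mk, algebraMapInv_algebraMap, hm,
      map_add, add_sub_cancel_right]
  choose X hX₁ hX₂ using key
  exact ⟨σ, X, hσ, hσc, hX₁, fun k l => hX₂ k (f l), fun k l => h₀ _ _⟩

/-- A framing defines a lift of the cotangent bundle preserving brackets. -/
theorem exists_lift_of_framing (σ : R →+* A) (X : Fin N → A)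
    (hσ : ∀ r, E.p (σ r) = Ideal.Quotient.mk _ (algebraMap R _ r))
    (hσc : ∀ c, σ (algebraMap ℂ R c) = E.const c)
    (hX : ∀ k, E.p (X k) = Ideal.Quotient.mk _ (ι R L (x k)))
    (hXσ : ∀ k l, E.br (X k) (σ (f l)) = Ideal.Quotient.mk _ (algebraMap R _ ⁅x k, f l⁆))
    (h₀ : ∀ k l, E.br (σ (f k)) (σ (f l)) = 0) :
    ∃ β : SymmetricAlgebra R L →+* A, (∀ r, β (algebraMap R _ r) = σ r) ∧
      (∀ y, β (ι R L y) = ∑ k, σ ⁅y, f k⁆ * X k) ∧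
      (∀ s, E.p (β s) = Ideal.Quotient.mk _ s) ∧
      (∀ s : symPow R L (n + 1), β s = E.incl s) ∧
      ∀ s t, E.br (β s) (β t) = Ideal.Quotient.mk _ (poisson R L s t) := by
  -- The `x k` need not be linearly independent. The canonical expansion `y = ∑ y (f k) • x k`
  -- nevertheless makes the lift of vector fields well defined and linear.
  obtain ⟨β, hβ₁, hβ₂⟩ := exists_ringHom σ (AddMonoidHom.mk' (fun y : L => ∑ k, σ ⁅y, f k⁆ * X k)
    fun y z => by
      rw [← Finset.sum_add_distrib]
      exact Finset.sum_congr rfl fun k _ => by rw [add_lie, map_add, add_mul])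
    (fun r y => by
      simp only [AddMonoidHom.mk'_apply, Finset.mul_sum]
      exact Finset.sum_congr rfl fun k _ => by
        rw [LieRinehartRing.lie_smul_eq_mul, map_mul, mul_assoc])
  simp only [AddMonoidHom.mk'_apply] at hβ₂
  have hp : ∀ s, E.p (β s) = Ideal.Quotient.mk _ s := by
    have : E.p.comp β = Ideal.Quotient.mk _ := ringHom_ext' (fun r => by
      rw [RingHom.comp_apply, hβ₁, hσ]) (fun y => by
      rw [RingHom.comp_apply, hβ₂, map_sum]
      conv_rhs => rw [h.vec y, map_sum, map_sum]
      exact Finset.sum_congr rfl fun k _ => by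
        rw [map_mul, hσ, hX, map_smul, Algebra.smul_def, map_mul])
    exact fun s => RingHom.congr_fun this s
  have key : ∀ (a : A) (g : R), E.br a (σ g) =
      ∑ k, Ideal.Quotient.mk _ (algebraMap R _ ⁅x k, g⁆) * E.br a (σ (f k)) := fun a g =>
    h.der _ (E.brFunDer σ hσ a)
      (fun c => (congrArg _ (hσc c)).trans (E.br_const_right a c)) g
  have hff : ∀ a b, E.br (σ a) (σ b) = 0 := fun a b => by
    rw [key]
    refine Finset.sum_eq_zero fun k _ => ?_
    rw [E.br_skew, key, Finset.sum_eq_zero fun l _ => by rw [h₀, mul_zero], neg_zero, mul_zero]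
  let lieDer (y : L) : Derivation ℤ R R := Derivation.mk'
    (AddMonoidHom.mk' (fun g : R => ⁅y, g⁆) (lie_add _)).toIntLinearMap fun s t => by
      change ⁅y, s * t⁆ = s • ⁅y, t⁆ + t • ⁅y, s⁆
      rw [LieRinehartRing.leibniz_mul_right, smul_eq_mul, smul_eq_mul]
      ring
  have hlie : ∀ (y : L) (g : R), ⁅y, g⁆ = ∑ k, ⁅x k, g⁆ * ⁅y, f k⁆ := fun y g =>
    h.der R (lieDer y) (fun c => h.lie_const y c) g
  have hv : ∀ y g, E.br (β (ι R L y)) (β (algebraMap R _ g)) =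
      Ideal.Quotient.mk _ (algebraMap R _ ⁅y, g⁆) := fun y g => by
    rw [hβ₁, hβ₂, map_sum, AddMonoidHom.finsetSum_apply]
    -- The brackets of `X k` are prescribed only with the `f l`; both sides being derivations in
    -- `g`, this determines them for every `g`.
    have h₁ : ∀ k, E.br (σ ⁅y, f k⁆ * X k) (σ g) =
        Ideal.Quotient.mk _ (algebraMap R _ (⁅y, f k⁆ * ⁅x k, g⁆)) := fun k => by
      rw [E.br_mul, hff, mul_zero, add_zero, hσ, key, hlie (x k) g, map_mul, map_mul]
      congr 1
      rw [map_sum, map_sum]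
      exact Finset.sum_congr rfl fun l _ => by rw [hXσ, map_mul, map_mul]
    simp only [h₁]
    rw [← map_sum, ← map_sum, hlie y g]
    simp only [mul_comm]
  have h₀' : ∀ k l, E.br (β (algebraMap R _ (f k))) (β (algebraMap R _ (f l))) = 0 := fun k l => by
    rw [hβ₁, hβ₁, h₀]
  have hc' : ∀ c, β (algebraMap R _ (algebraMap ℂ R c)) = E.const c := fun c => by rw [hβ₁, hσc]
  refine ⟨β, hβ₁, hβ₂, hp, E.lift_eq_incl h hp hv h₀' hc', fun s t => ?_⟩
  have h₁ : E.brDer β hp (β s) = mkDer n s := derivation_ext'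
    (fun r => by rw [brDer_apply, mkDer_apply, E.br_fun h hp hv h₀' hc'])
    (fun z => by
      rw [brDer_apply, mkDer_apply, E.br_skew,
        E.br_of_mem_augIdeal h hp hv (E.lift_eq_incl h hp hv h₀' hc') (ι_mem_augIdeal z), poisson_skew s, map_neg])
  exact DFunLike.congr_fun h₁ t

end Framing

end PoissonExt
end SymmetricAlgebra

/-! ### Differences of lifts, closed derivations and their potentials. -/

namespace SymmetricAlgebra

variable {R L : Type} [CommRing R] [LieRing L] [Module R L] [LieRingModule L R]
  [LieRinehartRing R L]

variable (R L) in
/-- A ring `A` over `R` with an ideal `Sym^{n+1} L` of square zero and a bracket `A × A → B` whose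
restriction to `Sym^{n+1} L × A` is the natural derivation with values in `Sym^n L ⊆ B`. -/
structure PoissonStep (n : ℕ) (A B : Type) [CommRing A] [AddCommGroup B] where
  red : A →+* R
  incl : symPow R L (n + 1) →+ A
  inclB : symPow R L n →+ B
  br : A →+ A →+ B
  incl_injective : Function.Injective incl
  inclB_injective : Function.Injective inclB
  red_incl : ∀ s, red (incl s) = 0
  incl_smul : ∀ a s, incl (red a • s) = a * incl s
  br_skew : ∀ a b, br a b = - br b a
  br_incl : ∀ s a, br (incl s) a = inclB (derive n s (red a))

namespace PoissonStep

variable {n : ℕ} {A A' B' : Type} [CommRing A] [CommRing A'] [AddCommGroup B']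
  (Q : PoissonStep R L n A' B')

theorem br_incl_right (a : A') (s : symPow R L (n + 1)) :
    Q.br a (Q.incl s) = - Q.inclB (derive n s (Q.red a)) := by
  rw [Q.br_skew, Q.br_incl]

theorem derive_zero (s : symPow R L (n + 1)) : derive n s (0 : R) = 0 :=
  Subtype.ext (by rw [derive_val, map_zero, map_zero]; rfl)

theorem incl_mul_incl (s t : symPow R L (n + 1)) : Q.incl s * Q.incl t = 0 := by
  rw [← Q.incl_smul, Q.red_incl, zero_smul, map_zero]

variable {red : A →+* R} {ψ₁ ψ₂ : A →+* A'}

/-- The bracket with an element of the square-zero ideal sees the other entry only through its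
reduction, which is the same for both lifts. The change of the bracket is therefore the exterior
derivative of the change of the lift. -/
theorem br_sub (a b : A) {s t : symPow R L (n + 1)} (hr₁ : ∀ a, Q.red (ψ₁ a) = red a)
    (hr₂ : ∀ a, Q.red (ψ₂ a) = red a)
    (hs : ψ₁ a - ψ₂ a = Q.incl s) (ht : ψ₁ b - ψ₂ b = Q.incl t) :
    Q.br (ψ₁ a) (ψ₁ b) - Q.br (ψ₂ a) (ψ₂ b) =
      Q.inclB (derive n s (red b) - derive n t (red a)) := by
  have h₁ : Q.br (ψ₁ a) (ψ₁ b) - Q.br (ψ₂ a) (ψ₂ b) =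
      Q.br (ψ₁ a - ψ₂ a) (ψ₁ b) + Q.br (ψ₂ a) (ψ₁ b - ψ₂ b) := by
    rw [map_sub, map_sub, AddMonoidHom.sub_apply]; abel
  rw [h₁, hs, ht, Q.br_incl, Q.br_incl_right, hr₁, hr₂, map_sub, sub_eq_add_neg]

/-- Two lifts with the same brackets of vector fields and functions differ by a derivation. -/
theorem exists_derivation_sub [Algebra ℂ R] {N : ℕ} {f : Fin N → R} {x : Fin N → L}
    (h : IsDualBasis R L f x) (hred : Function.Surjective red) (hr₁ : ∀ a, Q.red (ψ₁ a) = red a)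
    (hr₂ : ∀ a, Q.red (ψ₂ a) = red a) (hd : ∀ a, ∃ s, ψ₁ a - ψ₂ a = Q.incl s)
    (hb : ∀ a b, red a = 0 → Q.br (ψ₁ a) (ψ₁ b) = Q.br (ψ₂ a) (ψ₂ b)) :
    ∃ D : Derivation ℤ R (symPow R L (n + 1)), ∀ a, ψ₁ a - ψ₂ a = Q.incl (D (red a)) := by
  choose δ hδ using hd
  have hδ_add : ∀ a b, δ (a + b) = δ a + δ b := fun a b => Q.incl_injective (by
    rw [← hδ, map_add, map_add, map_add, ← hδ, ← hδ]; ring)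
  -- If `a` reduces to zero its brackets with everything agree under both lifts, so `δ a` has zero
  -- bracket with all functions and vanishes. Hence `δ` factors through the reduction.
  have hδ_zero : ∀ a, red a = 0 → δ a = 0 := fun a ha => h.derive_injective n fun g => by
    obtain ⟨b, rfl⟩ := hred g
    have := Q.br_sub a b hr₁ hr₂ (hδ a) (hδ b)
    rw [hb a b ha, sub_self, ha, derive_zero, sub_zero] at this
    rw [Q.inclB_injective (this.symm.trans (map_zero _).symm)]
    exact Subtype.ext (by rw [derive_val]; simp)
  have hδ_eq : ∀ a b, red a = red b → δ a = δ b := fun a b hab => by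
    have h₁ := hδ_add (a - b) b
    rw [hδ_zero (a - b) (by rw [map_sub, hab, sub_self]), sub_add_cancel, zero_add] at h₁
    exact h₁
  have hδ_mul : ∀ a b, δ (a * b) = red a • δ b + red b • δ a := fun a b => Q.incl_injective (by
    rw [← hδ, map_mul, map_mul, map_add, ← hr₁ a, ← hr₂ b, Q.incl_smul, Q.incl_smul, ← hδ, ← hδ]
    ring)
  choose σ hσ using hred
  refine ⟨Derivation.mk' (AddMonoidHom.mk' (fun r => δ (σ r)) fun a b => ?_).toIntLinearMap
    fun a b => ?_, fun a => ?_⟩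
  · rw [← hδ_add]
    exact hδ_eq _ _ (by rw [hσ, map_add, hσ, hσ])
  · change δ (σ (a * b)) = a • δ (σ b) + b • δ (σ a)
    have := hδ_mul (σ a) (σ b)
    rw [hσ, hσ] at this
    rw [← this]
    exact hδ_eq _ _ (by rw [hσ, map_mul, hσ, hσ])
  · rw [hδ]
    exact congrArg Q.incl (hδ_eq _ _ (hσ _).symm)

theorem derivation_closed {D : R → symPow R L (n + 1)} (hred : Function.Surjective red)
    (hr₁ : ∀ a, Q.red (ψ₁ a) = red a) (hr₂ : ∀ a, Q.red (ψ₂ a) = red a)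
    (hD : ∀ a, ψ₁ a - ψ₂ a = Q.incl (D (red a)))
    (hb : ∀ a b, Q.br (ψ₁ a) (ψ₁ b) = Q.br (ψ₂ a) (ψ₂ b)) (r s : R) :
    derive n (D r) s = derive n (D s) r := by
  obtain ⟨a, rfl⟩ := hred r
  obtain ⟨b, rfl⟩ := hred s
  have := Q.br_sub a b hr₁ hr₂ (hD a) (hD b)
  rw [hb, sub_self] at this
  exact sub_eq_zero.1 (Q.inclB_injective (this.symm.trans (map_zero _).symm))

/-- Modification of a lift by a derivation. -/
def shift (ψ : A →+* A') (hr : ∀ a, Q.red (ψ a) = red a)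
    (D : Derivation ℤ R (symPow R L (n + 1))) : A →+* A' where
  toFun a := ψ a + Q.incl (D (red a))
  map_one' := by simp
  map_zero' := by simp
  map_add' a b := by rw [map_add, map_add, map_add, map_add]; ring
  map_mul' a b := by
    rw [map_mul, map_mul, D.leibniz, map_add, ← hr, ← hr, Q.incl_smul, Q.incl_smul]
    linear_combination - Q.incl_mul_incl (D (Q.red (ψ a))) (D (Q.red (ψ b)))

variable {ψ : A →+* A'} (hr : ∀ a, Q.red (ψ a) = red a) (D : Derivation ℤ R (symPow R L (n + 1)))

theorem shift_apply (a : A) : Q.shift ψ hr D a = ψ a + Q.incl (D (red a)) := rfl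

theorem br_shift (hD : ∀ r s, derive n (D r) s = derive n (D s) r) (a b : A) :
    Q.br (Q.shift ψ hr D a) (Q.shift ψ hr D b) = Q.br (ψ a) (ψ b) := by
  have := Q.br_sub (ψ₁ := Q.shift ψ hr D) (ψ₂ := ψ) (red := red) a b
    (fun a => by rw [shift_apply, map_add, Q.red_incl, hr, add_zero]) hr
    (by rw [shift_apply, add_sub_cancel_left]) (by rw [shift_apply, add_sub_cancel_left])
  rw [hD, sub_self, map_zero] at this
  exact sub_eq_zero.1 this

end PoissonStep

/-- This is the Jacobi identity for `s` and two commuting functions; it says that derivations of the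
form `{s, -}` are closed. -/
theorem poisson_fun_comm (s : SymmetricAlgebra R L) (f g : R) :
    poisson R L (poisson R L s (algebraMap R _ f)) (algebraMap R _ g) =
      poisson R L (poisson R L s (algebraMap R _ g)) (algebraMap R _ f) := by
  induction s using SymmetricAlgebra.induction with
  | algebraMap r => simp [poisson_fun_fun]
  | ι x => simp [poisson_vec_fun, poisson_fun_fun]
  | mul a b ha hb =>
    simp only [poisson_mul_left, poisson_add_left, ha, hb]
    ring
  | add a b ha hb => rw [poisson_add_left, poisson_add_left, poisson_add_left, poisson_add_left, ha, hb]

theorem derive_comm (n : ℕ) (s : symPow R L (n + 2)) (f g : R) :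
    derive n (derive (n + 1) s f) g = derive n (derive (n + 1) s g) f :=
  Subtype.ext (poisson_fun_comm s.1 f g)

section Potential

variable [Algebra ℂ R] {N : ℕ}

/-- The potential of a family of elements of `Sym^n`: the element of `Sym^{n+1}` which integrates
closed derivations. -/
def potential (x : Fin N → L) (n : ℕ) : (Fin N → symPow R L n) →+ symPow R L (n + 1) :=
  AddMonoidHom.mk' (fun D => algebraMap ℂ R ((n + 1 : ℕ) : ℂ)⁻¹ •
    ∑ k, ⟨ι R L (x k) * (D k).1, ι_mul_mem_symPow _ (D k).2⟩) fun D E => by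
      rw [← smul_add, ← Finset.sum_add_distrib]
      congr 2
      funext k
      exact Subtype.ext (mul_add _ _ _)

omit [LieRingModule L R] [LieRinehartRing R L] in
theorem potential_val (x : Fin N → L) (n : ℕ) (D : Fin N → symPow R L n) :
    (potential x n D).1 = algebraMap ℂ R ((n + 1 : ℕ) : ℂ)⁻¹ • ∑ k, ι R L (x k) * (D k).1 := by
  change (algebraMap ℂ R ((n + 1 : ℕ) : ℂ)⁻¹ • ∑ k, (⟨ι R L (x k) * (D k).1,
    ι_mul_mem_symPow _ (D k).2⟩ : symPow R L (n + 1))).1 = _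
  rw [Submodule.coe_smul, Submodule.coe_sum]

theorem IsDualBasis.potential_derive {f : Fin N → R} {x : Fin N → L} (h : IsDualBasis R L f x) {n : ℕ}
    (s : symPow R L (n + 1)) : potential x n (fun k => derive n s (f k)) = s := by
  refine Subtype.ext ?_
  rw [potential_val]
  simp only [derive_val]
  rw [h.euler _ s.2, ← Nat.cast_smul_eq_nsmul R, ← mul_smul, ← map_natCast (algebraMap ℂ R), ← map_mul,
    inv_mul_cancel₀ (Nat.cast_ne_zero.2 n.succ_ne_zero), map_one, one_smul]

theorem IsDualBasis.derive_potential {f : Fin N → R} {x : Fin N → L} (h : IsDualBasis R L f x) {n : ℕ}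
    (D : Derivation ℤ R (symPow R L (n + 1))) (hD : ∀ c : ℂ, D (algebraMap ℂ R c) = 0)
    (hc : ∀ r s, derive n (D r) s = derive n (D s) r) (g : R) :
    derive (n + 1) (potential x (n + 1) fun k => D (f k)) g = D g := by
  obtain ⟨s, hs⟩ := h.exists_derive_eq (n + 1) D hD fun a b => congrArg Subtype.val (hc a b)
  have := h.potential_derive s
  simp only [hs] at this
  rw [this, hs]

end Potential

end SymmetricAlgebra

/-! ### Derivations along smooth and étale ring maps. -/

namespace CScheme
section Affine
variable {V : Scheme.{0}}

/-- A smaller affine open set need not be principal, so restriction need not be a localization.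
Being étale suffices for the unique extension of derivations and of lifts. -/
theorem etale_fres {U W : V.affineOpens} (h : W.1 ≤ U.1) : (fres V h).Etale := by
  have := HasRingHomProperty.appLE (P := @Etale) (𝟙 V) inferInstance U W h
  have h₂ : (Scheme.Hom.appLE (𝟙 V) U.1 W.1 h) = V.presheaf.map (homOfLE h).op := by
    exact Category.id_comp _
  rwa [h₂] at this

variable [V.Over specC]

theorem smooth_sections [Smooth (V ↘ specC)] (U : V.affineOpens) : Algebra.Smooth ℂ Γ(V, U.1) := by
  have h₁ := HasRingHomProperty.appLE (P := @Smooth) (V ↘ specC) inferInstance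
    ⟨⊤, isAffineOpen_top _⟩ U le_top
  have h₂ : (algebraMap ℂ Γ(V, U.1)) = ((V ↘ specC).appLE ⊤ U.1 le_top).hom.comp
    (Scheme.ΓSpecIso (CommRingCat.of ℂ)).inv.hom := rfl
  have h₃ : (algebraMap ℂ Γ(V, U.1)).Smooth := by
    rw [h₂]
    refine RingHom.Smooth.comp ?_ h₁
    have hb : Function.Bijective (Scheme.ΓSpecIso (CommRingCat.of ℂ)).inv.hom :=
      ConcreteCategory.bijective_of_isIso (Scheme.ΓSpecIso (CommRingCat.of ℂ)).inv
    exact RingHom.smooth_def.2 ⟨.of_bijective hb, RingHom.FinitePresentation.of_bijective hb⟩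
  exact (RingHom.smooth_algebraMap).1 h₃
end Affine
end CScheme

section Ring

variable {R : Type} [CommRing R]

/-- A derivation over `ℤ` killing constants is a derivation over `ℂ`. -/
theorem exists_complex_derivation [Algebra ℂ R] {M : Type} [AddCommGroup M] [Module R M]
    (D : Derivation ℤ R M) (hD : ∀ c : ℂ, D (algebraMap ℂ R c) = 0) :
    letI : Module ℂ M := Module.compHom M (algebraMap ℂ R)
    ∃ D' : Derivation ℂ R M, ∀ g, D' g = D g := by
  let _ : Module ℂ M := Module.compHom M (algebraMap ℂ R)
  refine ⟨Derivation.mk' { toFun := D, map_add' := map_add D, map_smul' := fun c r => ?_ } D.leibniz,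
    fun g => rfl⟩
  rw [Algebra.smul_def, D.leibniz, hD, smul_zero, add_zero]
  rfl

/-- A smooth algebra has a dual basis of functions and derivations. -/
theorem exists_dualBasis_derivations [Algebra ℂ R] [Algebra.Smooth ℂ R] :
    ∃ (N : ℕ) (f : Fin N → R) (x : Fin N → Derivation ℂ R R),
      ∀ (M : Type) [AddCommGroup M] [Module R M] (D : Derivation ℤ R M),
        (∀ c : ℂ, D (algebraMap ℂ R c) = 0) → ∀ g, D g = ∑ k, x k g • D (f k) := by
  have hfin : (⊤ : Submodule R (Ω[R⁄ℂ])).FG := Module.Finite.fg_top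
  rw [← KaehlerDifferential.span_range_derivation,
    Submodule.fg_span_iff_fg_span_finset_subset] at hfin
  obtain ⟨s, hs, hs'⟩ := hfin
  have h₁ : ∀ i : Fin s.card, ∃ r, KaehlerDifferential.D ℂ R r = (s.equivFin.symm i).1 := fun i =>
    hs (s.equivFin.symm i).2
  choose f hf using h₁
  let π : (Fin s.card → R) →ₗ[R] Ω[R⁄ℂ] := Fintype.linearCombination R fun i =>
    KaehlerDifferential.D ℂ R (f i)
  have hπ : Function.Surjective π := by
    rw [← LinearMap.range_eq_top, Fintype.range_linearCombination, eq_top_iff,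
      ← KaehlerDifferential.span_range_derivation, hs', Submodule.span_le]
    intro m hm
    exact Submodule.subset_span ⟨s.equivFin ⟨m, hm⟩, (hf _).trans (by rw [Equiv.symm_apply_apply])⟩
  -- The differentials are generated by finitely many `d (f k)` and are projective. The coordinates
  -- of a section `τ` of this presentation are the derivations `x k`.
  obtain ⟨τ, hτ⟩ := Module.projective_lifting_property π LinearMap.id hπ
  refine ⟨s.card, f, fun k => ((LinearMap.proj k).comp τ).compDer (KaehlerDifferential.D ℂ R),
    fun M _ _ D hD g => ?_⟩
  let _ : Module ℂ M := Module.compHom M (algebraMap ℂ R)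
  have _ : IsScalarTower ℂ R M := ⟨fun c r m => by
    rw [Algebra.smul_def, mul_smul]; rfl⟩
  obtain ⟨D', hD'⟩ := exists_complex_derivation D hD
  have h₂ : KaehlerDifferential.D ℂ R g = ∑ k, τ (KaehlerDifferential.D ℂ R g) k •
      KaehlerDifferential.D ℂ R (f k) := by
    conv_lhs => rw [← LinearMap.id_apply (R := R) (KaehlerDifferential.D ℂ R g), ← hτ]
    rfl
  have h₃ := congrArg D'.liftKaehlerDifferential h₂
  rw [map_sum] at h₃
  simp only [map_smul, Derivation.liftKaehlerDifferential_comp_D, hD'] at h₃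
  exact h₃

variable {R' : Type} [CommRing R'] [Algebra R R']

/-- Derivations on an unramified extension are determined by their restriction. -/
theorem Derivation.eq_of_formallyUnramified [Algebra.FormallyUnramified R R'] {M : Type}
    [AddCommGroup M] [Module R' M] {D E : Derivation ℤ R' M}
    (h : ∀ r, D (algebraMap R R' r) = E (algebraMap R R' r)) : D = E := by
  let _ : Module R M := Module.compHom M (algebraMap R R')
  have _ : IsScalarTower R R' M := ⟨fun c r m => by
    rw [Algebra.smul_def, mul_smul]; rfl⟩
  let F : Derivation R R' M := Derivation.mk'
    { toFun := D - E, map_add' := map_add (D - E), map_smul' := fun r a => by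
        change (D - E) (r • a) = algebraMap R R' r • (D - E) a
        rw [Algebra.smul_def, (D - E).leibniz, show (D - E) (algebraMap R R' r) = 0 from sub_eq_zero.2 (h r),
          smul_zero, add_zero] } (D - E).leibniz
  have hF : F = 0 := by
    rw [← F.liftKaehlerDifferential_comp, Subsingleton.elim F.liftKaehlerDifferential 0]
    ext; simp
  ext a
  exact sub_eq_zero.1 (DFunLike.congr_fun hF a)

/-- Derivations extend to étale extensions. -/
theorem exists_derivation_of_formallyEtale [Algebra.FormallyEtale R R'] (D : Derivation ℤ R R) :
    ∃ D' : Derivation ℤ R' R', ∀ r, D' (algebraMap R R' r) = algebraMap R R' (D r) := by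
  -- The map `r ↦ r + ε D r` makes the dual numbers over `R'` an `R`-algebra. A lift of the identity
  -- of `R'` to them has the extended derivation as its second component.
  let φ : R →+* TrivSqZeroExt R' R' :=
    { toFun := fun r => (algebraMap R R' r, algebraMap R R' (D r))
      map_one' := TrivSqZeroExt.ext (map_one _) (by
        change algebraMap R R' (D 1) = 0
        rw [D.map_one_eq_zero, map_zero])
      map_zero' := TrivSqZeroExt.ext (map_zero _) (by
        change algebraMap R R' (D 0) = 0
        rw [map_zero, map_zero])
      map_add' := fun a b => TrivSqZeroExt.ext (map_add _ _ _) (by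
        change algebraMap R R' (D (a + b)) = algebraMap R R' (D a) + algebraMap R R' (D b)
        rw [map_add, map_add])
      map_mul' := fun a b => TrivSqZeroExt.ext (map_mul _ _ _) (by
        change algebraMap R R' (D (a * b)) = algebraMap R R' a * algebraMap R R' (D b) +
          algebraMap R R' (D a) * algebraMap R R' b
        rw [D.leibniz, smul_eq_mul, smul_eq_mul, map_add, map_mul, map_mul]
        ring) }
  let _ : Algebra R (TrivSqZeroExt R' R') := φ.toAlgebra
  let p : TrivSqZeroExt R' R' →ₐ[R] R' :=
    { TrivSqZeroExt.fstHom R' R' R' with commutes' := fun _ => rfl }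
  have hp : Function.Surjective p := fun r => ⟨(r, 0), rfl⟩
  have hn : IsNilpotent (RingHom.ker (p : TrivSqZeroExt R' R' →+* R')) := by
    refine ⟨2, ?_⟩
    have h₀ : RingHom.ker (p : TrivSqZeroExt R' R' →+* R') *
        RingHom.ker (p : TrivSqZeroExt R' R' →+* R') ≤ ⊥ := by
      rw [Ideal.mul_le]
      intro a ha b hb
      have ha' : a.fst = 0 := ha
      have hb' : b.fst = 0 := hb
      refine TrivSqZeroExt.ext ?_ ?_
      · rw [TrivSqZeroExt.fst_mul, ha', zero_mul]; rfl
      · rw [TrivSqZeroExt.snd_mul, ha', hb']; simp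
    have h₁ : RingHom.ker (p : TrivSqZeroExt R' R' →+* R') ^ 2 ≤ ⊥ := by
      rw [pow_two]
      exact h₀
    exact le_bot_iff.1 h₁
  let σ := Algebra.FormallySmooth.liftOfSurjective (AlgHom.id R R') p hp hn
  have hσ : ∀ r, (σ r).fst = r := fun r =>
    Algebra.FormallySmooth.liftOfSurjective_apply (AlgHom.id R R') p hp hn r
  refine ⟨Derivation.mk' (AddMonoidHom.mk' (fun r => (σ r).snd) fun a b => ?_).toIntLinearMap
    fun a b => ?_, fun r => ?_⟩
  · rw [map_add, TrivSqZeroExt.snd_add]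
  · change (σ (a * b)).snd = a • (σ b).snd + b • (σ a).snd
    rw [map_mul, TrivSqZeroExt.snd_mul, hσ, hσ]
    simp [mul_comm]
  · change (σ (algebraMap R R' r)).snd = _
    rw [AlgHom.commutes]
    rfl

end Ring

/-! ### Vector fields and dual bases on affine open sets. -/

namespace CScheme

section Sections
variable {V : Scheme.{0}} (A : TopCat.Sheaf CommRingCat.{0} V)

theorem rs_rs {U W W' : V.Opens} (h : W ≤ U) (h' : W' ≤ W) (s : A.obj.obj (op U)) :
    rs A h' (rs A h s) = rs A (h'.trans h) s := by
  have : (homOfLE (h'.trans h)).op = (homOfLE h).op ≫ (homOfLE h').op := rfl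
  simp only [rs, this, Functor.map_comp, CommRingCat.hom_comp, RingHom.comp_apply]

theorem rs_refl {U : V.Opens} (s : A.obj.obj (op U)) : rs A (le_refl U) s = s := by
  simp [rs]

theorem rs_app {A B : TopCat.Sheaf CommRingCat.{0} V} (f : A ⟶ B) {U W : V.Opens} (h : W ≤ U)
    (s : A.obj.obj (op U)) : rs B h (onSec f U s) = onSec f W (rs A h s) :=
  (congrArg (fun g => g.hom s) (f.hom.naturality (homOfLE h).op)).symm

theorem exists_affine_le {U : V.Opens} {x : V} (hx : x ∈ U) :
    ∃ W : V.affineOpens, W.1 ≤ U ∧ x ∈ W.1 := by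
  obtain ⟨W, hW, hx, h⟩ := Opens.isBasis_iff_nbhd.1 V.isBasis_affineOpens hx
  exact ⟨⟨W, hW⟩, h, hx⟩

theorem rs_ext {U : V.Opens} {s t : A.obj.obj (op U)}
    (h : ∀ x ∈ U, ∃ (W : V.Opens) (h : W ≤ U), x ∈ W ∧ rs A h s = rs A h t) : s = t := by
  choose W hW hx hs using h
  refine TopCat.Sheaf.eq_of_locally_eq' (C := CommRingCat.{0}) (X := V) A
    (fun x : U => W x.1 x.2) U (fun x => homOfLE (hW x.1 x.2)) ?_ s t (fun x => hs x.1 x.2)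
  intro x hxU
  exact Opens.mem_iSup.2 ⟨⟨x, hxU⟩, hx x hxU⟩

theorem rs_ext_affine {U : V.Opens} {s t : A.obj.obj (op U)}
    (h : ∀ (W : V.affineOpens) (h : W.1 ≤ U), rs A h s = rs A h t) : s = t :=
  rs_ext A fun x hx => by
    obtain ⟨W, hW, hx⟩ := exists_affine_le hx
    exact ⟨W, hW, hx, h W hW⟩

theorem rs_glue {ι : Type} {U : V.Opens} (W : ι → V.Opens) (hW : ∀ i, W i ≤ U)
    (hc : ∀ x ∈ U, ∃ i, x ∈ W i) (s : ∀ i, A.obj.obj (op (W i)))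
    (h : ∀ i j (W' : V.affineOpens) (hi : W'.1 ≤ W i) (hj : W'.1 ≤ W j),
      rs A hi (s i) = rs A hj (s j)) :
    ∃ t, ∀ i, rs A (hW i) t = s i := by
  obtain ⟨t, ht, _⟩ := TopCat.Sheaf.existsUnique_gluing' (C := CommRingCat.{0}) (X := V) A
    W U (fun i => homOfLE (hW i)) (fun x hx => Opens.mem_iSup.2 (hc x hx)) s (fun i j => by
      refine rs_ext_affine A fun W' hW' => ?_
      exact (rs_rs A _ hW' (s i)).trans ((h i j W' (hW'.trans inf_le_left) (hW'.trans inf_le_right)).trans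
        (rs_rs A _ hW' (s j)).symm))
  exact ⟨t, ht⟩

end Sections

section Vector
variable {V : Scheme.{0}} [V.Over specC]

theorem fres_algebraMap {U W : V.Opens} (h : W ≤ U) (c : ℂ) :
    fres V h (algebraMap ℂ _ c) = algebraMap ℂ _ c :=
  fres_fres V le_top h _

omit [V.Over specC] in
theorem derivation_ext_fres {U W : V.affineOpens} (h : W.1 ≤ U.1) {M : Type} [AddCommGroup M]
    [Module Γ(V, W.1) M] {D E : Derivation ℤ Γ(V, W.1) M}
    (hDE : ∀ f, D (fres V h f) = E (fres V h f)) : D = E := by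
  let _ : Algebra Γ(V, U.1) Γ(V, W.1) := (fres V h).toAlgebra
  have : Algebra.Etale Γ(V, U.1) Γ(V, W.1) := etale_fres h
  exact Derivation.eq_of_formallyUnramified hDE

/-- The action of a vector field on functions, as a derivation over `ℤ`. -/
def TX.der {U : V.Opens} (D : TX V U) (W : V.Opens) (h : W ≤ U) : Derivation ℤ Γ(V, W) Γ(V, W) :=
  (D.at W h).restrictScalars ℤ

theorem TX.at_fres {U : V.Opens} (D : TX V U) {W W' : V.Opens} (h : W ≤ U) (h' : W' ≤ W) (f : Γ(V, W)) :
    D.at W' (h'.trans h) (fres V h' f) = fres V h' (D.at W h f) := D.2 ⟨W, h⟩ ⟨W', h'.trans h⟩ h' f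

/-- A derivation on an étale extension is determined by its restriction, so the action on functions
on `U` determines the action on every smaller affine open set, and on all open sets by the sheaf
property. -/
theorem TX.ext_affine {U : V.affineOpens} {D E : TX V U.1} (h : ∀ f : Γ(V, U.1), ⁅D, f⁆ = ⁅E, f⁆) :
    D = E := by
  refine TX.ext fun W hW f => ?_
  refine rs_ext_affine V.sheaf fun W' hW' => ?_
  refine (D.at_fres hW hW' f).symm.trans (Eq.trans ?_ (E.at_fres hW hW' f))
  have : D.der W'.1 (hW'.trans hW) = E.der W'.1 (hW'.trans hW) := derivation_ext_fres (hW'.trans hW)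
    fun g => by
      refine (D.at_fres le_rfl (hW'.trans hW) g).trans (Eq.trans ?_
        (E.at_fres le_rfl (hW'.trans hW) g).symm)
      exact congrArg _ (h g)
  exact DFunLike.congr_fun this _

/-- Derivations of the functions on an affine open set are vector fields. -/
theorem TX.exists_of_derivation {U : V.affineOpens} (δ : Derivation ℂ Γ(V, U.1) Γ(V, U.1)) :
    ∃ D : TX V U.1, ∀ f : Γ(V, U.1), ⁅D, f⁆ = δ f := by
  have h₁ : ∀ (W : V.affineOpens) (h : W.1 ≤ U.1), ∃ D : Derivation ℤ Γ(V, W.1) Γ(V, W.1),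
      ∀ f, D (fres V h f) = fres V h (δ f) := fun W h => by
    let _ : Algebra Γ(V, U.1) Γ(V, W.1) := (fres V h).toAlgebra
    have : Algebra.Etale Γ(V, U.1) Γ(V, W.1) := etale_fres h
    exact exists_derivation_of_formallyEtale (δ.restrictScalars ℤ)
  choose D hD using h₁
  -- The extensions were chosen separately on each affine open set. Compatibility follows since both
  -- composites extend the same derivation on `U`; on other open sets the values are then glued.
  have hres : ∀ (W W' : V.affineOpens) (h : W.1 ≤ U.1) (h' : W'.1 ≤ W.1) (f : Γ(V, W.1)),
      D W' (h'.trans h) (fres V h' f) = fres V h' (D W h f) := by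
    intro W W' h h'
    let _ : Module Γ(V, W.1) Γ(V, W'.1) := Module.compHom _ (fres V h')
    have : (Derivation.mk' ((D W' (h'.trans h) : Γ(V, W'.1) →ₗ[ℤ] Γ(V, W'.1)).toAddMonoidHom.comp
        (fres V h').toAddMonoidHom).toIntLinearMap fun a b => by
          change D W' (h'.trans h) (fres V h' (a * b)) = fres V h' a • D W' (h'.trans h) (fres V h' b) +
            fres V h' b • D W' (h'.trans h) (fres V h' a)
          rw [map_mul, Derivation.leibniz] : Derivation ℤ Γ(V, W.1) Γ(V, W'.1)) =
       (Derivation.mk' ((fres V h').toAddMonoidHom.comp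
        (D W h : Γ(V, W.1) →ₗ[ℤ] Γ(V, W.1)).toAddMonoidHom).toIntLinearMap fun a b => by
          change fres V h' (D W h (a * b)) = fres V h' a • fres V h' (D W h b) + fres V h' b • fres V h' (D W h a)
          rw [Derivation.leibniz, map_add, smul_eq_mul, smul_eq_mul, map_mul, map_mul]
          rfl) := derivation_ext_fres h fun g => by
        change D W' _ (fres V h' (fres V h g)) = fres V h' (D W h (fres V h g))
        rw [fres_fres, hD, hD, fres_fres]
    exact fun f => DFunLike.congr_fun this f
  have h₂ : ∀ (W : V.Opens) (h : W ≤ U.1) (f : Γ(V, W)), ∃ g : Γ(V, W), ∀ (W' : V.affineOpens)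
      (h' : W'.1 ≤ W), fres V h' g = D W' (h'.trans h) (fres V h' f) := by
    intro W h f
    obtain ⟨g, hg⟩ := rs_glue V.sheaf (U := W) (fun W' : {W' : V.affineOpens // W'.1 ≤ W} => W'.1.1)
      (fun W' => W'.2) (fun x hx => by
        obtain ⟨W', h', hx'⟩ := exists_affine_le hx
        exact ⟨⟨W', h'⟩, hx'⟩) (fun W' => D W'.1 (W'.2.trans h) (fres V W'.2 f))
      (fun i j W' hi hj => by
        refine (hres i.1 W' _ hi _).symm.trans (Eq.trans ?_ (hres j.1 W' _ hj _))
        rw [fres_fres, fres_fres])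
    exact ⟨g, fun W' h' => hg ⟨W', h'⟩⟩
  choose g hg using h₂
  have hext : ∀ (W : V.Opens) (a b : Γ(V, W)), (∀ (W' : V.affineOpens) (h : W'.1 ≤ W),
      fres V h a = fres V h b) → a = b := fun W a b hab => rs_ext_affine V.sheaf hab
  refine ⟨⟨fun W => Derivation.mk' ⟨⟨g W.1 W.2, fun a b => ?_⟩, fun c a => ?_⟩ fun a b => ?_,
    fun W W' h f => ?_⟩, fun f => ?_⟩
  · refine hext _ _ _ fun W' h' => ?_
    rw [map_add, hg, hg, hg, map_add, map_add]
  · refine hext _ _ _ fun W' h' => ?_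
    have hc : D W' (h'.trans W.2) (algebraMap ℂ _ c) = 0 := by
      rw [← fres_algebraMap (h'.trans W.2), hD, δ.map_algebraMap, map_zero]
    rw [RingHom.id_apply, Algebra.smul_def, Algebra.smul_def, map_mul, hg, hg, map_mul,
      Derivation.leibniz, fres_algebraMap, hc, smul_zero, add_zero, smul_eq_mul]
  · refine hext _ _ _ fun W' h' => ?_
    change fres V h' (g W.1 W.2 (a * b)) = fres V h' (a • g W.1 W.2 b + b • g W.1 W.2 a)
    rw [map_add, smul_eq_mul, smul_eq_mul, map_mul, map_mul, hg, hg, hg, map_mul, Derivation.leibniz]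
    rfl
  · refine hext _ _ _ fun W'' h' => ?_
    change fres V h' (g W'.1 W'.2 (fres V h f)) = fres V h' (fres V h (g W.1 W.2 f))
    rw [hg, fres_fres, fres_fres, hg]
  · change g U.1 le_rfl f = δ f
    have := hg U.1 le_rfl f U le_rfl
    rw [fres_refl] at this
    rw [this, hD, fres_refl]

theorem TX.res_lie {U W : V.Opens} (h : W ≤ U) (D : TX V U) (f : Γ(V, U)) :
    ⁅TX.res h D, fres V h f⁆ = fres V h ⁅D, f⁆ := D.at_fres le_rfl h f

/-- Smooth affine varieties have dual bases. -/
theorem exists_isDualBasis [Smooth (V ↘ specC)] (U : V.affineOpens) :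
    ∃ (N : ℕ) (f : Fin N → Γ(V, U.1)) (x : Fin N → TX V U.1),
      SymmetricAlgebra.IsDualBasis Γ(V, U.1) (TX V U.1) f x := by
  have := smooth_sections U
  obtain ⟨N, f, δ, h⟩ := exists_dualBasis_derivations (R := Γ(V, U.1))
  choose x hx using fun k => TX.exists_of_derivation (δ k)
  have hder : ∀ (M : Type) [AddCommGroup M] [Module Γ(V, U.1) M] (D : Derivation ℤ Γ(V, U.1) M),
    (∀ c : ℂ, D (algebraMap ℂ _ c) = 0) → ∀ g, D g = ∑ k, ⁅x k, g⁆ • D (f k) := by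
    intro M _ _ D hD g
    simp only [hx]
    exact h M D hD g
  have hc : ∀ (y : TX V U.1) (c : ℂ), ⁅y, algebraMap ℂ Γ(V, U.1) c⁆ = 0 := fun y c =>
    (y.at U.1 le_rfl).map_algebraMap c
  refine ⟨N, f, x, hc, hder, fun y => TX.ext_affine fun g => ?_⟩
  have h₁ := hder _ (y.der U.1 le_rfl) (hc y) g
  refine h₁.trans ?_
  have h₂ : ∀ (I : Finset (Fin N)), ⁅∑ k ∈ I, ⁅y, f k⁆ • x k, g⁆ = ∑ k ∈ I, ⁅x k, g⁆ • ⁅y, f k⁆ := by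
    intro I
    induction I using Finset.induction_on with
    | empty => simp
    | insert a I ha ih =>
      rw [Finset.sum_insert ha, Finset.sum_insert ha, add_lie, ih, LieRinehartRing.lie_smul_eq_mul,
        smul_eq_mul, mul_comm]
  exact (h₂ _).symm

/-- Dual bases restrict to smaller affine open sets. -/
theorem isDualBasis_res {U W : V.affineOpens} (h : W.1 ≤ U.1) {N : ℕ} {f : Fin N → Γ(V, U.1)}
    {x : Fin N → TX V U.1} (hfx : SymmetricAlgebra.IsDualBasis Γ(V, U.1) (TX V U.1) f x) :
    SymmetricAlgebra.IsDualBasis Γ(V, W.1) (TX V W.1) (fun k => fres V h (f k))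
      (fun k => TX.res h (x k)) := by
  have hder : ∀ (M : Type) [AddCommGroup M] [Module Γ(V, W.1) M] (D : Derivation ℤ Γ(V, W.1) M),
      (∀ c : ℂ, D (algebraMap ℂ _ c) = 0) → ∀ g, D g = ∑ k, ⁅TX.res h (x k), g⁆ • D (fres V h (f k)) := by
    intro M _ _ D hD
    let _ : Module Γ(V, U.1) M := Module.compHom M (fres V h)
    let E : Derivation ℤ Γ(V, W.1) M := ∑ k, (LinearMap.toSpanSingleton Γ(V, W.1) M
      (D (fres V h (f k)))).compDer ((TX.res h (x k)).der W.1 le_rfl)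
    have hE : ∀ g, E g = ∑ k, ⁅TX.res h (x k), g⁆ • D (fres V h (f k)) := fun g => by
      simp only [E]
      rw [← Derivation.coeFnAddMonoidHom_apply, map_sum, Finset.sum_apply]
      rfl
    have : D = E := derivation_ext_fres h fun g => by
      rw [hE]
      simp only [TX.res_lie]
      exact hfx.der M (Derivation.mk' ((D : Γ(V, W.1) →ₗ[ℤ] M).toAddMonoidHom.comp
        (fres V h).toAddMonoidHom).toIntLinearMap fun a b => by
          change D (fres V h (a * b)) = fres V h a • D (fres V h b) + fres V h b • D (fres V h a)
          rw [map_mul, Derivation.leibniz]) (fun c => by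
            change D (fres V h (algebraMap ℂ _ c)) = 0
            rw [fres_algebraMap, hD]) g
    exact fun g => (DFunLike.congr_fun this g).trans (hE g)
  have hc : ∀ (y : TX V W.1) (c : ℂ), ⁅y, algebraMap ℂ Γ(V, W.1) c⁆ = 0 := fun y c =>
    (y.at W.1 le_rfl).map_algebraMap c
  refine ⟨hc, hder, fun y => TX.ext_affine fun g => ?_⟩
  have h₁ := hder _ (y.der W.1 le_rfl) (hc y) g
  refine h₁.trans ?_
  have h₂ : ∀ (I : Finset (Fin N)), ⁅∑ k ∈ I, ⁅y, fres V h (f k)⁆ • TX.res h (x k), g⁆ =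
      ∑ k ∈ I, ⁅TX.res h (x k), g⁆ • ⁅y, fres V h (f k)⁆ := by
    intro I
    induction I using Finset.induction_on with
    | empty => simp
    | insert a I ha ih =>
      rw [Finset.sum_insert ha, Finset.sum_insert ha, add_lie, ih, LieRinehartRing.lie_smul_eq_mul,
        smul_eq_mul, mul_comm]
  exact (h₂ _).symm

end Vector
end CScheme

/-! ### Potentials of tensors and their naturality. -/

namespace SymmetricAlgebra

section Potential
variable {R L : Type} [CommRing R] [LieRing L] [Module R L] [LieRingModule L R]
  [LieRinehartRing R L]

theorem derive_smul (n : ℕ) (r : R) (s : symPow R L (n + 1)) (f : R) :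
    derive n (r • s) f = r • derive n s f := Subtype.ext (by
  rw [derive_val, Submodule.coe_smul, Submodule.coe_smul, derive_val, Algebra.smul_def, poisson_mul_left,
    poisson_fun_fun, mul_zero, add_zero, Algebra.smul_def])

theorem tensorDer_add (n : ℕ) (t t' : L ⊗[R] symPow R L n) (f : R) :
    tensorDer n (t + t') f = tensorDer n t f + tensorDer n t' f := map_add _ _ _

theorem tensorDer_zero (n : ℕ) (f : R) :
    tensorDer n (0 : L ⊗[R] symPow R L n) f = 0 := map_zero _

theorem tensorDer_neg (n : ℕ) (t : L ⊗[R] symPow R L n) (f : R) :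
    tensorDer n (-t) f = -tensorDer n t f := map_neg _ _

variable [Algebra ℂ R] {N : ℕ}

variable (R L) in
/-- The multiplication `L ⊗ Sym^n L → Sym^{n+1} L`, divided by `n + 1`. -/
def tensorPotential (n : ℕ) : (L ⊗[R] symPow R L n) →ₗ[R] symPow R L (n + 1) :=
  algebraMap ℂ R ((n + 1 : ℕ) : ℂ)⁻¹ • TensorProduct.lift
    (LinearMap.mk₂ R (fun (x : L) (s : symPow R L n) =>
      (⟨ι R L x * s.1, ι_mul_mem_symPow _ s.2⟩ : symPow R L (n + 1)))
      (fun x y s => Subtype.ext (by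
        change ι R L (x + y) * s.1 = ι R L x * s.1 + ι R L y * s.1
        rw [map_add, add_mul]))
      (fun r x s => Subtype.ext (by
        change ι R L (r • x) * s.1 = r • (ι R L x * s.1)
        rw [map_smul, smul_mul_assoc]))
      (fun x s t => Subtype.ext (mul_add _ _ _))
      (fun r x s => Subtype.ext (mul_smul_comm _ _ _)))

omit [LieRingModule L R] [LieRinehartRing R L] in
theorem tensorPotential_tmul (n : ℕ) (x : L) (s : symPow R L n) :
    tensorPotential R L n (x ⊗ₜ s) = algebraMap ℂ R ((n + 1 : ℕ) : ℂ)⁻¹ •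
      (⟨ι R L x * s.1, ι_mul_mem_symPow _ s.2⟩ : symPow R L (n + 1)) := rfl

theorem IsDualBasis.tensorPotential_eq {f : Fin N → R} {x : Fin N → L} (h : IsDualBasis R L f x) {n : ℕ}
    (t : L ⊗[R] symPow R L n) :
    tensorPotential R L n t = potential x n fun k => tensorDer n t (f k) := by
  conv_lhs => rw [h.tensor_eq_sum n t]
  rw [map_sum]
  simp only [tensorPotential_tmul]
  rw [← Finset.smul_sum]
  rfl

/-- Divided multiplication is defined on all tensors and is natural, without a choice of dual basis.
On the tensors of closed derivations it coincides with the homotopy of the first Poincaré lemma,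
hence inverts `s ↦ {s, -}`. -/
theorem IsDualBasis.derive_tensorPotential {f : Fin N → R} {x : Fin N → L} (h : IsDualBasis R L f x)
    {n : ℕ} (D : Derivation ℤ R (symPow R L (n + 1))) (hD : ∀ c : ℂ, D (algebraMap ℂ R c) = 0)
    (hc : ∀ r s, derive n (D r) s = derive n (D s) r) {t : L ⊗[R] symPow R L (n + 1)}
    (ht : ∀ g, tensorDer (n + 1) t g = D g) (g : R) :
    derive (n + 1) (tensorPotential R L (n + 1) t) g = D g := by
  rw [h.tensorPotential_eq]
  simp only [ht]
  exact h.derive_potential D hD hc g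

/-- The derivation `f ↦ {s, f}`. -/
def deriveDer (n : ℕ) (s : symPow R L (n + 1)) : Derivation ℤ R (symPow R L n) :=
  Derivation.mk' (AddMonoidHom.mk' (fun f => derive n s f) fun f g => Subtype.ext (by
    rw [derive_val, map_add, map_add]; rfl)).toIntLinearMap fun f g => Subtype.ext (by
      change poisson R L s.1 (algebraMap R _ (f * g)) =
        f • poisson R L s.1 (algebraMap R _ g) + g • poisson R L s.1 (algebraMap R _ f)
      rw [map_mul, poisson_mul_right, Algebra.smul_def, Algebra.smul_def])

end Potential

section Natural

variable {R L R' L' : Type} [CommRing R] [LieRing L] [Module R L] [LieRingModule L R]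
  [LieRinehartRing R L] [CommRing R'] [LieRing L'] [Module R' L'] [LieRingModule L' R']
  [LieRinehartRing R' L'] {φ : R →+* R'} {l : L →ₛₗ[φ] L'}

theorem mapSemi_poisson_fun (hl : ∀ y r, ⁅l y, φ r⁆ = φ ⁅y, r⁆) (s : SymmetricAlgebra R L) (g : R) :
    mapSemi φ l (poisson R L s (algebraMap R _ g)) =
      poisson R' L' (mapSemi φ l s) (algebraMap R' _ (φ g)) := by
  induction s using SymmetricAlgebra.induction with
  | algebraMap r => rw [poisson_fun_fun, mapSemi_algebraMap, poisson_fun_fun, map_zero]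
  | ι y => rw [poisson_vec_fun, mapSemi_ι, poisson_vec_fun, mapSemi_algebraMap, hl]
  | mul a b ha hb => rw [poisson_mul_left, map_mul, poisson_mul_left, map_add, map_mul, map_mul, ha, hb]
  | add a b ha hb => rw [poisson_add_left, map_add, map_add, poisson_add_left, ha, hb]

theorem powSemi_derive (hl : ∀ y r, ⁅l y, φ r⁆ = φ ⁅y, r⁆) (n : ℕ) (s : symPow R L (n + 1)) (g : R) :
    powSemi φ l n (derive n s g) = derive n (powSemi φ l (n + 1) s) (φ g) :=
  Subtype.ext (mapSemi_poisson_fun hl s.1 g)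

theorem powSemi_tensorDer (hl : ∀ y r, ⁅l y, φ r⁆ = φ ⁅y, r⁆) (n : ℕ) (t : L ⊗[R] symPow R L n) (g : R) :
    powSemi φ l n (tensorDer n t g) = tensorDer n (tensorSemi φ l n t) (φ g) := by
  induction t using TensorProduct.induction_on with
  | zero => rw [tensorDer_zero, map_zero, map_zero, tensorDer_zero]
  | tmul x s =>
    rw [tensorSemi_tmul, IsDualBasis.tensorDer_tmul, IsDualBasis.tensorDer_tmul, map_smulₛₗ, hl]
  | add a b ha hb => rw [tensorDer_add, map_add, map_add, tensorDer_add, ha, hb]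

variable [Algebra ℂ R] [Algebra ℂ R']

omit [LieRingModule L R] [LieRinehartRing R L] [LieRingModule L' R'] [LieRinehartRing R' L'] in
theorem powSemi_tensorPotential (hc : ∀ c : ℂ, φ (algebraMap ℂ R c) = algebraMap ℂ R' c) (n : ℕ)
    (t : L ⊗[R] symPow R L n) :
    powSemi φ l (n + 1) (tensorPotential R L n t) = tensorPotential R' L' n (tensorSemi φ l n t) := by
  induction t using TensorProduct.induction_on with
  | zero => rw [map_zero, map_zero, map_zero, map_zero]
  | tmul x s =>
    rw [tensorSemi_tmul, tensorPotential_tmul, tensorPotential_tmul, map_smulₛₗ, hc]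
    congr 1
    refine Subtype.ext ?_
    change mapSemi φ l (ι R L x * s.1) = ι R' L' (l x) * mapSemi φ l s.1
    rw [map_mul, mapSemi_ι]
  | add a b ha hb => rw [map_add, map_add, map_add, map_add, ha, hb]

omit [LieRingModule L R] [LieRinehartRing R L] [LieRingModule L' R'] [LieRinehartRing R' L'] in
theorem powSemi_potential (hc : ∀ c : ℂ, φ (algebraMap ℂ R c) = algebraMap ℂ R' c) (n : ℕ) {N : ℕ}
    (x : Fin N → L) (D : Fin N → symPow R L n) :
    powSemi φ l (n + 1) (potential x n D) = potential (fun k => l (x k)) n fun k => powSemi φ l n (D k) := by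
  refine Subtype.ext ?_
  change mapSemi φ l (potential x n D).1 = _
  rw [potential_val, potential_val, mapSemi_smul, hc, map_sum]
  simp only [map_mul, mapSemi_ι]
  rfl

end Natural

/-! ### Restriction of Poisson lifts along étale maps. -/

namespace PoissonExt

variable {R L : Type} [CommRing R] [LieRing L] [Module R L] [LieRingModule L R]
  [LieRinehartRing R L] [Algebra ℂ R] {n : ℕ} {A : Type} [CommRing A] (E : PoissonExt R L n A)

/-- The underlying square-zero extension of `R`-algebras with bracket. -/
def toStep {N : ℕ} {f : Fin N → R} {x : Fin N → L} (h : IsDualBasis R L f x) :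
    PoissonStep R L n A (SymmetricAlgebra R L ⧸ augIdeal R L ^ (n + 1)) where
  red := (zeroJet R L n).comp E.p
  incl := E.incl
  inclB := (Ideal.Quotient.mk (augIdeal R L ^ (n + 1))).toAddMonoidHom.comp
    (symPow R L n).toAddSubgroup.subtype
  br := E.br
  incl_injective := E.incl_injective
  inclB_injective := fun s t hst => Subtype.ext (mk_symPow_injective h s.2 t.2 hst)
  red_incl := fun s => by rw [RingHom.comp_apply, E.p_incl, map_zero]
  incl_smul := E.incl_smul
  br_skew := E.br_skew
  br_incl := E.br_incl

/-- A lift of the cotangent bundle preserving brackets. -/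
structure IsPoissonLift (β : SymmetricAlgebra R L →+* A) : Prop where
  const : ∀ c, β (algebraMap R _ (algebraMap ℂ R c)) = E.const c
  proj : ∀ s, E.p (β s) = Ideal.Quotient.mk _ s
  incl : ∀ s : symPow R L (n + 1), β s = E.incl s
  br : ∀ s t, E.br (β s) (β t) = Ideal.Quotient.mk _ (poisson R L s t)

theorem exists_isPoissonLift [Algebra.FormallySmooth ℂ R] {N : ℕ} {f : Fin N → R} {x : Fin N → L}
    (h : IsDualBasis R L f x) : ∃ β, E.IsPoissonLift β := by
  obtain ⟨σ, X, hσ, hσc, hX, hXσ, h₀⟩ := E.exists_framing h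
  obtain ⟨β, h₁, -, h₃, h₄, h₅⟩ := E.exists_lift_of_framing h σ X hσ hσc hX hXσ h₀
  exact ⟨β, fun c => by rw [h₁, hσc], h₃, h₄, h₅⟩

section Restrict

theorem isNilpotent_ker_p : IsNilpotent (RingHom.ker E.p) := by
  refine ⟨2, ?_⟩
  rw [pow_two, Ideal.zero_eq_bot, eq_bot_iff, Ideal.mul_le]
  intro a ha b hb
  obtain ⟨s, rfl⟩ := (E.exact a).1 ha
  obtain ⟨t, rfl⟩ := (E.exact b).1 hb
  exact E.incl_mul_incl s t

variable {R' L' : Type} [CommRing R'] [LieRing L'] [Module R' L'] [LieRingModule L' R']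
  [LieRinehartRing R' L'] [Algebra ℂ R'] {A' : Type} [CommRing A'] (E' : PoissonExt R' L' n A')
  {φ : R →+* R'} {l : L →ₛₗ[φ] L'} (hφ : φ.Etale)
  {res : A →+* A'}

include hφ

omit [Algebra ℂ R] in
/-- Two lifts of functions to `A'` which agree on `R` are equal. -/
theorem funLift_unique {σ τ : R' →+* A'} (hp : ∀ r, E'.p (σ r) = E'.p (τ r))
    (h : ∀ r, σ (φ r) = τ (φ r)) : σ = τ := by
  let _ : Algebra R R' := φ.toAlgebra
  have : Algebra.Etale R R' := hφ
  let _ : Algebra R A' := (σ.comp φ).toAlgebra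
  let σ' : R' →ₐ[R] A' := { σ with commutes' := fun r => rfl }
  let τ' : R' →ₐ[R] A' := { τ with commutes' := fun r => (h r).symm }
  have h₁ : σ' = τ' := Algebra.FormallyUnramified.ext (RingHom.ker E'.p) E'.isNilpotent_ker_p fun r => by
    rw [Ideal.Quotient.mk_eq_mk_iff_sub_mem, RingHom.mem_ker, map_sub, sub_eq_zero]
    exact hp r
  exact RingHom.ext fun r => DFunLike.congr_fun h₁ r

omit [Algebra ℂ R] in
theorem exists_funLift (σ : R →+* A')
    (hσ : ∀ r, E'.p (σ r) = Ideal.Quotient.mk _ (algebraMap R' _ (φ r))) :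
    ∃ τ : R' →+* A', (∀ r, τ (φ r) = σ r) ∧ ∀ r, E'.p (τ r) = Ideal.Quotient.mk _ (algebraMap R' _ r) := by
  let _ : Algebra R R' := φ.toAlgebra
  have : Algebra.Etale R R' := hφ
  let _ : Algebra R A' := σ.toAlgebra
  let _ : Algebra R (SymmetricAlgebra R' L' ⧸ augIdeal R' L' ^ (n + 1)) :=
    (((Ideal.Quotient.mk _).comp (algebraMap R' _)).comp φ).toAlgebra
  let p : A' →ₐ[R] (SymmetricAlgebra R' L' ⧸ augIdeal R' L' ^ (n + 1)) :=
    { E'.p with commutes' := fun r => hσ r }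
  let q : R' →ₐ[R] (SymmetricAlgebra R' L' ⧸ augIdeal R' L' ^ (n + 1)) :=
    { (Ideal.Quotient.mk _).comp (algebraMap R' _) with commutes' := fun r => rfl }
  let τ := Algebra.FormallySmooth.liftOfSurjective q p E'.p_surjective E'.isNilpotent_ker_p
  exact ⟨τ, fun r => τ.commutes r, fun r =>
    Algebra.FormallySmooth.liftOfSurjective_apply q p E'.p_surjective E'.isNilpotent_ker_p r⟩

variable {E E'} (hl : ∀ y r, ⁅l y, φ r⁆ = φ ⁅y, r⁆)
  {N : ℕ} {f : Fin N → R} {x : Fin N → L} (h : IsDualBasis R L f x)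
  (h' : IsDualBasis R' L' (fun k => φ (f k)) (fun k => l (x k)))

include h'

omit [LieRingModule L R] [LieRinehartRing R L] [Algebra ℂ R] in
-- On functions this is uniqueness of lifts along an étale map modulo a nilpotent ideal. On vector
-- fields it follows because the images of the `x k` generate `L'` over `R'`.
theorem IsPoissonLift.ext_restrict {β γ : SymmetricAlgebra R' L' →+* A'} (hβ : E'.IsPoissonLift β)
    (hγ : E'.IsPoissonLift γ) (hβγ : ∀ s, β (mapSemi φ l s) = γ (mapSemi φ l s)) : β = γ := by
  have h₁ : ∀ r, β (algebraMap R' _ r) = γ (algebraMap R' _ r) := fun r => RingHom.congr_fun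
    (E'.funLift_unique hφ (σ := β.comp (algebraMap R' _)) (τ := γ.comp (algebraMap R' _))
    (fun r => (hβ.proj _).trans (hγ.proj _).symm) (fun r => by
      have := hβγ (algebraMap R _ r)
      rwa [mapSemi_algebraMap] at this)) r
  refine ringHom_ext' h₁ fun y => ?_
  have h₂ : ι R' L' y = ∑ k, algebraMap R' _ ⁅y, φ (f k)⁆ * ι R' L' (l (x k)) := by
    conv_lhs => rw [h'.vec y]
    rw [map_sum]
    exact Finset.sum_congr rfl fun k _ => by rw [map_smul, Algebra.smul_def]
  rw [h₂, map_sum, map_sum]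
  refine Finset.sum_congr rfl fun k _ => ?_
  have := hβγ (ι R L (x k))
  rw [mapSemi_ι] at this
  rw [map_mul, map_mul, h₁, this]

include hl h

/-- Poisson lifts restrict along étale maps. -/
theorem IsPoissonLift.exists_restrict {β : SymmetricAlgebra R L →+* A} (hβ : E.IsPoissonLift β)
    (hp : ∀ a s, E.p a = Ideal.Quotient.mk _ s → E'.p (res a) = Ideal.Quotient.mk _ (mapSemi φ l s))
    (hbr : ∀ a b u, E.br a b = Ideal.Quotient.mk _ u →
      E'.br (res a) (res b) = Ideal.Quotient.mk _ (mapSemi φ l u))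
    (hc : ∀ c, res (E.const c) = E'.const c) (hφc : ∀ c, φ (algebraMap ℂ R c) = algebraMap ℂ R' c) :
    ∃ β', E'.IsPoissonLift β' ∧ ∀ s, β' (mapSemi φ l s) = res (β s) := by
  obtain ⟨σ, hσ₁, hσ₂⟩ := E'.exists_funLift hφ ((res.comp β).comp (algebraMap R _)) (fun r => by
    rw [← mapSemi_algebraMap φ l]
    exact hp _ _ (hβ.proj _))
  have hbr' : ∀ s t, E'.br (res (β s)) (res (β t)) =
    Ideal.Quotient.mk _ (mapSemi φ l (poisson R L s t)) := fun s t => hbr _ _ _ (hβ.br s t)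
  -- A framing requires bracket relations only among the functions and vector fields of the dual
  -- basis, and these restrict from `A`. Hence the étale extension `σ` and the restricted vector
  -- fields define a lift over `R'`.
  obtain ⟨β', h₁, h₂, h₃, h₄, h₅⟩ := E'.exists_lift_of_framing h' σ (fun k => res (β (ι R L (x k)))) hσ₂
    (fun c => by
      rw [← hφc, hσ₁]
      exact (congrArg res (hβ.const c)).trans (hc c))
    (fun k => by
      rw [← mapSemi_ι φ l]
      exact hp _ _ (hβ.proj _))
    (fun k j => by
      rw [hσ₁]
      refine (hbr' _ _).trans ?_
      rw [poisson_vec_fun, mapSemi_algebraMap, hl])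
    (fun k j => by
      rw [hσ₁, hσ₁]
      refine (hbr' _ _).trans ?_
      rw [poisson_fun_fun, map_zero, map_zero])
  have h₆ : ∀ r, β' (algebraMap R' _ (φ r)) = res (β (algebraMap R _ r)) := fun r => by
    rw [h₁, hσ₁]; rfl
  refine ⟨β', ⟨fun c => ?_, h₃, h₄, h₅⟩, fun s => ?_⟩
  · rw [← hφc, h₆, hβ.const, hc]
  · have : β'.comp (mapSemi φ l) = res.comp β := ringHom_ext' (fun r => by
      rw [RingHom.comp_apply, mapSemi_algebraMap, h₆]; rfl) (fun y => by
      have h₇ : ι R L y = ∑ k, algebraMap R _ ⁅y, f k⁆ * ι R L (x k) := by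
        conv_lhs => rw [h.vec y]
        rw [map_sum]
        exact Finset.sum_congr rfl fun k _ => by rw [map_smul, Algebra.smul_def]
      rw [RingHom.comp_apply, mapSemi_ι, h₂, RingHom.comp_apply, h₇, map_sum, map_sum]
      refine Finset.sum_congr rfl fun k _ => ?_
      rw [map_mul, map_mul, hl, hσ₁]
      rfl)
    exact RingHom.congr_fun this s

end Restrict
end PoissonExt
end SymmetricAlgebra

/-! ### Symmetric powers of the tangent module form a quasi-coherent sheaf. -/

namespace CScheme
open SymmetricAlgebra

theorem _root_.SymmetricAlgebra.derive_zero_left {R L : Type} [CommRing R] [LieRing L] [Module R L]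
    [LieRingModule L R] [LieRinehartRing R L] (n : ℕ) (f : R) :
    derive n (0 : symPow R L (n + 1)) f = 0 :=
  map_zero (AddMonoidHom.mk' (fun s : symPow R L (n + 1) => derive n s f) fun a b => derive_add n a b f)

variable {V : Scheme.{0}} [V.Over specC]

section Sections

theorem symTnRes_symTnRes (n : ℕ) {U W W' : V.Opens} (h : W ≤ U) (h' : W' ≤ W) (s : SymTn V n U) :
    symTnRes n h' (symTnRes n h s) = symTnRes n (h'.trans h) s := Subtype.ext (symRes_symRes h h' s.1)

theorem symTnRes_derive (n : ℕ) {U W : V.Opens} (h : W ≤ U) (s : SymTn V (n + 1) U) (g : Γ(V, U)) :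
    symTnRes n h (derive n s g) = derive n (symTnRes (n + 1) h s) (fres V h g) :=
  powSemi_derive (fun y r => TX.res_lie h y r) n s g

theorem symTnRes_tensorDer (n : ℕ) {U W : V.Opens} (h : W ≤ U) (t : TX V U ⊗[Γ(V, U)] SymTn V n U)
    (g : Γ(V, U)) :
    symTnRes n h (tensorDer n t g) = tensorDer n (tensorRes n h t) (fres V h g) :=
  powSemi_tensorDer (fun y r => TX.res_lie h y r) n t g

theorem symTnRes_tensorPotential (n : ℕ) {U W : V.Opens} (h : W ≤ U)
    (t : TX V U ⊗[Γ(V, U)] SymTn V n U) :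
    symTnRes (n + 1) h (tensorPotential _ _ n t) = tensorPotential _ _ n (tensorRes n h t) :=
  powSemi_tensorPotential (fres_algebraMap h) n t

theorem symTnRes_potential (n : ℕ) {U W : V.Opens} (h : W ≤ U) {N : ℕ} (x : Fin N → TX V U)
    (D : Fin N → SymTn V n U) :
    symTnRes (n + 1) h (potential x n D) =
      potential (fun k => TX.res h (x k)) n fun k => symTnRes n h (D k) :=
  powSemi_potential (fres_algebraMap h) n x D

theorem symTn_zero_ext {U : V.Opens} {s t : SymTn V 0 U} (h : zeroSec s.1 = zeroSec t.1) : s = t := by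
  obtain ⟨a, ha⟩ := mem_symPow_zero.1 s.2
  obtain ⟨b, hb⟩ := mem_symPow_zero.1 t.2
  rw [← ha, ← hb, algebraMapInv_algebraMap, algebraMapInv_algebraMap] at h
  exact Subtype.ext (ha.symm.trans ((congrArg _ h).trans hb))

theorem zeroSec_symRes {U W : V.Opens} (h : W ≤ U) (s : SymT V U) :
    zeroSec (symRes h s) = fres V h (zeroSec s) := by
  have : (zeroSec (X := V) : SymT V W →ₐ[Γ(V, W)] Γ(V, W)).toRingHom.comp (symRes h) =
      (fres V h).comp (zeroSec (X := V) : SymT V U →ₐ[Γ(V, U)] Γ(V, U)).toRingHom := ringHom_ext'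
    (fun r => by
      change zeroSec (symRes h (algebraMap _ _ r)) = fres V h (zeroSec (algebraMap _ _ r))
      rw [mapSemi_algebraMap, algebraMapInv_algebraMap, algebraMapInv_algebraMap])
    (fun y => by
      change zeroSec (symRes h (ι _ _ y)) = fres V h (zeroSec (ι _ _ y))
      rw [mapSemi_ι, algebraMapInv_ι, algebraMapInv_ι, map_zero])
  exact RingHom.congr_fun this s

theorem zeroSec_smul {n : ℕ} {U : V.Opens} (r : Γ(V, U)) (s : SymTn V n U) :
    zeroSec (r • s).1 = r * zeroSec (X := V) (U := U) s.1 :=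
  map_smul (zeroSec (X := V) (U := U)) r s.1

/-- Functions as elements of `Sym^0`. -/
def symTnZero {U : V.Opens} (r : Γ(V, U)) : SymTn V 0 U := ⟨ofFun r, algebraMap_mem_symPow_zero r⟩

variable [Smooth (V ↘ specC)]

/-- A section of `Sym^{n+1}` is recovered from its brackets with the `f k` through the potential.
Induction on `n` thus reduces the statement to functions; the next three proofs use the same
reduction. -/
theorem symTn_ext (n : ℕ) {U : V.affineOpens} {s t : SymTn V n U.1}
    (h : ∀ x ∈ U.1, ∃ (W : V.affineOpens) (hW : W.1 ≤ U.1), x ∈ W.1 ∧ symTnRes n hW s = symTnRes n hW t) :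
    s = t := by
  induction n with
  | zero =>
    refine symTn_zero_ext (rs_ext V.sheaf fun x hx => ?_)
    obtain ⟨W, hW, hx, h⟩ := h x hx
    refine ⟨W.1, hW, hx, ?_⟩
    exact (zeroSec_symRes hW s.1).symm.trans ((congrArg (fun s => zeroSec s.1) h).trans
      (zeroSec_symRes hW t.1))
  | succ n ih =>
    obtain ⟨N, f, x, hfx⟩ := exists_isDualBasis U
    rw [← hfx.potential_derive s, ← hfx.potential_derive t]
    congr 1
    funext k
    refine ih fun x hx => ?_
    obtain ⟨W, hW, hx, h⟩ := h x hx
    exact ⟨W, hW, hx, by rw [symTnRes_derive, symTnRes_derive, h]⟩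

/-- The brackets with the `f k` glue by induction. The potential of the glued family restricts to
the given sections because potentials and dual bases restrict. -/
theorem symTn_glue (n : ℕ) {U : V.affineOpens} {ι : Type} (W : ι → V.affineOpens)
    (hW : ∀ i, (W i).1 ≤ U.1) (hc : ∀ x ∈ U.1, ∃ i, x ∈ (W i).1) (s : ∀ i, SymTn V n (W i).1)
    (h : ∀ i j, ∀ x ∈ (W i).1, x ∈ (W j).1 → ∃ (W' : V.affineOpens) (hi : W'.1 ≤ (W i).1)
      (hj : W'.1 ≤ (W j).1), x ∈ W'.1 ∧ symTnRes n hi (s i) = symTnRes n hj (s j)) :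
    ∃ t : SymTn V n U.1, ∀ i, symTnRes n (hW i) t = s i := by
  induction n with
  | zero =>
    obtain ⟨r, hr⟩ : ∃ r : Γ(V, U.1), ∀ i, fres V (hW i) r = zeroSec (s i).1 := rs_glue V.sheaf (U := U.1) (fun i => (W i).1) hW hc (fun i => zeroSec (s i).1)
      (fun i j W' hi hj => rs_ext V.sheaf fun x hx => by
        obtain ⟨W'', hi', hj', hx', h⟩ := h i j x (hi hx) (hj hx)
        refine ⟨W''.1 ⊓ W'.1, inf_le_right, ⟨hx', hx⟩, ?_⟩
        have h₁ : fres V hi' (zeroSec (s i).1) = fres V hj' (zeroSec (s j).1) :=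
          (zeroSec_symRes hi' (s i).1).symm.trans ((congrArg (fun s => zeroSec s.1) h).trans
            (zeroSec_symRes hj' (s j).1))
        have h₂ := congrArg (fres V (inf_le_left : W''.1 ⊓ W'.1 ≤ W''.1)) h₁
        rw [fres_fres, fres_fres] at h₂
        exact (fres_fres V _ _ _).trans (h₂.trans (fres_fres V _ _ _).symm))
    refine ⟨symTnZero r, fun i => symTn_zero_ext ?_⟩
    refine (zeroSec_symRes (hW i) (ofFun r)).trans ?_
    rw [algebraMapInv_algebraMap]
    exact hr i
  | succ n ih =>
    obtain ⟨N, f, x, hfx⟩ := exists_isDualBasis U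
    have h₁ : ∀ k i j, ∀ x ∈ (W i).1, x ∈ (W j).1 → ∃ (W' : V.affineOpens) (hi : W'.1 ≤ (W i).1)
        (hj : W'.1 ≤ (W j).1), x ∈ W'.1 ∧ symTnRes n hi (derive n (s i) (fres V (hW i) (f k))) =
          symTnRes n hj (derive n (s j) (fres V (hW j) (f k))) := by
      intro k i j x hi hj
      obtain ⟨W', hi, hj, hx, h⟩ := h i j x hi hj
      have h₂ := symTnRes_derive n hi (s i) (fres V (hW i) (f k))
      have h₃ := symTnRes_derive n hj (s j) (fres V (hW j) (f k))
      have h₄ : fres V hi (fres V (hW i) (f k)) = fres V hj (fres V (hW j) (f k)) :=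
        (fres_fres V (hW i) hi (f k)).trans (fres_fres V (hW j) hj (f k)).symm
      exact ⟨W', hi, hj, hx, h₂.trans ((congrArg₂ (derive n) h h₄).trans h₃.symm)⟩
    choose t ht using fun k => ih (fun i => derive n (s i) (fres V (hW i) (f k))) (h₁ k)
    refine ⟨potential x n t, fun i => (symTnRes_potential n (hW i) x t).trans ?_⟩
    refine Eq.trans ?_ ((isDualBasis_res (hW i) hfx).potential_derive (s i))
    exact congrArg _ (funext fun k => ht k i)

omit [Smooth (V ↘ specC)] in
theorem symTnRes_smul (n : ℕ) {U W : V.Opens} (h : W ≤ U) (r : Γ(V, U)) (s : SymTn V n U) :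
    symTnRes n h (r • s) = fres V h r • symTnRes n h s := map_smulₛₗ _ _ _

/-- Together with `exists_smul_extends` this is the localization property over a principal open set.
The finitely many brackets with the `f k` are killed by powers of `g`, and the sum of the exponents
serves for all of them. -/
theorem exists_smul_eq_zero (n : ℕ) {U W : V.affineOpens} (h : W.1 ≤ U.1) (g : Γ(V, U.1))
    (hg : W.1 = V.basicOpen g) (s : SymTn V n U.1) (hs : symTnRes n h s = 0) :
    ∃ M₀ : ℕ, ∀ M, M₀ ≤ M → g ^ M • s = 0 := by
  suffices h : ∃ M : ℕ, g ^ M • s = 0 by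
    obtain ⟨M₀, hM₀⟩ := h
    refine ⟨M₀, fun M hM => ?_⟩
    rw [← Nat.sub_add_cancel hM, pow_add, mul_smul, hM₀, smul_zero]
  induction n with
  | zero =>
    have h₁ : fres V h (zeroSec s.1) = 0 := by
      rw [← zeroSec_symRes, show symRes h s.1 = 0 from congrArg Subtype.val hs, map_zero]
    have h₂ : fres V (V.basicOpen_le g) (zeroSec s.1) = 0 := by
      rw [← fres_fres V h hg.ge, h₁, map_zero]
    have := U.2.isLocalization_basicOpen g
    obtain ⟨⟨_, M, rfl⟩, hM⟩ := (IsLocalization.map_eq_zero_iff (Submonoid.powers g) Γ(V, V.basicOpen g) _).1 h₂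
    refine ⟨M, symTn_zero_ext ?_⟩
    exact (zeroSec_smul (g ^ M) s).trans (hM.trans (map_zero zeroSec).symm)
  | succ n ih =>
    obtain ⟨N, f, x, hfx⟩ := exists_isDualBasis U
    have h₁ : ∀ k, ∃ M : ℕ, g ^ M • derive n s (f k) = 0 := fun k => by
      refine ih (derive n s (f k)) ?_
      exact (symTnRes_derive n h s (f k)).trans ((congrArg (fun s => derive n s _) hs).trans
        (derive_zero_left n _))
    choose M hM using h₁
    refine ⟨∑ k, M k, (hfx.potential_derive (g ^ (∑ k, M k) • s)).symm.trans ?_⟩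
    refine (congrArg _ (funext fun k => ?_)).trans (map_zero (potential x n))
    refine (derive_smul n _ s (f k)).trans ?_
    have h₂ : g ^ (∑ k, M k) = g ^ (∑ j ∈ Finset.univ.erase k, M j) * g ^ M k := by
      rw [← pow_add, Finset.sum_erase_add _ _ (Finset.mem_univ k)]
    rw [h₂, mul_smul, hM]
    exact smul_zero _

omit [V.Over specC] [Smooth (V ↘ specC)] in
theorem exists_fres_eq_pow_mul {U W : V.affineOpens} (h : W.1 ≤ U.1) (g : Γ(V, U.1))
    (hg : W.1 = V.basicOpen g) (z : Γ(V, W.1)) :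
    ∃ (M : ℕ) (r : Γ(V, U.1)), fres V h r = fres V h g ^ M * z := by
  have := U.2.isLocalization_basicOpen g
  obtain ⟨⟨r, _, M, rfl⟩, hM⟩ := IsLocalization.surj (Submonoid.powers g) (fres V hg.ge z)
  have h₁ : fres V hg.ge z * fres V (V.basicOpen_le g) (g ^ M) =
    fres V (V.basicOpen_le g) r := hM
  have h₂ := congrArg (fres V hg.le) h₁
  rw [map_mul, fres_fres, fres_fres, fres_fres, fres_refl, map_pow] at h₂
  exact ⟨M, r, by rw [← h₂, mul_comm]⟩

set_option maxHeartbeats 400000 in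
-- After multiplication by powers of `g` the brackets with the `f k` extend. Further factors of `g`
-- bring the exponents to their sum, and the potential of the extended family extends the section.
theorem exists_smul_extends (n : ℕ) {U W : V.affineOpens} (h : W.1 ≤ U.1) (g : Γ(V, U.1))
    (hg : W.1 = V.basicOpen g) (s : SymTn V n W.1) :
    ∃ M₀ : ℕ, ∀ M, M₀ ≤ M → ∃ t : SymTn V n U.1, symTnRes n h t = fres V h g ^ M • s := by
  suffices h : ∃ (M : ℕ) (t : SymTn V n U.1), symTnRes n h t = fres V h g ^ M • s by
    obtain ⟨M₀, t, ht⟩ := h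
    refine ⟨M₀, fun M hM => ⟨g ^ (M - M₀) • t, ?_⟩⟩
    rw [symTnRes_smul, ht, ← mul_smul, map_pow, ← pow_add, Nat.sub_add_cancel hM]
  induction n with
  | zero =>
    obtain ⟨M, r, hr⟩ := exists_fres_eq_pow_mul h g hg (zeroSec s.1)
    have h₃ : zeroSec (symTnRes 0 h (symTnZero r)).1 = fres V h r :=
      (zeroSec_symRes h (ofFun r)).trans (congrArg _ (algebraMapInv_algebraMap r))
    exact ⟨M, symTnZero r, symTn_zero_ext (h₃.trans (hr.trans (zeroSec_smul (fres V h g ^ M) s).symm))⟩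
  | succ n ih =>
    obtain ⟨N, f, x, hfx⟩ := exists_isDualBasis U
    have h₁ : ∀ k, ∃ (M : ℕ) (t : SymTn V n U.1), symTnRes n h t =
      fres V h g ^ M • derive n s (fres V h (f k)) := fun k => ih (derive n s (fres V h (f k)))
    choose M t ht using h₁
    refine ⟨∑ k, M k, potential x n fun k => g ^ (∑ j ∈ Finset.univ.erase k, M j) • t k, ?_⟩
    refine (symTnRes_potential n h x _).trans (Eq.trans (congrArg _ (funext fun k => ?_))
      ((isDualBasis_res h hfx).potential_derive (fres V h g ^ (∑ k, M k) • s)))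
    have h₂ : fres V h g ^ (∑ k, M k) =
        fres V h (g ^ (∑ j ∈ Finset.univ.erase k, M j)) * fres V h g ^ M k := by
      rw [map_pow, ← pow_add, Finset.sum_erase_add _ _ (Finset.mem_univ k)]
    refine (symTnRes_smul n h _ (t k)).trans ?_
    rw [ht, ← mul_smul, ← h₂]
    exact (derive_smul n _ s _).symm

end Sections

end CScheme

/-! ### Sections of the sheafified tensor product and their potentials. -/

namespace CScheme
open SymmetricAlgebra

variable {V : Scheme.{0}} [V.Over specC]

section TensorSection

theorem tensorSection_res (n : ℕ) {U W : V.Opens} (h : W ≤ U) (t : TX V U ⊗[Γ(V, U)] SymTn V n U) :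
    ars (tensorSheaf V n) h (tensorSection V n U t) = tensorSection V n W (tensorRes n h t) :=
  (ConcreteCategory.congr_hom ((toSheafify (Opens.grothendieckTopology V)
    (tensorPresheaf V n)).naturality (homOfLE h).op) t).symm

theorem exists_local_tensorSection (n : ℕ) {U : V.Opens} (c : (tensorSheaf V n).obj.obj (op U)) {x : V}
    (hx : x ∈ U) : ∃ (W : V.affineOpens) (h : W.1 ≤ U) (t : TX V W.1 ⊗[Γ(V, W.1)] SymTn V n W.1), x ∈ W.1 ∧
      tensorSection V n W.1 t = ars (tensorSheaf V n) h c := by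
  obtain ⟨W, h, hx, t, ht⟩ := exists_local_toSheafify (tensorPresheaf V n) c hx
  obtain ⟨W', h', hx⟩ := exists_affine_le hx
  refine ⟨W', h'.trans h, tensorRes n h' t, hx, ?_⟩
  exact (tensorSection_res n h' t).symm.trans ((congrArg (ars (tensorSheaf V n) h') ht).trans
    (ars_ars (tensorSheaf V n) h h' c))

theorem exists_local_eq_of_tensorSection_eq (n : ℕ) {U : V.Opens} {s t : TX V U ⊗[Γ(V, U)] SymTn V n U}
    (h : tensorSection V n U s = tensorSection V n U t) {x : V} (hx : x ∈ U) :
    ∃ (W : V.affineOpens) (h : W.1 ≤ U), x ∈ W.1 ∧ tensorRes n h s = tensorRes n h t := by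
  have key : ∃ (W : V.Opens) (h : W ≤ U), x ∈ W ∧ tensorRes n h s = tensorRes n h t :=
    exists_local_eq_of_toSheafify_eq (X := V) (tensorPresheaf V n) (U := U) (s := s) (t := t) h hx
  obtain ⟨W, hW, hx, hst⟩ := key
  obtain ⟨W', h', hx⟩ := exists_affine_le hx
  exact ⟨W', h'.trans hW, hx, (tensorRes_tensorRes n hW h' s).symm.trans
    ((congrArg (tensorRes n h') hst).trans (tensorRes_tensorRes n hW h' t))⟩

theorem exists_local_tensorRes_eq (n : ℕ) {U W₁ W₂ : V.Opens} (h₁ : W₁ ≤ U) (h₂ : W₂ ≤ U)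
    (c : (tensorSheaf V n).obj.obj (op U)) (t₁ : TX V W₁ ⊗[Γ(V, W₁)] SymTn V n W₁)
    (t₂ : TX V W₂ ⊗[Γ(V, W₂)] SymTn V n W₂)
    (ht₁ : tensorSection V n W₁ t₁ = ars (tensorSheaf V n) h₁ c)
    (ht₂ : tensorSection V n W₂ t₂ = ars (tensorSheaf V n) h₂ c) {x : V} (hx₁ : x ∈ W₁) (hx₂ : x ∈ W₂) :
    ∃ (W : V.affineOpens) (h₁ : W.1 ≤ W₁) (h₂ : W.1 ≤ W₂), x ∈ W.1 ∧
      tensorRes n h₁ t₁ = tensorRes n h₂ t₂ := by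
  have i₁ : W₁ ⊓ W₂ ≤ W₁ := inf_le_left
  have i₂ : W₁ ⊓ W₂ ≤ W₂ := inf_le_right
  have e₁ : tensorSection V n (W₁ ⊓ W₂) (tensorRes n i₁ t₁) = ars (tensorSheaf V n) (i₁.trans h₁) c :=
    (tensorSection_res n i₁ t₁).symm.trans ((congrArg (ars (tensorSheaf V n) i₁) ht₁).trans
      (ars_ars (tensorSheaf V n) h₁ i₁ c))
  have e₂ : tensorSection V n (W₁ ⊓ W₂) (tensorRes n i₂ t₂) = ars (tensorSheaf V n) (i₂.trans h₂) c :=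
    (tensorSection_res n i₂ t₂).symm.trans ((congrArg (ars (tensorSheaf V n) i₂) ht₂).trans
      (ars_ars (tensorSheaf V n) h₂ i₂ c))
  exact (exists_local_eq_of_tensorSection_eq n (e₁.trans e₂.symm) (show x ∈ W₁ ⊓ W₂ from ⟨hx₁, hx₂⟩)).elim
    fun W H => H.elim fun hW H => ⟨W, hW.trans i₁, hW.trans i₂, H.1, (tensorRes_tensorRes n i₁ hW t₁).symm.trans
    (H.2.trans (tensorRes_tensorRes n i₂ hW t₂))⟩

variable [Smooth (V ↘ specC)]

set_option maxHeartbeats 1000000 in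
/-- The potential of a section of `T ⊗ Sym^n T`. -/
theorem exists_potential (n : ℕ) {U : V.affineOpens} (c : (tensorSheaf V n).obj.obj (op U.1)) :
    ∃ s : SymTn V (n + 1) U.1, ∀ (W : V.affineOpens) (h : W.1 ≤ U.1)
      (t : TX V W.1 ⊗[Γ(V, W.1)] SymTn V n W.1), tensorSection V n W.1 t = ars (tensorSheaf V n) h c →
      symTnRes (n + 1) h s = tensorPotential _ _ n t := by
  -- A section of the sheafification has tensor representatives only locally. Their potentials agree
  -- on overlaps and glue in the sheaf `Sym^{n+1}`.
  choose W h t hx ht using fun (x : U.1) => exists_local_tensorSection n c x.2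
  have hcompat : ∀ (W₁ W₂ : V.affineOpens) (h₁ : W₁.1 ≤ U.1) (h₂ : W₂.1 ≤ U.1)
      (t₁ : TX V W₁.1 ⊗[Γ(V, W₁.1)] SymTn V n W₁.1) (t₂ : TX V W₂.1 ⊗[Γ(V, W₂.1)] SymTn V n W₂.1)
      (_ : tensorSection V n W₁.1 t₁ = ars (tensorSheaf V n) h₁ c)
      (_ : tensorSection V n W₂.1 t₂ = ars (tensorSheaf V n) h₂ c), ∀ x ∈ W₁.1, x ∈ W₂.1 →
      ∃ (W' : V.affineOpens) (h₁ : W'.1 ≤ W₁.1) (h₂ : W'.1 ≤ W₂.1), x ∈ W'.1 ∧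
        symTnRes (n + 1) h₁ (tensorPotential _ _ n t₁) = symTnRes (n + 1) h₂ (tensorPotential _ _ n t₂) := by
    intro W₁ W₂ h₁ h₂ t₁ t₂ ht₁ ht₂ x hx₁ hx₂
    exact (exists_local_tensorRes_eq n h₁ h₂ c t₁ t₂ ht₁ ht₂ hx₁ hx₂).elim fun W' H => H.elim fun i₁ H =>
      H.elim fun i₂ H => ⟨W', i₁, i₂, H.1, (symTnRes_tensorPotential n i₁ t₁).trans
      ((congrArg (tensorPotential _ _ n) H.2).trans (symTnRes_tensorPotential n i₂ t₂).symm)⟩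
  refine (symTn_glue (n + 1) (U := U) W h (fun x hxU => ⟨⟨x, hxU⟩, hx ⟨x, hxU⟩⟩)
    (fun x => tensorPotential _ _ n (t x)) (fun i j => hcompat _ _ (h i) (h j) _ _ (ht i) (ht j))).elim fun s hs =>
    ⟨s, fun W' h' t' ht' => symTn_ext (n + 1) fun x hxW' => ?_⟩
  refine (hcompat _ _ (h ⟨x, h' hxW'⟩) h' _ _ (ht ⟨x, h' hxW'⟩) ht' x (hx ⟨x, h' hxW'⟩) hxW').elim
    fun W'' H => H.elim fun i₁ H => H.elim fun i₂ H =>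
      ⟨W'', i₂, H.1, (symTnRes_symTnRes (n + 1) h' i₂ s).trans (Eq.trans ?_ H.2)⟩
  exact (symTnRes_symTnRes (n + 1) (h ⟨x, h' hxW'⟩) i₁ s).symm.trans
    (congrArg (symTnRes (n + 1) i₁) (hs ⟨x, h' hxW'⟩))

omit [Smooth (V ↘ specC)] in
theorem tensorSection_res_eq (n : ℕ) {U W W' : V.Opens} (h : W ≤ U) (h' : W' ≤ W)
    (c : (tensorSheaf V n).obj.obj (op U)) (t : TX V W ⊗[Γ(V, W)] SymTn V n W)
    (ht : tensorSection V n W t = ars (tensorSheaf V n) h c) :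
    tensorSection V n W' (tensorRes n h' t) = ars (tensorSheaf V n) (h'.trans h) c :=
  (tensorSection_res n h' t).symm.trans ((congrArg (ars (tensorSheaf V n) h') ht).trans
      (ars_ars (tensorSheaf V n) h h' c))

set_option maxHeartbeats 1000000 in
-- This is additivity of the potential. It has to be checked locally, where both `c₁` and `c₂` have
-- tensor representatives.
theorem potential_sub (n : ℕ) {U₁ U₂ W : V.affineOpens} (h₁ : W.1 ≤ U₁.1) (h₂ : W.1 ≤ U₂.1)
    (c₁ : (tensorSheaf V n).obj.obj (op U₁.1)) (c₂ : (tensorSheaf V n).obj.obj (op U₂.1))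
    (s₁ : SymTn V (n + 1) U₁.1) (s₂ : SymTn V (n + 1) U₂.1)
    (hs₁ : ∀ (W : V.affineOpens) (h : W.1 ≤ U₁.1) (t : TX V W.1 ⊗[Γ(V, W.1)] SymTn V n W.1),
      tensorSection V n W.1 t = ars (tensorSheaf V n) h c₁ → symTnRes (n + 1) h s₁ = tensorPotential _ _ n t)
    (hs₂ : ∀ (W : V.affineOpens) (h : W.1 ≤ U₂.1) (t : TX V W.1 ⊗[Γ(V, W.1)] SymTn V n W.1),
      tensorSection V n W.1 t = ars (tensorSheaf V n) h c₂ → symTnRes (n + 1) h s₂ = tensorPotential _ _ n t)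
    (t : TX V W.1 ⊗[Γ(V, W.1)] SymTn V n W.1)
    (ht : tensorSection V n W.1 t = ars (tensorSheaf V n) h₂ c₂ - ars (tensorSheaf V n) h₁ c₁) :
    symTnRes (n + 1) h₂ s₂ - symTnRes (n + 1) h₁ s₁ = tensorPotential _ _ n t := by
  have key : ∀ x ∈ W.1, ∃ (W' : V.affineOpens) (h : W'.1 ≤ W.1), x ∈ W'.1 ∧
      symTnRes (n + 1) (h.trans h₂) s₂ - symTnRes (n + 1) (h.trans h₁) s₁ =
        symTnRes (n + 1) h (tensorPotential _ _ n t) := by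
    intro x hx
    refine (exists_local_tensorSection n c₁ (h₁ hx)).elim fun W₁ H => H.elim fun k₁ H => H.elim fun t₁ H₁ =>
      (exists_local_tensorSection n c₂ (h₂ hx)).elim fun W₂ H => H.elim fun k₂ H => H.elim fun t₂ H₂ =>
      (exists_affine_le (show x ∈ W.1 ⊓ (W₁.1 ⊓ W₂.1) from ⟨hx, H₁.1, H₂.1⟩)).elim fun W₃ H => ?_
    have k₃ := H.1
    have i : W₃.1 ≤ W.1 := k₃.trans inf_le_left
    have i₁ : W₃.1 ≤ W₁.1 := k₃.trans (inf_le_right.trans inf_le_left)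
    have i₂ : W₃.1 ≤ W₂.1 := k₃.trans (inf_le_right.trans inf_le_right)
    have e₁ := tensorSection_res_eq n k₁ i₁ c₁ t₁ H₁.2
    have e₂ := tensorSection_res_eq n k₂ i₂ c₂ t₂ H₂.2
    have e : tensorSection V n W₃.1 (tensorRes n i t) =
        tensorSection V n W₃.1 (tensorRes n i₂ t₂ - tensorRes n i₁ t₁) := by
      refine (tensorSection_res n i t).symm.trans ((congrArg _ ht).trans ?_)
      refine (map_sub (ars (tensorSheaf V n) i) _ _).trans (Eq.trans ?_
        (map_sub (tensorSection V n W₃.1) _ _).symm)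
      exact congrArg₂ (· - ·) ((ars_ars (tensorSheaf V n) h₂ i c₂).trans e₂.symm)
        ((ars_ars (tensorSheaf V n) h₁ i c₁).trans e₁.symm)
    refine (exists_local_eq_of_tensorSection_eq n e H.2).elim fun W' H => H.elim fun j H =>
      ⟨W', j.trans i, H.1, ?_⟩
    have f₁ := hs₁ W' (j.trans (i₁.trans k₁)) _ (tensorSection_res_eq n (i₁.trans k₁) j c₁ _ e₁)
    have f₂ := hs₂ W' (j.trans (i₂.trans k₂)) _ (tensorSection_res_eq n (i₂.trans k₂) j c₂ _ e₂)
    have f := (symTnRes_tensorPotential n (j.trans i) t).trans (congrArg (tensorPotential _ _ n)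
      ((tensorRes_tensorRes n i j t).symm.trans (H.2.trans (map_sub (tensorRes n j) _ _))))
    exact (congrArg₂ (· - ·) f₂ f₁).trans ((map_sub (tensorPotential _ _ n) _ _).symm.trans f.symm)
  refine symTn_ext (n + 1) fun x hx => ?_
  refine (key x hx).elim fun W' H => H.elim fun h H => ⟨W', h, H.1, Eq.trans ?_ H.2⟩
  exact (map_sub (symTnRes (n + 1) h) _ _).trans (congrArg₂ (· - ·) (symTnRes_symTnRes (n + 1) h₂ h s₂)
    (symTnRes_symTnRes (n + 1) h₁ h s₁))

end TensorSection

section Basis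

variable {𝓑 : Type} [Preorder 𝓑]

/-- Affine open sets `Z b`, indexed by a preorder, such that every point in `Z b₁ ∩ Z b₂` has
arbitrarily small neighbourhoods `Z b` with `b ≤ b₁` and `b ≤ b₂`. -/
structure IsAffineBasis (Z : 𝓑 → V.affineOpens) : Prop where
  mono : ∀ {b b' : 𝓑}, b' ≤ b → (Z b').1 ≤ (Z b).1
  exists_le : ∀ (b₁ b₂ : 𝓑) (x : V) (U : V.Opens), x ∈ (Z b₁).1 → x ∈ (Z b₂).1 → x ∈ U →
    ∃ b, b ≤ b₁ ∧ b ≤ b₂ ∧ x ∈ (Z b).1 ∧ (Z b).1 ≤ U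

variable [Smooth (V ↘ specC)] {Z : 𝓑 → V.affineOpens} (hZ : IsAffineBasis Z)
include hZ

set_option maxHeartbeats 1000000 in
/-- Compatible derivations define a section of `T ⊗ Sym^n T`. -/
theorem exists_section_of_derivations (n : ℕ) (U : V.Opens) (P : 𝓑 → Prop) (hP : ∀ b b', P b → b' ≤ b → P b')
    (hU : ∀ b, P b → (Z b).1 ≤ U) (hc : ∀ x ∈ U, ∃ b, P b ∧ x ∈ (Z b).1)
    (D : ∀ b, P b → Derivation ℤ Γ(V, (Z b).1) (SymTn V n (Z b).1))
    (hD : ∀ b hb (c : ℂ), D b hb (algebraMap ℂ _ c) = 0)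
    (hres : ∀ b b' (hb : P b) (h : b' ≤ b) f,
      D b' (hP b b' hb h) (fres V (hZ.mono h) f) = symTnRes n (hZ.mono h) (D b hb f)) :
    ∃ d : (tensorSheaf V n).obj.obj (op U), ∀ b hb,
      ∃ t : TX V (Z b).1 ⊗[Γ(V, (Z b).1)] SymTn V n (Z b).1,
        tensorSection V n (Z b).1 t = ars (tensorSheaf V n) (hU b hb) d ∧
        ∀ g, tensorDer n t g = D b hb g := by
  have h₁ : ∀ b (hb : P b), ∃ t : TX V (Z b).1 ⊗[Γ(V, (Z b).1)] SymTn V n (Z b).1,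
      ∀ g, tensorDer n t g = D b hb g := fun b hb => by
    obtain ⟨N, f, x, hfx⟩ := exists_isDualBasis (Z b)
    exact hfx.exists_tensorDer n (D b hb) (hD b hb)
  choose t ht using h₁
  -- A tensor is determined by its derivation, so the independently chosen tensors restrict to each
  -- other.
  have htr : ∀ b b' (hb : P b) (h : b' ≤ b), tensorRes n (hZ.mono h) (t b hb) = t b' (hP b b' hb h) := by
    intro b b' hb h
    obtain ⟨N, f, x, hfx⟩ := exists_isDualBasis (Z b)
    refine (isDualBasis_res (hZ.mono h) hfx).tensorDer_injective n fun k => ?_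
    exact (symTnRes_tensorDer n (hZ.mono h) (t b hb) (f k)).symm.trans
      ((congrArg (symTnRes n (hZ.mono h)) (ht b hb (f k))).trans
        ((hres b b' hb h (f k)).symm.trans (ht b' (hP b b' hb h) _).symm))
  obtain ⟨d, hd⟩ := ars_glue (tensorSheaf V n) (ι := {b // P b}) (U := U) (fun b => (Z b.1).1)
    (fun b => hU b.1 b.2) (fun x hx => by
      obtain ⟨b, hb, hx⟩ := hc x hx
      exact Opens.mem_iSup.2 ⟨⟨b, hb⟩, hx⟩) (fun b => tensorSection V n _ (t b.1 b.2)) (fun i j => by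
      refine ars_ext _ fun x hx => ?_
      obtain ⟨b, hi, hj, hx, hb⟩ := hZ.exists_le i.1 j.1 x _ hx.1 hx.2 hx
      refine ⟨(Z b).1, hb, hx, ?_⟩
      have e : ∀ (k : {b // P b}) (hk : b ≤ k.1), ars (tensorSheaf V n) (hZ.mono hk)
          (tensorSection V n _ (t k.1 k.2)) = tensorSection V n _ (t b (hP _ _ k.2 hk)) := fun k hk =>
        (tensorSection_res n (hZ.mono hk) (t k.1 k.2)).trans
          (congrArg (tensorSection V n (Z b).1) (htr k.1 b k.2 hk))
      exact (ars_ars (tensorSheaf V n) _ hb _).trans ((e i hi).trans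
        ((e j hj).symm.trans (ars_ars (tensorSheaf V n) _ hb _).symm)))
  exact ⟨d, fun b hb => ⟨t b hb, (hd ⟨b, hb⟩).symm, ht b hb⟩⟩

set_option maxHeartbeats 1000000 in
/-- A cochain of closed derivations whose class vanishes is a coboundary of exact derivations. -/
theorem exists_symTn_splitting (n : ℕ) {ι : Type} (u : ι → 𝓑)
    (D : ∀ i j b, b ≤ u i → b ≤ u j → Derivation ℤ Γ(V, (Z b).1) (SymTn V (n + 1) (Z b).1))
    (hD : ∀ i j b hi hj (c : ℂ), D i j b hi hj (algebraMap ℂ _ c) = 0)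
    (hcl : ∀ i j b hi hj r s, derive n (D i j b hi hj r) s = derive n (D i j b hi hj s) r)
    (d : ∀ i j, (tensorSheaf V (n + 1)).obj.obj (op ((Z (u i)).1 ⊓ (Z (u j)).1)))
    (hd : ∀ i j b hi hj, ∃ t : TX V (Z b).1 ⊗[Γ(V, (Z b).1)] SymTn V (n + 1) (Z b).1,
      tensorSection V (n + 1) (Z b).1 t =
        ars (tensorSheaf V (n + 1)) (le_inf (hZ.mono hi) (hZ.mono hj)) (d i j) ∧
        ∀ g, tensorDer (n + 1) t g = D i j b hi hj g)
    (h₀ : IsCechClass (fun i => (Z (u i)).1) d 0) :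
    ∃ s : ∀ i, SymTn V (n + 2) (Z (u i)).1, ∀ i j b (hi : b ≤ u i) (hj : b ≤ u j) g,
      derive (n + 1) (symTnRes (n + 2) (hZ.mono hj) (s j)) g -
        derive (n + 1) (symTnRes (n + 2) (hZ.mono hi) (s i)) g = D i j b hi hj g := by
  obtain ⟨c, hc⟩ := h₀.exists_coboundary
  -- The sections `c i` need not correspond to closed derivations. The potential is applied to the
  -- whole equation `d i j = c j - c i`, and only `d i j` has to be closed for its potential to
  -- differentiate back to it.
  choose s hs using fun i => exists_potential (n + 1) (c i)
  refine ⟨s, fun i j b hi hj g => ?_⟩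
  obtain ⟨t, ht, htD⟩ := hd i j b hi hj
  obtain ⟨N, f, x, hfx⟩ := exists_isDualBasis (Z b)
  have e₀ : symTnRes (n + 2) (hZ.mono hj) (s j) - symTnRes (n + 2) (hZ.mono hi) (s i) =
      tensorPotential _ _ (n + 1) t := by
    refine potential_sub (n + 1) (hZ.mono hi) (hZ.mono hj) (c i) (c j) (s i) (s j) (hs i) (hs j) t ?_
    have k := congrArg (ars (tensorSheaf V (n + 1)) (le_inf (hZ.mono hi) (hZ.mono hj))) (hc i j)
    rw [map_sub, ars_ars, ars_ars] at k
    exact ht.trans k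
  have e₁ := hfx.derive_tensorPotential (D i j b hi hj) (hD i j b hi hj) (hcl i j b hi hj) htD g
  rw [← e₀] at e₁
  exact (derive_sub _ _ _ _).symm.trans e₁

end Basis

end CScheme

/-! ### Vanishing of the first Čech cohomology on affine open sets. -/

namespace CScheme
open SymmetricAlgebra

variable {V : Scheme.{0}}

/-- The basic open set of a function on an affine open set. -/
def basicAffine {U : V.affineOpens} (g : Γ(V, U.1)) : V.affineOpens :=
  ⟨V.basicOpen g, U.2.basicOpen g⟩

theorem basicAffine_le {U : V.affineOpens} (g : Γ(V, U.1)) : (basicAffine g).1 ≤ U.1 := V.basicOpen_le g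

theorem basicAffine_mul {U : V.affineOpens} (f g : Γ(V, U.1)) :
    (basicAffine (f * g)).1 = (basicAffine f).1 ⊓ (basicAffine g).1 := V.basicOpen_mul f g

theorem basicAffine_mul_left {U : V.affineOpens} (f g : Γ(V, U.1)) :
    (basicAffine (f * g)).1 ≤ (basicAffine f).1 := (basicAffine_mul f g).trans_le inf_le_left

theorem basicAffine_mul_right {U : V.affineOpens} (f g : Γ(V, U.1)) :
    (basicAffine (f * g)).1 ≤ (basicAffine g).1 := (basicAffine_mul f g).trans_le inf_le_right

theorem basicAffine_mul_eq {U : V.affineOpens} (f g : Γ(V, U.1)) :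
    (basicAffine (f * g)).1 = V.basicOpen (fres V (basicAffine_le g) f) := by
  rw [basicAffine_mul, inf_comm]
  exact (V.basicOpen_res f (homOfLE (basicAffine_le g)).op).symm

/-- An ideal basis trick: a finite family of functions without common zeros on an affine open set. -/
theorem exists_finite_span {U : V.affineOpens} (S : Set Γ(V, U.1))
    (hS : ∀ x ∈ U.1, ∃ g ∈ S, x ∈ V.basicOpen g) : ∃ t : Finset Γ(V, U.1), (t : Set Γ(V, U.1)) ⊆ S ∧
      Ideal.span (t : Set Γ(V, U.1)) = ⊤ := by
  have h₁ : Ideal.span S = ⊤ := by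
    rw [← U.2.self_le_iSup_basicOpen_iff]
    intro x hx
    obtain ⟨g, hg, hx⟩ := hS x hx
    exact Opens.mem_iSup.2 ⟨⟨g, hg⟩, hx⟩
  exact (Ideal.span_eq_top_iff_finite S).1 h₁

theorem exists_mem_basicOpen_of_span {U : V.affineOpens} {t : Set Γ(V, U.1)} (ht : Ideal.span t = ⊤) {x : V}
    (hx : x ∈ U.1) : ∃ g ∈ t, x ∈ V.basicOpen g := by
  have := U.2.self_le_iSup_basicOpen_iff.2 ht hx
  obtain ⟨g, hg⟩ := Opens.mem_iSup.1 this
  exact ⟨g.1, g.2, hg⟩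

theorem exists_sum_mul_pow_eq_one {R κ : Type} [CommRing R] [Fintype κ] (g : κ → R)
    (hg : Ideal.span (Set.range g) = ⊤) (M : ℕ) : ∃ c : κ → R, ∑ r, c r * g r ^ M = 1 := by
  have h₁ := Ideal.span_pow_eq_top (Set.range g) hg M
  have h₂ : (1 : R) ∈ Ideal.span (Set.range fun r => g r ^ M) := by
    rw [← Set.range_comp] at h₁
    exact h₁ ▸ trivial
  exact (Ideal.mem_span_range_iff_exists_fun).1 h₂

theorem exists_uniform {κ : Type} [Finite κ] (P : κ → ℕ → Prop) (h : ∀ k, ∃ M₀, ∀ M, M₀ ≤ M → P k M) :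
    ∃ M, ∀ k, P k M := by
  choose M₀ hM₀ using h
  obtain ⟨M, hM⟩ := (Set.finite_range M₀).bddAbove
  exact ⟨M, fun k => hM₀ k M (hM ⟨k, rfl⟩)⟩

theorem smul_eq_zero_of_eq_mul {R M : Type} [CommRing R] [AddCommGroup M] [Module R M] {a b c : R} {m : M}
    (h : a = b * c) (hm : c • m = 0) : a • m = 0 := by
  rw [h, mul_smul, hm, smul_zero]

theorem eq_sum_smul_sub_sum_smul {R M κ : Type} [CommRing R] [AddCommGroup M] [Module R M] [Fintype κ]
    (a b : κ → R) (h : ∑ r, a r * b r = 1) (m : M) (z w : κ → M) (hz : ∀ r, a r • (z r - w r - b r • m) = 0) :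
    m = ∑ r, a r • z r - ∑ r, a r • w r := by
  rw [← Finset.sum_sub_distrib]
  calc m = (∑ r, a r * b r) • m := by rw [h, one_smul]
    _ = _ := by
      rw [Finset.sum_smul]
      refine Finset.sum_congr rfl fun r _ => ?_
      have := hz r
      rw [smul_sub, smul_sub, sub_eq_zero] at this
      rw [this, mul_smul]

theorem smul_sub_smul_sub_smul {R M : Type} [CommRing R] [AddCommGroup M] [Module R M] (c : R) (m₁ m₂ m₃ : M)
    (h : m₁ + m₂ = m₃) : c • m₃ - c • m₁ - c • m₂ = 0 := by
  rw [← h, smul_add]; abel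

section Cech

variable {F : V.Opens → Type} [∀ U, AddCommGroup (F U)] [∀ U, Module Γ(V, U) (F U)]
  (res : ∀ {U W : V.Opens} (h : W ≤ U), F U →ₛₗ[fres V h] F W)

theorem res_fres_smul {U W W' : V.Opens} (h : W ≤ U) (h' : W' ≤ W) (g : Γ(V, U))
    (s : F W) : res h' (fres V h g • s) = fres V (h'.trans h) g • res h' s :=
  ((res h').map_smulₛₗ _ s).trans (congrArg (fun c => c • res h' s) (fres_fres V h h' g))

theorem res_pow_smul {U W W' : V.Opens} (h : W ≤ U) (h' : W' ≤ W) (g : Γ(V, U)) (N : ℕ)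
    (s : F W) : res h' (fres V h g ^ N • s) = fres V (h'.trans h) g ^ N • res h' s := by
  rw [LinearMap.map_smulₛₗ, map_pow, fres_fres]

/-- The section `z r s` extends `g r ^ N • m r s` from `D(g r * g s)` to `D(g s)`. By the cocycle
relation the family `z r` splits `g r ^ N • m` after restriction to `D(g r)`, so the defect is
killed by a further power of `g r`. -/
theorem extension_defect
    (hres : ∀ {U W W' : V.Opens} (h : W ≤ U) (h' : W' ≤ W) (s : F U), res h' (res h s) = res (h'.trans h) s)
    {U : V.affineOpens} {κ : Type} (g : κ → Γ(V, U.1))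
    (m : ∀ r s : κ, F (basicAffine (g r * g s)).1)
    (hm : ∀ (r s u : κ) (W : V.affineOpens) (h₁ : W.1 ≤ (basicAffine (g r * g s)).1)
      (h₂ : W.1 ≤ (basicAffine (g s * g u)).1) (h₃ : W.1 ≤ (basicAffine (g r * g u)).1),
      res h₁ (m r s) + res h₂ (m s u) = res h₃ (m r u))
    (N : ℕ) (z : ∀ r s : κ, F (basicAffine (g s)).1)
    (hz : ∀ r s : κ, res (basicAffine_mul_right (g r) (g s)) (z r s) =
      fres V (basicAffine_le (g r * g s)) (g r) ^ N • m r s) (r s u : κ) :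
    res (basicAffine_mul_right (g r) (g s * g u))
      (res (basicAffine_mul_right (g s) (g u)) (z r u) - res (basicAffine_mul_left (g s) (g u)) (z r s) -
      fres V (basicAffine_le (g s * g u)) (g r) ^ N • m s u) = 0 := by
  have hu : (basicAffine (g r * (g s * g u))).1 ≤ (basicAffine (g r * g u)).1 := by
    rw [basicAffine_mul, basicAffine_mul, basicAffine_mul]
    exact inf_le_inf_left _ inf_le_right
  have hs : (basicAffine (g r * (g s * g u))).1 ≤ (basicAffine (g r * g s)).1 := by
    rw [basicAffine_mul, basicAffine_mul, basicAffine_mul]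
    exact inf_le_inf_left _ inf_le_left
  have hsu := basicAffine_mul_right (g r) (g s * g u)
  have hr := basicAffine_le (g r * (g s * g u))
  have e : ∀ (v : κ) (hv : (basicAffine (g r * (g s * g u))).1 ≤ (basicAffine (g r * g v)).1)
      (hv' : (basicAffine (g s * g u)).1 ≤ (basicAffine (g v)).1),
      res hsu (res hv' (z r v)) = fres V hr (g r) ^ N • res hv (m r v) := by
    intro v hv hv'
    have e₁ := congrArg (res hv) (hz r v)
    have e₂ := hres (basicAffine_mul_right (g r) (g v)) hv (z r v)
    have e₃ := hres hv' hsu (z r v)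
    have e₄ := res_pow_smul res (basicAffine_le (g r * g v)) hv (g r) N (m r v)
    exact e₃.trans (e₂.symm.trans (e₁.trans e₄))
  have e₁ := e u hu (basicAffine_mul_right (g s) (g u))
  have e₂ := e s hs (basicAffine_mul_left (g s) (g u))
  have e₃ := res_pow_smul res (basicAffine_le (g s * g u)) hsu (g r) N (m s u)
  have e₄ := hm r s u (basicAffine (g r * (g s * g u))) hs hsu hu
  have e₅ := map_sub (res hsu) (res (basicAffine_mul_right (g s) (g u)) (z r u) -
    res (basicAffine_mul_left (g s) (g u)) (z r s)) (fres V (basicAffine_le (g s * g u)) (g r) ^ N • m s u)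
  have e₆ := map_sub (res hsu) (res (basicAffine_mul_right (g s) (g u)) (z r u))
    (res (basicAffine_mul_left (g s) (g u)) (z r s))
  exact e₅.trans ((congrArg₂ (· - ·) (e₆.trans (congrArg₂ (· - ·) e₁ e₂)) e₃).trans
    (smul_sub_smul_sub_smul _ _ _ _ e₄))

theorem exists_uniform_pow_smul_eq_zero
    (hzero : ∀ {U : V.affineOpens} (f g : Γ(V, U.1)) (s : F (basicAffine g).1),
      res (basicAffine_mul_right f g) s = 0 → ∃ M₀ : ℕ, ∀ M, M₀ ≤ M → fres V (basicAffine_le g) f ^ M • s = 0)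
    {U : V.affineOpens} {κ : Type} [Finite κ] (g : κ → Γ(V, U.1))
    (e : ∀ r s u : κ, F (basicAffine (g s * g u)).1)
    (h : ∀ r s u : κ, res (basicAffine_mul_right (g r) (g s * g u)) (e r s u) = 0) :
    ∃ M, ∀ r s u : κ, fres V (basicAffine_le (g s * g u)) (g r) ^ M • e r s u = 0 := by
  have h₁ : ∀ k : κ × κ × κ, ∃ M₀ : ℕ, ∀ M, M₀ ≤ M →
      fres V (basicAffine_le (g k.2.1 * g k.2.2)) (g k.1) ^ M • e k.1 k.2.1 k.2.2 = 0 := fun k =>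
    hzero (g k.1) (g k.2.1 * g k.2.2) (e k.1 k.2.1 k.2.2) (h k.1 k.2.1 k.2.2)
  obtain ⟨M, hM⟩ := exists_uniform (fun (k : κ × κ × κ) M =>
      fres V (basicAffine_le (g k.2.1 * g k.2.2)) (g k.1) ^ M • e k.1 k.2.1 k.2.2 = 0) h₁
  exact ⟨M, fun r s u => hM (r, s, u)⟩

/-- The vanishing of the first Čech cohomology of a quasi-coherent presheaf of modules on an affine open set. -/
theorem exists_cech_split
    (hres : ∀ {U W W' : V.Opens} (h : W ≤ U) (h' : W' ≤ W) (s : F U), res h' (res h s) = res (h'.trans h) s)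
    (hext : ∀ {U : V.affineOpens} (f g : Γ(V, U.1)) (s : F (basicAffine (f * g)).1),
      ∃ M₀ : ℕ, ∀ M, M₀ ≤ M → ∃ z : F (basicAffine g).1,
        res (basicAffine_mul_right f g) z = fres V (basicAffine_le (f * g)) f ^ M • s)
    (hzero : ∀ {U : V.affineOpens} (f g : Γ(V, U.1)) (s : F (basicAffine g).1),
      res (basicAffine_mul_right f g) s = 0 → ∃ M₀ : ℕ, ∀ M, M₀ ≤ M → fres V (basicAffine_le g) f ^ M • s = 0)
    {U : V.affineOpens} {κ : Type} [Fintype κ] (g : κ → Γ(V, U.1))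
    (ht : Ideal.span (Set.range g) = ⊤)
    (m : ∀ r s : κ, F (basicAffine (g r * g s)).1)
    (hm : ∀ (r s u : κ) (W : V.affineOpens) (h₁ : W.1 ≤ (basicAffine (g r * g s)).1)
      (h₂ : W.1 ≤ (basicAffine (g s * g u)).1) (h₃ : W.1 ≤ (basicAffine (g r * g u)).1),
      res h₁ (m r s) + res h₂ (m s u) = res h₃ (m r u)) :
    ∃ y : ∀ s : κ, F (basicAffine (g s)).1, ∀ s u : κ,
      m s u = res (basicAffine_mul_right (g s) (g u)) (y u) -
        res (basicAffine_mul_left (g s) (g u)) (y s) := by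
  refine Exists.elim (exists_uniform (κ := κ × κ) (fun k N => ∃ z : F (basicAffine (g k.2)).1,
    res (basicAffine_mul_right (g k.1) (g k.2)) z =
      fres V (basicAffine_le (g k.1 * g k.2)) (g k.1) ^ N • m k.1 k.2)
    (fun k => hext (g k.1) (g k.2) (m k.1 k.2))) fun N hN => ?_
  have hN₁ : ∀ r s : κ, ∃ z : F (basicAffine (g s)).1,
      res (basicAffine_mul_right (g r) (g s)) z =
        fres V (basicAffine_le (g r * g s)) (g r) ^ N • m r s := fun r s => hN (r, s)
  choose z hz using hN₁
  have hd := extension_defect res hres g m hm N z hz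
  have hδ : ∀ r s u : κ, ∃ δ : F (basicAffine (g s * g u)).1,
      res (basicAffine_mul_right (g s) (g u)) (z r u) -
      res (basicAffine_mul_left (g s) (g u)) (z r s) -
      fres V (basicAffine_le (g s * g u)) (g r) ^ N • m s u = δ := fun r s u => exists_eq'
  choose δ hδ₁ using hδ
  have hd₁ : ∀ r s u, res (basicAffine_mul_right (g r) (g s * g u)) (δ r s u) = 0 := fun r s u =>
    (congrArg (res (basicAffine_mul_right (g r) (g s * g u))) (hδ₁ r s u)).symm.trans (hd r s u)
  refine (exists_uniform_pow_smul_eq_zero res hzero g δ hd₁).elim fun M hM => ?_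
  -- A partition of unity `∑ c r * g r ^ (M + N) = 1`: the factor `g r ^ N` is used to extend the
  -- sections and `g r ^ M` to kill the defects. The splitting is `∑ c r * g r ^ M • z r s`.
  refine (exists_sum_mul_pow_eq_one g ht (M + N)).elim fun c hc => ?_
  have hy : ∀ s : κ, ∃ y : F (basicAffine (g s)).1, ∀ (W : V.affineOpens)
      (h : W.1 ≤ (basicAffine (g s)).1), res h y =
        ∑ r : κ, fres V (h.trans (basicAffine_le (g s))) (c r * g r ^ M) • res h (z r s) := by
    intro s
    refine ⟨∑ r : κ, fres V (basicAffine_le (g s)) (c r * g r ^ M) • z r s, fun W h => ?_⟩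
    refine (map_sum (res h) _ _).trans (Finset.sum_congr rfl fun r _ => ?_)
    exact res_fres_smul res (basicAffine_le (g s)) h _ (z r s)
  choose y hy using hy
  refine ⟨y, fun s u => ?_⟩
  have h₁ : ∑ r : κ, fres V (basicAffine_le (g s * g u)) (c r * g r ^ M) *
      fres V (basicAffine_le (g s * g u)) (g r) ^ N = 1 := by
    have : ∀ r : κ, fres V (basicAffine_le (g s * g u)) (c r * g r ^ M) *
        fres V (basicAffine_le (g s * g u)) (g r) ^ N =
        fres V (basicAffine_le (g s * g u)) (c r * g r ^ (M + N)) := fun r => by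
      rw [← map_pow, ← map_mul, mul_assoc, ← pow_add]
    rw [Finset.sum_congr rfl fun r _ => this r, ← map_sum, hc, map_one]
  have h₅ : ∀ r : κ, fres V (basicAffine_le (g s * g u)) (c r * g r ^ M) =
      fres V (basicAffine_le (g s * g u)) (c r) * fres V (basicAffine_le (g s * g u)) (g r) ^ M := fun r => by
    rw [map_mul, map_pow]
  have h₂ := eq_sum_smul_sub_sum_smul _ _ h₁ (m s u)
    (fun r => res (basicAffine_mul_right (g s) (g u)) (z r u))
    (fun r => res (basicAffine_mul_left (g s) (g u)) (z r s))
    fun r => smul_eq_zero_of_eq_mul (h₅ r) ((congrArg _ (hδ₁ r s u)).trans (hM r s u))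
  have h₃ := hy u (basicAffine (g s * g u)) (basicAffine_mul_right (g s) (g u))
  have h₄ := hy s (basicAffine (g s * g u)) (basicAffine_mul_left (g s) (g u))
  exact h₂.trans (congrArg₂ (· - ·) h₃ h₄).symm

end Cech

variable [V.Over specC] [Smooth (V ↘ specC)]

theorem exists_smul_extends_of_eq (n : ℕ) {U W : V.affineOpens} (h : W.1 ≤ U.1) (g : Γ(V, U.1))
    (hg : W.1 = V.basicOpen g) (s : SymTn V n W.1) (c : Γ(V, W.1)) (hc : fres V h g = c) :
    ∃ M₀ : ℕ, ∀ M, M₀ ≤ M → ∃ t : SymTn V n U.1, symTnRes n h t = c ^ M • s := by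
  subst hc
  exact exists_smul_extends n h g hg s

theorem exists_smul_extends_basicAffine (n : ℕ) {U : V.affineOpens} (f g : Γ(V, U.1))
    (s : SymTn V n (basicAffine (f * g)).1) : ∃ M₀ : ℕ, ∀ M, M₀ ≤ M → ∃ z : SymTn V n (basicAffine g).1,
      symTnRes n (basicAffine_mul_right f g) z = fres V (basicAffine_le (f * g)) f ^ M • s :=
  exists_smul_extends_of_eq n (U := basicAffine g) (W := basicAffine (f * g)) (basicAffine_mul_right f g)
    (fres V (basicAffine_le g) f) (basicAffine_mul_eq f g) s (fres V (basicAffine_le (f * g)) f)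
    (fres_fres V _ _ _)

theorem exists_smul_eq_zero_basicAffine (n : ℕ) {U : V.affineOpens} (f g : Γ(V, U.1))
    (s : SymTn V n (basicAffine g).1) (hs : symTnRes n (basicAffine_mul_right f g) s = 0) :
    ∃ M₀ : ℕ, ∀ M, M₀ ≤ M → fres V (basicAffine_le g) f ^ M • s = 0 :=
  exists_smul_eq_zero n (U := basicAffine g) (W := basicAffine (f * g)) (basicAffine_mul_right f g)
    (fres V (basicAffine_le g) f) (basicAffine_mul_eq f g) s hs

/-- The vanishing of the first Čech cohomology of `Sym^n T` on an affine open set. -/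
theorem symTn_cech_split (n : ℕ) {U : V.affineOpens} {κ : Type} [Fintype κ] (g : κ → Γ(V, U.1))
    (ht : Ideal.span (Set.range g) = ⊤)
    (m : ∀ r s : κ, SymTn V n (basicAffine (g r * g s)).1)
    (hm : ∀ (r s u : κ) (W : V.affineOpens) (h₁ : W.1 ≤ (basicAffine (g r * g s)).1)
      (h₂ : W.1 ≤ (basicAffine (g s * g u)).1) (h₃ : W.1 ≤ (basicAffine (g r * g u)).1),
      symTnRes n h₁ (m r s) + symTnRes n h₂ (m s u) = symTnRes n h₃ (m r u)) :
    ∃ y : ∀ s : κ, SymTn V n (basicAffine (g s)).1, ∀ s u : κ,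
      m s u = symTnRes n (basicAffine_mul_right (g s) (g u)) (y u) -
        symTnRes n (basicAffine_mul_left (g s) (g u)) (y s) :=
  exists_cech_split (F := fun W => SymTn V n W) (fun h => symTnRes n h) (fun h h' s => symTnRes_symTnRes n h h' s)
    (exists_smul_extends_basicAffine n) (exists_smul_eq_zero_basicAffine n) g ht m hm

end CScheme

/-! ### Towers on affine open sets as Poisson extensions. -/

namespace CScheme
open SymmetricAlgebra

variable {V : Scheme.{0}} [V.Over specC]

omit [V.Over specC] in
theorem rs_sub_eq_rs_sub {A : TopCat.Sheaf CommRingCat.{0} V} {U₁ U₂ W W' : V.Opens} (h₁ : W ≤ U₁) (h₂ : W ≤ U₂)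
    (h : W' ≤ W) (b₁ c₁ : sec A U₁) (b₂ c₂ : sec A U₂)
    (e : rs A h₂ b₂ - rs A h₁ b₁ = rs A h₂ c₂ - rs A h₁ c₁) :
    rs A (h.trans h₁) (b₁ - c₁) = rs A (h.trans h₂) (b₂ - c₂) := by
  have e₁ : rs A h₁ (b₁ - c₁) = rs A h₂ (b₂ - c₂) := by
    rw [map_sub, map_sub]
    linear_combination -e
  have e₂ := congrArg (rs A h) e₁
  rwa [rs_rs, rs_rs] at e₂

namespace PoissonTower

variable {N : ℕ} (T : PoissonTower V N)

theorem proj_incl {l : ℕ} (hl : l < N) (W : V.affineOpens) (s : SymTn V (l + 1) W.1) :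
    onSec (T.proj l) W.1 (T.incl (l + 1) W s) = 0 := (T.exact l hl W _).2 ⟨s, rfl⟩

theorem exists_incl_eq_rs_sub {l : ℕ} (hl : l < N) {W₁ W₂ W : V.affineOpens} (h₁ : W.1 ≤ W₁.1)
    (h₂ : W.1 ≤ W₂.1) (b₁ : sec (T.A (l + 1)) W₁.1) (b₂ : sec (T.A (l + 1)) W₂.1)
    (h : rs (T.A l) h₁ (onSec (T.proj l) W₁.1 b₁) = rs (T.A l) h₂ (onSec (T.proj l) W₂.1 b₂)) :
    ∃ m, T.incl (l + 1) W m = rs (T.A (l + 1)) h₂ b₂ - rs (T.A (l + 1)) h₁ b₁ := by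
  refine (T.exact l hl W _).1 ?_
  rw [map_sub, ← rs_app, ← rs_app, h, sub_self]

/-- The image under `incl` of the restriction of a cochain of differences. -/
theorem incl_symTnRes_of_eq {l : ℕ} (hl : l ≤ N) {W₁ W₂ W W' : V.affineOpens} (h₁ : W.1 ≤ W₁.1)
    (h₂ : W.1 ≤ W₂.1) (h : W'.1 ≤ W.1) (b₁ : sec (T.A l) W₁.1) (b₂ : sec (T.A l) W₂.1)
    (m : SymTn V l W.1) (hm : T.incl l W m = rs (T.A l) h₂ b₂ - rs (T.A l) h₁ b₁) :
    T.incl l W' (symTnRes l h m) = rs (T.A l) (h.trans h₂) b₂ - rs (T.A l) (h.trans h₁) b₁ := by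
  rw [T.incl_res l hl W W' h m, hm, map_sub, rs_rs, rs_rs]

theorem rs_sub_incl_eq {l : ℕ} (hl : l ≤ N) {W₁ W₂ W W' : V.affineOpens} (h₁ : W.1 ≤ W₁.1)
    (h₂ : W.1 ≤ W₂.1) (h : W'.1 ≤ W.1) (b₁ : sec (T.A l) W₁.1) (b₂ : sec (T.A l) W₂.1)
    (m : SymTn V l W.1) (hm : T.incl l W m = rs (T.A l) h₂ b₂ - rs (T.A l) h₁ b₁)
    (y₁ : SymTn V l W₁.1) (y₂ : SymTn V l W₂.1) (hy : m = symTnRes l h₂ y₂ - symTnRes l h₁ y₁) :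
    rs (T.A l) (h.trans h₁) (b₁ - T.incl l W₁ y₁) = rs (T.A l) (h.trans h₂) (b₂ - T.incl l W₂ y₂) := by
  have e : rs (T.A l) h₂ b₂ - rs (T.A l) h₁ b₁ =
      rs (T.A l) h₂ (T.incl l W₂ y₂) - rs (T.A l) h₁ (T.incl l W₁ y₁) := by
    have e₁ := congrArg (T.incl l W) hy
    have e₂ := map_sub (T.incl l W) (symTnRes l h₂ y₂) (symTnRes l h₁ y₁)
    have e₃ := hm.symm.trans (e₁.trans e₂)
    have e₄ := T.incl_res l hl W₂ W h₂ y₂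
    have e₅ := T.incl_res l hl W₁ W h₁ y₁
    exact e₃.trans (congrArg₂ (fun a b : sec (T.A l) W.1 => a - b) e₄ e₅)
  exact rs_sub_eq_rs_sub h₁ h₂ h _ _ _ _ e

theorem add_eq_of_incl {l : ℕ} (hl : l ≤ N) {W : V.affineOpens} {m₁ m₂ m₃ : SymTn V l W.1}
    {a b c : sec (T.A l) W.1} (h₁ : T.incl l W m₁ = b - a) (h₂ : T.incl l W m₂ = c - b)
    (h₃ : T.incl l W m₃ = c - a) : m₁ + m₂ = m₃ :=
  T.incl_injective l hl W (by
    refine (map_add (T.incl l W) m₁ m₂).trans ?_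
    rw [h₁, h₂, h₃]; ring)

variable [Smooth (V ↘ specC)]

/-- The maps of a tower are surjective on affine open sets. -/
theorem proj_surjective_affine {l : ℕ} (hl : l < N) (W : V.affineOpens) :
    Function.Surjective (onSec (T.proj l) W.1) := by
  intro a
  obtain ⟨t, htS, ht⟩ := exists_finite_span (U := W) {g | ∃ b, onSec (T.proj l) (basicAffine g).1 b =
      rs (T.A l) (basicAffine_le g) a} (fun x hx => by
    obtain ⟨W', h', hx', b, hb⟩ := T.proj_surjective l hl W.1 a x hx
    obtain ⟨g, hg, hxg⟩ := W.2.exists_basicOpen_le (V := W') ⟨x, hx'⟩ hx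
    exact ⟨g, ⟨rs (T.A (l + 1)) hg b, (rs_app (T.proj l) hg b).symm.trans
      ((congrArg (rs (T.A l) hg) hb).trans (rs_rs (T.A l) h' hg a))⟩, hxg⟩)
  let g : t → Γ(V, W.1) := fun r => r.1
  have hg : Ideal.span (Set.range g) = ⊤ := (congrArg Ideal.span Subtype.range_coe).trans ht
  choose b hb using fun r : t => htS r.2
  have hb' : ∀ (r : t) (W' : V.affineOpens) (h : W'.1 ≤ (basicAffine (g r)).1),
      rs (T.A l) h (onSec (T.proj l) _ (b r)) = rs (T.A l) (h.trans (basicAffine_le (g r))) a := fun r W' h => by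
    rw [hb r, rs_rs]
  -- Two local preimages of `a` differ by a section of `Sym^{l+1} T`. These differences form a
  -- cocycle on a finite principal cover, and its splitting corrects the preimages so that they
  -- glue.
  choose m hm using fun r s : t => T.exists_incl_eq_rs_sub hl (W := basicAffine (g r * g s))
    (basicAffine_mul_left (g r) (g s)) (basicAffine_mul_right (g r) (g s)) (b r) (b s)
    ((hb' r _ _).trans (hb' s _ _).symm)
  obtain ⟨y, hy⟩ := symTn_cech_split (l + 1) g hg m fun r s u W' h₁ h₂ h₃ => T.add_eq_of_incl hl
    (T.incl_symTnRes_of_eq hl _ _ h₁ (b r) (b s) (m r s) (hm r s))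
    (T.incl_symTnRes_of_eq hl _ _ h₂ (b s) (b u) (m s u) (hm s u))
    (T.incl_symTnRes_of_eq hl _ _ h₃ (b r) (b u) (m r u) (hm r u))
  obtain ⟨c, hc⟩ := rs_glue (T.A (l + 1)) (U := W.1) (fun r : t => (basicAffine (g r)).1)
    (fun r => basicAffine_le (g r)) (fun x hx => by
      obtain ⟨r, hr, hx⟩ := exists_mem_basicOpen_of_span hg hx
      obtain ⟨r, rfl⟩ := hr
      exact ⟨r, hx⟩)
    (fun r => b r - T.incl (l + 1) (basicAffine (g r)) (y r)) (fun r s W' h₁ h₂ =>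
      T.rs_sub_incl_eq hl (basicAffine_mul_left (g r) (g s)) (basicAffine_mul_right (g r) (g s))
        ((le_inf h₁ h₂).trans (basicAffine_mul (g r) (g s)).ge) (b r) (b s) (m r s) (hm r s) (y r) (y s) (hy r s))
  refine ⟨c, rs_ext (T.A l) fun x hx => ?_⟩
  obtain ⟨_, ⟨r, rfl⟩, hx⟩ := exists_mem_basicOpen_of_span hg hx
  refine ⟨_, basicAffine_le (g r), hx, ?_⟩
  rw [rs_app, hc r, map_sub, T.proj_incl hl, sub_zero]
  exact hb r

end PoissonTower
end CScheme

namespace CScheme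
open SymmetricAlgebra

variable {V : Scheme.{0}} [V.Over specC]

theorem jet_eq_jet_iff {l : ℕ} {U : V.Opens} {s t : SymT V U} :
    jet V l s = jet V l t ↔ s - t ∈ zeroIdeal V U ^ (l + 1) := Ideal.Quotient.mk_eq_mk_iff_sub_mem _ _

theorem jet_zero_eq {U : V.Opens} (s : SymT V U) : jet V 0 s = jet V 0 (ofFun (zeroSec s)) := by
  rw [jet_eq_jet_iff, zero_add, pow_one, RingHom.mem_ker, map_sub, sub_eq_zero]
  exact (algebraMapInv_algebraMap _).symm

namespace LocalTriv

variable {n N : ℕ} {T : PoissonTower V N} {U : V.Opens} (τ : LocalTriv T n U)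

theorem red_α (hn : n ≤ N) (l : ℕ) (hl : l ≤ n) (W : V.affineOpens) (hW : W.1 ≤ U) (s : SymT V W.1) :
    onSec (T.red l) W.1 (τ.α l hl W hW (jet V l s)) = zeroSec s := by
  induction l generalizing s with
  | zero =>
    rw [jet_zero_eq]
    refine (congrArg (onSec (T.red 0) W.1) (τ.incl 0 hl W hW (symTnZero (zeroSec s)))).trans ?_
    refine (T.red_incl_zero W _).trans ?_
    exact algebraMapInv_algebraMap (R := Γ(V, W.1)) (L := TX V W.1) (zeroSec s)
  | succ l ih =>
    rw [T.red_succ l (by omega)]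
    exact (congrArg (onSec (T.red l) W.1) (τ.proj l hl W hW s)).trans (ih _ s)

end LocalTriv

section Ext

variable {n : ℕ} {T : PoissonTower V (n + 1)}

theorem red_eq_of_proj_eq {U : V.Opens} (τ : LocalTriv T n U) (W : V.affineOpens) (hW : W.1 ≤ U)
    (a : sec (T.A (n + 1)) W.1) :
    onSec (T.red (n + 1)) W.1 a = zeroJet Γ(V, W.1) (TX V W.1) n
      ((τ.α n le_rfl W hW).symm (onSec (T.proj n) W.1 a)) := by
  obtain ⟨s, hs⟩ := Ideal.Quotient.mk_surjective ((τ.α n le_rfl W hW).symm (onSec (T.proj n) W.1 a))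
  rw [← hs, zeroJet_mk]
  have h₁ : onSec (T.proj n) W.1 a = τ.α n le_rfl W hW (jet V n s) :=
    ((τ.α n le_rfl W hW).apply_symm_apply _).symm.trans (congrArg _ hs.symm)
  rw [T.red_succ n (Nat.lt_succ_self n)]
  exact (congrArg (onSec (T.red n) W.1) h₁).trans (τ.red_α (Nat.le_succ n) n le_rfl W hW s)

theorem bracket_lift {U : V.Opens} (m : ℕ) {T : PoissonTower V (m + 2)} (τ : LocalTriv T (m + 1) U)
    (W : V.affineOpens) (hW : W.1 ≤ U) (a b : sec (T.A (m + 2)) W.1) (s t u : SymT V W.1)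
    (ha : onSec (T.proj (m + 1)) W.1 a = τ.α (m + 1) le_rfl W hW (jet V (m + 1) s))
    (hb : onSec (T.proj (m + 1)) W.1 b = τ.α (m + 1) le_rfl W hW (jet V (m + 1) t))
    (hu : T.bracket (m + 1) W.1 a b = τ.α (m + 1) le_rfl W hW (jet V (m + 1) u)) :
    jet V m u = jet V m (cotBracket s t) := by
  have h₁ := T.bracket_proj m (by omega) W.1 a b
  have h₂ := τ.poisson m le_rfl W hW s t
  have h₃ := τ.proj m le_rfl W hW u
  refine (τ.α m (Nat.le_succ m) W hW).injective (h₃.symm.trans ((congrArg _ hu).symm.trans (h₁.trans ?_)))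
  rw [ha, hb]
  exact h₂

theorem jacobi_lift {U : V.Opens} (m : ℕ) {T : PoissonTower V (m + 2)} (τ : LocalTriv T (m + 1) U)
    (W : V.affineOpens) (hW : W.1 ≤ U) (a b c : sec (T.A (m + 2)) W.1) (s t r u v w : SymT V W.1)
    (ha : onSec (T.proj (m + 1)) W.1 a = τ.α (m + 1) le_rfl W hW (jet V (m + 1) s))
    (hb : onSec (T.proj (m + 1)) W.1 b = τ.α (m + 1) le_rfl W hW (jet V (m + 1) t))
    (hc : onSec (T.proj (m + 1)) W.1 c = τ.α (m + 1) le_rfl W hW (jet V (m + 1) r))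
    (hu : T.bracket (m + 1) W.1 a b = τ.α (m + 1) le_rfl W hW (jet V (m + 1) u))
    (hv : T.bracket (m + 1) W.1 b c = τ.α (m + 1) le_rfl W hW (jet V (m + 1) v))
    (hw : T.bracket (m + 1) W.1 c a = τ.α (m + 1) le_rfl W hW (jet V (m + 1) w)) :
    jet V m (cotBracket u r + cotBracket v s + cotBracket w t) = 0 := by
  have h₁ := T.jacobi m (by omega) W.1 a b c
  rw [ha, hb, hc, hu, hv, hw, τ.poisson m le_rfl W hW, τ.poisson m le_rfl W hW,
    τ.poisson m le_rfl W hW, ← map_add, ← map_add] at h₁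
  have h₂ := (map_eq_zero_iff _ (τ.α m (Nat.le_succ m) W hW).injective).1 h₁
  exact h₂

theorem eq_α_of_symm_eq {U : V.Opens} (τ : LocalTriv T n U) {W : V.affineOpens} {hW : W.1 ≤ U}
    {a : sec (T.A n) W.1} {s : SymT V W.1} (h : (τ.α n le_rfl W hW).symm a = jet V n s) :
    a = τ.α n le_rfl W hW (jet V n s) := (RingEquiv.symm_apply_eq _).1 h

variable [Smooth (V ↘ specC)]

/-- The sections of a tower with a trivialization, as an extension of Poisson algebras. -/
def towerExt {U : V.Opens} (τ : LocalTriv T n U) (W : V.affineOpens) (hW : W.1 ≤ U) :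
    PoissonExt Γ(V, W.1) (TX V W.1) n (sec (T.A (n + 1)) W.1) where
  const := (rs (T.A (n + 1)) le_top).comp (T.const (n + 1))
  p := (τ.α n le_rfl W hW).symm.toRingHom.comp (onSec (T.proj n) W.1)
  incl := T.incl (n + 1) W
  br := (AddMonoidHom.compHom (τ.α n le_rfl W hW).symm.toRingHom.toAddMonoidHom).comp (T.bracket n W.1)
  p_const c := by
    refine (RingEquiv.symm_apply_eq _).2 ?_
    refine ((rs_app (T.proj n) le_top _).symm.trans ?_).trans (τ.const n le_rfl W hW c).symm
    exact congrArg _ (T.proj_const n (Nat.lt_succ_self n) c)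
  p_surjective := (τ.α n le_rfl W hW).symm.surjective.comp (T.proj_surjective_affine (Nat.lt_succ_self n) W)
  incl_injective := T.incl_injective (n + 1) le_rfl W
  exact a := (map_eq_zero_iff _ (τ.α n le_rfl W hW).symm.injective).trans (T.exact n (Nat.lt_succ_self n) W a)
  incl_smul a s := (congrArg (fun r : Γ(V, W.1) => T.incl (n + 1) W (r • s)) (red_eq_of_proj_eq τ W hW a)).symm.trans
    (T.incl_smul (n + 1) le_rfl W a s)
  br_self a := (congrArg (τ.α n le_rfl W hW).symm (T.bracket_self n (Nat.lt_succ_self n) W.1 a)).trans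
    (map_zero (τ.α n le_rfl W hW).symm)
  br_const c a := by
    have h₁ := T.bracket_const n (Nat.lt_succ_self n) W.1 c 1 a
    -- The Leibniz rule for `1 * 1` gives `{1, a} = 0`, and linearity over `ℂ` extends this to all
    -- constants.
    have h₂ := T.bracket_mul n (Nat.lt_succ_self n) W.1 1 1 a
    rw [map_one, mul_one, one_mul, left_eq_add] at h₂
    rw [h₂, mul_zero, mul_one] at h₁
    exact (congrArg (τ.α n le_rfl W hW).symm h₁).trans (map_zero (τ.α n le_rfl W hW).symm)
  br_mul a b c := (congrArg (τ.α n le_rfl W hW).symm (T.bracket_mul n (Nat.lt_succ_self n) W.1 a b c)).trans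
    ((map_add (τ.α n le_rfl W hW).symm _ _).trans (congrArg₂ (· + ·) (map_mul (τ.α n le_rfl W hW).symm _ _)
      (map_mul (τ.α n le_rfl W hW).symm _ _)))
  br_incl s a := by
    refine (RingEquiv.symm_apply_eq _).2 ?_
    refine (T.bracket_incl n (Nat.lt_succ_self n) W s a).trans ?_
    refine (congrArg (fun r : Γ(V, W.1) => T.incl n W (derive n s r)) (red_eq_of_proj_eq τ W hW a)).trans ?_
    exact (τ.incl n le_rfl W hW _).symm
  br_lift a b s t u ha hb hu := by
    obtain _ | m := n
    · rw [pow_zero, Ideal.one_eq_top]; trivial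
    · exact jet_eq_jet_iff.1 (bracket_lift m τ W hW a b s t u (eq_α_of_symm_eq τ ha) (eq_α_of_symm_eq τ hb)
        (eq_α_of_symm_eq τ hu))
  jacobi a b c s t r u v w ha hb hc hu hv hw := by
    obtain _ | m := n
    · rw [pow_zero, Ideal.one_eq_top]; trivial
    · exact Ideal.Quotient.eq_zero_iff_mem.1 (jacobi_lift m τ W hW a b c s t r u v w (eq_α_of_symm_eq τ ha)
        (eq_α_of_symm_eq τ hb) (eq_α_of_symm_eq τ hc) (eq_α_of_symm_eq τ hu) (eq_α_of_symm_eq τ hv)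
        (eq_α_of_symm_eq τ hw))

end Ext
end CScheme

/-! ### Compatible families of Poisson lifts, and sections given by derivations. -/

namespace CScheme
open SymmetricAlgebra

variable {V : Scheme.{0}} [V.Over specC] [Smooth (V ↘ specC)] {𝓑 : Type} [Preorder 𝓑]

section Family

variable {n : ℕ} (Z : 𝓑 → V.affineOpens) (hZ : ∀ {b b' : 𝓑}, b' ≤ b → (Z b').1 ≤ (Z b).1)
  (A : 𝓑 → Type) [∀ b, CommRing (A b)]
  (E : ∀ b, PoissonExt Γ(V, (Z b).1) (TX V (Z b).1) n (A b))
  (res : ∀ {b b' : 𝓑}, b' ≤ b → A b →+* A b')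

set_option maxHeartbeats 1000000 in
/-- Over a preorder with a greatest element, compatible Poisson lifts exist. -/
theorem exists_isPoissonLift_family (b₀ : 𝓑) (h₀ : ∀ b, b ≤ b₀)
    (hres : ∀ {b b' b'' : 𝓑} (h : b' ≤ b) (h' : b'' ≤ b') a, res h' (res h a) = res (h'.trans h) a)
    (hp : ∀ {b b' : 𝓑} (h : b' ≤ b) a s, (E b).p a = jet V n s → (E b').p (res h a) = jet V n (symRes (hZ h) s))
    (hbr : ∀ {b b' : 𝓑} (h : b' ≤ b) a a' s, (E b).br a a' = jet V n s →
      (E b').br (res h a) (res h a') = jet V n (symRes (hZ h) s))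
    (hc : ∀ {b b' : 𝓑} (h : b' ≤ b) c, res h ((E b).const c) = (E b').const c) :
    ∃ β : ∀ b, SymT V (Z b).1 →+* A b, (∀ b, (E b).IsPoissonLift (β b)) ∧
      ∀ {b b' : 𝓑} (h : b' ≤ b) s, β b' (symRes (hZ h) s) = res h (β b s) := by
  have hsm := smooth_sections (Z b₀)
  obtain ⟨N, f, x, hfx⟩ := exists_isDualBasis (Z b₀)
  obtain ⟨β₀, hβ₀⟩ := (E b₀).exists_isPoissonLift hfx
  have key : ∀ {b b' : 𝓑} (h : b' ≤ b) (β : SymT V (Z b).1 →+* A b), (E b).IsPoissonLift β →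
      ∃ β' : SymT V (Z b').1 →+* A b', (E b').IsPoissonLift β' ∧ ∀ s, β' (symRes (hZ h) s) = res h (β s) := by
    intro b b' h β hβ
    obtain ⟨N, f, x, hfx⟩ := exists_isDualBasis (Z b)
    exact PoissonExt.IsPoissonLift.exists_restrict (E' := E b') (etale_fres (hZ h)) (fun y r => TX.res_lie (hZ h) y r) hfx
      (isDualBasis_res (hZ h) hfx) hβ (hp h) (hbr h) (hc h) (fres_algebraMap (hZ h))
  -- The lift is chosen only over the greatest element and restricted to all others. Uniqueness of
  -- restrictions along étale maps then gives compatibility between any two members.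
  choose β hβ hβr using fun b => key (h₀ b) β₀ hβ₀
  refine ⟨β, hβ, fun {b b'} h s => ?_⟩
  obtain ⟨γ, hγ, hγr⟩ := key h (β b) (hβ b)
  have e : β b' = γ := PoissonExt.IsPoissonLift.ext_restrict (E' := E b') (etale_fres (hZ (h₀ b')))
    (isDualBasis_res (hZ (h₀ b')) hfx) (hβ b') hγ fun s => by
      have e₁ := hγr (symRes (hZ (h₀ b)) s)
      have e₂ := congrArg γ (symRes_symRes (hZ (h₀ b)) (hZ h) s)
      have e₃ := (congrArg (res h) (hβr b s)).trans (hres (h₀ b) h (β₀ s))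
      exact (hβr b' s).trans (e₃.symm.trans (e₁.symm.trans e₂))
  exact (RingHom.congr_fun e _).trans (hγr s)

end Family

section GivenBy

variable {n : ℕ}

/-- A section of `T ⊗ Sym^n T` is given on `W` by the derivation `D : O(W) → Sym^n T(W)`. -/
def IsGivenBy (n : ℕ) {U : V.Opens} (d : (tensorSheaf V n).obj.obj (op U)) {W : V.affineOpens} (h : W.1 ≤ U)
    (D : Γ(V, W.1) → SymTn V n W.1) : Prop :=
  ∃ t : TX V W.1 ⊗[Γ(V, W.1)] SymTn V n W.1,
    tensorSection V n W.1 t = ars (tensorSheaf V n) h d ∧ ∀ g, tensorDer n t g = D g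

omit [Smooth (V ↘ specC)]

theorem IsGivenBy.add {U : V.Opens} {d d' : (tensorSheaf V n).obj.obj (op U)} {W : V.affineOpens} {h : W.1 ≤ U}
    {D D' : Γ(V, W.1) → SymTn V n W.1} (hd : IsGivenBy n d h D) (hd' : IsGivenBy n d' h D') :
    IsGivenBy n (d + d') h fun g => D g + D' g := by
  obtain ⟨t, ht, htD⟩ := hd
  obtain ⟨t', ht', htD'⟩ := hd'
  refine ⟨t + t', ?_, fun g => ?_⟩
  · exact (map_add (tensorSection V n W.1) t t').trans ((congrArg₂ (· + ·) ht ht').trans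
      (map_add (ars (tensorSheaf V n) h) d d').symm)
  · exact (tensorDer_add n t t' g).trans (congrArg₂ (· + ·) (htD g) (htD' g))

theorem IsGivenBy.neg {U : V.Opens} {d : (tensorSheaf V n).obj.obj (op U)} {W : V.affineOpens} {h : W.1 ≤ U}
    {D : Γ(V, W.1) → SymTn V n W.1} (hd : IsGivenBy n d h D) : IsGivenBy n (-d) h fun g => -D g := by
  obtain ⟨t, ht, htD⟩ := hd
  refine ⟨-t, ?_, fun g => ?_⟩
  · exact (map_neg (tensorSection V n W.1) t).trans ((congrArg (- ·) ht).trans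
      (map_neg (ars (tensorSheaf V n) h) d).symm)
  · exact (tensorDer_neg n t g).trans (congrArg (- ·) (htD g))

theorem IsGivenBy.sub {U : V.Opens} {d d' : (tensorSheaf V n).obj.obj (op U)} {W : V.affineOpens} {h : W.1 ≤ U}
    {D D' : Γ(V, W.1) → SymTn V n W.1} (hd : IsGivenBy n d h D) (hd' : IsGivenBy n d' h D') :
    IsGivenBy n (d - d') h fun g => D g - D' g := by
  simpa only [sub_eq_add_neg] using hd.add hd'.neg

theorem isGivenBy_zero {U : V.Opens} {W : V.affineOpens} (h : W.1 ≤ U) :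
    IsGivenBy n (0 : (tensorSheaf V n).obj.obj (op U)) h fun _ => 0 :=
  ⟨0, (map_zero (tensorSection V n W.1)).trans (map_zero (ars (tensorSheaf V n) h)).symm,
    fun g => tensorDer_zero n g⟩

theorem IsGivenBy.restrict {U U' : V.Opens} {d : (tensorSheaf V n).obj.obj (op U)} {W : V.affineOpens}
    (i : U' ≤ U) (h : W.1 ≤ U') {D : Γ(V, W.1) → SymTn V n W.1} (hd : IsGivenBy n d (h.trans i) D) :
    IsGivenBy n (ars (tensorSheaf V n) i d) h D := by
  obtain ⟨t, ht, htD⟩ := hd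
  exact ⟨t, ht.trans (ars_ars (tensorSheaf V n) i h d).symm, htD⟩

theorem IsGivenBy.congr {U : V.Opens} {d : (tensorSheaf V n).obj.obj (op U)} {W : V.affineOpens} {h : W.1 ≤ U}
    {D D' : Γ(V, W.1) → SymTn V n W.1} (hd : IsGivenBy n d h D) (hD : ∀ g, D g = D' g) : IsGivenBy n d h D' := by
  obtain ⟨t, ht, htD⟩ := hd
  exact ⟨t, ht, fun g => (htD g).trans (hD g)⟩

/-- Sections of `T ⊗ Sym^n T` given locally by the same derivations are equal. -/
theorem eq_of_isGivenBy [Smooth (V ↘ specC)] {U : V.Opens} {d d' : (tensorSheaf V n).obj.obj (op U)}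
    (h : ∀ x ∈ U, ∃ (W : V.affineOpens) (h : W.1 ≤ U) (D : Γ(V, W.1) → SymTn V n W.1), x ∈ W.1 ∧
      IsGivenBy n d h D ∧ IsGivenBy n d' h D) : d = d' := by
  refine ars_ext (tensorSheaf V n) fun x hx => ?_
  obtain ⟨W, hW, D, hx, ⟨t, ht, htD⟩, t', ht', htD'⟩ := h x hx
  obtain ⟨N, f, x, hfx⟩ := exists_isDualBasis W
  have e : t = t' := hfx.tensorDer_injective n fun k => (htD _).trans (htD' _).symm
  exact ⟨W.1, hW, hx, ht.symm.trans ((congrArg _ e).trans ht')⟩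

end GivenBy
end CScheme

/-! ### Comparison systems: the obstruction cocycle and the gluing of lifts. -/

namespace CScheme
open SymmetricAlgebra

variable {V : Scheme.{0}} [V.Over specC] {𝓑 : Type} [Preorder 𝓑]

theorem derive_symTnRes_trans (n : ℕ) {U W W' : V.Opens} (h : W ≤ U) (h' : W' ≤ W) (s : SymTn V (n + 1) U)
    (g : Γ(V, W)) : derive n (symTnRes (n + 1) (h'.trans h) s) (fres V h' g) =
      symTnRes n h' (derive n (symTnRes (n + 1) h s) g) := by
  have e₁ := symTnRes_derive n h' (symTnRes (n + 1) h s) g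
  have e₂ := symTnRes_symTnRes (n + 1) h h' s
  exact (congrArg (fun t => derive n t (fres V h' g)) e₂).symm.trans e₁.symm

/-- The data needed to compare lifts `A → A'` of homomorphisms with values in a quotient of `A'` by
`Sym^{n+1} T`, where `A` and `A'` are rings with brackets over a basis of affine open sets. -/
structure ComparisonSystem {Z : 𝓑 → V.affineOpens} (hZ : IsAffineBasis Z) (n : ℕ) (A A' B C : 𝓑 → Type)
    [∀ b, CommRing (A b)] [∀ b, CommRing (A' b)] [∀ b, AddCommGroup (B b)] [∀ b, AddCommGroup (C b)] where
  resA : ∀ {b b' : 𝓑}, b' ≤ b → A b →+* A b'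
  resA' : ∀ {b b' : 𝓑}, b' ≤ b → A' b →+* A' b'
  red : ∀ b, A b →+* Γ(V, (Z b).1)
  const : ∀ b, ℂ → A b
  const' : ∀ b, ℂ → A' b
  step : ∀ b, PoissonStep Γ(V, (Z b).1) (TX V (Z b).1) n (A' b) (B b)
  p : ∀ b, A b → C b
  p' : ∀ b, A' b →+ C b
  br : ∀ b, A b → A b → B b
  red_surjective : ∀ b, Function.Surjective (red b)
  red_res : ∀ {b b' : 𝓑} (h : b' ≤ b) a, red b' (resA h a) = fres V (hZ.mono h) (red b a)
  red_const : ∀ b c, red b (const b c) = algebraMap ℂ _ c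
  step_red_eq : ∀ b a a', p' b a' = p b a → (step b).red a' = red b a
  incl_res : ∀ {b b' : 𝓑} (h : b' ≤ b) s,
    resA' h ((step b).incl s) = (step b').incl (symTnRes (n + 1) (hZ.mono h) s)
  exact : ∀ b a, p' b a = 0 ↔ ∃ s, (step b).incl s = a

theorem add_eq_add_of_sub_eq_sub {G : Type} [AddCommGroup G] {a b c d : G} (h : c - d = a - b) : a + d = b + c := by
  rw [sub_eq_sub_iff_add_eq_add] at h
  rw [add_comm b c, h]

theorem sub_add_sub_sub_sub {G : Type} [AddCommGroup G] (a b c d : G) : a - b + (b - d - (a - c)) = c - d := by abel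

namespace ComparisonSystem

variable {Z : 𝓑 → V.affineOpens} {hZ : IsAffineBasis Z} {n : ℕ} {A A' B C : 𝓑 → Type}
  [∀ b, CommRing (A b)] [∀ b, CommRing (A' b)] [∀ b, AddCommGroup (B b)] [∀ b, AddCommGroup (C b)]
  (S : ComparisonSystem hZ n A A' B C)

/-- A compatible family of lifts over a lower set of the basis, compatible with the brackets of
elements reducing to `0`. -/
structure Lift (P : LowerSet 𝓑) where
  ψ : ∀ b, b ∈ P → A b →+* A' b
  res : ∀ {b b' : 𝓑} (hb : b ∈ P) (h : b' ≤ b) a, ψ b' (P.lower h hb) (S.resA h a) = S.resA' h (ψ b hb a)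
  const : ∀ b hb c, ψ b hb (S.const b c) = S.const' b c
  proj : ∀ b hb a, S.p' b (ψ b hb a) = S.p b a
  br : ∀ b hb a a', S.red b a = 0 → (S.step b).br (ψ b hb a) (ψ b hb a') = S.br b a a'

variable {S}

namespace Lift

/-- A lift preserving all brackets. -/
def IsPoisson {P : LowerSet 𝓑} (ψ : S.Lift P) : Prop :=
  ∀ b hb a a', (S.step b).br (ψ.ψ b hb a) (ψ.ψ b hb a') = S.br b a a'

/-- Restriction to a smaller lower set. -/
def restrict {P P' : LowerSet 𝓑} (ψ : S.Lift P) (h : P' ≤ P) : S.Lift P' where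
  ψ b hb := ψ.ψ b (h hb)
  res hb i a := ψ.res (h hb) i a
  const b hb c := ψ.const b (h hb) c
  proj b hb a := ψ.proj b (h hb) a
  br b hb a a' ha := ψ.br b (h hb) a a' ha

variable {P : LowerSet 𝓑} (ψ ψ' : S.Lift P)

theorem red (b : 𝓑) (hb : b ∈ P) (a : A b) : (S.step b).red (ψ.ψ b hb a) = S.red b a :=
  S.step_red_eq b a _ (ψ.proj b hb a)

variable [Smooth (V ↘ specC)]

theorem exists_difference (b : 𝓑) (hb : b ∈ P) :
    ∃ D : Derivation ℤ Γ(V, (Z b).1) (SymTn V (n + 1) (Z b).1), ∀ a,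
      ψ.ψ b hb a - ψ'.ψ b hb a = (S.step b).incl (D (S.red b a)) := by
  obtain ⟨N, f, x, hfx⟩ := exists_isDualBasis (Z b)
  refine (S.step b).exists_derivation_sub hfx (S.red_surjective b) (ψ.red b hb) (ψ'.red b hb) (fun a => ?_)
    fun a a' ha => (ψ.br b hb a a' ha).trans (ψ'.br b hb a a' ha).symm
  obtain ⟨s, hs⟩ := (S.exact b (ψ.ψ b hb a - ψ'.ψ b hb a)).1 (by rw [map_sub, ψ.proj, ψ'.proj, sub_self])
  exact ⟨s, hs.symm⟩

/-- The derivation `O → Sym^{n+1} T` which is the difference of two lifts. -/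
def difference (b : 𝓑) (hb : b ∈ P) : Derivation ℤ Γ(V, (Z b).1) (SymTn V (n + 1) (Z b).1) :=
  (exists_difference ψ ψ' b hb).choose

theorem incl_difference (b : 𝓑) (hb : b ∈ P) (a : A b) :
    (S.step b).incl (difference ψ ψ' b hb (S.red b a)) = ψ.ψ b hb a - ψ'.ψ b hb a :=
  ((exists_difference ψ ψ' b hb).choose_spec a).symm

theorem difference_const (b : 𝓑) (hb : b ∈ P) (c : ℂ) :
    difference ψ ψ' b hb (algebraMap ℂ Γ(V, (Z b).1) c) = 0 := by
  refine (S.step b).incl_injective ?_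
  rw [← S.red_const, incl_difference, ψ.const, ψ'.const, sub_self, map_zero]

theorem difference_res {b b' : 𝓑} (hb : b ∈ P) (h : b' ≤ b) (g : Γ(V, (Z b).1)) :
    difference ψ ψ' b' (P.lower h hb) (fres V (hZ.mono h) g) =
      symTnRes (n + 1) (hZ.mono h) (difference ψ ψ' b hb g) := by
  obtain ⟨a, rfl⟩ := S.red_surjective b g
  refine (S.step b').incl_injective ?_
  have e₁ := (congrArg (S.resA' h) (incl_difference ψ ψ' b hb a)).trans (map_sub (S.resA' h) _ _)
  have e₂ := incl_difference ψ ψ' b' (P.lower h hb) (S.resA h a)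
  rw [S.red_res, ψ.res hb h, ψ'.res hb h] at e₂
  exact e₂.trans (e₁.symm.trans (S.incl_res h _))

theorem difference_closed (hψ : ψ.IsPoisson) (hψ' : ψ'.IsPoisson) (b : 𝓑) (hb : b ∈ P) (r s : Γ(V, (Z b).1)) :
    derive n (difference ψ ψ' b hb r) s = derive n (difference ψ ψ' b hb s) r :=
  (S.step b).derivation_closed (S.red_surjective b) (ψ.red b hb) (ψ'.red b hb)
    (fun a => (incl_difference ψ ψ' b hb a).symm) (fun a a' => (hψ b hb a a').trans (hψ' b hb a a').symm) r s

/-- Modification of a lift by an element of `Sym^{n+2} T`. -/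
def shift {b₀ : 𝓑} (ψ : S.Lift (LowerSet.Iic b₀)) (s : SymTn V (n + 2) (Z b₀).1) : S.Lift (LowerSet.Iic b₀) where
  ψ b hb := (S.step b).shift (ψ.ψ b hb) (ψ.red b hb) (deriveDer (n + 1) (symTnRes (n + 2) (hZ.mono hb) s))
  res {b b'} hb h a := (congrArg₂ (· + ·) (ψ.res hb h a)
    ((congrArg (fun r => (S.step b').incl (deriveDer (n + 1) (symTnRes (n + 2) (hZ.mono (h.trans hb)) s) r))
      (S.red_res h a)).trans ((congrArg (S.step b').incl (derive_symTnRes_trans (n + 1) (hZ.mono hb) (hZ.mono h) s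
        (S.red b a))).trans (S.incl_res h _).symm))).trans (map_add (S.resA' h) _ _).symm
  const b hb c := by
    obtain ⟨N, f, x, hfx⟩ := exists_isDualBasis (Z b)
    have : deriveDer (n + 1) (symTnRes (n + 2) (hZ.mono hb) s) (S.red b (S.const b c)) = 0 :=
      (congrArg _ (S.red_const b c)).trans (Subtype.ext (IsDualBasis.poisson_const hfx.lie_const _ c))
    exact (congrArg₂ (· + ·) (ψ.const b hb c) ((congrArg (S.step b).incl this).trans (map_zero _))).trans (add_zero _)
  proj b hb a := (map_add (S.p' b) _ _).trans ((congrArg₂ (· + ·) (ψ.proj b hb a)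
    ((S.exact b _).2 ⟨_, rfl⟩)).trans (add_zero _))
  br b hb a a' ha := by
    -- The derivation `{s, -}` is closed since functions commute, so adding it to a lift changes no
    -- bracket at all.
    have e := (S.step b).br_shift (ψ := ψ.ψ b hb) (ψ.red b hb) (deriveDer (n + 1) (symTnRes (n + 2) (hZ.mono hb) s))
      (fun r s' => derive_comm n (symTnRes (n + 2) (hZ.mono hb) s) r s') a a'
    exact e.trans (ψ.br b hb a a' ha)

theorem shift_ψ {b₀ : 𝓑} (ψ : S.Lift (LowerSet.Iic b₀)) (s : SymTn V (n + 2) (Z b₀).1) (b : 𝓑) (hb : b ≤ b₀)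
    (a : A b) : (ψ.shift s).ψ b hb a = ψ.ψ b hb a +
      (S.step b).incl (derive (n + 1) (symTnRes (n + 2) (hZ.mono hb) s) (S.red b a)) := rfl

theorem IsPoisson.shift {b₀ : 𝓑} {ψ : S.Lift (LowerSet.Iic b₀)} (hψ : ψ.IsPoisson)
    (s : SymTn V (n + 2) (Z b₀).1) : (ψ.shift s).IsPoisson := by
  intro b hb a a'
  have e := (S.step b).br_shift (ψ := ψ.ψ b hb) (ψ.red b hb) (deriveDer (n + 1) (symTnRes (n + 2) (hZ.mono hb) s))
    (fun r s' => derive_comm n (symTnRes (n + 2) (hZ.mono hb) s) r s') a a'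
  exact e.trans (hψ b hb a a')

end Lift

variable [Smooth (V ↘ specC)] {ι : Type} {u : ι → 𝓑}

/-- The difference of two members of a family of lifts. -/
def diff (ψ : ∀ i, S.Lift (LowerSet.Iic (u i))) (i j : ι) (b : 𝓑) (hi : b ≤ u i) (hj : b ≤ u j) :
    Derivation ℤ Γ(V, (Z b).1) (SymTn V (n + 1) (Z b).1) :=
  Lift.difference ((ψ i).restrict (inf_le_left : LowerSet.Iic (u i) ⊓ LowerSet.Iic (u j) ≤ _))
    ((ψ j).restrict inf_le_right) b ⟨hi, hj⟩

theorem incl_diff (ψ : ∀ i, S.Lift (LowerSet.Iic (u i))) (i j : ι) (b : 𝓑) (hi : b ≤ u i) (hj : b ≤ u j) (a : A b) :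
    (S.step b).incl (diff ψ i j b hi hj (S.red b a)) = (ψ i).ψ b hi a - (ψ j).ψ b hj a :=
  Lift.incl_difference _ _ b _ a

theorem exists_cochain (ψ : ∀ i, S.Lift (LowerSet.Iic (u i))) :
    ∃ d : ∀ i j, (tensorSheaf V (n + 1)).obj.obj (op ((Z (u i)).1 ⊓ (Z (u j)).1)),
      ∀ i j b hi hj, IsGivenBy (n + 1) (d i j) (le_inf (hZ.mono hi) (hZ.mono hj)) (diff ψ i j b hi hj) := by
  have key : ∀ i j, ∃ d : (tensorSheaf V (n + 1)).obj.obj (op ((Z (u i)).1 ⊓ (Z (u j)).1)),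
      ∀ b (hb : b ≤ u i ∧ b ≤ u j),
        IsGivenBy (n + 1) d (le_inf (hZ.mono hb.1) (hZ.mono hb.2)) (diff ψ i j b hb.1 hb.2) := by
    intro i j
    exact exists_section_of_derivations hZ (n + 1) ((Z (u i)).1 ⊓ (Z (u j)).1) (fun b => b ≤ u i ∧ b ≤ u j)
      (fun b b' hb h => ⟨h.trans hb.1, h.trans hb.2⟩) (fun b hb => le_inf (hZ.mono hb.1) (hZ.mono hb.2))
      (fun x hx => by
        obtain ⟨b, h₁, h₂, hx, -⟩ := hZ.exists_le (u i) (u j) x ⊤ hx.1 hx.2 trivial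
        exact ⟨b, ⟨h₁, h₂⟩, hx⟩)
      (fun b hb => diff ψ i j b hb.1 hb.2) (fun b hb c => Lift.difference_const _ _ b _ c)
      (fun b b' hb h f => Lift.difference_res _ _ _ h f)
  choose d hd using key
  exact ⟨d, fun i j b hi hj => hd i j b ⟨hi, hj⟩⟩

theorem diff_closed {ψ : ∀ i, S.Lift (LowerSet.Iic (u i))} (hψ : ∀ i, (ψ i).IsPoisson) (i j : ι) (b : 𝓑)
    (hi : b ≤ u i) (hj : b ≤ u j) (r s : Γ(V, (Z b).1)) :
    derive n (diff ψ i j b hi hj r) s = derive n (diff ψ i j b hi hj s) r :=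
  Lift.difference_closed ((ψ i).restrict (inf_le_left : LowerSet.Iic (u i) ⊓ LowerSet.Iic (u j) ≤ _))
    ((ψ j).restrict inf_le_right) (fun b hb => hψ i b hb.1) (fun b hb => hψ j b hb.2) b ⟨hi, hj⟩ r s

omit [Smooth (V ↘ specC)] in
/-- Lifts which agree on overlaps glue. -/
theorem exists_lift_of_eq {ψ : ∀ i, S.Lift (LowerSet.Iic (u i))} (hψ : ∀ i, (ψ i).IsPoisson)
    (h : ∀ i j b hi hj a, (ψ i).ψ b hi a = (ψ j).ψ b hj a) {P : LowerSet 𝓑} (hP : ∀ b ∈ P, ∃ i, b ≤ u i) :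
    ∃ Ψ : S.Lift P, Ψ.IsPoisson := by
  choose i hi using hP
  refine ⟨⟨fun b hb => (ψ (i b hb)).ψ b (hi b hb), fun {b b'} hb h' a => ?_, fun b hb c => (ψ _).const b _ c,
    fun b hb a => (ψ _).proj b _ a, fun b hb a a' ha => (ψ _).br b _ a a' ha⟩, fun b hb a a' => hψ _ b _ a a'⟩
  exact (h _ (i b hb) b' _ (h'.trans (hi b hb)) _).trans ((ψ _).res _ h' a)

section Cochain

variable {ψ : ∀ i, S.Lift (LowerSet.Iic (u i))}
  {d : ∀ i j, (tensorSheaf V (n + 1)).obj.obj (op ((Z (u i)).1 ⊓ (Z (u j)).1))}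
  (hd : ∀ i j b hi hj, IsGivenBy (n + 1) (d i j) (le_inf (hZ.mono hi) (hZ.mono hj)) (diff ψ i j b hi hj))

include hd

/-- The differences of lifts telescope. Sections of the tensor sheaf given locally by the same
derivations are equal, so it suffices to look at basis members contained in all three sets. -/
theorem isCocycle_of_isGivenBy : IsCocycle (tensorSheaf V (n + 1)) (fun i => (Z (u i)).1) d := by
  intro i j k W hi hj hk
  refine eq_of_isGivenBy fun x hx => ?_
  obtain ⟨b, h₁, h₂, hxb, hbW⟩ := hZ.exists_le (u i) (u j) x W (hi hx) (hj hx) hx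
  obtain ⟨b', h₃, h₄, hxb', -⟩ := hZ.exists_le b (u k) x W hxb (hk hx) hx
  have hW := (hZ.mono h₃).trans hbW
  refine ⟨Z b', hW, diff ψ i k b' (h₃.trans h₁) h₄, hxb', ?_, ?_⟩
  · refine (IsGivenBy.add ((hd i j b' (h₃.trans h₁) (h₃.trans h₂)).restrict (le_inf hi hj) hW)
      ((hd j k b' (h₃.trans h₂) h₄).restrict (le_inf hj hk) hW)).congr fun g => ?_
    obtain ⟨a, rfl⟩ := S.red_surjective b' g
    refine (S.step b').incl_injective (((S.step b').incl.map_add _ _).trans ?_)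
    rw [incl_diff, incl_diff, incl_diff]; ring
  · exact (hd i k b' (h₃.trans h₁) h₄).restrict (le_inf hi hk) hW

/-- If the lifts agree on overlaps the cochain vanishes. -/
theorem cochain_eq_zero (hψ : ∀ i j b hi hj a, (ψ i).ψ b hi a = (ψ j).ψ b hj a) (i j : ι) : d i j = 0 := by
  refine eq_of_isGivenBy fun x hx => ?_
  obtain ⟨b, h₁, h₂, hxb, -⟩ := hZ.exists_le (u i) (u j) x ⊤ hx.1 hx.2 trivial
  refine ⟨Z b, le_inf (hZ.mono h₁) (hZ.mono h₂), _, hxb, hd i j b h₁ h₂, (isGivenBy_zero _).congr fun g => ?_⟩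
  obtain ⟨a, rfl⟩ := S.red_surjective b g
  refine (S.step b).incl_injective ?_
  rw [incl_diff, hψ i j b h₁ h₂, sub_self, map_zero]

set_option maxHeartbeats 1000000 in
/-- The class of the cochain does not depend on the lifts. -/
theorem isCechClass_of_isCechClass {ψ' : ∀ i, S.Lift (LowerSet.Iic (u i))}
    {d' : ∀ i j, (tensorSheaf V (n + 1)).obj.obj (op ((Z (u i)).1 ⊓ (Z (u j)).1))}
    (hd' : ∀ i j b hi hj, IsGivenBy (n + 1) (d' i j) (le_inf (hZ.mono hi) (hZ.mono hj)) (diff ψ' i j b hi hj))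
    {ξ : Sheaf.H.{0} (tensorSheaf V (n + 1)) 1} (h : IsCechClass (fun i => (Z (u i)).1) d ξ) :
    IsCechClass (fun i => (Z (u i)).1) d' ξ := by
  -- The differences between the two lifts over each `U i` are derivations as well. They form the
  -- zero-cochain whose coboundary relates the two cocycles.
  have key : ∀ i, ∃ c : (tensorSheaf V (n + 1)).obj.obj (op (Z (u i)).1),
      ∀ b (hb : b ≤ u i), IsGivenBy (n + 1) c (hZ.mono hb) (Lift.difference (ψ i) (ψ' i) b hb) := fun i =>
    exists_section_of_derivations hZ (n + 1) (Z (u i)).1 (fun b => b ≤ u i)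
      (fun b b' hb h => h.trans hb) (fun b hb => hZ.mono hb) (fun x hx => ⟨u i, le_rfl, hx⟩)
      (fun b hb => Lift.difference (ψ i) (ψ' i) b hb) (fun b hb c => Lift.difference_const _ _ b _ c)
      (fun b b' hb h f => Lift.difference_res _ _ _ h f)
  choose c hc using key
  refine h.add_coboundary c d' fun i j => eq_of_isGivenBy fun x hx => ?_
  obtain ⟨b, h₁, h₂, hxb, -⟩ := hZ.exists_le (u i) (u j) x ⊤ hx.1 hx.2 trivial
  refine ⟨Z b, le_inf (hZ.mono h₁) (hZ.mono h₂), _, hxb, hd' i j b h₁ h₂,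
    ((hd i j b h₁ h₂).add (((hc j b h₂).restrict inf_le_right (le_inf (hZ.mono h₁) (hZ.mono h₂))).sub
      ((hc i b h₁).restrict inf_le_left (le_inf (hZ.mono h₁) (hZ.mono h₂))))).congr fun g => ?_⟩
  obtain ⟨a, rfl⟩ := S.red_surjective b g
  refine (S.step b).incl_injective (((S.step b).incl.map_add _ _).trans
    ((congrArg (_ + ·) ((S.step b).incl.map_sub _ _)).trans ?_))
  exact (congrArg₂ (· + ·) (incl_diff ψ i j b h₁ h₂ a) (congrArg₂ (· - ·) (Lift.incl_difference (ψ j) (ψ' j) b h₂ a)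
    (Lift.incl_difference (ψ i) (ψ' i) b h₁ a))).trans ((sub_add_sub_sub_sub _ _ _ _).trans (incl_diff ψ' i j b h₁ h₂ a).symm)

set_option maxHeartbeats 1000000 in
/-- If the class vanishes, Poisson lifts can be modified so as to agree on overlaps. -/
theorem exists_global_lift (hψ : ∀ i, (ψ i).IsPoisson) (h₀ : IsCechClass (fun i => (Z (u i)).1) d 0)
    {P : LowerSet 𝓑} (hP : ∀ b ∈ P, ∃ i, b ≤ u i) : ∃ Ψ : S.Lift P, Ψ.IsPoisson := by
  -- The lifts being Poisson, their differences are closed and are split by potentials `s i`; the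
  -- shifts by `{s i, -}` agree on overlaps and remain Poisson.
  obtain ⟨s, hs⟩ := exists_symTn_splitting hZ n u (fun i j b hi hj => diff ψ i j b hi hj)
    (fun i j b hi hj c => Lift.difference_const _ _ b _ c) (fun i j b hi hj => diff_closed hψ i j b hi hj) d hd h₀
  refine exists_lift_of_eq (ψ := fun i => (ψ i).shift (s i)) (fun i => (hψ i).shift (s i))
    (fun i j b hi hj a => ?_) hP
  have e := incl_diff ψ i j b hi hj a
  have e' := (congrArg (S.step b).incl (hs i j b hi hj (S.red b a))).symm
  have e'' := e'.symm.trans e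
  have e₃ := ((S.step b).incl.map_sub _ _).symm.trans e''
  have e₄ := (ψ i).shift_ψ (s i) b hi a
  have e₅ := (ψ j).shift_ψ (s j) b hj a
  exact e₄.trans ((add_eq_add_of_sub_eq_sub e₃).trans e₅.symm)

end Cochain
end ComparisonSystem
end CScheme

/-! ### Morphisms of sheaves of rings defined on small affine open sets. -/

namespace CScheme
open SymmetricAlgebra

variable {V : Scheme.{0}}

section SheafHom

variable {F G : TopCat.Sheaf CommRingCat.{0} V} {P : LowerSet V.affineOpens}
  (hP : ∀ x : V, ∃ W ∈ P, x ∈ W.1)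

include hP in
theorem exists_mem_affine_le {U : V.Opens} {x : V} (hx : x ∈ U) : ∃ W ∈ P, W.1 ≤ U ∧ x ∈ W.1 := by
  obtain ⟨W, hW, hxW⟩ := hP x
  obtain ⟨W', h, hx'⟩ := exists_affine_le (U := W.1 ⊓ U) ⟨hxW, hx⟩
  exact ⟨W', P.lower (show W' ≤ W from h.trans inf_le_left) hW, h.trans inf_le_right, hx'⟩

include hP in
theorem rs_ext_of_mem {U : V.Opens} {s t : sec F U}
    (h : ∀ W ∈ P, ∀ h : W.1 ≤ U, rs F h s = rs F h t) : s = t :=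
  rs_ext F fun x hx => by
    obtain ⟨W, hW, h', hx⟩ := exists_mem_affine_le hP hx
    exact ⟨W.1, h', hx, h W hW h'⟩

include hP in
theorem sheafHom_ext_of_mem {f g : F ⟶ G} (h : ∀ W ∈ P, ∀ a, onSec f W.1 a = onSec g W.1 a) : f = g := by
  refine ObjectProperty.hom_ext _ (NatTrans.ext (funext fun U => CommRingCat.hom_ext (RingHom.ext fun a => ?_)))
  refine rs_ext_of_mem hP fun W hW hWU => ?_
  exact (rs_app f hWU a).trans ((h W hW _).trans (rs_app g hWU a).symm)

include hP in
/-- Compatible ring homomorphisms on small affine open sets define a morphism of sheaves. -/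
theorem exists_sheafHom (Ψ : ∀ W, W ∈ P → sec F W.1 →+* sec G W.1)
    (hΨ : ∀ (W W' : V.affineOpens) (hW : W ∈ P) (h : W' ≤ W) a,
      Ψ W' (P.lower h hW) (rs F h a) = rs G h (Ψ W hW a)) :
    ∃ f : F ⟶ G, ∀ W hW a, onSec f W.1 a = Ψ W hW a := by
  have key : ∀ (U : V.Opens) (a : sec F U), ∃ b : sec G U, ∀ W hW (h : W.1 ≤ U), rs G h b = Ψ W hW (rs F h a) := by
    intro U a
    obtain ⟨b, hb⟩ := rs_glue G (U := U) (fun W : {W : V.affineOpens // W ∈ P ∧ W.1 ≤ U} => W.1.1) (fun W => W.2.2)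
      (fun x hx => by
        obtain ⟨W, hW, h, hx⟩ := exists_mem_affine_le hP hx
        exact ⟨⟨W, hW, h⟩, hx⟩)
      (fun W => Ψ W.1 W.2.1 (rs F W.2.2 a))
      (fun W₁ W₂ W' h₁ h₂ => by
        rw [← hΨ W₁.1 W' W₁.2.1 h₁, ← hΨ W₂.1 W' W₂.2.1 h₂, rs_rs, rs_rs])
    exact ⟨b, fun W hW h => hb ⟨W, hW, h⟩⟩
  choose b hb using key
  have hunique : ∀ (U : V.Opens) (s t : sec G U), (∀ W ∈ P, ∀ h : W.1 ≤ U, rs G h s = rs G h t) → s = t :=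
    fun U s t h => rs_ext_of_mem hP h
  let f (U : V.Opens) : sec F U →+* sec G U :=
    { toFun := b U
      map_one' := hunique _ _ _ fun W hW h => by rw [hb _ _ W hW, map_one, map_one, map_one]
      map_zero' := hunique _ _ _ fun W hW h => by rw [hb _ _ W hW, map_zero, map_zero, map_zero]
      map_add' := fun x y => hunique _ _ _ fun W hW h => by
        rw [hb _ _ W hW, map_add, map_add, map_add, hb _ _ W hW, hb _ _ W hW]
      map_mul' := fun x y => hunique _ _ _ fun W hW h => by
        rw [hb _ _ W hW, map_mul, map_mul, map_mul, hb _ _ W hW, hb _ _ W hW] }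
  refine ⟨⟨⟨fun U => CommRingCat.ofHom (f U.unop), fun U U' i => CommRingCat.hom_ext (RingHom.ext fun a => ?_)⟩⟩,
    fun W hW a => ?_⟩
  · refine hunique _ _ _ fun W hW h => ?_
    change rs G h (b U'.unop (rs F i.unop.le a)) = rs G h (rs G i.unop.le (b U.unop a))
    rw [hb _ _ W hW, rs_rs, rs_rs, hb _ _ W hW]
  · have := hb W.1 a W hW le_rfl
    rw [rs_refl, rs_refl] at this
    exact this

include hP in
/-- Compatible isomorphisms on small affine open sets define an isomorphism of sheaves. -/
theorem exists_sheafIso (Ψ : ∀ W, W ∈ P → sec F W.1 →+* sec G W.1)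
    (hΨ : ∀ (W W' : V.affineOpens) (hW : W ∈ P) (h : W' ≤ W) a,
      Ψ W' (P.lower h hW) (rs F h a) = rs G h (Ψ W hW a))
    (hb : ∀ W hW, Function.Bijective (Ψ W hW)) : ∃ f : F ≅ G, ∀ W hW a, onSec f.hom W.1 a = Ψ W hW a := by
  obtain ⟨f, hf⟩ := exists_sheafHom hP Ψ hΨ
  let e (W : V.affineOpens) (hW : W ∈ P) := RingEquiv.ofBijective (Ψ W hW) (hb W hW)
  obtain ⟨g, hg⟩ := exists_sheafHom (F := G) (G := F) hP (fun W hW => (e W hW).symm.toRingHom)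
    (fun W W' hW h a => by
      refine (RingEquiv.symm_apply_eq (e W' (P.lower h hW))).2 ?_
      refine Eq.trans ?_ (hΨ W W' hW h ((e W hW).symm a)).symm
      exact congrArg _ ((e W hW).apply_symm_apply a).symm)
  refine ⟨⟨f, g, sheafHom_ext_of_mem hP fun W hW a => ?_, sheafHom_ext_of_mem hP fun W hW a => ?_⟩, hf⟩
  · change onSec g W.1 (onSec f W.1 a) = a
    rw [hf W hW, hg W hW]
    exact (e W hW).symm_apply_apply a
  · change onSec f W.1 (onSec g W.1 a) = a
    rw [hf W hW, hg W hW]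
    exact (e W hW).apply_symm_apply a

end SheafHom
end CScheme

/-! ### Normalized lifts and the comparison of two towers. -/

namespace CScheme
open SymmetricAlgebra

variable {V : Scheme.{0}} [V.Over specC]

omit [V.Over specC] in
theorem isAffineBasis_id : IsAffineBasis (fun W : V.affineOpens => W) where
  mono h := h
  exists_le b₁ b₂ x U h₁ h₂ h := by
    obtain ⟨W, hW, hx⟩ := exists_affine_le (U := b₁.1 ⊓ b₂.1 ⊓ U) ⟨⟨h₁, h₂⟩, h⟩
    exact ⟨W, hW.trans (inf_le_left.trans inf_le_left), hW.trans (inf_le_left.trans inf_le_right), hx,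
      hW.trans inf_le_right⟩

namespace NormalizedLift

variable {n : ℕ} {T : PoissonTower V (n + 1)} {U : V.Opens} {τ : LocalTriv T n U} (β : NormalizedLift τ)

theorem red (W : V.affineOpens) (hW : W.1 ≤ U) (s : SymT V W.1) :
    onSec (T.red (n + 1)) W.1 (β.β W hW (jet V (n + 1) s)) = zeroSec s := by
  rw [T.red_succ n (Nat.lt_succ_self n)]
  exact (congrArg (onSec (T.red n) W.1) (β.proj W hW s)).trans (τ.red_α (Nat.le_succ n) n le_rfl W hW s)

/-- The lift preserves all brackets. -/
def IsPoisson : Prop := ∀ (W : V.affineOpens) (hW : W.1 ≤ U) (s t : SymT V W.1),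
  T.bracket n W.1 (β.β W hW (jet V (n + 1) s)) (β.β W hW (jet V (n + 1) t)) =
    τ.α n le_rfl W hW (jet V n (cotBracket s t))

theorem symm_res (W W' : V.affineOpens) (hW : W.1 ≤ U) (h : W'.1 ≤ W.1) (a : sec (T.A (n + 1)) W.1) (s : SymT V W.1)
    (hs : (β.β W hW).symm a = jet V (n + 1) s) :
    (β.β W' (h.trans hW)).symm (rs (T.A (n + 1)) h a) = jet V (n + 1) (symRes h s) := by
  rw [RingEquiv.symm_apply_eq] at hs ⊢
  rw [hs]
  exact (β.res W W' hW h s).symm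

variable [Smooth (V ↘ specC)]

/-- The normalization fixes all brackets in which one entry lies in the ideal of the zero section;
only brackets of two functions may fail to be preserved. This is exactly what makes differences of
normalized lifts into derivations of `O_V`. -/
theorem br_of_zeroSec_eq_zero (W : V.affineOpens) (hW : W.1 ≤ U) (s t : SymT V W.1) (hs : zeroSec s = 0) :
    T.bracket n W.1 (β.β W hW (jet V (n + 1) s)) (β.β W hW (jet V (n + 1) t)) =
      τ.α n le_rfl W hW (jet V n (cotBracket s t)) := by
  obtain ⟨N, f, x, hfx⟩ := exists_isDualBasis W
  have := (towerExt τ W hW).br_of_mem_augIdeal hfx (β := (β.β W hW).toRingHom.comp (Ideal.Quotient.mk _))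
    (fun s => (RingEquiv.symm_apply_eq (τ.α n le_rfl W hW)).2 (β.proj W hW s))
    (fun y g => (RingEquiv.symm_apply_eq (τ.α n le_rfl W hW)).2 (β.vec_fun W hW y g))
    (fun s => β.incl W hW s) (a := s) hs t
  exact (RingEquiv.symm_apply_eq (τ.α n le_rfl W hW)).1 this

set_option maxHeartbeats 1000000 in
/-- Local lifts preserving all brackets exist. -/
theorem exists_isPoisson (U : V.affineOpens) (τ : LocalTriv T n U.1) : ∃ β : NormalizedLift τ, β.IsPoisson := by
  obtain ⟨β, hβ, hr⟩ := exists_isPoissonLift_family (n := n) (fun W : {W : V.affineOpens // W.1 ≤ U.1} => W.1)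
    (fun h => h) (fun W => sec (T.A (n + 1)) W.1.1) (fun W => towerExt τ W.1 W.2)
    (fun {W W'} h => rs (T.A (n + 1)) h) ⟨U, le_rfl⟩ (fun b => b.2) (fun h h' a => rs_rs _ h h' a)
    (fun {W W'} h a s ha => (RingEquiv.symm_apply_eq (τ.α n le_rfl W'.1 W'.2)).2
      ((rs_app (T.proj n) h a).symm.trans ((congrArg (rs (T.A n) h) (eq_α_of_symm_eq τ ha)).trans
        (τ.res n le_rfl W.1 W'.1 W.2 h s).symm)))
    (fun {W W'} h a a' s ha => (RingEquiv.symm_apply_eq (τ.α n le_rfl W'.1 W'.2)).2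
      ((T.bracket_res n (Nat.lt_succ_self n) W.1.1 W'.1.1 h a a').trans
        ((congrArg (rs (T.A n) h) (eq_α_of_symm_eq τ ha)).trans (τ.res n le_rfl W.1 W'.1 W.2 h s).symm)))
    (fun h c => rs_rs _ _ _ _)
  let e (W : V.affineOpens) (hW : W.1 ≤ U.1) := (towerExt τ W hW).jetEquiv (hβ ⟨W, hW⟩).proj (hβ ⟨W, hW⟩).incl
  have he : ∀ W hW s, e W hW (jet V (n + 1) s) = β ⟨W, hW⟩ s := fun W hW s => rfl
  have hbr : ∀ (W : V.affineOpens) (hW : W.1 ≤ U.1) (s t : SymT V W.1),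
      T.bracket n W.1 (e W hW (jet V (n + 1) s)) (e W hW (jet V (n + 1) t)) =
        τ.α n le_rfl W hW (jet V n (cotBracket s t)) := fun W hW s t =>
    eq_α_of_symm_eq τ ((hβ ⟨W, hW⟩).br s t)
  refine ⟨⟨e, fun W W' hW h s => ?_, fun W hW c => (hβ ⟨W, hW⟩).const c, fun W hW s => (hβ ⟨W, hW⟩).incl s,
    fun W hW s => eq_α_of_symm_eq τ ((hβ ⟨W, hW⟩).proj s), fun W hW D f => ?_⟩, hbr⟩
  · exact hr (b := ⟨W, hW⟩) (b' := ⟨W', h.trans hW⟩) h s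
  · exact (hbr W hW _ _).trans (congrArg (fun x => τ.α n le_rfl W hW (jet V n x)) (poisson_vec_fun D f))

end NormalizedLift

section System

variable {n : ℕ}

theorem red_surjective [Smooth (V ↘ specC)] {N : ℕ} (T : PoissonTower V N) (l : ℕ) (hl : l ≤ N) (W : V.affineOpens) :
    Function.Surjective (onSec (T.red l) W.1) := by
  induction l with
  | zero => exact (T.red_zero_bijective W.1).2
  | succ l ih =>
    rw [T.red_succ l hl]
    exact (ih (Nat.le_of_succ_le hl)).comp (T.proj_surjective_affine hl W)

/-- The last step of a tower. -/
def towerStep (T : PoissonTower V (n + 1)) (W : V.affineOpens) :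
    PoissonStep Γ(V, W.1) (TX V W.1) n (sec (T.A (n + 1)) W.1) (sec (T.A n) W.1) where
  red := onSec (T.red (n + 1)) W.1
  incl := T.incl (n + 1) W
  inclB := T.incl n W
  br := T.bracket n W.1
  incl_injective := T.incl_injective (n + 1) le_rfl W
  inclB_injective := T.incl_injective n (Nat.le_succ n) W
  red_incl s := by
    rw [T.red_succ n (Nat.lt_succ_self n)]
    exact (congrArg (onSec (T.red n) W.1) (T.proj_incl (Nat.lt_succ_self n) W s)).trans (map_zero _)
  incl_smul a s := T.incl_smul (n + 1) le_rfl W a s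
  br_skew a b := by
    have := T.bracket_self n (Nat.lt_succ_self n) W.1 (a + b)
    rw [map_add, map_add, AddMonoidHom.add_apply, AddMonoidHom.add_apply,
      T.bracket_self n (Nat.lt_succ_self n), T.bracket_self n (Nat.lt_succ_self n), zero_add, add_zero] at this
    exact eq_neg_of_add_eq_zero_right this
  br_incl s a := T.bracket_incl n (Nat.lt_succ_self n) W s a

/-- The comparison of two towers with the same lower part. -/
def towerSystem [Smooth (V ↘ specC)] (T T' : PoissonTower V (n + 1)) (φ : T.A n ≅ T'.A n)
    (hφ : ∀ (W : V.affineOpens) a, onSec (T'.red n) W.1 (onSec φ.hom W.1 a) = onSec (T.red n) W.1 a) :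
    ComparisonSystem (isAffineBasis_id (V := V)) n (fun W => sec (T.A (n + 1)) W.1)
      (fun W => sec (T'.A (n + 1)) W.1) (fun W => sec (T'.A n) W.1) (fun W => sec (T'.A n) W.1) where
  resA h := rs (T.A (n + 1)) h
  resA' h := rs (T'.A (n + 1)) h
  red W := onSec (T.red (n + 1)) W.1
  const W c := rs (T.A (n + 1)) le_top (T.const (n + 1) c)
  const' W c := rs (T'.A (n + 1)) le_top (T'.const (n + 1) c)
  step W := towerStep T' W
  p W a := onSec φ.hom W.1 (onSec (T.proj n) W.1 a)
  p' W := (onSec (T'.proj n) W.1).toAddMonoidHom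
  br W a b := onSec φ.hom W.1 (T.bracket n W.1 a b)
  red_surjective W := red_surjective T (n + 1) le_rfl W
  red_res h a := (rs_app (T.red (n + 1)) h a).symm
  red_const W c := by
    have key : ∀ l ≤ n + 1, onSec (T.red l) ⊤ (T.const l c) = algebraMap ℂ Γ(V, ⊤) c := by
      intro l hl
      induction l with
      | zero => exact T.red_const c
      | succ l ih =>
        rw [T.red_succ l hl]
        exact (congrArg (onSec (T.red l) ⊤) (T.proj_const l hl c)).trans (ih (Nat.le_of_succ_le hl))
    exact (rs_app (T.red (n + 1)) le_top _).symm.trans ((congrArg _ (key (n + 1) le_rfl)).trans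
      (fres_algebraMap (V := V) (le_top : W.1 ≤ ⊤) c))
  step_red_eq W a a' h := by
    change onSec (T'.red (n + 1)) W.1 a' = onSec (T.red (n + 1)) W.1 a
    rw [T.red_succ n (Nat.lt_succ_self n), T'.red_succ n (Nat.lt_succ_self n)]
    exact (congrArg (onSec (T'.red n) W.1) h).trans (hφ W _)
  incl_res {W W'} h s := (T'.incl_res (n + 1) le_rfl W W' h s).symm
  exact W a := T'.exact n (Nat.lt_succ_self n) W a

end System
end CScheme

namespace CScheme
open SymmetricAlgebra

variable {V : Scheme.{0}} [V.Over specC] {n : ℕ} {T T' : PoissonTower V (n + 1)} {φ : T.A n ≅ T'.A n}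

theorem NormalizedLift.exists_jet {U : V.Opens} {τ : LocalTriv T n U} (β : NormalizedLift τ) (W : V.affineOpens)
    (hW : W.1 ≤ U) (a : sec (T.A (n + 1)) W.1) : ∃ s, a = β.β W hW (jet V (n + 1) s) := by
  obtain ⟨s, hs⟩ := Ideal.Quotient.mk_surjective ((β.β W hW).symm a)
  exact ⟨s, (RingEquiv.symm_apply_eq _).1 hs.symm⟩

/-- In both local trivializations the map to `O_V` is the projection to degree zero, and `φ`
intertwines the trivializations on the cover. -/
theorem onSec_red_eq {ι : Type} {U : ι → V.affineOpens} (hU : ⨆ i, (U i).1 = (⊤ : V.Opens))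
    (τ : ∀ i, LocalTriv T n (U i).1) (τ' : ∀ i, LocalTriv T' n (U i).1)
    (hφ : ∀ (i : ι) (W : V.affineOpens) (hW : W.1 ≤ (U i).1) (s : Jet V n W.1),
      onSec φ.hom W.1 ((τ i).α n le_rfl W hW s) = (τ' i).α n le_rfl W hW s) (W : V.affineOpens)
    (a : sec (T.A n) W.1) : onSec (T'.red n) W.1 (onSec φ.hom W.1 a) = onSec (T.red n) W.1 a := by
  refine rs_ext V.sheaf fun x hx => ?_
  obtain ⟨i, hi⟩ := exists_mem_of_cover hU x
  obtain ⟨W', h, hx⟩ := exists_affine_le (U := W.1 ⊓ (U i).1) ⟨hx, hi⟩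
  refine ⟨W'.1, h.trans inf_le_left, hx, ?_⟩
  rw [rs_app, rs_app, rs_app]
  obtain ⟨s, hs⟩ := Ideal.Quotient.mk_surjective (((τ i).α n le_rfl W' (h.trans inf_le_right)).symm
    (rs (T.A n) (h.trans inf_le_left) a))
  have hs := eq_α_of_symm_eq (τ i) hs.symm
  rw [hs, hφ]
  exact ((τ' i).red_α (Nat.le_succ n) n le_rfl W' _ s).trans ((τ i).red_α (Nat.le_succ n) n le_rfl W' _ s).symm

section

variable [Smooth (V ↘ specC)]
  {hφr : ∀ (W : V.affineOpens) a, onSec (T'.red n) W.1 (onSec φ.hom W.1 a) = onSec (T.red n) W.1 a}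
  {U : V.affineOpens} {τ : LocalTriv T n U.1} {τ' : LocalTriv T' n U.1}

/-- A pair of normalized lifts defines a lift `A_{n+1} → A'_{n+1}`. -/
def NormalizedLift.toLift (hφr : ∀ (W : V.affineOpens) a,
      onSec (T'.red n) W.1 (onSec φ.hom W.1 a) = onSec (T.red n) W.1 a)
    (hφ : ∀ (W : V.affineOpens) (hW : W.1 ≤ U.1) (s : Jet V n W.1),
      onSec φ.hom W.1 (τ.α n le_rfl W hW s) = τ'.α n le_rfl W hW s)
    (β : NormalizedLift τ) (β' : NormalizedLift τ') : (towerSystem T T' φ hφr).Lift (LowerSet.Iic U) where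
  ψ W hW := (β'.β W hW).toRingHom.comp (β.β W hW).symm.toRingHom
  res {W W'} hW h a := by
    obtain ⟨s, hs⟩ := Ideal.Quotient.mk_surjective ((β.β W hW).symm a)
    exact (congrArg (β'.β W' (le_trans h hW)) (β.symm_res W W' hW h a s hs.symm)).trans
      ((β'.res W W' hW h s).trans (congrArg (fun x => rs (T'.A (n + 1)) h (β'.β W hW x)) hs))
  const W hW c := by
    have h := (RingEquiv.symm_apply_eq (β.β W hW)).2 (β.const W hW c).symm
    exact (congrArg (β'.β W hW) h).trans (β'.const W hW c)
  proj W hW a := by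
    obtain ⟨s, rfl⟩ := β.exists_jet W hW a
    have h := (RingEquiv.symm_apply_apply (β.β W hW) (jet V (n + 1) s))
    exact (congrArg (fun x => onSec (T'.proj n) W.1 (β'.β W hW x)) h).trans ((β'.proj W hW s).trans
      ((hφ W hW _).symm.trans (congrArg (onSec φ.hom W.1) (β.proj W hW s).symm)))
  br W hW a a' ha := by
    obtain ⟨s, rfl⟩ := β.exists_jet W hW a
    obtain ⟨t, rfl⟩ := β.exists_jet W hW a'
    have h := (RingEquiv.symm_apply_apply (β.β W hW) (jet V (n + 1) s))
    have h' := (RingEquiv.symm_apply_apply (β.β W hW) (jet V (n + 1) t))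
    have hs : zeroSec s = 0 := (β.red W hW s).symm.trans ha
    exact (congrArg₂ (fun x y => T'.bracket n W.1 (β'.β W hW x) (β'.β W hW y)) h h').trans
      ((β'.br_of_zeroSec_eq_zero W hW s t hs).trans ((hφ W hW _).symm.trans
        (congrArg (onSec φ.hom W.1) (β.br_of_zeroSec_eq_zero W hW s t hs).symm)))

variable
  (hφ : ∀ (W : V.affineOpens) (hW : W.1 ≤ U.1) (s : Jet V n W.1),
      onSec φ.hom W.1 (τ.α n le_rfl W hW s) = τ'.α n le_rfl W hW s)

theorem NormalizedLift.toLift_jet (β : NormalizedLift τ) (β' : NormalizedLift τ') (W : V.affineOpens) (hW : W.1 ≤ U.1)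
    (s : Jet V (n + 1) W.1) : (NormalizedLift.toLift hφr hφ β β').ψ W hW (β.β W hW s) = β'.β W hW s :=
  congrArg (β'.β W hW) (RingEquiv.symm_apply_apply (β.β W hW) s)

theorem NormalizedLift.toLift_isPoisson {β : NormalizedLift τ} {β' : NormalizedLift τ'} (h : β.IsPoisson)
    (h' : β'.IsPoisson) : (NormalizedLift.toLift hφr hφ β β').IsPoisson := by
  intro W hW a a'
  obtain ⟨s, rfl⟩ := β.exists_jet W hW a
  obtain ⟨t, rfl⟩ := β.exists_jet W hW a'
  refine (congrArg₂ (T'.bracket n W.1 · ·) (NormalizedLift.toLift_jet (hφr := hφr) hφ β β' W hW (jet V (n + 1) s))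
    (NormalizedLift.toLift_jet (hφr := hφr) hφ β β' W hW (jet V (n + 1) t))).trans ?_
  exact (h' W hW s t).trans ((hφ W hW _).symm.trans (congrArg (onSec φ.hom W.1) (h W hW s t).symm))

end

section

variable [Smooth (V ↘ specC)] {ι : Type} {U : ι → V.affineOpens} {τ : ∀ i, LocalTriv T n (U i).1}
  {τ' : ∀ i, LocalTriv T' n (U i).1}
  {hφr : ∀ (W : V.affineOpens) a, onSec (T'.red n) W.1 (onSec φ.hom W.1 a) = onSec (T.red n) W.1 a}
  {hφ : ∀ (i : ι) (W : V.affineOpens) (hW : W.1 ≤ (U i).1) (s : Jet V n W.1),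
      onSec φ.hom W.1 ((τ i).α n le_rfl W hW s) = (τ' i).α n le_rfl W hW s}

set_option maxHeartbeats 1000000 in
/-- The cochain of differences of lifts is the cochain of differences of transition maps. -/
theorem isDifference_of_isGivenBy {β : ∀ i, NormalizedLift (τ i)} {β' : ∀ i, NormalizedLift (τ' i)}
    {d : ∀ i j, (tensorSheaf V (n + 1)).obj.obj (op ((U i).1 ⊓ (U j).1))}
    (hd : ∀ i j b hi hj, IsGivenBy (n + 1) (d i j) (le_inf hi hj)
      ((towerSystem T T' φ hφr).diff (fun i => NormalizedLift.toLift hφr (hφ i) (β i) (β' i)) i j b hi hj)) :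
    IsDifference β β' d := by
  intro i j W hi hj
  obtain ⟨t, ht, htD⟩ := hd i j W hi hj
  refine ⟨t, ht, fun s => ?_⟩
  have e := (towerSystem T T' φ hφr).incl_diff (fun i => NormalizedLift.toLift hφr (hφ i) (β i) (β' i)) i j W hi hj
    ((β j).β W hj (jet V (n + 1) s))
  have e₁ : (towerSystem T T' φ hφr).red W ((β j).β W hj (jet V (n + 1) s)) = zeroSec s := (β j).red W hj s
  have e₂ : T'.incl (n + 1) W (tensorDer (n + 1) t (zeroSec s)) =
      (β' i).β W hi (((β i).β W hi).symm ((β j).β W hj (jet V (n + 1) s))) - (β' j).β W hj (jet V (n + 1) s) :=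
    (congrArg (T'.incl (n + 1) W) ((htD _).trans (congrArg _ e₁.symm))).trans (e.trans (congrArg (_ - ·)
      (NormalizedLift.toLift_jet (hφr := hφr) (hφ j) (β j) (β' j) W hj (jet V (n + 1) s))))
  have e₃ := (RingEquiv.symm_apply_eq ((β' i).β W hi)).2 (((β' i).incl W hi (tensorDer (n + 1) t (zeroSec s))).trans e₂).symm
  refine Eq.trans ?_ e₃
  refine ((map_sub ((β' i).β W hi).symm _ _).trans ?_).symm
  exact congrArg (· - _) (RingEquiv.symm_apply_apply ((β' i).β W hi) _)

end

end CScheme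

/-! ### Poisson isomorphisms of thickenings and the obstruction class. -/

namespace CScheme
open SymmetricAlgebra

variable {V : Scheme.{0}} [V.Over specC] {n : ℕ} {T T' : PoissonTower V (n + 1)} {φ : T.A n ≅ T'.A n}

omit [V.Over specC] in
/-- An isomorphism of sheaves of rings on sections. -/
def isoSec {F G : TopCat.Sheaf CommRingCat.{0} V} (f : F ≅ G) (U : V.Opens) : sec F U ≃+* sec G U :=
  RingEquiv.ofRingHom (onSec f.hom U) (onSec f.inv U)
    (RingHom.ext fun a => congrArg (fun g : G ⟶ G => onSec g U a) f.inv_hom_id)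
    (RingHom.ext fun a => congrArg (fun g : F ⟶ F => onSec g U a) f.hom_inv_id)

/-- Composition of a normalized lift with a Poisson isomorphism. -/
def NormalizedLift.comp {U : V.Opens} {τ : LocalTriv T n U} {τ' : LocalTriv T' n U}
    (hφ : ∀ (W : V.affineOpens) (hW : W.1 ≤ U) (s : Jet V n W.1),
      onSec φ.hom W.1 (τ.α n le_rfl W hW s) = τ'.α n le_rfl W hW s) (β : NormalizedLift τ)
    {ψ : T.A (n + 1) ≅ T'.A (n + 1)} (hψ : IsPoissonExtension φ ψ) : NormalizedLift τ' where
  β W hW := (β.β W hW).trans (isoSec ψ W.1)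
  res W W' hW h s := (congrArg (onSec ψ.hom W'.1) (β.res W W' hW h s)).trans (rs_app ψ.hom h _).symm
  const W hW c := (congrArg (onSec ψ.hom W.1) (β.const W hW c)).trans ((rs_app ψ.hom le_top _).symm.trans
    (congrArg (rs (T'.A (n + 1)) le_top) (hψ.const c)))
  incl W hW s := (congrArg (onSec ψ.hom W.1) (β.incl W hW s)).trans (hψ.incl W s)
  proj W hW s := (congrArg (fun g : T.A (n + 1) ⟶ T'.A n => onSec g W.1 (β.β W hW (jet V (n + 1) s))) hψ.proj).trans
    ((congrArg (onSec φ.hom W.1) (β.proj W hW s)).trans (hφ W hW _))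
  vec_fun W hW D f := (hψ.poisson W.1 _ _).symm.trans ((congrArg (onSec φ.hom W.1) (β.vec_fun W hW D f)).trans
    (hφ W hW _))

section Global

variable [Smooth (V ↘ specC)]
  {hφr : ∀ (W : V.affineOpens) a, onSec (T'.red n) W.1 (onSec φ.hom W.1 a) = onSec (T.red n) W.1 a}
  {P : LowerSet V.affineOpens} (hP : ∀ x : V, ∃ W ∈ P, x ∈ W.1)
  (hφi : ∀ W ∈ P, ∀ s, onSec φ.hom W.1 (T.incl n W s) = T'.incl n W s)
  (Ψ : (towerSystem T T' φ hφr).Lift P) (hΨ : Ψ.IsPoisson)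

include hφi hΨ

set_option maxHeartbeats 1000000 in
-- The image of `s` is some `s'` in `Sym^{n+1}`. Since brackets are preserved, `s` and `s'` act in
-- the same way on functions, and an element of positive degree is determined by this action.
theorem lift_incl (W : V.affineOpens) (hW : W ∈ P) (s : SymTn V (n + 1) W.1) :
    Ψ.ψ W hW (T.incl (n + 1) W s) = T'.incl (n + 1) W s := by
  have h₁ : onSec (T'.proj n) W.1 (Ψ.ψ W hW (T.incl (n + 1) W s)) = 0 :=
    (Ψ.proj W hW _).trans ((congrArg (onSec φ.hom W.1) (T.proj_incl (Nat.lt_succ_self n) W s)).trans (map_zero _))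
  obtain ⟨s', hs'⟩ := (T'.exact n (Nat.lt_succ_self n) W _).1 h₁
  rw [← hs']
  obtain ⟨N, f, x, hfx⟩ := exists_isDualBasis W
  refine congrArg _ (hfx.derive_injective n fun g => ?_)
  obtain ⟨b, hb⟩ := red_surjective T (n + 1) le_rfl W g
  refine T'.incl_injective n (Nat.le_succ n) W ?_
  have hr : onSec (T'.red (n + 1)) W.1 (Ψ.ψ W hW b) = g := (Ψ.red W hW b).trans hb
  have e₁ := T'.bracket_incl n (Nat.lt_succ_self n) W s' (Ψ.ψ W hW b)
  have e₂ := T.bracket_incl n (Nat.lt_succ_self n) W s b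
  have e₃ : T'.bracket n W.1 (Ψ.ψ W hW (T.incl (n + 1) W s)) (Ψ.ψ W hW b) =
    onSec φ.hom W.1 (T.bracket n W.1 (T.incl (n + 1) W s) b) := hΨ W hW _ _
  rw [hs', hr] at e₁
  rw [hb] at e₂
  exact e₁.symm.trans (e₃.trans ((congrArg (onSec φ.hom W.1) e₂).trans (hφi W hW _)))

/-- The five lemma: the map is the identity on `Sym^{n+1}` and is induced by the isomorphism `φ` on
the quotient. -/
theorem lift_bijective (W : V.affineOpens) (hW : W ∈ P) : Function.Bijective (Ψ.ψ W hW) := by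
  have hp : ∀ a, onSec (T'.proj n) W.1 (Ψ.ψ W hW a) = onSec φ.hom W.1 (onSec (T.proj n) W.1 a) := Ψ.proj W hW
  constructor
  · refine (injective_iff_map_eq_zero _).2 fun a ha => ?_
    have h₁ := hp a
    rw [ha, map_zero] at h₁
    obtain ⟨s, rfl⟩ := (T.exact n (Nat.lt_succ_self n) W a).1
      ((map_eq_zero_iff _ (isoSec φ W.1).injective).1 h₁.symm)
    have h₂ := (lift_incl hφi Ψ hΨ W hW s).symm.trans ha
    rw [T'.incl_injective (n + 1) le_rfl W (h₂.trans (map_zero _).symm), map_zero]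
  · intro a'
    obtain ⟨y, hy⟩ := (isoSec φ W.1).surjective (onSec (T'.proj n) W.1 a')
    obtain ⟨a, rfl⟩ := T.proj_surjective_affine (Nat.lt_succ_self n) W y
    obtain ⟨s, hs⟩ := (T'.exact n (Nat.lt_succ_self n) W (a' - Ψ.ψ W hW a)).1 (by
      rw [map_sub, hp]
      exact sub_eq_zero.2 hy.symm)
    refine ⟨a + T.incl (n + 1) W s, ?_⟩
    rw [map_add, lift_incl hφi Ψ hΨ W hW s, hs, add_sub_cancel]

include hP

/-- A Poisson lift over all small affine open sets defines an isomorphism of Poisson thickenings. -/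
theorem exists_isPoissonExtension_of_lift : ∃ ψ : T.A (n + 1) ≅ T'.A (n + 1), IsPoissonExtension φ ψ := by
  obtain ⟨ψ, hψ⟩ := exists_sheafIso hP Ψ.ψ (fun W W' hW h a => Ψ.res hW h a) (lift_bijective hφi Ψ hΨ)
  refine ⟨ψ, ⟨fun c => rs_ext_of_mem hP fun W hW h => ?_, sheafHom_ext_of_mem hP fun W hW a => ?_,
    fun W s => rs_ext_of_mem hP fun W' hW' h => ?_, fun U a b => rs_ext_of_mem hP fun W hW h => ?_⟩⟩
  · rw [rs_app, hψ W hW]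
    exact Ψ.const W hW c
  · refine (congrArg (onSec (T'.proj n) W.1) (hψ W hW a)).trans ?_
    exact Ψ.proj W hW a
  · have e₁ := T.incl_res (n + 1) le_rfl W W' h s
    have e₂ := T'.incl_res (n + 1) le_rfl W W' h s
    rw [rs_app, ← e₂, ← e₁, hψ W' hW']
    exact lift_incl hφi Ψ hΨ W' hW' _
  · have e₁ := T.bracket_res n (Nat.lt_succ_self n) U W.1 h a b
    have e₂ := T'.bracket_res n (Nat.lt_succ_self n) U W.1 h (onSec ψ.hom U a) (onSec ψ.hom U b)
    rw [rs_app, ← e₁, ← e₂, rs_app, rs_app, hψ W hW, hψ W hW]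
    exact (hΨ W hW _ _).symm

end Global

/-- The obstruction to extending an isomorphism of towers of Poisson thickenings. -/
theorem exists_obstruction_class [Smooth (V ↘ specC)] (T T' : PoissonTower V (n + 1)) {ι : Type}
    (U : ι → V.affineOpens) (hU : ⨆ i, (U i).1 = (⊤ : V.Opens)) (τ : ∀ i, LocalTriv T n (U i).1)
    (τ' : ∀ i, LocalTriv T' n (U i).1) (φ : T.A n ≅ T'.A n)
    (hφ : ∀ (i : ι) (W : V.affineOpens) (hW : W.1 ≤ (U i).1) (s : Jet V n W.1),
      onSec φ.hom W.1 ((τ i).α n le_rfl W hW s) = (τ' i).α n le_rfl W hW s) :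
    ∃ ξ : Sheaf.H.{0} (tensorSheaf V (n + 1)) 1,
      (∀ (β : ∀ i, NormalizedLift (τ i)) (β' : ∀ i, NormalizedLift (τ' i)),
        ∃ d, IsDifference β β' d ∧ ∀ ξ' : Sheaf.H.{0} (tensorSheaf V (n + 1)) 1,
          IsCechClass (fun i => (U i).1) d ξ' ↔ ξ' = ξ) ∧
      (ξ = 0 ↔ ∃ ψ : T.A (n + 1) ≅ T'.A (n + 1), IsPoissonExtension φ ψ) := by
  have hφr := onSec_red_eq hU τ τ' hφ
  -- Lifts preserving all brackets serve as reference for defining `ξ`. The class does not depend on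
  -- the lifts, but the splitting by potentials needs the closedness of these particular
  -- differences.
  choose β₀ hβ₀ using fun i => NormalizedLift.exists_isPoisson (U i) (τ i)
  choose β₀' hβ₀' using fun i => NormalizedLift.exists_isPoisson (U i) (τ' i)
  let L (β : ∀ i, NormalizedLift (τ i)) (β' : ∀ i, NormalizedLift (τ' i)) (i : ι) :=
    NormalizedLift.toLift hφr (hφ i) (β i) (β' i)
  obtain ⟨d₀, hd₀⟩ := (towerSystem T T' φ hφr).exists_cochain (L β₀ β₀')
  obtain ⟨ξ, hξ⟩ := exists_isCechClass_iff hU ((towerSystem T T' φ hφr).isCocycle_of_isGivenBy hd₀)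
  have key : ∀ β β' d, (∀ i j b hi hj, IsGivenBy (n + 1) (d i j) (le_inf hi hj)
      ((towerSystem T T' φ hφr).diff (L β β') i j b hi hj)) →
      ∀ ξ', IsCechClass (fun i => (U i).1) d ξ' ↔ ξ' = ξ := by
    intro β β' d hd ξ'
    obtain ⟨η, hη⟩ := exists_isCechClass_iff hU ((towerSystem T T' φ hφr).isCocycle_of_isGivenBy hd)
    have h₁ := (towerSystem T T' φ hφr).isCechClass_of_isCechClass hd₀ hd ((hξ ξ).2 rfl)
    rw [hη, (hη ξ).1 h₁]
  refine ⟨ξ, fun β β' => ?_, fun h => ?_, ?_⟩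
  · obtain ⟨d, hd⟩ := (towerSystem T T' φ hφr).exists_cochain (L β β')
    exact ⟨d, isDifference_of_isGivenBy hd, key β β' d hd⟩
  · let P : LowerSet V.affineOpens := ⟨{W | ∃ i, W ≤ U i}, fun W W' h ⟨i, hi⟩ => ⟨i, h.trans hi⟩⟩
    obtain ⟨Ψ, hΨ⟩ := (towerSystem T T' φ hφr).exists_global_lift hd₀
      (fun i => NormalizedLift.toLift_isPoisson (hφ i) (hβ₀ i) (hβ₀' i)) ((hξ 0).2 h.symm) (P := P) fun b hb => hb
    refine exists_isPoissonExtension_of_lift (fun x => ?_) (fun W hW s => ?_) Ψ hΨ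
    · obtain ⟨i, hi⟩ := exists_mem_of_cover hU x
      exact ⟨U i, ⟨i, le_rfl⟩, hi⟩
    · obtain ⟨i, hi⟩ := hW
      rw [← (τ i).incl n le_rfl W hi, ← (τ' i).incl n le_rfl W hi]
      exact hφ i W hi _
  · rintro ⟨ψ, hψ⟩
    -- Given a global isomorphism `ψ`, its composites with the `β₀ i` are normalized lifts for the
    -- second tower. With this choice every comparison lift is `ψ` itself, so the cochain is zero.
    obtain ⟨d, hd⟩ := (towerSystem T T' φ hφr).exists_cochain (L β₀ fun i => (β₀ i).comp (hφ i) hψ)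
    have h₁ := (towerSystem T T' φ hφr).cochain_eq_zero hd fun i j W hi hj a => by
      have h : ∀ i (hi : W ≤ U i), (L β₀ (fun i => (β₀ i).comp (hφ i) hψ) i).ψ W hi a = onSec ψ.hom W.1 a := fun i hi =>
        congrArg (onSec ψ.hom W.1) (((β₀ i).β W hi).apply_symm_apply a)
      exact (h i hi).trans (h j hj).symm
    have h₂ := key _ _ d hd
    have h₃ : d = fun i j => 0 := funext fun i => funext fun j => h₁ i j
    exact ((h₂ 0).1 (h₃ ▸ isCechClass_zero hU)).symm

end CScheme

/-! ### Leading terms along a Lagrangian, in algebraic form. -/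

namespace SymmetricAlgebra

variable {R L S : Type} [CommRing R] [LieRing L] [Module R L] [LieRingModule L R]
  [LieRinehartRing R L] [Algebra ℂ R] [CommRing S] [Algebra ℂ S]

variable (R L S) in
/-- A Poisson algebra `S` with a surjection onto `R` whose kernel `I` is closed under the bracket and
such that the bracket identifies `I / I²` with `L`. -/
structure LagrangianPair where
  π : S →+* R
  br : S →+ S →+ S
  π_surjective : Function.Surjective π
  π_const : ∀ c, π (algebraMap ℂ S c) = algebraMap ℂ R c
  br_self : ∀ a, br a a = 0
  br_mul : ∀ a b c, br (a * b) c = a * br b c + b * br a c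
  br_const : ∀ c a, br (algebraMap ℂ S c) a = 0
  jacobi : ∀ a b c, br (br a b) c + br (br b c) a + br (br c a) b = 0
  exists_vec : ∀ x : L, ∃ u, π u = 0 ∧ ∀ g, π (br u g) = ⁅x, π g⁆
  exists_lie : ∀ u, π u = 0 → ∃ x : L, ∀ g, π (br u g) = ⁅x, π g⁆
  mem_sq : ∀ u, π u = 0 → (∀ g, π (br u g) = 0) → u ∈ RingHom.ker π ^ 2

namespace LagrangianPair

variable (Q : LagrangianPair R L S)

/-- The ideal of the Lagrangian. -/
abbrev ideal : Ideal S := RingHom.ker Q.π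

omit [Module R L] [LieRinehartRing R L] in
theorem br_skew (a b : S) : Q.br a b = - Q.br b a := by
  have := Q.br_self (a + b)
  rw [map_add, map_add, AddMonoidHom.add_apply, AddMonoidHom.add_apply, Q.br_self, Q.br_self,
    zero_add, add_zero] at this
  exact eq_neg_of_add_eq_zero_right this

omit [Module R L] [LieRinehartRing R L] in
theorem br_mem_pow (l : ℕ) {f : S} (hf : f ∈ Q.ideal ^ (l + 1)) (g : S) : Q.br f g ∈ Q.ideal ^ l := by
  induction l generalizing f with
  | zero => rw [pow_zero, Ideal.one_eq_top]; trivial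
  | succ l ih =>
    rw [pow_succ'] at hf
    induction hf using Submodule.mul_induction_on' with
    | mem_mul_mem u hu f hf =>
      rw [Q.br_mul]
      refine add_mem ?_ ?_
      · rw [pow_succ']
        exact Ideal.mul_mem_mul hu (ih hf)
      · exact Ideal.mul_mem_right _ _ hf
    | add a _ b _ ha hb => rw [map_add]; exact add_mem ha hb

/-- The derivation `{-, g}`. -/
def brDer (g : S) : Derivation ℤ S S :=
  Derivation.mk' (AddMonoidHom.mk' (fun f => Q.br f g) fun a b => by
    rw [map_add]; rfl).toIntLinearMap fun a b => Q.br_mul a b g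

variable {N : ℕ} {f : Fin N → R} {x : Fin N → L} (h : IsDualBasis R L f x)

include h in
/-- An Euler derivation along the Lagrangian. -/
theorem exists_euler : ∃ E : Derivation ℤ S S, (∀ u, Q.π u = 0 → E u - u ∈ Q.ideal ^ 2) ∧
    ∀ (l : ℕ) (s : S), (∀ g, Q.br s g ∈ Q.ideal ^ l) → E s ∈ Q.ideal ^ (l + 1) := by
  choose u hu hux using fun k => Q.exists_vec (x k)
  choose f' hf' using fun k => Q.π_surjective (f k)
  have hE : ∀ s, (∑ k, u k • Q.brDer (f' k)) s = ∑ k, u k * Q.br s (f' k) := fun s => by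
    rw [← Derivation.coeFnAddMonoidHom_apply, map_sum, Finset.sum_apply]
    rfl
  -- The Euler formula transported to `S`: each `u k` in `I` represents `x k`, and `f' k` lifts `f
  -- k`. On `I / I²`, which the bracket embeds into `L`, this derivation is the identity by `y = ∑ y
  -- (f k) • x k`.
  refine ⟨∑ k, u k • Q.brDer (f' k), fun v hv => ?_, fun l s hs => ?_⟩
  · obtain ⟨y, hy⟩ := Q.exists_lie v hv
    rw [hE]
    refine Q.mem_sq _ ?_ fun g => ?_
    · rw [map_sub, hv, sub_zero, map_sum]
      exact Finset.sum_eq_zero fun k _ => by rw [map_mul, hu, zero_mul]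
    · have h₁ : ∀ k, Q.π (Q.br (u k * Q.br v (f' k)) g) = ⁅y, f k⁆ * ⁅x k, Q.π g⁆ := fun k => by
        rw [Q.br_mul, map_add, map_mul, map_mul, hu, zero_mul, zero_add, hux, hy, hf']
      rw [map_sub, map_sum, AddMonoidHom.sub_apply, AddMonoidHom.finsetSum_apply, map_sub, map_sum, hy,
        Finset.sum_congr rfl fun k _ => h₁ k]
      have h₂ : ∀ a : Fin N → R, ⁅∑ k, a k • x k, Q.π g⁆ = ∑ k, a k * ⁅x k, Q.π g⁆ := fun a => by
        rw [show ⁅∑ k, a k • x k, Q.π g⁆ = (AddMonoidHom.mk' (fun z : L => ⁅z, Q.π g⁆) fun z w => add_lie z w _)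
          (∑ k, a k • x k) from rfl, map_sum]
        exact Finset.sum_congr rfl fun k _ => LieRinehartRing.lie_smul_eq_mul _ _ _
      have h₃ := h₂ fun k => ⁅y, f k⁆
      conv at h₃ => lhs; rw [← h.vec y]
      rw [← h₃]
      exact sub_self _
  · rw [hE]
    refine sum_mem fun k _ => ?_
    rw [pow_succ']
    exact Ideal.mul_mem_mul (hu k) (hs _)

omit [LieRing L] [Module R L] [LieRingModule L R] [LieRinehartRing R L] [Algebra ℂ S] in
-- By the Leibniz rule a derivation that is the identity on `I / I²` is multiplication by `l` on
-- `I^l / I^{l+1}` for `l ≥ 1`. The hypothesis says nothing about `E` outside `I`, so `l = 0` is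
-- excluded.
theorem _root_.Derivation.sub_nsmul_mem_pow {E : Derivation ℤ S S} {I : Ideal S}
    (hE : ∀ u ∈ I, E u - u ∈ I ^ 2) (l : ℕ) {s : S} (hs : s ∈ I ^ l) :
    E s - l • s ∈ I ^ (l + 1) ∨ l = 0 := by
  cases l with
  | zero => exact Or.inr rfl
  | succ l =>
    refine Or.inl ?_
    induction l generalizing s with
    | zero =>
      rw [zero_add, pow_one] at hs
      rw [zero_add, one_smul]
      exact hE s hs
    | succ l ih =>
      rw [pow_succ'] at hs
      induction hs using Submodule.mul_induction_on' with
      | mem_mul_mem u hu f hf =>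
        have h₁ : E (u * f) - (l + 1 + 1) • (u * f) =
            u * (E f - (l + 1) • f) + (E u - u) * f := by
          rw [Derivation.leibniz, smul_eq_mul, smul_eq_mul]
          simp only [nsmul_eq_mul]
          push_cast
          ring
        rw [h₁]
        refine add_mem ?_ ?_
        · rw [pow_succ']
          exact Ideal.mul_mem_mul hu (ih hf)
        · rw [show l + 1 + 1 + 1 = 2 + (l + 1) by ring, pow_add]
          exact Ideal.mul_mem_mul (hE u hu) hf
      | add a _ b _ ha hb =>
        rw [map_add, smul_add, add_sub_add_comm]
        exact add_mem ha hb

include h in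
-- Under this hypothesis the Euler derivation sends `s` into the power `l + 2`, while it is
-- congruent to `(l + 1) • s` modulo the same power; and `l + 1` is invertible.
theorem mem_pow_succ (l : ℕ) {s : S} (hs : s ∈ Q.ideal ^ (l + 1))
    (hb : ∀ g, Q.br s g ∈ Q.ideal ^ (l + 1)) : s ∈ Q.ideal ^ (l + 2) := by
  obtain ⟨E, hE, hE'⟩ := Q.exists_euler h
  have h₁ := (E.sub_nsmul_mem_pow hE _ hs).resolve_right l.succ_ne_zero
  have h₂ : (l + 1) • s ∈ Q.ideal ^ (l + 2) := by
    rw [← sub_sub_cancel (E s) ((l + 1) • s)]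
    exact sub_mem (hE' _ _ hb) h₁
  have h₃ : s = algebraMap ℂ S ((l + 1 : ℕ) : ℂ)⁻¹ * ((l + 1) • s) := by
    rw [nsmul_eq_mul, ← map_natCast (algebraMap ℂ S), ← mul_assoc, ← map_mul,
      inv_mul_cancel₀ (Nat.cast_ne_zero.2 l.succ_ne_zero), map_one, one_mul]
  rw [h₃]
  exact Ideal.mul_mem_left _ _ h₂

/-- The element `s` of `Sym^l L` is the leading term of `f ∈ I ^ l`. -/
def IsSymbol : ℕ → S → SymmetricAlgebra R L → Prop
  | 0, f, s => s = algebraMap R _ (Q.π f)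
  | l + 1, f, s => f ∈ Q.ideal ^ (l + 1) ∧ s ∈ symPow R L (l + 1) ∧
      ∀ g, IsSymbol l (Q.br f g) (poisson R L s (algebraMap R _ (Q.π g)))

namespace IsSymbol

variable {Q} {l : ℕ} {a b : S} {s t : SymmetricAlgebra R L}

theorem mem_pow (hs : Q.IsSymbol l a s) : a ∈ Q.ideal ^ l := by
  cases l with
  | zero => rw [pow_zero, Ideal.one_eq_top]; trivial
  | succ l => exact hs.1

theorem mem_symPow (hs : Q.IsSymbol l a s) : s ∈ symPow R L l := by
  cases l with
  | zero => rw [show s = _ from hs]; exact algebraMap_mem_symPow_zero _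
  | succ l => exact hs.2.1

theorem zero_of_mem (ha : a ∈ Q.ideal ^ (l + 1)) : Q.IsSymbol l a (0 : SymmetricAlgebra R L) := by
  induction l generalizing a with
  | zero =>
    rw [zero_add, pow_one] at ha
    change 0 = algebraMap R _ (Q.π a)
    rw [show Q.π a = 0 from ha, map_zero]
  | succ l ih =>
    refine ⟨Ideal.pow_le_pow_right (Nat.le_succ _) ha, zero_mem _, fun g => ?_⟩
    rw [map_zero]
    exact ih (Q.br_mem_pow _ ha g)

theorem add (hs : Q.IsSymbol l a s) (ht : Q.IsSymbol l b t) : Q.IsSymbol l (a + b) (s + t) := by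
  induction l generalizing a b s t with
  | zero =>
    change s + t = algebraMap R _ (Q.π (a + b))
    rw [map_add, map_add, ← show s = _ from hs, ← show t = _ from ht]
  | succ l ih =>
    refine ⟨add_mem hs.1 ht.1, add_mem hs.2.1 ht.2.1, fun g => ?_⟩
    rw [map_add, poisson_add_left]
    exact ih (hs.2.2 g) (ht.2.2 g)

theorem mul (hs : Q.IsSymbol l a s) (r : S) : Q.IsSymbol l (r * a) (Q.π r • s) := by
  induction l generalizing a s with
  | zero =>
    change _ = algebraMap R _ (Q.π (r * a))
    rw [map_mul, map_mul, ← show s = _ from hs, Algebra.smul_def]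
  | succ l ih =>
    refine ⟨Ideal.mul_mem_left _ _ hs.1, Submodule.smul_mem _ _ hs.2.1, fun g => ?_⟩
    rw [Q.br_mul, Algebra.smul_def, poisson_mul_left, poisson_fun_fun, mul_zero, add_zero,
      ← Algebra.smul_def, ← add_zero (Q.π r • _)]
    exact (ih (hs.2.2 g)).add (zero_of_mem (Ideal.mul_mem_right _ _ hs.1))

theorem neg (hs : Q.IsSymbol l a s) : Q.IsSymbol l (-a) (-s) := by
  have := hs.mul (-1)
  rwa [map_neg, map_one, neg_smul, one_smul, neg_one_mul] at this

theorem sub (hs : Q.IsSymbol l a s) (ht : Q.IsSymbol l b t) : Q.IsSymbol l (a - b) (s - t) := by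
  rw [sub_eq_add_neg, sub_eq_add_neg]
  exact hs.add ht.neg

include h in
-- All brackets of `a` with functions have symbol zero as well, so induction puts them one power
-- deeper, and the Euler derivation of `S` transfers this to `a`. With `eq_zero`, which uses Euler's
-- formula in `Sym`, it identifies `I^l / I^{l+1}` with `Sym^l L`.
theorem mem_of_zero (hs : Q.IsSymbol l a (0 : SymmetricAlgebra R L)) : a ∈ Q.ideal ^ (l + 1) := by
  induction l generalizing a with
  | zero =>
    rw [zero_add, pow_one]
    have h₀ : (0 : SymmetricAlgebra R L) = algebraMap R _ (Q.π a) := hs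
    have h₁ := algebraMapInv_algebraMap (L := L) (Q.π a)
    rw [← h₀, map_zero] at h₁
    exact h₁.symm
  | succ l ih =>
    refine Q.mem_pow_succ h l hs.1 fun g => ih ?_
    have := hs.2.2 g
    rwa [map_zero] at this

include h in
theorem eq_zero (hs : Q.IsSymbol l a s) (ha : a ∈ Q.ideal ^ (l + 1)) : s = 0 := by
  induction l generalizing a s with
  | zero =>
    rw [zero_add, pow_one] at ha
    rw [show s = _ from hs, show Q.π a = 0 from ha, map_zero]
  | succ l ih =>
    refine h.eq_zero_of_derive l hs.2.1 fun k => ?_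
    obtain ⟨g, hg⟩ := Q.π_surjective (f k)
    rw [← hg]
    exact ih (hs.2.2 g) (Q.br_mem_pow _ ha g)

include h in
theorem unique (hs : Q.IsSymbol l a s) (ht : Q.IsSymbol l a t) : s = t := by
  refine sub_eq_zero.1 ((hs.sub ht).eq_zero h ?_)
  rw [sub_self]
  exact zero_mem _

/-- Symbols are multiplicative because both brackets obey the Leibniz rule; this is how symbols of
products of elements of `I`, and elements with given symbols, are produced. -/
theorem ι_mul (hs : Q.IsSymbol l a s) {u : S} (hu : Q.π u = 0) {x : L}
    (hux : ∀ g, Q.π (Q.br u g) = ⁅x, Q.π g⁆) : Q.IsSymbol (l + 1) (u * a) (ι R L x * s) := by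
  induction l generalizing a s with
  | zero =>
    refine ⟨?_, ι_mul_mem_symPow x hs.mem_symPow, fun g => ?_⟩
    · change u * a ∈ Q.ideal ^ 1
      rw [pow_one]
      exact Ideal.mul_mem_right _ _ hu
    · change _ = algebraMap R _ (Q.π (Q.br (u * a) g))
      rw [Q.br_mul, poisson_mul_left, poisson_vec_fun, show s = _ from hs, poisson_fun_fun, mul_zero,
        zero_add, map_add, map_mul, hu, zero_mul, zero_add, map_mul, hux, map_mul]
  | succ l ih =>
    refine ⟨?_, ι_mul_mem_symPow x hs.mem_symPow, fun g => ?_⟩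
    · rw [pow_succ']
      exact Ideal.mul_mem_mul hu hs.1
    · rw [Q.br_mul, poisson_mul_left, poisson_vec_fun, mul_comm s, ← Algebra.smul_def, ← hux,
        mul_comm a]
      exact (ih (hs.2.2 g)).add (hs.mul _)

variable (Q) in
theorem exists_of_mem_pow (l : ℕ) {a : S} (ha : a ∈ Q.ideal ^ l) :
    ∃ s : SymmetricAlgebra R L, Q.IsSymbol l a s := by
  induction l generalizing a with
  | zero => exact ⟨_, rfl⟩
  | succ l ih =>
    rw [pow_succ'] at ha
    induction ha using Submodule.mul_induction_on' with
    | mem_mul_mem u hu a ha =>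
      obtain ⟨s, hs⟩ := ih ha
      obtain ⟨x, hx⟩ := Q.exists_lie u hu
      exact ⟨_, hs.ι_mul hu hx⟩
    | add a _ b _ ha hb =>
      obtain ⟨s, hs⟩ := ha
      obtain ⟨t, ht⟩ := hb
      exact ⟨_, hs.add ht⟩

variable (Q) in
theorem exists_of_mem_symPow (l : ℕ) {s : SymmetricAlgebra R L} (hs : s ∈ symPow R L l) :
    ∃ a, Q.IsSymbol l a s := by
  induction l generalizing s with
  | zero =>
    obtain ⟨r, rfl⟩ := mem_symPow_zero.1 hs
    obtain ⟨a, rfl⟩ := Q.π_surjective r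
    exact ⟨a, rfl⟩
  | succ l ih =>
    induction hs using symPow_succ_induction with
    | mul x t ht =>
      obtain ⟨a, ha⟩ := ih ht
      obtain ⟨u, hu, hux⟩ := Q.exists_vec x
      exact ⟨_, ha.ι_mul hu hux⟩
    | add s t _ _ hs ht =>
      obtain ⟨a, ha⟩ := hs
      obtain ⟨b, hb⟩ := ht
      exact ⟨_, ha.add hb⟩

end IsSymbol
end LagrangianPair
end SymmetricAlgebra

/-! ### Infinitesimal neighbourhoods of a Lagrangian as Poisson extensions. -/

namespace SymmetricAlgebra

variable {R L S : Type} [CommRing R] [LieRing L] [Module R L] [LieRingModule L R]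
  [LieRinehartRing R L] [Algebra ℂ R] [CommRing S] [Algebra ℂ S]

namespace LagrangianPair

variable (Q : LagrangianPair R L S)

/-- The isomorphism `φ` of the `n`-th infinitesimal neighbourhoods of the Lagrangian and of the zero section of
the cotangent bundle is compatible with constants, leading terms and brackets. -/
structure IsJetIso (n : ℕ)
    (φ : (S ⧸ Q.ideal ^ (n + 1)) ≃+* SymmetricAlgebra R L ⧸ augIdeal R L ^ (n + 1)) : Prop where
  const : ∀ c, φ (Ideal.Quotient.mk _ (algebraMap ℂ S c)) =
    Ideal.Quotient.mk _ (algebraMap R _ (algebraMap ℂ R c))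
  base : ∀ f s, φ (Ideal.Quotient.mk _ f) = Ideal.Quotient.mk _ s → algebraMapInv s = Q.π f
  symbol : ∀ f s, Q.IsSymbol n f s → φ (Ideal.Quotient.mk _ f) = Ideal.Quotient.mk _ s
  bracket : ∀ f g s t u, φ (Ideal.Quotient.mk _ f) = Ideal.Quotient.mk _ s →
    φ (Ideal.Quotient.mk _ g) = Ideal.Quotient.mk _ t →
    φ (Ideal.Quotient.mk _ (Q.br f g)) = Ideal.Quotient.mk _ u →
    u - poisson R L s t ∈ augIdeal R L ^ n

/-- The isomorphism `S / I ≃ R ≃ Sym L / Sym^{≥ 1} L`. -/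
def jetIsoZero : (S ⧸ Q.ideal ^ (0 + 1)) ≃+* SymmetricAlgebra R L ⧸ augIdeal R L ^ (0 + 1) :=
  RingEquiv.ofBijective (Ideal.Quotient.lift _
    ((Ideal.Quotient.mk (augIdeal R L ^ (0 + 1))).comp ((algebraMap R _).comp Q.π)) fun f hf => by
      rw [zero_add, pow_one] at hf
      rw [RingHom.comp_apply, RingHom.comp_apply, show Q.π f = 0 from hf, map_zero, map_zero]) <| by
    constructor
    · refine (injective_iff_map_eq_zero _).2 fun a ha => ?_
      obtain ⟨f, rfl⟩ := Ideal.Quotient.mk_surjective a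
      rw [Ideal.Quotient.lift_mk, RingHom.comp_apply, Ideal.Quotient.eq_zero_iff_mem, zero_add, pow_one] at ha
      rw [Ideal.Quotient.eq_zero_iff_mem, zero_add, pow_one]
      exact (algebraMapInv_algebraMap (L := L) (Q.π f)).symm.trans ha
    · intro y
      obtain ⟨s, rfl⟩ := Ideal.Quotient.mk_surjective y
      obtain ⟨f, hf⟩ := Q.π_surjective (algebraMapInv s)
      refine ⟨Ideal.Quotient.mk _ f, ?_⟩
      rw [Ideal.Quotient.lift_mk, RingHom.comp_apply, RingHom.comp_apply, hf, eq_comm,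
        Ideal.Quotient.mk_eq_mk_iff_sub_mem, zero_add, pow_one]
      exact sub_algebraMap_mem_augIdeal s

omit [LieRinehartRing R L] in
theorem jetIsoZero_mk (f : S) : Q.jetIsoZero (Ideal.Quotient.mk _ f) =
    Ideal.Quotient.mk _ (algebraMap R (SymmetricAlgebra R L) (Q.π f)) := rfl

theorem isJetIso_zero : Q.IsJetIso 0 Q.jetIsoZero where
  const c := by rw [jetIsoZero_mk, Q.π_const]
  base f s h := by
    rw [jetIsoZero_mk] at h
    exact (congrArg (zeroJet R L 0) h).symm.trans (algebraMapInv_algebraMap _)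
  symbol f s h := by rw [jetIsoZero_mk, show s = _ from h]
  bracket f g s t u _ _ _ := by rw [pow_zero, Ideal.one_eq_top]; trivial

section Bracket

variable (n : ℕ)

/-- Restriction of functions to the previous infinitesimal neighbourhood. -/
def reduce : (S ⧸ Q.ideal ^ (n + 2)) →+* S ⧸ Q.ideal ^ (n + 1) :=
  Ideal.Quotient.factor (Ideal.pow_le_pow_right (Nat.le_succ _))

omit [Module R L] [LieRinehartRing R L] in
theorem reduce_mk (f : S) : Q.reduce n (Ideal.Quotient.mk _ f) = Ideal.Quotient.mk _ f := rfl

omit [Module R L] [LieRinehartRing R L] in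
theorem exists_quotBr : ∃ b : (S ⧸ Q.ideal ^ (n + 2)) →+ (S ⧸ Q.ideal ^ (n + 2)) →+ S ⧸ Q.ideal ^ (n + 1),
    ∀ f g, b (Ideal.Quotient.mk _ f) (Ideal.Quotient.mk _ g) = Ideal.Quotient.mk _ (Q.br f g) := by
  let q : S →+ S ⧸ Q.ideal ^ (n + 2) := (Ideal.Quotient.mk (Q.ideal ^ (n + 2))).toAddMonoidHom
  have hq : Function.RightInverse (Function.surjInv (f := q) Ideal.Quotient.mk_surjective) q :=
    Function.rightInverse_surjInv _
  have h₁ : ∀ f, q.ker ≤ ((Ideal.Quotient.mk (Q.ideal ^ (n + 1))).toAddMonoidHom.comp (Q.br f)).ker := by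
    intro f g hg
    have hg' : g ∈ Q.ideal ^ (n + 2) := Ideal.Quotient.eq_zero_iff_mem.1 hg
    refine Ideal.Quotient.eq_zero_iff_mem.2 ?_
    rw [Q.br_skew]
    exact neg_mem (Q.br_mem_pow _ hg' f)
  let b₁ (f : S) := q.liftOfRightInverse _ hq ⟨_, h₁ f⟩
  have hb₁ : ∀ f g, b₁ f (q g) = Ideal.Quotient.mk _ (Q.br f g) := fun f g =>
    q.liftOfRightInverse_comp_apply _ hq ⟨_, h₁ f⟩ g
  let b₂ : S →+ (S ⧸ Q.ideal ^ (n + 2)) →+ S ⧸ Q.ideal ^ (n + 1) := AddMonoidHom.mk' b₁ fun f f' => by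
    refine AddMonoidHom.ext fun a => ?_
    obtain ⟨g, rfl⟩ := (Ideal.Quotient.mk_surjective : Function.Surjective q) a
    refine (hb₁ _ g).trans (Eq.trans ?_ (congrArg₂ (· + ·) (hb₁ f g) (hb₁ f' g)).symm)
    rw [map_add, AddMonoidHom.add_apply, map_add]
  have h₂ : q.ker ≤ b₂.ker := by
    intro f hf
    have hf' : f ∈ Q.ideal ^ (n + 2) := Ideal.Quotient.eq_zero_iff_mem.1 hf
    refine AddMonoidHom.ext fun a => ?_
    obtain ⟨g, rfl⟩ := (Ideal.Quotient.mk_surjective : Function.Surjective q) a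
    exact (hb₁ f g).trans (Ideal.Quotient.eq_zero_iff_mem.2 (Q.br_mem_pow _ hf' g))
  exact ⟨q.liftOfRightInverse _ hq ⟨b₂, h₂⟩, fun f g =>
    (DFunLike.congr_fun (q.liftOfRightInverse_comp_apply _ hq ⟨b₂, h₂⟩ f) _).trans (hb₁ f g)⟩

/-- The bracket of functions on infinitesimal neighbourhoods. -/
def quotBr : (S ⧸ Q.ideal ^ (n + 2)) →+ (S ⧸ Q.ideal ^ (n + 2)) →+ S ⧸ Q.ideal ^ (n + 1) :=
  (Q.exists_quotBr n).choose

omit [Module R L] [LieRinehartRing R L] in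
theorem quotBr_mk (f g : S) : Q.quotBr n (Ideal.Quotient.mk _ f) (Ideal.Quotient.mk _ g) =
    Ideal.Quotient.mk _ (Q.br f g) := (Q.exists_quotBr n).choose_spec f g

variable {N : ℕ} {f : Fin N → R} {x : Fin N → L} (h : IsDualBasis R L f x)

include h in
theorem mk_eq_of_isSymbol {l : ℕ} {a b : S} {s : SymmetricAlgebra R L} (ha : Q.IsSymbol l a s)
    (hb : Q.IsSymbol l b s) :
    Ideal.Quotient.mk (Q.ideal ^ (l + 1)) a = Ideal.Quotient.mk (Q.ideal ^ (l + 1)) b := by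
  rw [Ideal.Quotient.mk_eq_mk_iff_sub_mem]
  refine IsSymbol.mem_of_zero h ?_
  rw [← sub_self s]
  exact ha.sub hb

/-- The inclusion of `Sym^l L` as the ideal `I^l / I^{l+1}`. -/
def symbolIncl (l : ℕ) : symPow R L l →+ S ⧸ Q.ideal ^ (l + 1) :=
  AddMonoidHom.mk' (fun s => Ideal.Quotient.mk _ (IsSymbol.exists_of_mem_symPow Q l s.2).choose) fun s t => by
    rw [← map_add]
    exact Q.mk_eq_of_isSymbol h (IsSymbol.exists_of_mem_symPow Q l (s + t).2).choose_spec
      ((IsSymbol.exists_of_mem_symPow Q l s.2).choose_spec.add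
        (IsSymbol.exists_of_mem_symPow Q l t.2).choose_spec)

theorem symbolIncl_eq {l : ℕ} {a : S} {s : SymmetricAlgebra R L} (ha : Q.IsSymbol l a s) :
    Q.symbolIncl h l ⟨s, ha.mem_symPow⟩ = Ideal.Quotient.mk _ a :=
  Q.mk_eq_of_isSymbol h (IsSymbol.exists_of_mem_symPow Q l ha.mem_symPow).choose_spec ha

theorem exists_symbolIncl {l : ℕ} (s : symPow R L l) :
    ∃ a, Q.IsSymbol l a s.1 ∧ Q.symbolIncl h l s = Ideal.Quotient.mk _ a :=
  ⟨_, (IsSymbol.exists_of_mem_symPow Q l s.2).choose_spec, rfl⟩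

end Bracket

namespace IsJetIso

variable {Q} {n : ℕ} {φ : (S ⧸ Q.ideal ^ (n + 1)) ≃+* SymmetricAlgebra R L ⧸ augIdeal R L ^ (n + 1)}
  (hφ : Q.IsJetIso n φ) {N : ℕ} {f : Fin N → R} {x : Fin N → L} (h : IsDualBasis R L f x)

include hφ in
theorem zeroJet_mk (a : S) : zeroJet R L n (φ (Ideal.Quotient.mk _ a)) = Q.π a := by
  obtain ⟨s, hs⟩ := Ideal.Quotient.mk_surjective (φ (Ideal.Quotient.mk _ a))
  rw [← hs]
  exact hφ.base a s hs.symm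

/-- The next infinitesimal neighbourhood as an extension of a neighbourhood of the zero section. -/
def toExt : PoissonExt R L n (S ⧸ Q.ideal ^ (n + 1 + 1)) where
  const := (Ideal.Quotient.mk _).comp (algebraMap ℂ S)
  p := φ.toRingHom.comp (Q.reduce n)
  incl := Q.symbolIncl h (n + 1)
  br := (AddMonoidHom.compHom φ.toAddMonoidHom).comp (Q.quotBr n)
  p_const := hφ.const
  p_surjective y := by
    obtain ⟨z, rfl⟩ := φ.surjective y
    obtain ⟨a, rfl⟩ := Ideal.Quotient.mk_surjective z
    exact ⟨Ideal.Quotient.mk _ a, rfl⟩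
  incl_injective := (injective_iff_map_eq_zero _).2 fun s hs => by
    obtain ⟨a, ha, has⟩ := Q.exists_symbolIncl h s
    rw [has, Ideal.Quotient.eq_zero_iff_mem] at hs
    exact Subtype.ext (ha.eq_zero h hs)
  exact a := by
    obtain ⟨a, rfl⟩ := Ideal.Quotient.mk_surjective a
    refine (map_eq_zero_iff φ φ.injective).trans ?_
    rw [reduce_mk, Ideal.Quotient.eq_zero_iff_mem]
    constructor
    · intro ha
      obtain ⟨s, hs⟩ := IsSymbol.exists_of_mem_pow Q (n + 1) ha
      exact ⟨_, Q.symbolIncl_eq h hs⟩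
    · rintro ⟨s, hs⟩
      obtain ⟨b, hb, hbs⟩ := Q.exists_symbolIncl h s
      rw [hbs, Ideal.Quotient.mk_eq_mk_iff_sub_mem] at hs
      rw [← sub_sub_cancel b a]
      exact sub_mem hb.mem_pow (Ideal.pow_le_pow_right (Nat.le_succ _) hs)
  incl_smul a s := by
    obtain ⟨a, rfl⟩ := Ideal.Quotient.mk_surjective a
    obtain ⟨b, hb, hbs⟩ := Q.exists_symbolIncl h s
    have h₁ : zeroJet R L n (φ (Q.reduce n (Ideal.Quotient.mk _ a))) = Q.π a := hφ.zeroJet_mk a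
    have h₂ := Q.symbolIncl_eq h (hb.mul a)
    rw [map_mul, ← hbs] at h₂
    refine Eq.trans (congrArg _ (Subtype.ext ?_)) h₂
    exact congrArg (· • s.1) h₁
  br_self a := by
    obtain ⟨a, rfl⟩ := Ideal.Quotient.mk_surjective a
    refine (congrArg φ (Q.quotBr_mk n a a)).trans ?_
    rw [Q.br_self, map_zero, map_zero]
  br_const c a := by
    obtain ⟨a, rfl⟩ := Ideal.Quotient.mk_surjective a
    refine (congrArg φ (Q.quotBr_mk n _ a)).trans ?_
    rw [Q.br_const, map_zero, map_zero]
  br_mul a b c := by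
    obtain ⟨a, rfl⟩ := Ideal.Quotient.mk_surjective a
    obtain ⟨b, rfl⟩ := Ideal.Quotient.mk_surjective b
    obtain ⟨c, rfl⟩ := Ideal.Quotient.mk_surjective c
    change φ (Q.quotBr n (Ideal.Quotient.mk _ (a * b)) (Ideal.Quotient.mk _ c)) =
      φ (Ideal.Quotient.mk _ a) * φ (Q.quotBr n (Ideal.Quotient.mk _ b) (Ideal.Quotient.mk _ c)) +
        φ (Ideal.Quotient.mk _ b) * φ (Q.quotBr n (Ideal.Quotient.mk _ a) (Ideal.Quotient.mk _ c))
    rw [Q.quotBr_mk, Q.quotBr_mk, Q.quotBr_mk, Q.br_mul, map_add, map_mul, map_mul, map_add, map_mul, map_mul]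
  br_incl s a := by
    obtain ⟨a, rfl⟩ := Ideal.Quotient.mk_surjective a
    obtain ⟨b, hb, hbs⟩ := Q.exists_symbolIncl h s
    have h₁ : zeroJet R L n (φ (Q.reduce n (Ideal.Quotient.mk _ a))) = Q.π a := hφ.zeroJet_mk a
    rw [hbs]
    refine (congrArg φ (Q.quotBr_mk n b a)).trans ((hφ.symbol _ _ (hb.2.2 a)).trans ?_)
    exact congrArg (fun r => Ideal.Quotient.mk _ (poisson R L s.1 (algebraMap R _ r))) h₁.symm
  br_lift a b s t u ha hb hab := by
    obtain ⟨a, rfl⟩ := Ideal.Quotient.mk_surjective a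
    obtain ⟨b, rfl⟩ := Ideal.Quotient.mk_surjective b
    exact hφ.bracket a b s t u ha hb ((congrArg φ (Q.quotBr_mk n a b)).symm.trans hab)
  jacobi a b c s t r u v w ha hb hc hab hbc hca := by
    obtain ⟨a, rfl⟩ := Ideal.Quotient.mk_surjective a
    obtain ⟨b, rfl⟩ := Ideal.Quotient.mk_surjective b
    obtain ⟨c, rfl⟩ := Ideal.Quotient.mk_surjective c
    replace hab := (congrArg φ (Q.quotBr_mk n a b)).symm.trans hab
    replace hbc := (congrArg φ (Q.quotBr_mk n b c)).symm.trans hbc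
    replace hca := (congrArg φ (Q.quotBr_mk n c a)).symm.trans hca
    obtain ⟨y₁, h₁⟩ := Ideal.Quotient.mk_surjective (φ (Ideal.Quotient.mk _ (Q.br (Q.br a b) c)))
    obtain ⟨y₂, h₂⟩ := Ideal.Quotient.mk_surjective (φ (Ideal.Quotient.mk _ (Q.br (Q.br b c) a)))
    obtain ⟨y₃, h₃⟩ := Ideal.Quotient.mk_surjective (φ (Ideal.Quotient.mk _ (Q.br (Q.br c a) b)))
    have e₁ := hφ.bracket _ _ _ _ _ hab hc h₁.symm
    have e₂ := hφ.bracket _ _ _ _ _ hbc ha h₂.symm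
    have e₃ := hφ.bracket _ _ _ _ _ hca hb h₃.symm
    have e : y₁ + y₂ + y₃ ∈ augIdeal R L ^ (n + 1) := by
      rw [← Ideal.Quotient.eq_zero_iff_mem, map_add, map_add, h₁, h₂, h₃, ← map_add, ← map_add, ← map_add,
        ← map_add, Q.jacobi, map_zero, map_zero]
    -- Each iterated bracket in `Sym` agrees, modulo the power `n` of the ideal, with the
    -- representative of the iterated bracket in `S`. The latter three sum to zero by the Jacobi
    -- identity in `S`.
    have : poisson R L u r + poisson R L v s + poisson R L w t = (y₁ + y₂ + y₃) -
        ((y₁ - poisson R L u r) + (y₂ - poisson R L v s) + (y₃ - poisson R L w t)) := by ring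
    rw [this]
    exact sub_mem (Ideal.pow_le_pow_right (Nat.le_succ _) e) (add_mem (add_mem e₁ e₂) e₃)

variable {β : SymmetricAlgebra R L →+* S ⧸ Q.ideal ^ (n + 1 + 1)}
  (hβ : (hφ.toExt h).IsPoissonLift β)

/-- The isomorphism of infinitesimal neighbourhoods defined by a lift. -/
def liftEquiv : (S ⧸ Q.ideal ^ (n + 1 + 1)) ≃+* SymmetricAlgebra R L ⧸ augIdeal R L ^ (n + 1 + 1) :=
  ((hφ.toExt h).jetEquiv hβ.proj hβ.incl).symm

theorem liftEquiv_eq_iff {a : S ⧸ Q.ideal ^ (n + 1 + 1)} {s : SymmetricAlgebra R L} :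
    hφ.liftEquiv h hβ a = Ideal.Quotient.mk _ s ↔ β s = a := by
  rw [liftEquiv, RingEquiv.symm_apply_eq, eq_comm]
  rfl

theorem liftEquiv_reduce (a : S) (s : SymmetricAlgebra R L)
    (ha : hφ.liftEquiv h hβ (Ideal.Quotient.mk _ a) = Ideal.Quotient.mk _ s) :
    φ (Ideal.Quotient.mk _ a) = Ideal.Quotient.mk _ s := by
  have := hβ.proj s
  rw [(hφ.liftEquiv_eq_iff h hβ).1 ha] at this
  exact this

theorem isJetIso_liftEquiv : Q.IsJetIso (n + 1) (hφ.liftEquiv h hβ) where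
  const c := (hφ.liftEquiv_eq_iff h hβ).2 (hβ.const c)
  base a s ha := hφ.base a s (hφ.liftEquiv_reduce h hβ a s ha)
  symbol a s ha := (hφ.liftEquiv_eq_iff h hβ).2
    ((hβ.incl ⟨s, ha.mem_symPow⟩).trans (Q.symbolIncl_eq h ha))
  bracket a b s t u ha hb hab := by
    have h₁ := hβ.br s t
    rw [(hφ.liftEquiv_eq_iff h hβ).1 ha, (hφ.liftEquiv_eq_iff h hβ).1 hb] at h₁
    have h₂ := (congrArg φ (Q.quotBr_mk n a b)).symm.trans h₁
    rw [hφ.liftEquiv_reduce h hβ _ u hab, Ideal.Quotient.mk_eq_mk_iff_sub_mem] at h₂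
    exact h₂

end IsJetIso
end LagrangianPair
end SymmetricAlgebra

/-! ### Coordinates of standard smooth algebras and linear symplectic algebra. -/

/-- A standard smooth algebra of relative dimension `n` over `ℂ` has `n` vector fields dual to a basis of the
differentials. -/
theorem exists_standardSmooth_coordinates {T : Type} [CommRing T] [Algebra ℂ T] [Nontrivial T] (n : ℕ)
    [Algebra.IsStandardSmoothOfRelativeDimension n ℂ T] :
    ∃ (m : ℕ) (g : Fin m → T) (a : Fin n → Fin m → T) (δ : Fin n → Derivation ℂ T T),
      (∀ i j, ∑ k, a i k * δ j (g k) = if i = j then 1 else 0) ∧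
      ∀ (M : Type) [AddCommGroup M] [Module T M] (D : Derivation ℤ T M),
        (∀ c : ℂ, D (algebraMap ℂ T c) = 0) → ∀ r, D r = ∑ j, δ j r • ∑ k, a j k • D (g k) := by
  have : Algebra.IsStandardSmooth ℂ T := Algebra.IsStandardSmoothOfRelativeDimension.isStandardSmooth n
  have hrank : Module.finrank T (Ω[T⁄ℂ]) = n := Module.finrank_eq_of_rank_eq
    (Algebra.IsStandardSmoothOfRelativeDimension.rank_kaehlerDifferential n)
  let b := Module.finBasisOfFinrankEq T (Ω[T⁄ℂ]) hrank
  obtain ⟨m, g, x, hx⟩ := exists_dualBasis_derivations (R := T)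
  have h₁ : ∀ y : Ω[T⁄ℂ], y = ∑ k, (x k).liftKaehlerDifferential y • KaehlerDifferential.D ℂ T (g k) := by
    have : LinearMap.id = ∑ k, (x k).liftKaehlerDifferential.smulRight (KaehlerDifferential.D ℂ T (g k)) := by
      refine Derivation.liftKaehlerDifferential_unique _ _ ?_
      ext r
      change KaehlerDifferential.D ℂ T r = (∑ k, (x k).liftKaehlerDifferential.smulRight _) _
      rw [LinearMap.sum_apply, show KaehlerDifferential.D ℂ T r = ∑ k, x k r • _ from
        hx _ ((KaehlerDifferential.D ℂ T).restrictScalars ℤ) (fun c => Derivation.map_algebraMap _ c) r]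
      refine Finset.sum_congr rfl fun k _ => ?_
      exact congrArg (· • _) ((x k).liftKaehlerDifferential_comp_D r).symm
    intro y
    conv_lhs => rw [← LinearMap.id_apply (R := T) y, this]
    rw [LinearMap.sum_apply]
    rfl
  -- The basis `b` of the differentials need not consist of exact forms `d g`. The coefficients `a i
  -- k` express `b i` through the generators `d (g k)`.
  refine ⟨m, g, fun i k => (x k).liftKaehlerDifferential (b i),
    fun j => (b.coord j).compDer (KaehlerDifferential.D ℂ T), fun i j => ?_, fun M _ _ D hD r => ?_⟩
  · have := congrArg (b.coord j) (h₁ (b i))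
    rw [Module.Basis.coord_apply, Module.Basis.repr_self, Finsupp.single_apply, map_sum] at this
    rw [this]
    exact Finset.sum_congr rfl fun k _ => by rw [map_smul]; rfl
  · have h₂ : ∀ k, x k r = ∑ j, b.coord j (KaehlerDifferential.D ℂ T r) *
        (x k).liftKaehlerDifferential (b j) := fun k => by
      rw [← (x k).liftKaehlerDifferential_comp_D r]
      conv_lhs => rw [← b.sum_repr (KaehlerDifferential.D ℂ T r), map_sum]
      exact Finset.sum_congr rfl fun j _ => by rw [map_smul]; rfl
    rw [hx M D hD]
    simp only [h₂, Finset.smul_sum, Finset.sum_smul]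
    rw [Finset.sum_comm]
    exact Finset.sum_congr rfl fun j _ => Finset.sum_congr rfl fun k _ => mul_smul _ _ _

namespace SymmetricAlgebra

variable {S M K : Type} [CommRing S] [LieRing M] [Module S M] [LieRingModule M S] [LieRinehartRing S M]
  [Algebra ℂ S] [Field K] [Algebra ℂ K] [Algebra S K] [IsScalarTower ℂ S K]

/-- In a symplectic space of dimension `2d`, Hamiltonian vector fields of functions vanishing along an isotropic
subspace of dimension `d` belong to this subspace. -/
theorem IsDualBasis.algebraMap_lie_hamiltonian {N : ℕ} {f : Fin N → S} {x : Fin N → M}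
    (h : IsDualBasis S M f x) (ω : M →ₗ[S] Module.Dual S M) (H : S → M) (hH : ∀ g D, ω (H g) D = ⁅D, g⁆)
    {d : ℕ} (e : Derivation ℂ S K →ₗ[K] (Fin (2 * d) → K)) (he : Function.Injective e) (y : Fin d → M)
    (hy : ∀ c : Fin d → K, (∀ g, ∑ j, c j * algebraMap S K ⁅y j, g⁆ = 0) → ∀ j, c j = 0)
    (hω : ∀ i j, algebraMap S K (ω (y i) (y j)) = 0) {u v : S} (hu : ∀ j, algebraMap S K ⁅y j, u⁆ = 0)
    (hv : ∀ j, algebraMap S K ⁅y j, v⁆ = 0) : algebraMap S K ⁅H u, v⁆ = 0 := by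
  let z (D : M) : Derivation ℂ S K := Derivation.mk'
    { toFun := fun g => algebraMap S K ⁅D, g⁆
      map_add' := fun a b => by rw [lie_add, map_add]
      map_smul' := fun c a => by
        rw [Algebra.smul_def, LieRinehartRing.leibniz_mul_right, h.lie_const, zero_mul, add_zero, smul_eq_mul,
          map_mul, RingHom.id_apply, Algebra.smul_def, ← IsScalarTower.algebraMap_apply] } fun a b => by
      change algebraMap S K ⁅D, a * b⁆ = a • algebraMap S K ⁅D, b⁆ + b • algebraMap S K ⁅D, a⁆
      rw [LieRinehartRing.leibniz_mul_right, map_add, smul_eq_mul, map_mul, map_mul,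
        Algebra.smul_def, Algebra.smul_def, mul_comm (algebraMap S K ⁅D, a⁆)]
  have hz : ∀ D g, z D g = algebraMap S K ⁅D, g⁆ := fun _ _ => rfl
  -- `B` is the form `ω` at the point of `K`, written on derivations into `K` by means of the dual
  -- basis. `B E D` corresponds to `ω D E`, in the opposite order.
  let B : LinearMap.BilinForm K (Derivation ℂ S K) := LinearMap.mk₂ K
    (fun E D => ∑ l, E (f l) * ∑ k, D (f k) * algebraMap S K (ω (x k) (x l)))
    (fun E E' D => by
      simp only [Derivation.add_apply, add_mul, Finset.sum_add_distrib])
    (fun c E D => by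
      simp only [Derivation.smul_apply, smul_eq_mul, mul_assoc, Finset.mul_sum])
    (fun E D D' => by
      simp only [Derivation.add_apply, add_mul, Finset.sum_add_distrib, mul_add])
    (fun c E D => by
      simp only [Derivation.smul_apply, smul_eq_mul, mul_assoc, Finset.mul_sum]
      exact Finset.sum_congr rfl fun l _ => Finset.sum_congr rfl fun k _ => by ring)
  have hB : ∀ E D, B E (z D) = ∑ l, E (f l) * algebraMap S K (ω D (x l)) := fun E D => by
    change ∑ l, E (f l) * ∑ k, z D (f k) * algebraMap S K (ω (x k) (x l)) = _
    refine Finset.sum_congr rfl fun l _ => congrArg _ ?_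
    conv_rhs => rw [h.vec D, map_sum, LinearMap.sum_apply, map_sum]
    exact Finset.sum_congr rfl fun k _ => by
      rw [map_smul, LinearMap.smul_apply, smul_eq_mul, map_mul, hz]
  have hBH : ∀ E g, B E (z (H g)) = E g := fun E g => by
    rw [hB, show E g = ∑ k, ⁅x k, g⁆ • E (f k) from h.der K (E.restrictScalars ℤ)
      (fun c => E.map_algebraMap c) g]
    exact Finset.sum_congr rfl fun l _ => by rw [hH, Algebra.smul_def, mul_comm]
  have hBz : ∀ D E, B (z E) (z D) = algebraMap S K (ω D E) := fun D E => by
    rw [hB]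
    conv_rhs => rw [h.vec E, map_sum, map_sum]
    exact Finset.sum_congr rfl fun k _ => by rw [map_smul, smul_eq_mul, map_mul, hz]
  have hfin : Module.Finite K (Derivation ℂ S K) := Module.Finite.of_injective e he
  have hdim : Module.finrank K (Derivation ℂ S K) ≤ 2 * d := by
    have := LinearMap.finrank_le_finrank_of_injective he
    rwa [Module.finrank_fin_fun] at this
  have hli : LinearIndependent K fun j => z (y j) := by
    rw [Fintype.linearIndependent_iff]
    refine fun c hc => hy c fun g => ?_
    have := DFunLike.congr_fun hc g
    rw [← Derivation.coeFnAddMonoidHom_apply, map_sum, Finset.sum_apply] at this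
    exact this
  let Z := Submodule.span K (Set.range fun j => z (y j))
  have hZ : Module.finrank K Z = d := by
    rw [finrank_span_eq_card hli, Fintype.card_fin]
  have hker : B.ker = ⊥ := by
    refine LinearMap.ker_eq_bot'.2 fun E hE => ?_
    ext g
    rw [← hBH E g, hE]
    rfl
  have hle : Z ≤ B.orthogonal Z := by
    refine Submodule.span_le.2 ?_
    rintro _ ⟨i, rfl⟩
    refine LinearMap.BilinForm.mem_orthogonal_iff.2 fun E hE => ?_
    induction hE using Submodule.span_induction with
    | mem E hE =>
      obtain ⟨j, rfl⟩ := hE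
      exact (hBz _ _).trans (hω _ _)
    | zero => rw [map_zero, LinearMap.zero_apply]
    | add E E' _ _ hE hE' => rw [map_add, LinearMap.add_apply, hE, hE', add_zero]
    | smul c E _ hE => rw [map_smul, LinearMap.smul_apply, hE, smul_zero]
  -- `Z` has dimension `d` and is isotropic. As `B` is non-degenerate and the whole space has
  -- dimension at most `2 * d`, the orthogonal of `Z` has dimension at most `d`.
  have heq : Z = B.orthogonal Z := Submodule.eq_of_le_of_finrank_le hle (by
    have := LinearMap.BilinForm.finrank_add_finrank_orthogonal' (B := B) Z
    rw [hker, inf_bot_eq, finrank_bot, add_zero] at this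
    lia)
  -- Pairing with the Hamiltonian field of `u` is differentiation of `u`, which vanishes on `Z`. So
  -- the field lies in the orthogonal of `Z`, hence in `Z`, and therefore kills `v`.
  have hmem : z (H u) ∈ Z := by
    rw [heq]
    refine LinearMap.BilinForm.mem_orthogonal_iff.2 fun E hE => ?_
    rw [hBH]
    induction hE using Submodule.span_induction with
    | mem E hE =>
      obtain ⟨j, rfl⟩ := hE
      exact hu j
    | zero => rfl
    | add E E' _ _ hE hE' => rw [Derivation.add_apply, hE, hE', add_zero]
    | smul c E _ hE => rw [Derivation.smul_apply, hE, smul_zero]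
  have : ∀ E ∈ Z, E v = 0 := fun E hE => by
    induction hE using Submodule.span_induction with
    | mem E hE =>
      obtain ⟨j, rfl⟩ := hE
      exact hv j
    | zero => rfl
    | add E E' _ _ hE hE' => rw [Derivation.add_apply, hE, hE', add_zero]
    | smul c E _ hE => rw [Derivation.smul_apply, hE, smul_zero]
  exact this _ hmem

end SymmetricAlgebra

/-! ### Hamiltonian vector fields, and involutivity of the ideal of a Lagrangian. -/

namespace CScheme
open SymmetricAlgebra

section Chart

variable {X : Scheme.{0}} [X.Over specC]

theorem exists_standardSmooth_chart {d : ℕ} (hX : SmoothOfRelativeDimension d (X ↘ specC)) (x : X) :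
    ∃ U : X.affineOpens, x ∈ U.1 ∧ Algebra.IsStandardSmoothOfRelativeDimension d ℂ Γ(X, U.1) := by
  obtain ⟨T, hT, U, hU, hx, e, h⟩ := hX.exists_isStandardSmoothOfRelativeDimension x
  -- `Spec ℂ` is a single point, so the open set of the base occurring in the chart is everything.
  obtain rfl : T = ⊤ := by
    have : Subsingleton specC := inferInstanceAs (Subsingleton (PrimeSpectrum ℂ))
    refine top_le_iff.1 fun y _ => ?_
    rw [Subsingleton.elim y ((X ↘ specC) x)]
    exact e hx
  refine ⟨⟨U, hU⟩, hx, ?_⟩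
  have h₂ : (algebraMap ℂ Γ(X, U)) = ((X ↘ specC).appLE ⊤ U e).hom.comp
    (Scheme.ΓSpecIso (CommRingCat.of ℂ)).inv.hom := rfl
  rw [← RingHom.isStandardSmoothOfRelativeDimension_algebraMap, h₂]
  exact RingHom.isStandardSmoothOfRelativeDimension_respectsIso.2 _
    (Scheme.ΓSpecIso (CommRingCat.of ℂ)).symm.commRingCatIsoToRingEquiv h

variable (ω : SymplecticForm X)

theorem SymplecticForm.form_hamiltonian (U : X.affineOpens) (f : Γ(X, U.1)) (D : TX X U.1) :
    ω.form U.1 (ω.hamiltonian U f) D = ⁅D, f⁆ :=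
  DFunLike.congr_fun ((LinearEquiv.ofBijective (ω.form U.1) (ω.nondegenerate U)).apply_symm_apply
    (differential f)) D

theorem SymplecticForm.form_skew (U : X.Opens) (D E : TX X U) : ω.form U D E = - ω.form U E D := by
  have := ω.alternating U (D + E)
  rw [map_add, map_add, LinearMap.add_apply, LinearMap.add_apply, ω.alternating, ω.alternating, zero_add,
    add_zero] at this
  exact eq_neg_of_add_eq_zero_right this

theorem SymplecticForm.bracket_eq (U : X.affineOpens) (f g : Γ(X, U.1)) :
    ω.bracket U f g = ⁅ω.hamiltonian U g, f⁆ := ω.form_hamiltonian U f _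

theorem SymplecticForm.bracket_eq_neg (U : X.affineOpens) (f g : Γ(X, U.1)) :
    ω.bracket U f g = -⁅ω.hamiltonian U f, g⁆ := by
  rw [← ω.form_hamiltonian U g, ← ω.form_skew]
  rfl

variable [Smooth (X ↘ specC)]

/-- The form on `W` is known only on vector fields restricted from `U`. By the dual basis these
generate all vector fields on `W`, so non-degeneracy on `W` gives the equality. -/
theorem SymplecticForm.hamiltonian_res {U W : X.affineOpens} (h : W.1 ≤ U.1) (f : Γ(X, U.1)) :
    ω.hamiltonian W (fres X h f) = TX.res h (ω.hamiltonian U f) := by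
  refine (ω.nondegenerate W).1 (LinearMap.ext fun D => ?_)
  obtain ⟨N, g, x, hgx⟩ := exists_isDualBasis U
  have e := (isDualBasis_res h hgx).vec D
  rw [ω.form_hamiltonian, e, map_sum]
  have h₁ : ∀ a : Fin N → Γ(X, W.1), ⁅∑ k, a k • TX.res h (x k), fres X h f⁆ =
      ∑ k, a k * ⁅TX.res h (x k), fres X h f⁆ := fun a =>
    (map_sum (differential (fres X h f)) _ _).trans (Finset.sum_congr rfl fun k _ => map_smul _ _ _)
  rw [h₁]
  refine Finset.sum_congr rfl fun k _ => ?_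
  rw [map_smul, ω.res, ω.form_hamiltonian, TX.res_lie, smul_eq_mul]

theorem SymplecticForm.bracket_res {U W : X.affineOpens} (h : W.1 ≤ U.1) (f g : Γ(X, U.1)) :
    ω.bracket W (fres X h f) (fres X h g) = fres X h (ω.bracket U f g) := by
  rw [ω.bracket_eq, ω.bracket_eq, ω.hamiltonian_res h, TX.res_lie]

end Chart

section Lagrangian

variable {V Y : Scheme.{0}} (i : V ⟶ Y)

/-- Restriction of functions from `Y` to `V`. -/
abbrev pull (W : Y.Opens) : Γ(Y, W) →+* Γ(V, i ⁻¹ᵁ W) := (i.app W).hom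

theorem pull_res {W W' : Y.Opens} (h : W' ≤ W) (f : Γ(Y, W)) :
    pull i W' (fres Y h f) = fres V (i.preimage_mono h) (pull i W f) :=
  congrArg (fun g => g.hom f) (i.naturality (homOfLE h).op)

variable [V.Over specC] [Y.Over specC]

theorem pull_const [i.IsOver specC] (W : Y.Opens) (c : ℂ) :
    pull i W (algebraMap ℂ _ c) = algebraMap ℂ _ c := by
  refine (pull_res i le_top _).trans (congrArg (fres V _) ?_)
  have h₁ : (V ↘ specC).appTop = (Y ↘ specC).appTop ≫ i.appTop := by
    rw [← Scheme.Hom.comp_appTop, comp_over]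
  exact (congrArg (fun g => g.hom ((Scheme.ΓSpecIso (CommRingCat.of ℂ)).inv.hom c)) h₁).symm

/-- The affine open set `V ∩ W`. -/
abbrev preimageAffine [IsAffineHom i] (W : Y.affineOpens) : V.affineOpens := ⟨i ⁻¹ᵁ W.1, W.2.preimage i⟩

omit [V.Over specC] in
/-- Derivations along `i` extend to vector fields. -/
theorem exists_vectorField_lift [IsClosedImmersion i] [Smooth (Y ↘ specC)] (W : Y.affineOpens)
    (D : Derivation ℤ Γ(V, i ⁻¹ᵁ W.1) Γ(V, i ⁻¹ᵁ W.1)) (hD : ∀ c : ℂ, D (pull i W.1 (algebraMap ℂ _ c)) = 0) :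
    ∃ E : TX Y W.1, ∀ f, pull i W.1 ⁅E, f⁆ = D (pull i W.1 f) := by
  obtain ⟨N, f, x, h⟩ := exists_isDualBasis W
  -- The values of `D` on the functions `f k` are lifted to `Y` and used as coefficients of the `x
  -- k`. By the dual basis property this prescribes the derivation along `i` on all functions.
  choose s hs using fun k => i.app_surjective W.1 W.2 (D (pull i W.1 (f k)))
  refine ⟨∑ k, s k • x k, fun g => ?_⟩
  have h₁ : ⁅∑ k, s k • x k, g⁆ = ∑ k, s k * ⁅x k, g⁆ :=
    (map_sum (differential g) _ _).trans (Finset.sum_congr rfl fun k _ => map_smul _ _ _)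
  let _ : Module Γ(Y, W.1) Γ(V, i ⁻¹ᵁ W.1) := Module.compHom _ (pull i W.1)
  let D' : Derivation ℤ Γ(Y, W.1) Γ(V, i ⁻¹ᵁ W.1) := Derivation.mk'
    ((D : Γ(V, i ⁻¹ᵁ W.1) →ₗ[ℤ] Γ(V, i ⁻¹ᵁ W.1)).toAddMonoidHom.comp
      (pull i W.1).toAddMonoidHom).toIntLinearMap fun a b => by
        change D (pull i W.1 (a * b)) = pull i W.1 a • D (pull i W.1 b) + pull i W.1 b • D (pull i W.1 a)
        rw [map_mul, D.leibniz]
  have h₂ := h.der Γ(V, i ⁻¹ᵁ W.1) D' hD g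
  refine Eq.trans ?_ h₂.symm
  rw [h₁, map_sum]
  refine Finset.sum_congr rfl fun k _ => ?_
  rw [map_mul, mul_comm]
  exact congrArg (pull i W.1 ⁅x k, g⁆ * ·) (hs k)

end Lagrangian
end CScheme

namespace CScheme
open SymmetricAlgebra

section Chart
variable {X : Scheme.{0}} [X.Over specC]

/-- On a small affine open set, derivations with values in a field have at most as many coordinates as the
dimension. -/
theorem exists_injective_coordinates {n : ℕ} {U W : X.affineOpens} [Nontrivial Γ(X, U.1)]
    [Algebra.IsStandardSmoothOfRelativeDimension n ℂ Γ(X, U.1)] (h : W.1 ≤ U.1) (K : Type) [Field K] [Algebra ℂ K]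
    [Algebra Γ(X, W.1) K] [IsScalarTower ℂ Γ(X, W.1) K] :
    ∃ e : Derivation ℂ Γ(X, W.1) K →ₗ[K] (Fin n → K), Function.Injective e := by
  obtain ⟨m, g, a, δ, -, hδ⟩ := exists_standardSmooth_coordinates (T := Γ(X, U.1)) n
  let e : Derivation ℂ Γ(X, W.1) K →ₗ[K] (Fin n → K) :=
    { toFun := fun D j => ∑ k, algebraMap _ K (fres X h (a j k)) * D (fres X h (g k))
      map_add' := fun D E => by
        funext j
        simp only [Derivation.add_apply, mul_add, Finset.sum_add_distrib, Pi.add_apply]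
      map_smul' := fun c D => by
        funext j
        simp only [Derivation.smul_apply, smul_eq_mul, Pi.smul_apply, RingHom.id_apply, Finset.mul_sum]
        exact Finset.sum_congr rfl fun k _ => by ring }
  refine ⟨e, (injective_iff_map_eq_zero e).2 fun D hD => ?_⟩
  -- Derivations on the functions on `W` are determined on those restricted from the chart `U`,
  -- where the basis of the differentials is available.
  have h₀ : D.restrictScalars ℤ = 0 := derivation_ext_fres h fun r => by
    let _ : Module Γ(X, U.1) K := Module.compHom _ (fres X h)
    let D' : Derivation ℤ Γ(X, U.1) K := Derivation.mk'
      (((D : Γ(X, W.1) →ₗ[ℂ] K) : Γ(X, W.1) →+ K).comp (fres X h).toAddMonoidHom).toIntLinearMap fun a b => by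
          change D (fres X h (a * b)) = fres X h a • D (fres X h b) + fres X h b • D (fres X h a)
          rw [map_mul, D.leibniz]
    have h₂ := hδ K D' (fun c => by
      change D (fres X h (algebraMap ℂ _ c)) = 0
      rw [fres_algebraMap, D.map_algebraMap]) r
    refine h₂.trans (Finset.sum_eq_zero fun j _ => ?_)
    have h₃ : ∑ k, a j k • D' (g k) = 0 := by
      refine Eq.trans (Finset.sum_congr rfl fun k _ => ?_) (congrFun hD j)
      exact Algebra.smul_def (fres X h (a j k)) (D (fres X h (g k)))
    rw [h₃]
    exact smul_zero (fres X h (δ j r))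
  ext r
  exact DFunLike.congr_fun h₀ r

/-- A standard smooth affine open set of dimension `n` has `n` vector fields which are linearly independent at the
points of every smaller affine open set. -/
theorem exists_independent_vectorFields {n : ℕ} (U : X.affineOpens) [Nontrivial Γ(X, U.1)]
    [Algebra.IsStandardSmoothOfRelativeDimension n ℂ Γ(X, U.1)] :
    ∃ y : Fin n → TX X U.1, ∀ (W : X.affineOpens) (h : W.1 ≤ U.1) (K : Type) [Field K] [Algebra Γ(X, W.1) K]
      (c : Fin n → K), (∀ r : Γ(X, W.1), ∑ j, c j * algebraMap _ K ⁅TX.res h (y j), r⁆ = 0) → ∀ j, c j = 0 := by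
  obtain ⟨m, g, a, δ, hδ, -⟩ := exists_standardSmooth_coordinates (T := Γ(X, U.1)) n
  choose y hy using fun j => TX.exists_of_derivation (δ j)
  refine ⟨y, fun W h K _ _ c hc i => ?_⟩
  have h₁ : ∀ k, ∑ j, algebraMap _ K (fres X h (a i k)) *
      (c j * algebraMap _ K ⁅TX.res h (y j), fres X h (g k)⁆) = 0 := fun k => by
    rw [← Finset.mul_sum, hc, mul_zero]
  have h₂ := Finset.sum_eq_zero (s := Finset.univ) fun k (_ : k ∈ Finset.univ) => h₁ k
  rw [Finset.sum_comm] at h₂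
  have h₃ : ∀ j, ∑ k, algebraMap _ K (fres X h (a i k)) *
      (c j * algebraMap _ K ⁅TX.res h (y j), fres X h (g k)⁆) = c j * if i = j then 1 else 0 := fun j => by
    have := congrArg (fun r => algebraMap Γ(X, W.1) K (fres X h r)) (hδ i j)
    simp only [map_sum, map_mul, ← hy] at this
    rw [show (if i = j then 1 else 0 : K) = algebraMap Γ(X, W.1) K (fres X h (if i = j then 1 else 0)) by
      split_ifs <;> simp, ← this, Finset.mul_sum]
    exact Finset.sum_congr rfl fun k _ => by rw [TX.res_lie]; ring
  simp only [h₃] at h₂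
  simpa using h₂

end Chart

variable {V Y : Scheme.{0}} [V.Over specC] [Y.Over specC] {ω : SymplecticForm Y} {i : V ⟶ Y} [i.IsOver specC]

/-- The ideal of a Lagrangian subvariety is closed under the Poisson bracket. -/
theorem IsLagrangian.bracket_mem [IsIntegral V] (hL : IsLagrangian ω i) (W : Y.affineOpens) (u v : Γ(Y, W.1))
    (hu : pull i W.1 u = 0) (hv : pull i W.1 v = 0) : pull i W.1 (ω.bracket W u v) = 0 := by
  have := hL.closedImmersion
  obtain ⟨d, hV, hY⟩ := hL.dim
  have := SmoothOfRelativeDimension.smooth (2 * d) (Y ↘ specC)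
  by_cases hne : Nonempty (i ⁻¹ᵁ W.1)
  swap
  · refine rs_ext_affine V.sheaf fun W' hW' => ?_
    have h₁ : (W'.1 : V.Opens) = ⊥ := by
      refine le_bot_iff.1 fun x hx => hne ⟨⟨x, hW' hx⟩⟩
    have : Subsingleton Γ(V, W'.1) := by
      rw [h₁]
      infer_instance
    exact Subsingleton.elim (α := Γ(V, W'.1)) _ _
  obtain ⟨x, hx⟩ := hne
  obtain ⟨Y₁, hxY, hY₁⟩ := exists_standardSmooth_chart hY (i x)
  obtain ⟨V₁, hxV, hV₁⟩ := exists_standardSmooth_chart hV x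
  obtain ⟨O, hO, hOV⟩ := i.isClosedEmbedding.isEmbedding.isInducing.isOpen_iff.1 V₁.1.2
  have hxO : i x ∈ O := by
    have : x ∈ i ⁻¹' O := by rw [hOV]; exact hxV
    exact this
  -- A small affine neighbourhood inside a chart of `Y` whose trace on `V` lies inside a chart of
  -- `V`; the latter is arranged through the open set `O`, whose trace is the chart of `V`.
  obtain ⟨W₂, hW₂, hxW⟩ := exists_affine_le (U := W.1 ⊓ Y₁.1 ⊓ ⟨O, hO⟩) ⟨⟨hx, hxY⟩, hxO⟩
  have hW : W₂.1 ≤ W.1 := hW₂.trans (inf_le_left.trans inf_le_left)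
  have hWY : W₂.1 ≤ Y₁.1 := hW₂.trans (inf_le_left.trans inf_le_right)
  have hWV : (preimageAffine i W₂).1 ≤ V₁.1 := fun z hz => by
    have : z ∈ i ⁻¹' O := (hW₂ hz).2
    rw [hOV] at this
    exact this
  have hne₁ : Nonempty Y₁.1 := ⟨⟨_, hxY⟩⟩
  have hne₂ : Nonempty V₁.1 := ⟨⟨_, hxV⟩⟩
  have hne₃ : Nonempty (i ⁻¹ᵁ W₂.1 : V.Opens) := ⟨⟨x, hxW⟩⟩
  let R := Γ(V, i ⁻¹ᵁ W₂.1)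
  -- The linear algebra takes place at the generic point of `V`. Since `V` is integral, vanishing
  -- there implies vanishing on `W₂` and on the larger open set.
  let K := FractionRing R
  let _ : Algebra Γ(Y, W₂.1) K := ((algebraMap R K).comp (pull i W₂.1)).toAlgebra
  have _ : IsScalarTower ℂ Γ(Y, W₂.1) K := IsScalarTower.of_algebraMap_eq fun c => by
    change _ = algebraMap R K (pull i W₂.1 (algebraMap ℂ _ c))
    rw [pull_const, ← IsScalarTower.algebraMap_apply]
  have hK : ∀ a : R, algebraMap R K a = 0 → a = 0 := fun a ha =>
    (map_eq_zero_iff _ (IsFractionRing.injective R K)).1 ha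
  obtain ⟨N, f, x', hfx⟩ := exists_isDualBasis W₂
  obtain ⟨e, he⟩ := exists_injective_coordinates (n := 2 * d) hWY K
  obtain ⟨y, hy⟩ := exists_independent_vectorFields (n := d) V₁
  choose E hE using fun j => exists_vectorField_lift i W₂ ((TX.res hWV (y j)).der _ le_rfl) fun c => by
    rw [pull_const]
    exact ((TX.res hWV (y j)).at _ le_rfl).map_algebraMap c
  have hE₀ : ∀ j, ∀ f ∈ idealOn i W₂.1, ⁅E j, f⁆ ∈ idealOn i W₂.1 := fun j f hf => by
    refine (hE j f).trans ?_
    rw [show pull i W₂.1 f = 0 from hf, map_zero]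
  have hres : ∀ u : Γ(Y, W.1), pull i W.1 u = 0 → pull i W₂.1 (fres Y hW u) = 0 := fun u hu => by
    rw [pull_res, hu, map_zero]
  have hE₁ : ∀ j, ∀ f : Γ(Y, W₂.1), pull i W₂.1 f = 0 → algebraMap Γ(Y, W₂.1) K ⁅E j, f⁆ = 0 := fun j f hf => by
    change algebraMap R K (pull i W₂.1 _) = 0
    rw [show pull i W₂.1 ⁅E j, f⁆ = 0 from hE₀ j f hf, map_zero]
  have key := hfx.algebraMap_lie_hamiltonian (ω.form W₂.1) (ω.hamiltonian W₂) (ω.form_hamiltonian W₂) e he E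
    (fun c hc => hy (preimageAffine i W₂) hWV K c fun r => by
      obtain ⟨g, rfl⟩ := i.app_surjective W₂.1 W₂.2 r
      refine Eq.trans (Finset.sum_congr rfl fun j _ => ?_) (hc g)
      exact congrArg (fun r => c j * algebraMap R K r) (hE j g).symm)
    (fun j k => by
      change algebraMap R K (pull i W₂.1 _) = 0
      rw [show pull i W₂.1 (ω.form W₂.1 (E j) (E k)) = 0 from hL.isotropic W₂ _ _ (hE₀ j) (hE₀ k), map_zero])
    (fun j => hE₁ j _ (hres u hu)) (fun j => hE₁ j _ (hres v hv))
  have key₁ : pull i W₂.1 ⁅ω.hamiltonian W₂ (fres Y hW u), fres Y hW v⁆ = 0 := hK _ key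
  rw [← neg_eq_zero, ← map_neg, ← ω.bracket_eq_neg, ω.bracket_res hW, pull_res] at key₁
  exact (map_eq_zero_iff _ (map_injective_of_isIntegral V (homOfLE (i.preimage_mono hW)))).1 key₁

end CScheme

/-! ### The conormal module, and the identification of `I / I²` with `T_V`. -/

namespace SymmetricAlgebra

/-- For a smooth quotient `R = S / I`, the differential identifies `I / I²` with a direct summand of the
restriction of the differentials. -/
theorem IsDualBasis.exists_conormal {S M R : Type} [CommRing S] [LieRing M] [Module S M] [LieRingModule M S]
    [LieRinehartRing S M] [Algebra ℂ S] [CommRing R] [Algebra ℂ R] [Algebra.FormallySmooth ℂ R] {N : ℕ}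
    {f : Fin N → S} {x : Fin N → M} (h : IsDualBasis S M f x) (π : S →+* R) (hπ : Function.Surjective π)
    (hc : ∀ c, π (algebraMap ℂ S c) = algebraMap ℂ R c) :
    ∃ δ : Fin N → S, (∀ k, π (δ k) = 0) ∧ ∀ a, π a = 0 → a - ∑ k, ⁅x k, a⁆ * δ k ∈ RingHom.ker π ^ 2 := by
  let I := RingHom.ker π
  let q : S ⧸ I ^ 2 →+* R := Ideal.Quotient.lift _ π fun a ha => Ideal.pow_le_self two_ne_zero ha
  have hqmk : ∀ a, q (Ideal.Quotient.mk _ a) = π a := fun _ => rfl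
  let qa : S ⧸ I ^ 2 →ₐ[ℂ] R := { q with commutes' := hc }
  have hqs : Function.Surjective qa := fun r => by
    obtain ⟨a, rfl⟩ := hπ r
    exact ⟨Ideal.Quotient.mk _ a, rfl⟩
  have hmul : ∀ a b, q a = 0 → q b = 0 → a * b = 0 := fun a b ha hb => by
    obtain ⟨a, rfl⟩ := Ideal.Quotient.mk_surjective a
    obtain ⟨b, rfl⟩ := Ideal.Quotient.mk_surjective b
    rw [← map_mul, Ideal.Quotient.eq_zero_iff_mem, pow_two]
    exact Ideal.mul_mem_mul ha hb
  have hn : IsNilpotent (RingHom.ker (qa : S ⧸ I ^ 2 →+* R)) := by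
    have hJ : ∀ J : Ideal (S ⧸ I ^ 2), (∀ a ∈ J, q a = 0) → J ^ 2 ≤ ⊥ := fun J hJ => by
      rw [pow_two J, Ideal.mul_le]
      exact fun a ha b hb => hmul a b (hJ a ha) (hJ b hb)
    exact ⟨2, le_bot_iff.1 (hJ _ fun a ha => ha)⟩
  -- Smoothness of `R` splits `S / I² → R`. The projection `a ↦ a - σ (π a)` onto `I / I²` is then a
  -- derivation of `S` restricting to the identity on `I`, and the dual basis expands it with
  -- coefficients `δ k`.
  let σ := Algebra.FormallySmooth.liftOfSurjective (AlgHom.id ℂ R) qa hqs hn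
  have hσ : ∀ r, q (σ r) = r := Algebra.FormallySmooth.liftOfSurjective_apply (AlgHom.id ℂ R) qa hqs hn
  have h₀ : ∀ a, q (Ideal.Quotient.mk _ a - σ (π a)) = 0 := fun a => by
    rw [map_sub, hσ, hqmk, sub_self]
  let D : Derivation ℤ S (S ⧸ I ^ 2) := Derivation.mk'
    (AddMonoidHom.mk' (fun a => Ideal.Quotient.mk (I ^ 2) a - σ (π a)) fun a b => by
      rw [map_add, map_add, map_add]; abel).toIntLinearMap fun a b => by
    change Ideal.Quotient.mk _ (a * b) - σ (π (a * b)) = Ideal.Quotient.mk _ a * (Ideal.Quotient.mk _ b - σ (π b)) +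
      Ideal.Quotient.mk _ b * (Ideal.Quotient.mk _ a - σ (π a))
    rw [map_mul, map_mul, map_mul]
    linear_combination -hmul _ _ (h₀ a) (h₀ b)
  have hD : ∀ a, D a = Ideal.Quotient.mk _ a - σ (π a) := fun _ => rfl
  choose δ hδ using fun k => Ideal.Quotient.mk_surjective (D (f k))
  refine ⟨δ, fun k => ?_, fun a ha => ?_⟩
  · rw [← hqmk, hδ]
    exact h₀ _
  · have h₁ := h.der _ D (fun c => by
      rw [hD, hc, AlgHom.commutes]
      exact sub_self _) a
    rw [hD, ha, map_zero, sub_zero] at h₁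
    rw [← Ideal.Quotient.eq_zero_iff_mem, map_sub, map_sum, sub_eq_zero]
    refine h₁.trans (Finset.sum_congr rfl fun k _ => ?_)
    rw [map_mul, hδ]
    rfl

end SymmetricAlgebra

namespace CScheme
open SymmetricAlgebra

section Symplectic
variable {X : Scheme.{0}} [X.Over specC] (ω : SymplecticForm X) (U : X.affineOpens)

/-- The Poisson bracket of a symplectic form as a biadditive map. -/
def SymplecticForm.bracketHom : Γ(X, U.1) →+ Γ(X, U.1) →+ Γ(X, U.1) :=
  AddMonoidHom.mk' (fun f => AddMonoidHom.mk' (fun g => ω.bracket U f g) fun g g' => by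
    rw [ω.bracket_eq_neg, ω.bracket_eq_neg, ω.bracket_eq_neg, lie_add, neg_add]) fun f f' => by
      ext g
      change ω.bracket U (f + f') g = ω.bracket U f g + ω.bracket U f' g
      rw [ω.bracket_eq, ω.bracket_eq, ω.bracket_eq, lie_add]

/-- Closedness of `ω` evaluated on three Hamiltonian vector fields. -/
theorem SymplecticForm.jacobi (f g h : Γ(X, U.1)) : ω.bracket U (ω.bracket U f g) h +
    ω.bracket U (ω.bracket U g h) f + ω.bracket U (ω.bracket U h f) g = 0 := by
  have skew : ∀ a b, ω.bracket U a b = - ω.bracket U b a := fun a b => by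
    rw [ω.bracket_eq, ω.bracket_eq_neg, neg_neg]
  have neg : ∀ a b, ω.bracket U (-a) b = - ω.bracket U a b := fun a b => by
    rw [ω.bracket_eq, ω.bracket_eq, lie_neg]
  have h₁ : ∀ a b c, ω.form U.1 ⁅ω.hamiltonian U a, ω.hamiltonian U b⁆ (ω.hamiltonian U c) =
      ω.bracket U (ω.bracket U c a) b - ω.bracket U (ω.bracket U c b) a := fun a b c => by
    rw [ω.form_skew, ω.form_hamiltonian, lie_lie, ← ω.bracket_eq, ← ω.bracket_eq, ← ω.bracket_eq, ← ω.bracket_eq,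
      neg_sub]
  have h₂ : ∀ a b c, ⁅ω.hamiltonian U a, ω.form U.1 (ω.hamiltonian U b) (ω.hamiltonian U c)⁆ =
      ω.bracket U (ω.bracket U b c) a := fun a b c => (ω.bracket_eq U _ a).symm
  have key := ω.closed U.1 (ω.hamiltonian U f) (ω.hamiltonian U g) (ω.hamiltonian U h)
  rw [h₁, h₁, h₁, h₂, h₂, h₂, skew f h, skew h g, skew g f, neg, neg, neg] at key
  linear_combination -key

theorem SymplecticForm.eq_sum_hamiltonian {N : ℕ} {f : Fin N → Γ(X, U.1)} {x : Fin N → TX X U.1}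
    (h : IsDualBasis Γ(X, U.1) (TX X U.1) f x) (D : TX X U.1) :
    D = ∑ k, ω.form U.1 D (x k) • ω.hamiltonian U (f k) := by
  refine (ω.nondegenerate U).1 (LinearMap.ext fun E => ?_)
  rw [map_sum, LinearMap.sum_apply]
  conv_lhs => rw [h.vec E, map_sum]
  refine Finset.sum_congr rfl fun k _ => ?_
  rw [map_smul, map_smul, LinearMap.smul_apply, ω.form_hamiltonian, smul_eq_mul, smul_eq_mul, mul_comm]

end Symplectic

variable {V Y : Scheme.{0}} [V.Over specC] [Y.Over specC] {ω : SymplecticForm Y} {i : V ⟶ Y} [i.IsOver specC]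

theorem sum_smul_lie {X : Scheme.{0}} [X.Over specC] {U : X.Opens} {κ : Type} [Fintype κ] (a : κ → Γ(X, U))
    (x : κ → TX X U) (g : Γ(X, U)) : ⁅∑ k, a k • x k, g⁆ = ∑ k, a k * ⁅x k, g⁆ :=
  (map_sum (differential g) _ _).trans (Finset.sum_congr rfl fun k _ => map_smul _ _ _)

variable [IsIntegral V] [Smooth (V ↘ specC)] [Smooth (Y ↘ specC)]

omit [Smooth (V ↘ specC)] [Smooth (Y ↘ specC)] in
-- For `u` in `I`, the value of `{u, g}` on `V` depends only on `g` restricted to `V`, because `I`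
-- is closed under the bracket. So the Hamiltonian field of `u` is tangent to `V` and induces a
-- vector field there.
theorem IsLagrangian.exists_lie (hL : IsLagrangian ω i) [IsClosedImmersion i] (W : Y.affineOpens) (u : Γ(Y, W.1))
    (hu : pull i W.1 u = 0) :
    ∃ x : TX V (i ⁻¹ᵁ W.1), ∀ g, pull i W.1 (ω.bracket W u g) = ⁅x, pull i W.1 g⁆ := by
  have hs := i.app_surjective W.1 W.2
  have h₀ : ∀ g g', pull i W.1 g = pull i W.1 g' → pull i W.1 (ω.bracket W u g) = pull i W.1 (ω.bracket W u g') :=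
    fun g g' hg => by
      rw [← sub_eq_zero, ← map_sub, ω.bracket_eq_neg, ω.bracket_eq_neg, ← neg_sub', ← lie_sub, ← ω.bracket_eq_neg]
      exact hL.bracket_mem W _ _ hu (by rw [map_sub, hg, sub_self])
  choose s hs' using hs
  have h₁ : ∀ g, pull i W.1 (ω.bracket W u (s (pull i W.1 g))) = pull i W.1 (ω.bracket W u g) := fun g =>
    h₀ _ _ (hs' _)
  have hc : ∀ c g, ω.bracket W u (algebraMap ℂ _ c * g) = algebraMap ℂ _ c * ω.bracket W u g := fun c g => by
    rw [ω.bracket_eq_neg, ω.bracket_eq_neg, LieRinehartRing.leibniz_mul_right,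
      show ⁅ω.hamiltonian W u, algebraMap ℂ Γ(Y, W.1) c⁆ = 0 from
        ((ω.hamiltonian W u).at W.1 le_rfl).map_algebraMap c, zero_mul, add_zero, smul_eq_mul, mul_neg]
  let D : Derivation ℂ Γ(V, i ⁻¹ᵁ W.1) Γ(V, i ⁻¹ᵁ W.1) := Derivation.mk'
    { toFun := fun r => pull i W.1 (ω.bracket W u (s r))
      map_add' := fun a b => by
        rw [← map_add, ω.bracket_eq_neg, ω.bracket_eq_neg W u (s a), ω.bracket_eq_neg, ← neg_add, ← lie_add,
          ← ω.bracket_eq_neg, ← ω.bracket_eq_neg]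
        exact h₀ _ _ (by rw [map_add, hs', hs', hs'])
      map_smul' := fun c a => by
        rw [Algebra.smul_def, RingHom.id_apply, Algebra.smul_def, ← pull_const i, ← map_mul, ← hc]
        exact h₀ _ _ (by rw [map_mul, hs', hs']) } fun a b => by
      change pull i W.1 (ω.bracket W u (s (a * b))) = a * pull i W.1 (ω.bracket W u (s b)) +
        b * pull i W.1 (ω.bracket W u (s a))
      rw [h₀ (s (a * b)) (s a * s b) (by rw [map_mul, hs', hs', hs']), ω.bracket_eq_neg,
        LieRinehartRing.leibniz_mul_right, ω.bracket_eq_neg, ω.bracket_eq_neg, smul_eq_mul, map_neg, map_add, map_mul,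
        map_mul, hs', hs', map_neg, map_neg]
      ring
  obtain ⟨x, hx⟩ := TX.exists_of_derivation (U := preimageAffine i W) D
  exact ⟨x, fun g => (h₁ g).symm.trans (hx _).symm⟩

set_option maxHeartbeats 1000000 in
/-- The functions on an affine open set and on its intersection with a Lagrangian subvariety. -/
def lagrangianPair (hL : IsLagrangian ω i) [IsClosedImmersion i] (W : Y.affineOpens) :
    LagrangianPair Γ(V, i ⁻¹ᵁ W.1) (TX V (i ⁻¹ᵁ W.1)) Γ(Y, W.1) where
  π := pull i W.1
  br := ω.bracketHom W
  π_surjective := i.app_surjective W.1 W.2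
  π_const := pull_const i W.1
  br_self a := ω.alternating _ _
  br_mul a b c := by
    change ω.bracket W (a * b) c = a * ω.bracket W b c + b * ω.bracket W a c
    rw [ω.bracket_eq, ω.bracket_eq, ω.bracket_eq, LieRinehartRing.leibniz_mul_right, smul_eq_mul, mul_comm b]
  br_const c a := (ω.bracket_eq W _ a).trans (((ω.hamiltonian W a).at W.1 le_rfl).map_algebraMap c)
  jacobi := ω.jacobi W
  exists_lie := hL.exists_lie W
  exists_vec x := by
    have hsm := smooth_sections (preimageAffine i W)
    obtain ⟨N, f, X, h⟩ := exists_isDualBasis W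
    obtain ⟨δ, hδ, hδ'⟩ := h.exists_conormal (pull i W.1) (i.app_surjective W.1 W.2) (pull_const i W.1)
    obtain ⟨D, hD⟩ := exists_vectorField_lift i W (x.der _ le_rfl) fun c => by
      rw [pull_const]
      exact (x.at _ le_rfl).map_algebraMap c
    have hDI : ∀ a ∈ idealOn i W.1, ⁅D, a⁆ ∈ idealOn i W.1 := fun a ha => by
      refine (hD a).trans ?_
      rw [show pull i W.1 a = 0 from ha, map_zero]
    -- Here `D` extends `x` and is tangent to `V`. The function `u` in `I` is chosen to have, along
    -- `V`, the differential of a function with Hamiltonian field `-D`; the `δ k` turn the values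
    -- `ω(D, X k)` into such a function.
    refine ⟨-∑ k, ω.form W.1 D (X k) * δ k, ?_, fun g => ?_⟩
    · rw [map_neg, map_sum, Finset.sum_eq_zero fun k _ => by rw [map_mul, hδ, mul_zero], neg_zero]
    · let H := ω.hamiltonian W g
      have hmul : ∀ a b, pull i W.1 b = 0 → pull i W.1 ⁅H, a * b⁆ = pull i W.1 a * pull i W.1 ⁅H, b⁆ :=
        fun a b hb => by
          rw [LieRinehartRing.leibniz_mul_right, smul_eq_mul, map_add, map_mul, map_mul, hb, mul_zero, add_zero]
      have hsum : ∀ a : Fin N → Γ(Y, W.1), pull i W.1 ⁅H, ∑ k, a k * δ k⁆ =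
          ∑ k, pull i W.1 (a k) * pull i W.1 ⁅H, δ k⁆ := fun a => by
        rw [show ⁅H, ∑ k, a k * δ k⁆ = ∑ k, ⁅H, a k * δ k⁆ from map_sum (H.der W.1 le_rfl) _ _, map_sum]
        exact Finset.sum_congr rfl fun k _ => hmul _ _ (hδ k)
      -- Subtracting `∑ H (δ k) X k` removes the normal component of the Hamiltonian field `H` of
      -- `g`. The difference is tangent to `V`, so isotropy with `D` computes `ω(D, H)` along `V`.
      have htan : ∀ a ∈ idealOn i W.1, ⁅H - ∑ k, ⁅H, δ k⁆ • X k, a⁆ ∈ idealOn i W.1 := fun a ha => by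
        have h₁ : pull i W.1 ⁅H, a - ∑ k, ⁅X k, a⁆ * δ k⁆ = 0 := by
          have := derivation_pow_mem (H.der W.1 le_rfl) (RingHom.ker (pull i W.1)) 1 (hδ' a ha)
          rwa [pow_one] at this
        rw [lie_sub, map_sub, hsum] at h₁
        change pull i W.1 _ = 0
        rw [sub_lie, sum_smul_lie, map_sub, map_sum, ← h₁]
        refine congrArg _ (Finset.sum_congr rfl fun k _ => ?_)
        rw [map_mul, mul_comm]
      have h₂ := hL.isotropic W D _ hDI htan
      have h₃ : pull i W.1 (ω.form W.1 D H) = ∑ k, pull i W.1 ⁅H, δ k⁆ * pull i W.1 (ω.form W.1 D (X k)) := by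
        have h₄ : pull i W.1 (ω.form W.1 D (H - ∑ k, ⁅H, δ k⁆ • X k)) = 0 := h₂
        rw [map_sub, map_sum, map_sub, map_sum, sub_eq_zero] at h₄
        rw [h₄]
        exact Finset.sum_congr rfl fun k _ => by rw [map_smul, smul_eq_mul, map_mul]
      change pull i W.1 (ω.bracket W _ g) = _
      rw [ω.bracket_eq, lie_neg, map_neg]
      refine Eq.trans (congrArg _ ((hsum _).trans (Eq.trans (Finset.sum_congr rfl fun k _ => mul_comm _ _) h₃.symm))) ?_
      rw [← map_neg, ← ω.form_skew, ω.form_hamiltonian, hD]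
      rfl
  mem_sq u hu hb := by
    have hsm := smooth_sections (preimageAffine i W)
    obtain ⟨N, f, X, h⟩ := exists_isDualBasis W
    obtain ⟨δ, hδ, hδ'⟩ := h.exists_conormal (pull i W.1) (i.app_surjective W.1 W.2) (pull_const i W.1)
    -- Hamiltonian fields generate all vector fields, so every vector field maps `u` into `I`. The
    -- conormal expansion then places `u` in `I²`.
    have h₀ : ∀ k, pull i W.1 ⁅X k, u⁆ = 0 := fun k => by
      rw [ω.eq_sum_hamiltonian W h (X k), sum_smul_lie, map_sum]
      refine Finset.sum_eq_zero fun l _ => ?_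
      rw [map_mul, ← ω.bracket_eq]
      exact mul_eq_zero_of_right _ (hb (f l))
    rw [← sub_add_cancel u (∑ k, ⁅X k, u⁆ * δ k)]
    refine add_mem (hδ' u hu) (sum_mem fun k _ => ?_)
    rw [pow_two]
    exact Ideal.mul_mem_mul (h₀ k) (hδ k)

end CScheme

/-! ### Compatibility of leading terms and extensions with restriction. -/

namespace SymmetricAlgebra.PoissonExt

variable {R L : Type} [CommRing R] [LieRing L] [Module R L] [LieRingModule L R]
  [LieRinehartRing R L] [Algebra ℂ R] {n : ℕ} {A : Type} [CommRing A] (E : PoissonExt R L n A)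

/-- A lift preserving brackets is the identity on `Sym^{n+1} L`. -/
theorem isPoissonLift_of_br {N : ℕ} {f : Fin N → R} {x : Fin N → L} (h : IsDualBasis R L f x)
    {β : SymmetricAlgebra R L →+* A} (hc : ∀ c, β (algebraMap R _ (algebraMap ℂ R c)) = E.const c)
    (hp : ∀ s, E.p (β s) = Ideal.Quotient.mk _ s)
    (hb : ∀ s t, E.br (β s) (β t) = Ideal.Quotient.mk _ (poisson R L s t)) : E.IsPoissonLift β where
  const := hc
  proj := hp
  br := hb
  incl s := by
    have h₁ : E.p (β s) = 0 := by
      rw [hp, Ideal.Quotient.eq_zero_iff_mem]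
      exact symPow_le_augIdeal_pow _ s.2
    obtain ⟨s', hs'⟩ := (E.exact _).1 h₁
    rw [← hs']
    refine congrArg _ (h.derive_injective n fun g => Subtype.ext ?_)
    refine mk_symPow_injective h (derive n s' g).2 (derive n s g).2 ?_
    have h₂ := E.br_incl s' (β (algebraMap R _ g))
    rw [hs', hb, hp, zeroJet_mk, algebraMapInv_algebraMap] at h₂
    exact h₂.symm

end SymmetricAlgebra.PoissonExt

namespace CScheme
open SymmetricAlgebra

variable {V Y : Scheme.{0}} [V.Over specC] [Y.Over specC] {ω : SymplecticForm Y} {i : V ⟶ Y} [i.IsOver specC]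
  [IsClosedImmersion i]

omit [V.Over specC] [Y.Over specC] [i.IsOver specC] in
-- `V` carries the topology induced from `Y`, so the traces of affine open sets of `Y` are a basis.
-- Indexing by open sets of `Y` is what the rings `O_Y / I^l` require.
theorem isAffineBasis_preimage : IsAffineBasis (preimageAffine i) where
  mono h := i.preimage_mono h
  exists_le b₁ b₂ x U h₁ h₂ hU := by
    obtain ⟨O, hO, hOU⟩ := i.isClosedEmbedding.isEmbedding.isInducing.isOpen_iff.1 U.2
    have hxO : x ∈ i ⁻¹' O := by rw [hOU]; exact hU
    obtain ⟨W, hW, hx⟩ := exists_affine_le (U := b₁.1 ⊓ b₂.1 ⊓ ⟨O, hO⟩) ⟨⟨h₁, h₂⟩, hxO⟩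
    refine ⟨W, hW.trans (inf_le_left.trans inf_le_left), hW.trans (inf_le_left.trans inf_le_right), hx,
      fun z hz => ?_⟩
    have : z ∈ i ⁻¹' O := (hW hz).2
    rw [hOU] at this
    exact this

omit [V.Over specC] [Y.Over specC] [i.IsOver specC] [IsClosedImmersion i] in
theorem fres_mem_idealOn_pow {W W' : Y.Opens} (h : W' ≤ W) (m : ℕ) {f : Γ(Y, W)} (hf : f ∈ idealOn i W ^ m) :
    fres Y h f ∈ idealOn i W' ^ m := by
  have h₁ : (idealOn i W).map (fres Y h) ≤ idealOn i W' := Ideal.map_le_iff_le_comap.2 fun g hg => by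
    change pull i W' (fres Y h g) = 0
    rw [pull_res, show pull i W g = 0 from hg, map_zero]
  have h₂ := Ideal.mem_map_of_mem (fres Y h) hf
  rw [Ideal.map_pow] at h₂
  exact Ideal.pow_right_mono h₁ m h₂

/-- Restriction of functions on infinitesimal neighbourhoods. -/
def quotRes (i : V ⟶ Y) (m : ℕ) {W W' : Y.Opens} (h : W' ≤ W) :
    Γ(Y, W) ⧸ idealOn i W ^ m →+* Γ(Y, W') ⧸ idealOn i W' ^ m :=
  Ideal.quotientMap _ (fres Y h) fun _ hf => fres_mem_idealOn_pow h m hf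

omit [V.Over specC] [Y.Over specC] [i.IsOver specC] [IsClosedImmersion i] in
theorem quotRes_mk (m : ℕ) {W W' : Y.Opens} (h : W' ≤ W) (f : Γ(Y, W)) :
    quotRes i m h (Ideal.Quotient.mk _ f) = Ideal.Quotient.mk _ (fres Y h f) := rfl

omit [V.Over specC] [Y.Over specC] [i.IsOver specC] [IsClosedImmersion i] in
theorem quotRes_quotRes (m : ℕ) {W W' W'' : Y.Opens} (h : W' ≤ W) (h' : W'' ≤ W')
    (a : Γ(Y, W) ⧸ idealOn i W ^ m) : quotRes i m h' (quotRes i m h a) = quotRes i m (h'.trans h) a := by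
  obtain ⟨f, rfl⟩ := Ideal.Quotient.mk_surjective a
  rw [quotRes_mk, quotRes_mk, quotRes_mk, fres_fres]

variable [IsIntegral V] [Smooth (V ↘ specC)] [Smooth (Y ↘ specC)] (hL : IsLagrangian ω i)

/-- A symbol on `W'` involves brackets with all functions on `W'`, not only with restricted ones. So
some symbol of the restriction is taken, and it is identified by its brackets with the restricted
dual basis functions, which suffice by Euler's formula. -/
theorem isSymbol_res {W W' : Y.affineOpens} (h : W'.1 ≤ W.1) (l : ℕ) {f : Γ(Y, W.1)} {s : SymT V (i ⁻¹ᵁ W.1)}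
    (hs : (lagrangianPair hL W).IsSymbol l f s) :
    (lagrangianPair hL W').IsSymbol l (fres Y h f) (symRes (i.preimage_mono h) s) := by
  obtain ⟨N, g, x, hgx⟩ := exists_isDualBasis (preimageAffine i W)
  have hgx' := isDualBasis_res (W := preimageAffine i W') (i.preimage_mono h) hgx
  induction l generalizing f s with
  | zero =>
    change _ = algebraMap _ _ (pull i W'.1 (fres Y h f))
    rw [show s = algebraMap _ _ (pull i W.1 f) from hs, mapSemi_algebraMap, pull_res]
  | succ l ih =>
    obtain ⟨s', hs'⟩ := LagrangianPair.IsSymbol.exists_of_mem_pow (lagrangianPair hL W') (l + 1)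
      (fres_mem_idealOn_pow h (l + 1) hs.1)
    have hss : s' = symRes (i.preimage_mono h) s := by
      refine sub_eq_zero.1 (hgx'.eq_zero_of_derive l
        (sub_mem hs'.mem_symPow (mapSemi_mem_symPow _ _ _ hs.mem_symPow)) fun k => ?_)
      obtain ⟨a, ha⟩ := i.app_surjective W.1 W.2 (g k)
      have h₁ := hs'.2.2 (fres Y h a)
      have h₂ := ih (hs.2.2 a)
      have h₃ : fres Y h (ω.bracket W f a) = ω.bracket W' (fres Y h f) (fres Y h a) := (ω.bracket_res h f a).symm
      have h₄ : poisson _ _ s' (algebraMap _ _ (pull i W'.1 (fres Y h a))) =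
          symRes (i.preimage_mono h) (poisson _ _ s (algebraMap _ _ (pull i W.1 a))) :=
        LagrangianPair.IsSymbol.unique hgx' h₁ (by
          change (lagrangianPair hL W').IsSymbol l (ω.bracket W' (fres Y h f) (fres Y h a)) _
          rw [← h₃]
          exact h₂)
      rw [mapSemi_poisson_fun (fun y r => TX.res_lie _ y r), pull_res, show pull i W.1 a = g k from ha] at h₄
      exact (poisson_sub_left _ _ _).trans (sub_eq_zero.2 h₄)
    rw [← hss]
    exact hs'

end CScheme

/-! ### The formal neighbourhood of a Lagrangian, by induction on its order. -/

namespace CScheme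
open SymmetricAlgebra

variable {V Y : Scheme.{0}} [V.Over specC] [Y.Over specC] {ω : SymplecticForm Y} {i : V ⟶ Y} [i.IsOver specC]
  [IsClosedImmersion i] [IsIntegral V] [Smooth (V ↘ specC)] [Smooth (Y ↘ specC)] (hL : IsLagrangian ω i)

/-- Compatible isomorphisms of the `n`-th infinitesimal neighbourhoods of a Lagrangian subvariety and of the zero
section of its cotangent bundle. -/
structure JetSystem (n : ℕ) where
  φ : ∀ W : Y.affineOpens, (Γ(Y, W.1) ⧸ idealOn i W.1 ^ (n + 1)) ≃+* Jet V n (i ⁻¹ᵁ W.1)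
  isJetIso : ∀ W, (lagrangianPair hL W).IsJetIso n (φ W)
  res : ∀ (W W' : Y.affineOpens) (h : W'.1 ≤ W.1) (f : Γ(Y, W.1)) (s : SymT V (i ⁻¹ᵁ W.1)),
    φ W (Ideal.Quotient.mk _ f) = jet V n s →
    φ W' (Ideal.Quotient.mk _ (fres Y h f)) = jet V n (symRes (i.preimage_mono h) s)

/-- The isomorphisms of the reduced subschemes. -/
def jetSystemZero : JetSystem hL 0 where
  φ W := (lagrangianPair hL W).jetIsoZero
  isJetIso W := (lagrangianPair hL W).isJetIso_zero
  res W W' h f s hs := by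
    have h₁ : zeroSec s = pull i W.1 f := (lagrangianPair hL W).isJetIso_zero.base f s hs
    refine ((lagrangianPair hL W').jetIsoZero_mk _).trans (Eq.trans ?_ (jet_zero_eq _).symm)
    refine congrArg (fun r => jet V 0 (ofFun r)) ?_
    rw [zeroSec_symRes, h₁]
    exact pull_res i h f

namespace JetSystem

variable {hL} {n : ℕ} (Φ : JetSystem hL n)

omit [Y.Over specC] [IsIntegral V] [Smooth (Y ↘ specC)] in
theorem exists_basis (i : V ⟶ Y) [IsClosedImmersion i] (W : Y.affineOpens) :
    ∃ (N : ℕ) (fx : (Fin N → Γ(V, i ⁻¹ᵁ W.1)) × (Fin N → TX V (i ⁻¹ᵁ W.1))),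
      IsDualBasis Γ(V, i ⁻¹ᵁ W.1) (TX V (i ⁻¹ᵁ W.1)) fx.1 fx.2 := by
  obtain ⟨N, f, x, h⟩ := exists_isDualBasis (preimageAffine i W)
  exact ⟨N, (f, x), h⟩

/-- The next infinitesimal neighbourhood of the Lagrangian, as an extension. -/
def ext (W : Y.affineOpens) : PoissonExt Γ(V, i ⁻¹ᵁ W.1) (TX V (i ⁻¹ᵁ W.1)) n
    (Γ(Y, W.1) ⧸ idealOn i W.1 ^ (n + 1 + 1)) :=
  (Φ.isJetIso W).toExt (exists_basis i W).choose_spec.choose_spec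

theorem ext_br_mk (W : Y.affineOpens) (f g : Γ(Y, W.1)) :
    (Φ.ext W).br (Ideal.Quotient.mk _ f) (Ideal.Quotient.mk _ g) = Φ.φ W (Ideal.Quotient.mk _ (ω.bracket W f g)) :=
  congrArg (Φ.φ W) ((lagrangianPair hL W).quotBr_mk n f g)

theorem ext_p_res {W W' : Y.affineOpens} (h : W'.1 ≤ W.1) (a : Γ(Y, W.1) ⧸ idealOn i W.1 ^ (n + 1 + 1))
    (s : SymT V (i ⁻¹ᵁ W.1)) (ha : (Φ.ext W).p a = jet V n s) :
    (Φ.ext W').p (quotRes i _ h a) = jet V n (symRes (i.preimage_mono h) s) := by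
  obtain ⟨f, rfl⟩ := Ideal.Quotient.mk_surjective a
  exact Φ.res W W' h f s ha

theorem ext_br_res {W W' : Y.affineOpens} (h : W'.1 ≤ W.1) (a a' : Γ(Y, W.1) ⧸ idealOn i W.1 ^ (n + 1 + 1))
    (s : SymT V (i ⁻¹ᵁ W.1)) (ha : (Φ.ext W).br a a' = jet V n s) :
    (Φ.ext W').br (quotRes i _ h a) (quotRes i _ h a') = jet V n (symRes (i.preimage_mono h) s) := by
  obtain ⟨f, rfl⟩ := Ideal.Quotient.mk_surjective a
  obtain ⟨g, rfl⟩ := Ideal.Quotient.mk_surjective a'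
  rw [ext_br_mk] at ha
  refine (Φ.ext_br_mk W' _ _).trans ?_
  rw [ω.bracket_res h f g]
  exact Φ.res W W' h _ s ha

theorem ext_const_res {W W' : Y.affineOpens} (h : W'.1 ≤ W.1) (c : ℂ) :
    quotRes i _ h ((Φ.ext W).const c) = (Φ.ext W').const c :=
  congrArg (Ideal.Quotient.mk _) (fres_algebraMap h c)

theorem ext_incl_res {W W' : Y.affineOpens} (h : W'.1 ≤ W.1) (s : SymTn V (n + 1) (i ⁻¹ᵁ W.1)) :
    quotRes i _ h ((Φ.ext W).incl s) = (Φ.ext W').incl (symTnRes (n + 1) (i.preimage_mono h) s) := by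
  obtain ⟨f, hf, hfs⟩ := (lagrangianPair hL W).exists_symbolIncl (exists_basis i W).choose_spec.choose_spec s
  have h₁ := isSymbol_res hL h (n + 1) hf
  exact (congrArg (quotRes i _ h) hfs).trans
    ((lagrangianPair hL W').symbolIncl_eq (exists_basis i W').choose_spec.choose_spec h₁).symm

/-- Local lifts of the isomorphisms to the next infinitesimal neighbourhood. -/
theorem exists_local_lift (W₀ : Y.affineOpens) :
    ∃ β : ∀ b : {W : Y.affineOpens // W ≤ W₀}, SymT V (i ⁻¹ᵁ b.1.1) →+* Γ(Y, b.1.1) ⧸ idealOn i b.1.1 ^ (n + 1 + 1),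
      (∀ b, (Φ.ext b.1).IsPoissonLift (β b)) ∧
      ∀ {b b'} (h : b' ≤ b) s, β b' (symRes (i.preimage_mono h) s) = quotRes i _ h (β b s) :=
  exists_isPoissonLift_family (n := n) (fun b : {W : Y.affineOpens // W ≤ W₀} => preimageAffine i b.1)
    (fun h => i.preimage_mono h) (fun b => Γ(Y, b.1.1) ⧸ idealOn i b.1.1 ^ (n + 1 + 1)) (fun b => Φ.ext b.1)
    (fun h => quotRes i _ h) ⟨W₀, le_rfl⟩ (fun b => b.2) (fun h h' a => quotRes_quotRes _ h h' a)
    (fun h a s ha => Φ.ext_p_res h a s ha) (fun h a a' s ha => Φ.ext_br_res h a a' s ha)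
    (fun h c => Φ.ext_const_res h c)

/-- The comparison of the next infinitesimal neighbourhoods. -/
def system : ComparisonSystem (isAffineBasis_preimage (i := i)) n (fun W => SymT V (i ⁻¹ᵁ W.1))
    (fun W => Γ(Y, W.1) ⧸ idealOn i W.1 ^ (n + 1 + 1)) (fun W => Jet V n (i ⁻¹ᵁ W.1))
    (fun W => Jet V n (i ⁻¹ᵁ W.1)) where
  resA h := symRes (i.preimage_mono h)
  resA' h := quotRes i _ h
  red W := (zeroSec (X := V) (U := i ⁻¹ᵁ W.1) : SymT V (i ⁻¹ᵁ W.1) →+* Γ(V, i ⁻¹ᵁ W.1))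
  const W c := ofFun (algebraMap ℂ Γ(V, i ⁻¹ᵁ W.1) c)
  const' W c := (Φ.ext W).const c
  step W := (Φ.ext W).toStep (exists_basis i W).choose_spec.choose_spec
  p W s := jet V n s
  p' W := (Φ.ext W).p.toAddMonoidHom
  br W s t := jet V n (cotBracket s t)
  red_surjective W r := ⟨ofFun r, algebraMapInv_algebraMap r⟩
  red_res h s := zeroSec_symRes _ s
  red_const W c := algebraMapInv_algebraMap _
  step_red_eq W s a ha := congrArg (zeroJet _ _ n) ha
  incl_res h s := Φ.ext_incl_res h s
  exact W a := (Φ.ext W).exact a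

theorem exists_lift (W₀ : Y.affineOpens) : ∃ ψ : Φ.system.Lift (LowerSet.Iic W₀), ψ.IsPoisson := by
  obtain ⟨β, hβ, hr⟩ := Φ.exists_local_lift W₀
  exact ⟨⟨fun b hb => β ⟨b, hb⟩, fun {b b'} hb h s => hr (b := ⟨b, hb⟩) (b' := ⟨b', h.trans hb⟩) h s,
    fun b hb c => (hβ ⟨b, hb⟩).const c, fun b hb s => (hβ ⟨b, hb⟩).proj s, fun b hb s t _ => (hβ ⟨b, hb⟩).br s t⟩,
    fun b hb s t => (hβ ⟨b, hb⟩).br s t⟩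

theorem exists_global_lift (hH : Subsingleton (Sheaf.H.{0} (tensorSheaf V (n + 1)) 1)) :
    ∃ Ψ : Φ.system.Lift ⊤, Ψ.IsPoisson := by
  choose ψ hψ using Φ.exists_lift
  obtain ⟨d, hd⟩ := Φ.system.exists_cochain ψ
  have hU : ⨆ W : Y.affineOpens, (preimageAffine i W).1 = (⊤ : V.Opens) := by
    refine top_unique fun x _ => ?_
    obtain ⟨W, -, hx⟩ := exists_affine_le (U := (⊤ : Y.Opens)) (x := i x) trivial
    exact Opens.mem_iSup.2 ⟨W, hx⟩
  obtain ⟨ξ, hξ⟩ := exists_isCechClass_iff hU (Φ.system.isCocycle_of_isGivenBy hd)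
  -- The cover consists of all affine open sets of `Y`, so the glued lift is defined on every one of
  -- them, including those not meeting `V`.
  exact Φ.system.exists_global_lift hd hψ ((hξ 0).2 (Subsingleton.elim _ _)) fun b _ => ⟨b, le_rfl⟩

/-- Compatible isomorphisms can be extended to the next infinitesimal neighbourhood. -/
theorem exists_next (hH : Subsingleton (Sheaf.H.{0} (tensorSheaf V (n + 1)) 1)) :
    ∃ Φ' : JetSystem hL (n + 1), ∀ (W : Y.affineOpens) (f : Γ(Y, W.1)) (s : SymT V (i ⁻¹ᵁ W.1)),
      Φ'.φ W (Ideal.Quotient.mk _ f) = jet V (n + 1) s → Φ.φ W (Ideal.Quotient.mk _ f) = jet V n s := by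
  obtain ⟨Ψ, hΨ⟩ := Φ.exists_global_lift hH
  -- A `Lift` does not record compatibility with `Sym^{n+1}`; it is recovered from the preservation
  -- of brackets.
  have hβ : ∀ W, (Φ.ext W).IsPoissonLift (Ψ.ψ W trivial) := fun W =>
    (Φ.ext W).isPoissonLift_of_br (exists_basis i W).choose_spec.choose_spec (Ψ.const W trivial)
      (Ψ.proj W trivial) (hΨ W trivial)
  refine ⟨⟨fun W => (Φ.isJetIso W).liftEquiv _ (hβ W), fun W => (Φ.isJetIso W).isJetIso_liftEquiv _ (hβ W),
    fun W W' h f s hs => ?_⟩, fun W f s => (Φ.isJetIso W).liftEquiv_reduce _ (hβ W) f s⟩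
  refine ((Φ.isJetIso W').liftEquiv_eq_iff _ (hβ W')).2 ?_
  refine (Ψ.res trivial h s).trans ?_
  exact congrArg (quotRes i _ h) (((Φ.isJetIso W).liftEquiv_eq_iff _ (hβ W)).1 hs)

end JetSystem

include hL in
/-- The formal completion along a Lagrangian subvariety is that of the cotangent bundle if the obstruction groups
vanish. -/
theorem IsLagrangian.nonempty_formalPoissonIso
    (hH : ∀ n : ℕ, 1 ≤ n → Subsingleton (Sheaf.H.{0} (tensorSheaf V n) 1)) : Nonempty (FormalPoissonIso ω i) := by
  -- The step from order `n` to order `n + 1` needs the obstruction group with `Sym^{n+1}`. Choosing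
  -- successors as a function makes the recursively defined system compatible for varying order.
  choose next hnext using fun n (Φ : JetSystem hL n) => Φ.exists_next (hH (n + 1) (Nat.succ_pos n))
  let Φ (n : ℕ) : JetSystem hL n := Nat.rec (jetSystemZero hL) next n
  have hΦ : ∀ n, Φ (n + 1) = next n (Φ n) := fun n => rfl
  have proj : ∀ (l : ℕ) (W : Y.affineOpens) (f : Γ(Y, W.1)) (s : SymT V (i ⁻¹ᵁ W.1)),
      (Φ (l + 1)).φ W (Ideal.Quotient.mk _ f) = jet V (l + 1) s → (Φ l).φ W (Ideal.Quotient.mk _ f) = jet V l s :=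
    fun l => hnext l (Φ l)
  refine ⟨⟨fun n W => (Φ n).φ W, fun n => (Φ n).res, fun n W => ((Φ n).isJetIso W).const, proj, fun W f => rfl,
    fun l W f g s t hf hg => ?_⟩⟩
  -- The isomorphism of order `l + 1` controls brackets modulo the power `l + 1` of the ideal, which
  -- is exactly the precision of the neighbourhood of order `l`.
  obtain ⟨u, hu⟩ := Ideal.Quotient.mk_surjective ((Φ (l + 1)).φ W (Ideal.Quotient.mk _ (ω.bracket W f g)))
  refine (proj l W _ u hu.symm).trans (jet_eq_jet_iff.2 ?_)
  exact ((Φ (l + 1)).isJetIso W).bracket f g s t u hf hg hu.symm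

end CScheme

/-! ### The theorem. -/

open CScheme in
theorem lemma3 (V : Scheme.{0}) [V.Over specC] (hV : IsSmoothVariety V) :
    (∀ (n : ℕ) (T T' : PoissonTower V (n + 1)) (ι : Type) (U : ι → V.affineOpens)
      (_ : ⨆ i, (U i).1 = (⊤ : V.Opens))
      (τ : ∀ i, LocalTriv T n (U i).1) (τ' : ∀ i, LocalTriv T' n (U i).1)
      (φ : T.A n ≅ T'.A n)
      (_ : ∀ (i : ι) (W : V.affineOpens) (hW : W.1 ≤ (U i).1) (s : Jet V n W.1),
        onSec φ.hom W.1 ((τ i).α n le_rfl W hW s) = (τ' i).α n le_rfl W hW s),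
      (Nonempty (∀ i, NormalizedLift (τ i)) ∧ Nonempty (∀ i, NormalizedLift (τ' i))) ∧
      ∃ ξ : Sheaf.H.{0} (tensorSheaf V (n + 1)) 1,
        (∀ (β : ∀ i, NormalizedLift (τ i)) (β' : ∀ i, NormalizedLift (τ' i)),
          ∃ d, IsDifference β β' d ∧
            ∀ ξ' : Sheaf.H.{0} (tensorSheaf V (n + 1)) 1,
              IsCechClass (fun i => (U i).1) d ξ' ↔ ξ' = ξ) ∧
        (ξ = 0 ↔ ∃ ψ : T.A (n + 1) ≅ T'.A (n + 1), IsPoissonExtension φ ψ)) ∧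
    (∀ (Y : Scheme.{0}) [Y.Over specC] (_ : IsSmoothVariety Y) (ω : SymplecticForm Y)
      (i : V ⟶ Y) [i.IsOver specC] (_ : IsLagrangian ω i)
      (_ : ∀ n : ℕ, 1 ≤ n → Subsingleton (Sheaf.H.{0} (tensorSheaf V n) 1)),
      Nonempty (FormalPoissonIso ω i)) := by
  refine ⟨fun n T T' ι U hU τ τ' φ hφ => ?_, fun Y _ hY ω i _ hL hH => ?_⟩
  · have := hV.smooth
    exact ⟨⟨⟨fun i => (NormalizedLift.exists_isPoisson (U i) (τ i)).choose⟩,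
      ⟨fun i => (NormalizedLift.exists_isPoisson (U i) (τ' i)).choose⟩⟩,
      exists_obstruction_class T T' U hU τ τ' φ hφ⟩
  · have := hV.integral
    have := hV.smooth
    have := hY.smooth
    have := hL.closedImmersion
    exact hL.nonempty_formalPoissonIso hH
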